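/- **Proposition E.1.** *Parameters.* Let $\rho\in(0,1)$. Let $\varphi(x)=\sum_{i=1}^{L}a_i\cos(b_ix)$ satisfy $|\varphi|,|\varphi'|,|\varphi''|\le 100$, $|\varphi^{(k)}(x)|\le(100+|x|)^k$ for $k\ge1$, and $\mathbb E\varphi(X)=0$, $\mathbb E\varphi(X)^2=1$ for $X\sim\mathcal N(0,1)$. For $u\in[-1,1]$ put $\phi(u)=\mathbb E[\varphi(X)\varphi(Y)]$, where $X,Y$ are standard normal with correlation $u$. Assume $\phi''(0)\ne0$, and let $\Lambda>0$ satisfy $|\phi^{(k)}(0)/k!|\le\Lambda 2^k$ for all $k\ge 0$. Put $\varepsilon_0=\phi(\rho/2)$. Let $K_0$ be a multiple of $12$ with $$K_0\ge 10^{30}\rho^{-30}|\phi''(0)|^4\Lambda^4\varepsilon_0^{-2},\qquad \frac{\log(10^{-30}|\phi''(0)|^2\Lambda^2\rho^{20}K_0)}{\log(10^{40}|\phi''(0)|^4\Lambda^{-4}\rho^{24}K_0\varepsilon_0^2)}<1.01 .$$ Let $K_{t+1}$ be $10^{-20}\rho^{20}|\phi''(0)|^2\Lambda^{-2}K_t^2$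 rounded down to a multiple of $12$, and let $t^*=\min\{t\ge0:K_t\ge(\log n)^{1.1}\}$. *The algorithm.* The input is a pair $A',B'$ of real symmetric $n\times n$ matrices, $n\ge K_0$. 1. *Preprocessing.* With independent $G_{ij}\sim\mathcal N(0,1)$ attached to the unordered pairs $\{i,j\}$, let $\widehat A'_{ij}=(A'_{ij}+G_{ij})/\sqrt2$ for $i>j$, $\widehat A'_{ij}=(A'_{ij}-G_{ij})/\sqrt2$ for $i<j$, $\widehat A'_{ii}=0$. Define $\widehat B'$ in the same way from $B'$ and independent noise $H$. 2. *Spectral cleaning.* Put $\mathscr M=\widehat A'$. While $\|\mathscr M\|_{\rm op}\ge10\sqrt n$, take unit left and right singular vectors $v,u$ of $\mathscr M$ for its largest singular value (by a fixed rule if they are not unique), draw $i\in[n]$ with probability $(v_i^2+u_i^2)/2$, and set the $i$-th row and column of $\mathscr M$ to zero. The result is $\widehat{\mathscr A}$. Obtain $\widehat{\mathscr B}$ from $\widehat B'$ in the same way. 3. *Spectral subroutine.* Put $\Phi^{(0)}=\mathbb I$, $\Psi^{(0)}=\varepsilon_0\mathbb I$. Call $(\Phi,\Psi,\varepsilon)$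 of size $k$ *good* if at least $3k/4$ eigenvalues of $\Phi$ lie in $(0.9,1.1)$ and at least $3k/4$ eigenvalues of $\Psi$ lie in $(0.9\varepsilon,1.1\varepsilon)$. Given a good $(\Phi^{(t)},\Psi^{(t)},\varepsilon_t)$, choose (by a fixed rule, as a function of this triple) a $K_t\times\frac{K_t}{12}$ matrix $\Xi^{(t)}$ whose columns lie both in the span of $3K_t/4$ orthonormal eigenvectors of $\Phi^{(t)}$ and in the span of $3K_t/4$ orthonormal eigenvectors of $\Psi^{(t)}$ with eigenvalues in these intervals, such that $(\Xi^{(t)})^\top\Phi^{(t)}\Xi^{(t)}=\mathbb I$ and $D=(\Xi^{(t)})^\top\Psi^{(t)}\Xi^{(t)}$ is diagonal with entries in $(\frac{0.9}{1.1}\varepsilon_t,\frac{1.1}{0.9}\varepsilon_t)$. Draw a $\frac{K_t}{12}\times K_{t+1}$ matrix $\beta^{(t)}$ with independent uniform entries $\pm\sqrt{12/K_t}$ and put $\Phi^{(t+1)}_{ij}=\phi((\beta_i^{(t)})^\top\beta_j^{(t)})$, $\Psi^{(t+1)}_{ij}=\phi(\frac\rho2(\beta_i^{(t)})^\top D\beta_j^{(t)})$,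 $\varepsilon_{t+1}=\phi(\frac\rho2\cdot\frac{12}{K_t}\operatorname{tr}D)$. Redraw $\beta^{(t)}$ until the new triple is good. 4. *Candidates.* For a pair of sequences $\mathsf V_i=(u_1,\dots,u_{K_0})$, $\mathsf V_j=(v_1,\dots,v_{K_0})$ of distinct elements of $[n]$, let $f^{(0)}_{x,k}=\varphi(\widehat{\mathscr A}_{x,u_k})$ for $x\in[n]\setminus\mathsf V_i$ and $g^{(0)}_{x,k}=\varphi(\widehat{\mathscr B}_{x,v_k})$ for $x\in[n]\setminus\mathsf V_j$, and iterate $h^{(t)}=n^{-1/2}\widehat{\mathscr A}_{([n]\setminus\mathsf V_i)\times([n]\setminus\mathsf V_i)}f^{(t)}\Xi^{(t)}$, $f^{(t+1)}=\varphi\circ(h^{(t)}\beta^{(t)})$ (entrywise), and likewise $\ell^{(t)},g^{(t+1)}$ from $\widehat{\mathscr B}$, $\mathsf V_j$ and $g^{(t)}$. The candidate matching $\pi_{i,j}$ is a permutation with $\pi_{i,j}(u_k)=v_k$ for all $k$ whose restriction to $[n]\setminus\mathsf V_i$ is a bijection $\sigma:[n]\setminus\mathsf V_i\to[n]\setminus\mathsf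 V_j$ maximizing $\sum_{x}\sum_{k}h^{(t^*)}_{x,k}\,\ell^{(t^*)}_{\sigma(x),k}$. 5. *Refinement.* Let $\alpha=\mathbb P(X\ge1)$ and $\Delta=\frac n{10}\mathbb P(X\ge1,Y\ge1)$ for standard normal $X,Y$ with correlation $\rho$, and $N(u,v)=\sum_{w}(\mathbf 1_{A'_{u,w}\ge1}-\alpha)(\mathbf 1_{B'_{v,\pi_{i,j}(w)}\ge1}-\alpha)$. Start with $\hat\pi=\pi_{i,j}$. As long as there are $u,v$ with $N(u,v)\ge\Delta$, $N(u,\hat\pi(u))<\Delta/10$ and $N(\hat\pi^{-1}(v),v)<\Delta/10$, change $\hat\pi$ so that it maps $u$ to $v$ and $\hat\pi^{-1}(v)$ to $\hat\pi(u)$. The result is $\hat\pi_{i,j}$. 6. *Output.* Over all pairs of sequences, return a $\hat\pi_{i,j}$ that maximizes $\sum_{u<v}\mathbf 1_{A'_{u,v}\ge1}\mathbf 1_{B'_{\hat\pi_{i,j}(u),\hat\pi_{i,j}(v)}\ge1}$. *Running time.* Running time is the expected number of steps, over the random choices of the algorithm and in the worst case over inputs, of a program for a real random access machine. The program does not depend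 on $n$ and may contain real constants. Unit-cost operations are: memory access, addition, (truncated) subtraction and comparison of natural numbers, $+,-,\times,/,\sqrt{\ },\exp,\log,\cos$ and comparison of reals, and access to an independent Gaussian, uniform or coin sample. Singular vectors and eigenvectors, which finitely many such operations cannot produce exactly, are numerical primitives: a unit leading left and right singular pair of a $d\times d$ matrix is charged $s(d)$ and a spectral decomposition of a symmetric $d\times d$ matrix is charged $e(d)$, where $s(d)=O(d^{2+o(1)})$ and $e(d)=O(d^{3+o(1)})$ are arbitrary. *Claim.* For every sufficiently large $K_0$ as above (depending on $\rho,\varphi,\Lambda$), with a suitable rule for $\Xi$, there are a program that on input $(A',B',\mathsf V_i,\mathsf V_j)$ halts almost surely and computes $\pi_{i,j}$ (and $\hat\pi_{i,j}$) in time $O(n^{3+o(1)})$, uniformly in $A',B'$ and in the pair $(\mathsf V_i,\mathsf V_j)$, and a program that on input $(A',B')$ halts almost surely and performs the whole robust matching algorithm in time $O(n^{2K_0+3+o(1)})$, uniformly in $A',B'$. The programs do not depend on the price functions $s,e$. -/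

import Mathlib

open MeasureTheory ProbabilityTheory Filter Topology
open scoped ENNReal Matrix

namespace RobustMatching

/-! ## Asymptotic notation -/

/-- `T n = O(n ^ (a + o(1)))`. -/
def IsBigOPow (T : ℕ → ℝ) (a : ℝ) : Prop :=
  ∃ (C : ℝ) (e : ℕ → ℝ), Tendsto e atTop (𝓝 0) ∧
    ∀ n : ℕ, 1 ≤ n → T n ≤ C * (n : ℝ) ^ (a + e n)

/-! ## The denoiser and the constants of the algorithm -/

/-- The standard Gaussian law on the line. -/
noncomputable def gauss : Measure ℝ := gaussianReal 0 1

/-- A trigonometric sum `x ↦ ∑ i, a i * cos (b i * x)`. -/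
structure Denoiser where
  /-- number of terms -/
  L : ℕ
  /-- amplitudes -/
  a : Fin L → ℝ
  /-- frequencies -/
  b : Fin L → ℝ

/-- The denoiser as a function. -/
noncomputable def Denoiser.eval (φ : Denoiser) (x : ℝ) : ℝ :=
  ∑ i, φ.a i * Real.cos (φ.b i * x)

/-- The conditions imposed on the denoiser: bounds on the derivatives, and mean `0` and variance `1`
under the standard Gaussian law. -/
structure Denoiser.Admissible (φ : Denoiser) : Prop where
  bound_zero : ∀ x, |φ.eval x| ≤ 100
  bound_one : ∀ x, |deriv φ.eval x| ≤ 100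
  bound_two : ∀ x, |iteratedDeriv 2 φ.eval x| ≤ 100
  bound_all : ∀ k : ℕ, 1 ≤ k → ∀ x, |iteratedDeriv k φ.eval x| ≤ (100 + |x|) ^ k
  mean_zero : ∫ x, φ.eval x ∂gauss = 0
  variance_one : ∫ x, φ.eval x ^ 2 ∂gauss = 1

/-- `u ↦ 𝔼[φ(X) φ(Y)]` for standard Gaussian `X`, `Y` with correlation `u ∈ [-1, 1]`, realized as
`Y = u X + √(1 - u²) Z` with `Z` an independent standard Gaussian. -/
noncomputable def Denoiser.corr (φ : Denoiser) (u : ℝ) : ℝ :=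
  ∫ p : ℝ × ℝ, φ.eval p.1 * φ.eval (u * p.1 + √(1 - u ^ 2) * p.2) ∂(gauss.prod gauss)

/-- The second derivative at `0` of the correlation function. -/
noncomputable def Denoiser.curv (φ : Denoiser) : ℝ := iteratedDeriv 2 φ.corr 0

/-- `ℙ(X ≥ 1)` for a standard Gaussian `X`. -/
noncomputable def tailProb : ℝ := (gauss (Set.Ici 1)).toReal

/-- `ℙ(X ≥ 1, Y ≥ 1)` for standard Gaussian `X`, `Y` with correlation `ρ`. -/
noncomputable def jointTailProb (ρ : ℝ) : ℝ :=
  ((gauss.prod gauss) {p : ℝ × ℝ | 1 ≤ p.1 ∧ 1 ≤ ρ * p.1 + √(1 - ρ ^ 2) * p.2}).toReal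

/-- The data on which the algorithm depends, besides the number of seeds: the correlation `ρ`, the
denoiser `φ`, and the constant `Λ`. -/
structure Params where
  /-- correlation of the two matrices -/
  ρ : ℝ
  /-- denoiser -/
  φ : Denoiser
  /-- bound for the Taylor coefficients of `φ.corr` -/
  Λ : ℝ

/-- Standing assumptions on the parameters. -/
structure Params.Standing (m : Params) : Prop where
  rho_pos : 0 < m.ρ
  rho_lt_one : m.ρ < 1
  admissible : m.φ.Admissible
  curv_ne_zero : m.φ.curv ≠ 0
  Lam_pos : 0 < m.Λ
  coeff_le : ∀ k : ℕ, |iteratedDeriv k m.φ.corr 0 / (k.factorial : ℝ)| ≤ m.Λ * 2 ^ k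

/-- The starting value `ε₀ = corr (ρ / 2)`. -/
noncomputable def Params.eps0 (m : Params) : ℝ := m.φ.corr (m.ρ / 2)

/-- The explicit conditions on the number `K₀` of seeds. -/
def Params.SeedCondition (m : Params) (K0 : ℕ) : Prop :=
  10 ^ 30 * m.ρ⁻¹ ^ 30 * |m.φ.curv| ^ 4 * m.Λ ^ 4 * m.eps0⁻¹ ^ 2 ≤ (K0 : ℝ) ∧
    Real.log (10⁻¹ ^ 30 * |m.φ.curv| ^ 2 * m.Λ ^ 2 * m.ρ ^ 20 * K0) /
      Real.log (10 ^ 40 * |m.φ.curv| ^ 4 * m.Λ⁻¹ ^ 4 * m.ρ ^ 24 * K0 * m.eps0 ^ 2) < 1.01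

/-- The dimensions `K_t`: `K_{t+1}` is `10⁻²⁰ ρ²⁰ |corr''(0)|² Λ⁻² K_t²`, rounded down to a multiple
of `12`. -/
noncomputable def Params.K (m : Params) (K0 : ℕ) : ℕ → ℕ
  | 0 => K0
  | t + 1 =>
    12 * ⌊10⁻¹ ^ 20 * m.ρ ^ 20 * |m.φ.curv| ^ 2 * m.Λ⁻¹ ^ 2 * (Params.K m K0 t : ℝ) ^ 2 / 12⌋₊

/-- The number of iterations: the least `t` with `K_t ≥ (log n) ^ 1.1`. -/
noncomputable def Params.tStar (m : Params) (K0 n : ℕ) : ℕ :=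
  sInf {t : ℕ | Real.log n ^ (1.1 : ℝ) ≤ (m.K K0 t : ℝ)}

/-! ## Randomness -/

/-- A sample of all the random choices: a table of Gaussians, a table of uniform variables on
`[0, 1]` and a table of fair coins. -/
abbrev Tape : Type :=
  (ℕ × ℕ × ℕ → ℝ) × (ℕ × ℕ → unitInterval) × (ℕ × ℕ × ℕ × ℕ → Bool)

/-- The law of the tape: all entries of all tables are independent. -/
noncomputable def tapeLaw : Measure Tape :=
  (Measure.infinitePi (fun _ : ℕ × ℕ × ℕ => gaussianReal 0 1)).prod
    ((Measure.infinitePi (fun _ : ℕ × ℕ => (volume : Measure unitInterval))).prod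
      (Measure.infinitePi (fun _ : ℕ × ℕ × ℕ × ℕ => (PMF.uniformOfFintype Bool).toMeasure)))

/-- The Gaussian in position `(x, i, j)`. -/
def Tape.gaussAt (ω : Tape) (x i j : ℕ) : ℝ := ω.1 (x, i, j)

/-- The uniform variable in position `(x, s)`. -/
def Tape.unifAt (ω : Tape) (x s : ℕ) : ℝ := ω.2.1 (x, s)

/-- The coin in position `(t, r, i, j)`. -/
def Tape.coinAt (ω : Tape) (t r i j : ℕ) : Bool := ω.2.2 (t, r, i, j)

/-! ## Preprocessing and spectral cleaning -/

/-- Noise is added to the lower triangle and subtracted from the upper one; the noise `g i j` is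
attached to the unordered pair `{i, j}`, `i > j`, and the diagonal is set to `0`. -/
noncomputable def perturb {n : ℕ} (A : Matrix (Fin n) (Fin n) ℝ) (g : ℕ → ℕ → ℝ) :
    Matrix (Fin n) (Fin n) ℝ := fun i j =>
  if j < i then (A i j + g i j) / √2 else if i < j then (A i j - g j i) / √2 else 0

/-- The operator norm with respect to Euclidean norms. -/
noncomputable def opNorm {n : ℕ} (M : Matrix (Fin n) (Fin n) ℝ) : ℝ :=
  ‖Matrix.toEuclideanCLM (n := Fin n) (𝕜 := ℝ) M‖

/-- `v` and `w` are unit left and right singular vectors of `M` for the leading singular value. -/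
def IsLeadingPair {n : ℕ} (M : Matrix (Fin n) (Fin n) ℝ) (v w : Fin n → ℝ) : Prop :=
  v ⬝ᵥ v = 1 ∧ w ⬝ᵥ w = 1 ∧ M *ᵥ w = opNorm M • v ∧ Mᵀ *ᵥ v = opNorm M • w

open Classical in
/-- A fixed choice of a leading singular pair. It exists as soon as `n ≥ 1`. -/
noncomputable def leadingPair {n : ℕ} (M : Matrix (Fin n) (Fin n) ℝ) :
    (Fin n → ℝ) × (Fin n → ℝ) :=
  if h : ∃ p : (Fin n → ℝ) × (Fin n → ℝ), IsLeadingPair M p.1 p.2 then h.choose else (0, 0)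

/-- The sampling weights `(v_i² + w_i²) / 2`. -/
noncomputable def leverage {n : ℕ} (M : Matrix (Fin n) (Fin n) ℝ) (i : Fin n) : ℝ :=
  ((leadingPair M).1 i ^ 2 + (leadingPair M).2 i ^ 2) / 2

/-- `i` is the index drawn from the weights `p` with the help of `r ∈ [0, 1)`: the number `r` falls
into the `i`-th of the consecutive intervals of lengths `p 0, p 1, …`. -/
def Drawn {n : ℕ} (p : Fin n → ℝ) (r : ℝ) (i : Fin n) : Prop :=
  ∑ j ∈ Finset.Iio i, p j ≤ r ∧ r < ∑ j ∈ Finset.Iic i, p j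

open Classical in
/-- One round of cleaning: draw an index and set its row and its column to zero. -/
noncomputable def cleanStep {n : ℕ} (M : Matrix (Fin n) (Fin n) ℝ) (r : ℝ) :
    Matrix (Fin n) (Fin n) ℝ := fun i j =>
  if Drawn (leverage M) r i ∨ Drawn (leverage M) r j then 0 else M i j

/-- The matrix after `s` rounds of cleaning. -/
noncomputable def cleanSeq {n : ℕ} (M : Matrix (Fin n) (Fin n) ℝ) (r : ℕ → ℝ) :
    ℕ → Matrix (Fin n) (Fin n) ℝ
  | 0 => M
  | s + 1 => cleanStep (cleanSeq M r s) (r s)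

/-- The output of spectral cleaning: rounds are performed while the operator norm is at least
`10 √n`. -/
noncomputable def clean {n : ℕ} (M : Matrix (Fin n) (Fin n) ℝ) (r : ℕ → ℝ) :
    Matrix (Fin n) (Fin n) ℝ :=
  cleanSeq M r (sInf {s : ℕ | opNorm (cleanSeq M r s) < 10 * √(n : ℝ)})

/-- The cleaned first matrix. -/
noncomputable def cleanedA {n : ℕ} (ω : Tape) (A : Matrix (Fin n) (Fin n) ℝ) :
    Matrix (Fin n) (Fin n) ℝ :=
  clean (perturb A (ω.gaussAt 0)) (ω.unifAt 0)

/-- The cleaned second matrix. -/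
noncomputable def cleanedB {n : ℕ} (ω : Tape) (B : Matrix (Fin n) (Fin n) ℝ) :
    Matrix (Fin n) (Fin n) ℝ :=
  clean (perturb B (ω.gaussAt 1)) (ω.unifAt 1)

/-! ## Spectral subroutine -/

/-- `ν` is an orthonormal family of eigenvectors of `M` with eigenvalues in `(a, b)`. -/
def EigenFamily {k l : ℕ} (M : Matrix (Fin k) (Fin k) ℝ) (a b : ℝ) (ν : Fin l → Fin k → ℝ) : Prop :=
  (∀ i j, ν i ⬝ᵥ ν j = if i = j then 1 else 0) ∧
    ∀ i, ∃ x ∈ Set.Ioo a b, M *ᵥ ν i = x • ν i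

/-- At least `3k/4` eigenvalues of `Φ` lie in `(0.9, 1.1)` and at least `3k/4` eigenvalues of `Ψ` lie
in `(0.9 ε, 1.1 ε)` (for symmetric matrices, with multiplicity). -/
def SpectralAssumption {k : ℕ} (Φ Ψ : Matrix (Fin k) (Fin k) ℝ) (ε : ℝ) : Prop :=
  (∃ ν : Fin (3 * k / 4) → Fin k → ℝ, EigenFamily Φ 0.9 1.1 ν) ∧
    ∃ ζ : Fin (3 * k / 4) → Fin k → ℝ, EigenFamily Ψ (0.9 * ε) (1.1 * ε) ζ

/-- The columns of `Ξ` lie in the intersection of the spans of `3k/4` of the above eigenvectors of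
`Φ` and of `Ψ`, they are orthonormal for `Φ` and orthogonal for `Ψ`, and `Ψ` takes values comparable
to `ε` on them. -/
def IsXi {k : ℕ} (Φ Ψ : Matrix (Fin k) (Fin k) ℝ) (ε : ℝ) (Ξ : Matrix (Fin k) (Fin (k / 12)) ℝ) :
    Prop :=
  (∃ ν ζ : Fin (3 * k / 4) → Fin k → ℝ,
      EigenFamily Φ 0.9 1.1 ν ∧ EigenFamily Ψ (0.9 * ε) (1.1 * ε) ζ ∧
      ∀ j, (fun i => Ξ i j) ∈
        Submodule.span ℝ (Set.range ν) ⊓ Submodule.span ℝ (Set.range ζ)) ∧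
    Ξᵀ * Φ * Ξ = 1 ∧ (Ξᵀ * Ψ * Ξ).IsDiag ∧
    ∀ j, (Ξᵀ * Ψ * Ξ) j j ∈ Set.Ioo (0.9 / 1.1 * ε) (1.1 / 0.9 * ε)

/-- A rule that selects `Ξ` as a function of `(Φ, Ψ, ε)`. -/
def XiRule : Type :=
  ∀ k : ℕ, Matrix (Fin k) (Fin k) ℝ → Matrix (Fin k) (Fin k) ℝ → ℝ →
    Matrix (Fin k) (Fin (k / 12)) ℝ

/-- The rule selects an appropriate `Ξ` whenever the spectral assumption holds. -/
def XiRule.Valid (χ : XiRule) : Prop :=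
  ∀ (k : ℕ) (Φ Ψ : Matrix (Fin k) (Fin k) ℝ) (ε : ℝ), 12 ∣ k → Φ.IsSymm → Ψ.IsSymm →
    SpectralAssumption Φ Ψ ε → IsXi Φ Ψ ε (χ k Φ Ψ ε)

/-- The triple `(Φ, Ψ, ε)` that the spectral subroutine maintains. -/
structure SpecState (k : ℕ) where
  /-- the matrix `Φ` -/
  Phi : Matrix (Fin k) (Fin k) ℝ
  /-- the matrix `Ψ` -/
  Psi : Matrix (Fin k) (Fin k) ℝ
  /-- the number `ε` -/
  eps : ℝ

/-- The spectral assumption for a triple. -/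
def SpecState.Good {k : ℕ} (s : SpecState k) : Prop := SpectralAssumption s.Phi s.Psi s.eps

/-- The value of the rule on a triple. -/
def XiRule.app (χ : XiRule) {k : ℕ} (s : SpecState k) : Matrix (Fin k) (Fin (k / 12)) ℝ :=
  χ k s.Phi s.Psi s.eps

/-- The `k/12` by `l` sign matrix with entries `±√(12/k)` given by coins. -/
noncomputable def signMatrix (k l : ℕ) (coin : ℕ → ℕ → Bool) : Matrix (Fin (k / 12)) (Fin l) ℝ :=
  fun i j => if coin i j then √(12 / (k : ℝ)) else -√(12 / (k : ℝ))

/-- The next triple, computed from the present one, from `Ξ` and from `β`. -/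
noncomputable def SpecState.next (m : Params) {k l : ℕ} (s : SpecState k)
    (Ξ : Matrix (Fin k) (Fin (k / 12)) ℝ) (β : Matrix (Fin (k / 12)) (Fin l) ℝ) : SpecState l where
  Phi := fun i j => m.φ.corr ((βᵀ * β) i j)
  Psi := fun i j => m.φ.corr (m.ρ / 2 * (βᵀ * (Ξᵀ * s.Psi * Ξ) * β) i j)
  eps := m.φ.corr (m.ρ / 2 * (12 / (k : ℝ) * (Ξᵀ * s.Psi * Ξ).trace))

/-- The sign matrix at level `t` that is accepted: the first one in the sequence of independent
samples for which the next triple satisfies the spectral assumption. -/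
noncomputable def acceptedSigns (m : Params) {k : ℕ} (l : ℕ) (s : SpecState k)
    (Ξ : Matrix (Fin k) (Fin (k / 12)) ℝ) (coin : ℕ → ℕ → ℕ → Bool) :
    Matrix (Fin (k / 12)) (Fin l) ℝ :=
  signMatrix k l (coin (sInf {r : ℕ | (s.next m Ξ (signMatrix k l (coin r))).Good}))

/-- The triples `(Φ^(t), Ψ^(t), ε_t)`. -/
noncomputable def specSeq (m : Params) (K0 : ℕ) (χ : XiRule) (ω : Tape) :
    (t : ℕ) → SpecState (m.K K0 t)
  | 0 => { Phi := 1, Psi := m.eps0 • 1, eps := m.eps0 }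
  | t + 1 =>
    (specSeq m K0 χ ω t).next m (χ.app (specSeq m K0 χ ω t))
      (acceptedSigns m (m.K K0 (t + 1)) (specSeq m K0 χ ω t) (χ.app (specSeq m K0 χ ω t))
        (ω.coinAt t))

/-- The matrices `Ξ^(t)`. -/
noncomputable def xiSeq (m : Params) (K0 : ℕ) (χ : XiRule) (ω : Tape) (t : ℕ) :
    Matrix (Fin (m.K K0 t)) (Fin (m.K K0 t / 12)) ℝ :=
  χ.app (specSeq m K0 χ ω t)

/-- The matrices `β^(t)`. -/
noncomputable def betaSeq (m : Params) (K0 : ℕ) (χ : XiRule) (ω : Tape) (t : ℕ) :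
    Matrix (Fin (m.K K0 t / 12)) (Fin (m.K K0 (t + 1))) ℝ :=
  acceptedSigns m (m.K K0 (t + 1)) (specSeq m K0 χ ω t) (xiSeq m K0 χ ω t) (ω.coinAt t)

/-! ## Vector approximate message passing and the candidate matchings -/

/-- The indices outside a seed sequence. -/
abbrev Rest {n K0 : ℕ} (U : Fin K0 ↪ Fin n) : Type := {i : Fin n // ∀ k, U k ≠ i}

/-- One linear step of the iteration, from `f^(t)` to `h^(t)`. -/
noncomputable def ampLinear {n K0 k l : ℕ} (M : Matrix (Fin n) (Fin n) ℝ) (U : Fin K0 ↪ Fin n)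
    (f : Matrix (Rest U) (Fin k) ℝ) (Ξ : Matrix (Fin k) (Fin l) ℝ) : Matrix (Rest U) (Fin l) ℝ :=
  (√(n : ℝ))⁻¹ •
    ((M.submatrix Subtype.val Subtype.val : Matrix (Rest U) (Rest U) ℝ) * f * Ξ)

/-- The iterates `f^(t)` (or `g^(t)`), started from the columns of the seeds. -/
noncomputable def ampF (m : Params) {n K0 : ℕ} (χ : XiRule) (ω : Tape)
    (M : Matrix (Fin n) (Fin n) ℝ) (U : Fin K0 ↪ Fin n) :
    (t : ℕ) → Matrix (Rest U) (Fin (m.K K0 t)) ℝ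
  | 0 => fun i k => m.φ.eval (M i (U k))
  | t + 1 =>
    (ampLinear M U (ampF m χ ω M U t) (xiSeq m K0 χ ω t) * betaSeq m K0 χ ω t).map m.φ.eval

/-- The iterates `h^(t)` (or `ℓ^(t)`). -/
noncomputable def ampH (m : Params) {n K0 : ℕ} (χ : XiRule) (ω : Tape)
    (M : Matrix (Fin n) (Fin n) ℝ) (U : Fin K0 ↪ Fin n) (t : ℕ) :
    Matrix (Rest U) (Fin (m.K K0 t / 12)) ℝ :=
  ampLinear M U (ampF m χ ω M U t) (xiSeq m K0 χ ω t)

/-- The entrywise inner product of `h` with the matrix `ℓ` whose rows are rearranged by `σ`. -/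
noncomputable def assignmentValue {X Y : Type} [Fintype X] {l : ℕ} (h : Matrix X (Fin l) ℝ)
    (ℓ : Matrix Y (Fin l) ℝ) (σ : X ≃ Y) : ℝ :=
  ∑ i, ∑ j, h i j * ℓ (σ i) j

/-- `π` sends the seeds `U` to the seeds `V` in order, and on the other indices it solves the linear
assignment problem. -/
def SolvesAssignment {n K0 l : ℕ} (U V : Fin K0 ↪ Fin n) (h : Matrix (Rest U) (Fin l) ℝ)
    (ℓ : Matrix (Rest V) (Fin l) ℝ) (π : Equiv.Perm (Fin n)) : Prop :=
  (∀ k, π (U k) = V k) ∧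
    ∃ σ : Rest U ≃ Rest V, (∀ i : Rest U, π i = σ i) ∧
      ∀ τ : Rest U ≃ Rest V, assignmentValue h ℓ τ ≤ assignmentValue h ℓ σ

/-- `π` is the candidate matching for the pair of seed sequences `(U, V)`. -/
def IsCandidate (m : Params) {n K0 : ℕ} (χ : XiRule) (ω : Tape) (A B : Matrix (Fin n) (Fin n) ℝ)
    (U V : Fin K0 ↪ Fin n) (π : Equiv.Perm (Fin n)) : Prop :=
  SolvesAssignment U V (ampH m χ ω (cleanedA ω A) U (m.tStar K0 n))
    (ampH m χ ω (cleanedB ω B) V (m.tStar K0 n)) π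

/-! ## Seeded matching and the final selection -/

/-- The number `∑ w, (𝟙[A u w ≥ 1] - α) (𝟙[B v (π w) ≥ 1] - α)`. -/
noncomputable def neighborhood {n : ℕ} (A B : Matrix (Fin n) (Fin n) ℝ) (π : Equiv.Perm (Fin n))
    (u v : Fin n) : ℝ :=
  ∑ w, (Set.indicator (Set.Ici 1) 1 (A u w) - tailProb) *
    (Set.indicator (Set.Ici 1) 1 (B v (π w)) - tailProb)

/-- One modification of `σ` in the seeded matching algorithm with scores `N` and threshold `Δ`. The
permutation `swap (σ u) v * σ` maps `u` to `v` and `σ⁻¹ v` to `σ u`. -/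
def SeededStep {n : ℕ} (N : Fin n → Fin n → ℝ) (Δ : ℝ) (σ σ' : Equiv.Perm (Fin n)) : Prop :=
  ∃ u v : Fin n, Δ ≤ N u v ∧ N u (σ u) < Δ / 10 ∧ N (σ⁻¹ v) v < Δ / 10 ∧
    σ' = Equiv.swap (σ u) v * σ

/-- `σ` is an output of the seeded matching algorithm on the input `π`: it is reached from `π` by
modifications, and no further modification is possible. -/
def IsRefinement (ρ : ℝ) {n : ℕ} (A B : Matrix (Fin n) (Fin n) ℝ) (π σ : Equiv.Perm (Fin n)) :
    Prop :=
  Relation.ReflTransGen (SeededStep (neighborhood A B π) (jointTailProb ρ * n / 10)) π σ ∧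
    ∀ σ', ¬ SeededStep (neighborhood A B π) (jointTailProb ρ * n / 10) σ σ'

open Classical in
/-- The number of pairs `u < v` with `A u v ≥ 1` and `B (σ u) (σ v) ≥ 1`. -/
noncomputable def overlap {n : ℕ} (A B : Matrix (Fin n) (Fin n) ℝ) (σ : Equiv.Perm (Fin n)) : ℕ :=
  (Finset.univ.filter fun p : Fin n × Fin n =>
    p.1 < p.2 ∧ 1 ≤ A p.1 p.2 ∧ 1 ≤ B (σ p.1) (σ p.2)).card

/-- `σ` is an output of the whole algorithm: among the refinements of the candidate matchings of all
pairs of seed sequences it has the largest overlap. -/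
def IsFinalOutput (m : Params) (K0 : ℕ) {n : ℕ} (χ : XiRule) (ω : Tape)
    (A B : Matrix (Fin n) (Fin n) ℝ) (σ : Equiv.Perm (Fin n)) : Prop :=
  ∃ cand refined : (Fin K0 ↪ Fin n) → (Fin K0 ↪ Fin n) → Equiv.Perm (Fin n),
    (∀ U V, IsCandidate m χ ω A B U V (cand U V)) ∧
    (∀ U V, IsRefinement m.ρ A B (cand U V) (refined U V)) ∧
    ∃ U V, σ = refined U V ∧ ∀ U' V', overlap A B (refined U' V') ≤ overlap A B σ

/-! ## The machine model

A real random access machine with structured control. Its memory consists of named two-dimensional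
arrays of natural numbers and of real numbers. Natural numbers can only be added, subtracted and
compared. Real numbers can be combined by the field operations, compared, and `√`, `exp`, `log` and
`cos` can be evaluated. There is no rounding of real numbers. Every elementary operation, memory
access and access to the table of random samples costs one step. As exact singular vectors and
eigenvectors cannot be obtained by finitely many of these operations, there are two numerical
primitives; their prices are parameters. -/

/-- Expressions for natural numbers. -/
inductive NExp : Type
  | const (c : ℕ)
  | get (x : ℕ) (i j : NExp)
  | add (e e' : NExp)
  | sub (e e' : NExp)
  | coin (t r i j : NExp)

/-- Expressions for real numbers. -/
inductive RExp : Type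
  | const (c : ℝ)
  | get (x : ℕ) (i j : NExp)
  | ofNat (e : NExp)
  | add (e e' : RExp)
  | sub (e e' : RExp)
  | mul (e e' : RExp)
  | div (e e' : RExp)
  | sqrt (e : RExp)
  | exp (e : RExp)
  | log (e : RExp)
  | cos (e : RExp)
  | gauss (x i j : NExp)
  | unif (x s : NExp)

/-- Tests. -/
inductive BExp : Type
  | natLe (e e' : NExp)
  | realLe (e e' : RExp)
  | not (b : BExp)
  | and (b b' : BExp)

/-- Programs. The array names are constants of the program. -/
inductive Cmd : Type
  | skip
  | setNat (x : ℕ) (i j : NExp) (e : NExp)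
  | setReal (x : ℕ) (i j : NExp) (e : RExp)
  | seq (c c' : Cmd)
  | ite (b : BExp) (c c' : Cmd)
  | while (b : BExp) (c : Cmd)
  /-- leading singular pair of the leading `d × d` block of the array `x`, written to `y` and `z` -/
  | singular (x : ℕ) (d : NExp) (y z : ℕ)
  /-- spectral decomposition of the leading `d × d` block of the array `x`, eigenvalues written to `y`
  and eigenvectors to the columns of `z` -/
  | spectral (x : ℕ) (d : NExp) (y z : ℕ)

/-- Memory contents. -/
structure Mem where
  /-- arrays of natural numbers -/
  nat : ℕ → ℕ → ℕ → ℕ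
  /-- arrays of real numbers -/
  real : ℕ → ℕ → ℕ → ℝ

/-- Value of an expression. -/
def NExp.val (ω : Tape) (s : Mem) : NExp → ℕ
  | const c => c
  | get x i j => s.nat x (i.val ω s) (j.val ω s)
  | add e e' => e.val ω s + e'.val ω s
  | sub e e' => e.val ω s - e'.val ω s
  | coin t r i j => (ω.coinAt (t.val ω s) (r.val ω s) (i.val ω s) (j.val ω s)).toNat

/-- Number of steps for an expression. -/
def NExp.cost : NExp → ℕ
  | const _ => 1
  | get _ i j => i.cost + j.cost + 1
  | add e e' => e.cost + e'.cost + 1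
  | sub e e' => e.cost + e'.cost + 1
  | coin t r i j => t.cost + r.cost + i.cost + j.cost + 1

/-- Value of an expression. -/
noncomputable def RExp.val (ω : Tape) (s : Mem) : RExp → ℝ
  | const c => c
  | get x i j => s.real x (i.val ω s) (j.val ω s)
  | ofNat e => (e.val ω s : ℝ)
  | add e e' => e.val ω s + e'.val ω s
  | sub e e' => e.val ω s - e'.val ω s
  | mul e e' => e.val ω s * e'.val ω s
  | div e e' => e.val ω s / e'.val ω s
  | sqrt e => √(e.val ω s)
  | exp e => Real.exp (e.val ω s)
  | log e => Real.log (e.val ω s)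
  | cos e => Real.cos (e.val ω s)
  | gauss x i j => ω.gaussAt (x.val ω s) (i.val ω s) (j.val ω s)
  | unif x t => ω.unifAt (x.val ω s) (t.val ω s)

/-- Number of steps for an expression. -/
def RExp.cost : RExp → ℕ
  | const _ => 1
  | get _ i j => i.cost + j.cost + 1
  | ofNat e => e.cost + 1
  | add e e' => e.cost + e'.cost + 1
  | sub e e' => e.cost + e'.cost + 1
  | mul e e' => e.cost + e'.cost + 1
  | div e e' => e.cost + e'.cost + 1
  | sqrt e => e.cost + 1
  | exp e => e.cost + 1
  | log e => e.cost + 1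
  | cos e => e.cost + 1
  | gauss x i j => x.cost + i.cost + j.cost + 1
  | unif x t => x.cost + t.cost + 1

/-- Truth of a test. -/
def BExp.Holds (ω : Tape) (s : Mem) : BExp → Prop
  | natLe e e' => e.val ω s ≤ e'.val ω s
  | realLe e e' => e.val ω s ≤ e'.val ω s
  | not b => ¬ b.Holds ω s
  | and b b' => b.Holds ω s ∧ b'.Holds ω s

/-- Number of steps for a test. -/
def BExp.cost : BExp → ℕ
  | natLe e e' => e.cost + e'.cost + 1
  | realLe e e' => e.cost + e'.cost + 1
  | not b => b.cost + 1
  | and b b' => b.cost + b'.cost + 1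

/-- Write one entry of an array of natural numbers. -/
def Mem.setNat (s : Mem) (x i j v : ℕ) : Mem :=
  { s with nat := fun x' i' j' => if x' = x ∧ i' = i ∧ j' = j then v else s.nat x' i' j' }

/-- Write one entry of an array of real numbers. -/
def Mem.setReal (s : Mem) (x i j : ℕ) (v : ℝ) : Mem :=
  { s with real := fun x' i' j' => if x' = x ∧ i' = i ∧ j' = j then v else s.real x' i' j' }

/-- The leading `d × d` block of a real array. -/
def Mem.block (s : Mem) (x d : ℕ) : Matrix (Fin d) (Fin d) ℝ := fun i j => s.real x i j

/-- Overwrite the leading `d × l` block of a real array. -/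
def Mem.setBlock (s : Mem) (x : ℕ) {d l : ℕ} (M : Matrix (Fin d) (Fin l) ℝ) : Mem :=
  { s with
    real := fun x' i j =>
      if h : x' = x ∧ i < d ∧ j < l then M ⟨i, h.2.1⟩ ⟨j, h.2.2⟩ else s.real x' i j }

/-- Overwrite the first `d` entries of the first column of a real array. -/
def Mem.setColumn (s : Mem) (x : ℕ) {d : ℕ} (v : Fin d → ℝ) : Mem :=
  s.setBlock x (Matrix.of fun (i : Fin d) (_ : Fin 1) => v i)

/-- `x` and the columns of the orthogonal matrix `Q` are the eigenvalues and eigenvectors of `M`. -/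
def IsSpectralDecomposition {d : ℕ} (M : Matrix (Fin d) (Fin d) ℝ) (x : Fin d → ℝ)
    (Q : Matrix (Fin d) (Fin d) ℝ) : Prop :=
  Qᵀ * Q = 1 ∧ M * Q = Q * Matrix.diagonal x

open Classical in
/-- A fixed choice of a spectral decomposition. It exists for every symmetric matrix. -/
noncomputable def spectralDecomposition {d : ℕ} (M : Matrix (Fin d) (Fin d) ℝ) :
    (Fin d → ℝ) × Matrix (Fin d) (Fin d) ℝ :=
  if h : ∃ p : (Fin d → ℝ) × Matrix (Fin d) (Fin d) ℝ, IsSpectralDecomposition M p.1 p.2 then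
    h.choose else (0, 0)

/-- `Exec ω sv eg c s s' k`: on the tape `ω`, the program `c` started in the memory `s` halts in the
memory `s'` after `k` steps. Here `sv d` and `eg d` are the prices of a leading singular pair and of a
spectral decomposition in dimension `d`. -/
inductive Exec (ω : Tape) (sv eg : ℕ → ℕ) : Cmd → Mem → Mem → ℕ → Prop
  | skip (s : Mem) : Exec ω sv eg .skip s s 1
  | setNat (x : ℕ) (i j e : NExp) (s : Mem) :
      Exec ω sv eg (.setNat x i j e) s (s.setNat x (i.val ω s) (j.val ω s) (e.val ω s))
        (i.cost + j.cost + e.cost + 1)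
  | setReal (x : ℕ) (i j : NExp) (e : RExp) (s : Mem) :
      Exec ω sv eg (.setReal x i j e) s (s.setReal x (i.val ω s) (j.val ω s) (e.val ω s))
        (i.cost + j.cost + e.cost + 1)
  | seq {c c' : Cmd} {s s' s'' : Mem} {k k' : ℕ} :
      Exec ω sv eg c s s' k → Exec ω sv eg c' s' s'' k' →
        Exec ω sv eg (.seq c c') s s'' (k + k')
  | iteTrue {b : BExp} {c c' : Cmd} {s s' : Mem} {k : ℕ} :
      b.Holds ω s → Exec ω sv eg c s s' k → Exec ω sv eg (.ite b c c') s s' (b.cost + k + 1)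
  | iteFalse {b : BExp} {c c' : Cmd} {s s' : Mem} {k : ℕ} :
      ¬ b.Holds ω s → Exec ω sv eg c' s s' k → Exec ω sv eg (.ite b c c') s s' (b.cost + k + 1)
  | whileTrue {b : BExp} {c : Cmd} {s s' s'' : Mem} {k k' : ℕ} :
      b.Holds ω s → Exec ω sv eg c s s' k → Exec ω sv eg (.while b c) s' s'' k' →
        Exec ω sv eg (.while b c) s s'' (b.cost + k + k' + 1)
  | whileFalse {b : BExp} {c : Cmd} {s : Mem} :
      ¬ b.Holds ω s → Exec ω sv eg (.while b c) s s (b.cost + 1)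
  | singular (x : ℕ) (d : NExp) (y z : ℕ) (s : Mem) :
      Exec ω sv eg (.singular x d y z) s
        ((s.setColumn y (leadingPair (s.block x (d.val ω s))).1).setColumn z
          (leadingPair (s.block x (d.val ω s))).2)
        (d.cost + sv (d.val ω s) + 1)
  | spectral (x : ℕ) (d : NExp) (y z : ℕ) (s : Mem) :
      Exec ω sv eg (.spectral x d y z) s
        ((s.setColumn y (spectralDecomposition (s.block x (d.val ω s))).1).setBlock z
          (spectralDecomposition (s.block x (d.val ω s))).2)
        (d.cost + eg (d.val ω s) + 1)

/-- With probability one over the tape the program halts in a memory that satisfies `post`, and its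
expected number of steps is at most `T`. (The number of steps is bounded by a measurable function of
the tape with expectation at most `T`.) -/
def HaltsInExpectedTime (sv eg : ℕ → ℕ) (c : Cmd) (s : Mem) (post : Tape → Mem → Prop) (T : ℝ) :
    Prop :=
  ∃ τ : Tape → ℝ≥0∞, Measurable τ ∧ ∫⁻ ω, τ ω ∂tapeLaw ≤ ENNReal.ofReal T ∧
    ∀ᵐ ω ∂tapeLaw, ∃ (s' : Mem) (k : ℕ), Exec ω sv eg c s s' k ∧ (k : ℝ≥0∞) ≤ τ ω ∧ post ω s'

/-- The memory that contains `n` (array `0` of naturals) and the matrices `A`, `B` (arrays `0` and `1`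
of reals), and zeros otherwise. -/
def inputMem {n : ℕ} (A B : Matrix (Fin n) (Fin n) ℝ) : Mem :=
  Mem.setNat
    (Mem.setBlock (Mem.setBlock { nat := fun _ _ _ => 0, real := fun _ _ _ => 0 } 0 A) 1 B)
    0 0 0 n

/-- As `inputMem`, with the seed sequences `U`, `V` in the arrays `1` and `2` of naturals. -/
def inputMemSeeds {n K0 : ℕ} (A B : Matrix (Fin n) (Fin n) ℝ) (U V : Fin K0 ↪ Fin n) : Mem :=
  { inputMem A B with
    nat := fun x i j =>
      if h : x = 1 ∧ i < K0 ∧ j = 0 then (U ⟨i, h.2.1⟩ : ℕ)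
      else if h : x = 2 ∧ i < K0 ∧ j = 0 then (V ⟨i, h.2.1⟩ : ℕ)
      else (inputMem A B).nat x i j }

/-- The array `x` of naturals contains the table of values of `π`. -/
def Mem.Stores (s : Mem) (x : ℕ) {n : ℕ} (π : Equiv.Perm (Fin n)) : Prop :=
  ∀ i : Fin n, s.nat x i 0 = (π i : ℕ)

/-- The program `c` computes, for the pair `(U, V)` of seed sequences, the candidate matching (array
`3`) and its refinement (array `4`), in expected time `T`. -/
def ComputesCandidate (m : Params) (sv eg : ℕ → ℕ) (χ : XiRule) (c : Cmd) {n K0 : ℕ}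
    (A B : Matrix (Fin n) (Fin n) ℝ) (U V : Fin K0 ↪ Fin n) (T : ℝ) : Prop :=
  HaltsInExpectedTime sv eg c (inputMemSeeds A B U V)
    (fun ω s => ∃ π σ : Equiv.Perm (Fin n), IsCandidate m χ ω A B U V π ∧
      IsRefinement m.ρ A B π σ ∧ s.Stores 3 π ∧ s.Stores 4 σ) T

/-- The program `c` performs the whole algorithm with `K0` seeds, writing the final matching to the
array `3`, in expected time `T`. -/
def ComputesMatching (m : Params) (sv eg : ℕ → ℕ) (χ : XiRule) (c : Cmd) (K0 : ℕ) {n : ℕ}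
    (A B : Matrix (Fin n) (Fin n) ℝ) (T : ℝ) : Prop :=
  HaltsInExpectedTime sv eg c (inputMem A B)
    (fun ω s => ∃ σ : Equiv.Perm (Fin n), IsFinalOutput m K0 χ ω A B σ ∧ s.Stores 3 σ) T

end RobustMatching

/-!
The running time is controlled in two separate steps: a program logic reduces everything to the
number of rejected sign matrices, and a moment computation bounds the expectation of that number.

*Programs.* `Tri E c s T Q` says that the program `c`, started in `s`, halts within `T` times its
own text size in a memory that satisfies `Q`. With this normalization sequencing does not change
`T`, a loop multiplies it by the number of rounds (`Tri.whileLoop`), and no constants have to be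
tracked. `Frame` and `Exec.frame` carry the rest of the memory past a program. Each part of the
algorithm becomes a program with such a specification, and it remains to bound the number of rounds
of the loops.

* Spectral cleaning: an index with positive probability has a nonzero row or column, so each round
  removes one of at most `n` such indices (`mem_alive_of_leverage_pos`, `card_alive_cleanSeq`).
* Candidates: the constrained optimal bijection is an unconstrained optimal assignment once the
  pairs of seeds have prohibitively large weight (`solvesAssignment_of_forced`). The assignment
  problem is solved in cubic time by the primal-dual method: a partial matching by tight edges
  (`PrimalDual`) is enlarged along an alternating tree (`AltTree`), and a full matching by tight
  edges is optimal.
* Refinement: every modification increases the number of rows with a score of at least `Δ / 10`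
  (`settled_step`).
* The rule for `Ξ`: common vectors of the two spans of eigenvectors are the eigenvectors with
  eigenvalue `2` of the sum of the two projections, and there are enough of them by counting
  dimensions (`le_card_common`). Two further spectral decompositions make them orthonormal for `Φ`
  and diagonalize `Ψ`. So `rule` is valid (`rule_valid`) and is computed by finitely many spectral
  decompositions.
* The entries of `Φ` and `Ψ` are evaluated from a closed form of the correlation function
  (`corr_eq`).

*Rejected samples.* By the Gaussian integral, the correlation function is an even power series with
nonnegative coefficients (`hasSum_corr`). As the denoiser has mean zero and variance one, it starts
with the quadratic term and the coefficients sum to one, so that `corr u` is `coef 1 * u ^ 2` up to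
`u ^ 4` (`corr_bounds`). Its off-diagonal arguments in `Φ` and `Ψ` are sums of independent signs.
Their moments (`sign_moments`) bound the expected Frobenius distance of `Φ` from the identity and of
`Ψ` from `ε` times the identity (`sum_corr_sq_le`). A small distance leaves at most a quarter of the
eigenvalues outside the prescribed intervals (`le_card_eigenvalues`). Hence at least half of the
sign matrices are good (`card_not_good_le`), provided that the next dimension is at most a small
multiple of the square of the present one; this holds for large `K0` (`exists_dims`). The triple at
level `t` depends on the coins of the lower levels only (`measurableSet_specSeq`), so that the
samples at level `t` are independent of it and the number of them is dominated by a geometric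
variable: it is almost surely finite (`ae_accepted`) with expectation at most two
(`lintegral_samples_le`).

*Exponents.* The dimensions at least double and the last one is bounded by a power of `log n`
(`Dims.isBigOPow_K`). So the number of levels and all prices of spectral decompositions in these
dimensions are `n ^ o(1)`, and one pair costs `n ^ (3 + o(1))`, from products of square matrices
with thin ones, the assignment problem, `n` singular pairs and `n` scans during the refinement. All
pairs of sequences of seeds are visited by `2 * K0` nested loops (`Tri.nest`), which gives the
factor `n ^ (2 * K0)`.
-/

namespace RobustMatching
section

/-! ### A program logic with running times -/

/-- The environment of an execution: the tape and the prices of the two numerical primitives. -/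
structure Env where
  /-- the tape -/
  ω : Tape
  /-- price of a leading singular pair -/
  sv : ℕ → ℕ
  /-- price of a spectral decomposition -/
  eg : ℕ → ℕ

/-- The syntactic size of a program: the price of one pass through its text. -/
def Cmd.size : Cmd → ℕ
  | skip => 1
  | setNat _ i j e => i.cost + j.cost + e.cost + 1
  | setReal _ i j e => i.cost + j.cost + e.cost + 1
  | seq c c' => c.size + c'.size
  | ite b c c' => b.cost + c.size + c'.size + 1
  | .while b c => b.cost + c.size + 1
  | singular _ d _ _ => d.cost + 1
  | spectral _ d _ _ => d.cost + 1

/-- Whether the text of a program contains an assignment to the array `x` of naturals. -/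
def Cmd.setsNat (x : ℕ) : Cmd → Bool
  | skip => false
  | setNat y _ _ _ => y == x
  | setReal _ _ _ _ => false
  | seq c c' => c.setsNat x || c'.setsNat x
  | ite _ c c' => c.setsNat x || c'.setsNat x
  | .while _ c => c.setsNat x
  | singular _ _ _ _ => false
  | spectral _ _ _ _ => false

/-- Whether the text of a program contains an assignment to the array `x` of reals. -/
def Cmd.setsReal (x : ℕ) : Cmd → Bool
  | skip => false
  | setNat _ _ _ _ => false
  | setReal y _ _ _ => y == x
  | seq c c' => c.setsReal x || c'.setsReal x
  | ite _ c c' => c.setsReal x || c'.setsReal x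
  | .while _ c => c.setsReal x
  | singular _ _ y z => (y == x) || (z == x)
  | spectral _ _ y z => (y == x) || (z == x)

/-- The memories `s` and `s'` agree on all arrays to which `c` does not assign. -/
structure Frame (c : Cmd) (s s' : Mem) : Prop where
  nat : ∀ x, c.setsNat x = false → s'.nat x = s.nat x
  real : ∀ x, c.setsReal x = false → s'.real x = s.real x

theorem Frame.refl (c : Cmd) (s : Mem) : Frame c s s := ⟨fun _ _ => rfl, fun _ _ => rfl⟩

theorem Frame.trans {c : Cmd} {s s' s'' : Mem} (h : Frame c s s') (h' : Frame c s' s'') :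
    Frame c s s'' :=
  ⟨fun x hx => (h'.nat x hx).trans (h.nat x hx), fun x hx => (h'.real x hx).trans (h.real x hx)⟩

theorem Frame.mono {c c' : Cmd} {s s' : Mem} (h : Frame c s s')
    (hn : ∀ x, c'.setsNat x = false → c.setsNat x = false)
    (hr : ∀ x, c'.setsReal x = false → c.setsReal x = false) : Frame c' s s' :=
  ⟨fun x hx => h.nat x (hn x hx), fun x hx => h.real x (hr x hx)⟩

theorem Mem.setNat_nat (s : Mem) (x i j v x' i' j' : ℕ) :
    (s.setNat x i j v).nat x' i' j' = if x' = x ∧ i' = i ∧ j' = j then v else s.nat x' i' j' := rfl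

theorem Mem.setNat_nat_ne (s : Mem) {x x' : ℕ} (i j v : ℕ) (h : x' ≠ x) :
    (s.setNat x i j v).nat x' = s.nat x' := by
  funext i' j'; simp [Mem.setNat, h]

theorem Mem.setNat_nat_self (s : Mem) (x i j v : ℕ) : (s.setNat x i j v).nat x i j = v := by
  simp [Mem.setNat]

theorem Mem.setNat_real (s : Mem) (x i j v : ℕ) : (s.setNat x i j v).real = s.real := rfl

theorem Mem.setReal_nat (s : Mem) (x i j : ℕ) (v : ℝ) : (s.setReal x i j v).nat = s.nat := rfl

theorem Mem.setReal_real (s : Mem) (x i j : ℕ) (v : ℝ) (x' i' j' : ℕ) :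
    (s.setReal x i j v).real x' i' j' =
      if x' = x ∧ i' = i ∧ j' = j then v else s.real x' i' j' := rfl

theorem Mem.setReal_real_ne (s : Mem) {x x' : ℕ} (i j : ℕ) (v : ℝ) (h : x' ≠ x) :
    (s.setReal x i j v).real x' = s.real x' := by
  funext i' j'; simp [Mem.setReal, h]

theorem Mem.setReal_real_self (s : Mem) (x i j : ℕ) (v : ℝ) :
    (s.setReal x i j v).real x i j = v := by
  simp [Mem.setReal]

theorem Mem.setBlock_real_ne (s : Mem) {x x' : ℕ} {d l : ℕ} (M : Matrix (Fin d) (Fin l) ℝ)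
    (h : x' ≠ x) : (s.setBlock x M).real x' = s.real x' := by
  funext i j; simp [Mem.setBlock, h]

theorem Mem.setBlock_real_self (s : Mem) (x : ℕ) {d l : ℕ} (M : Matrix (Fin d) (Fin l) ℝ)
    (i : Fin d) (j : Fin l) : (s.setBlock x M).real x i j = M i j := by
  simp [Mem.setBlock]

/-- An execution changes only the arrays to which the text of the program assigns. What a program
leaves alone can therefore be read off its text, and invariants are carried past it by `rfl`. -/
theorem Exec.frame {ω : Tape} {sv eg : ℕ → ℕ} {c : Cmd} {s s' : Mem} {k : ℕ}
    (h : Exec ω sv eg c s s' k) : Frame c s s' := by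
  induction h with
  | skip s => exact Frame.refl _ _
  | setNat x i j e s =>
    refine ⟨fun y hy => ?_, fun y _ => rfl⟩
    simp only [Cmd.setsNat, beq_eq_false_iff_ne] at hy
    exact Mem.setNat_nat_ne _ _ _ _ (Ne.symm hy)
  | setReal x i j e s =>
    refine ⟨fun y _ => rfl, fun y hy => ?_⟩
    simp only [Cmd.setsReal, beq_eq_false_iff_ne] at hy
    exact Mem.setReal_real_ne _ _ _ _ (Ne.symm hy)
  | seq _ _ h1 h2 =>
    refine (h1.mono ?_ ?_).trans (h2.mono ?_ ?_) <;> intro x hx <;>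
      simp_all [Cmd.setsNat, Cmd.setsReal]
  | iteTrue _ _ h1 => refine h1.mono ?_ ?_ <;> intro x hx <;> simp_all [Cmd.setsNat, Cmd.setsReal]
  | iteFalse _ _ h1 => refine h1.mono ?_ ?_ <;> intro x hx <;> simp_all [Cmd.setsNat, Cmd.setsReal]
  | whileTrue _ _ _ h1 h2 => exact Frame.trans (h1.mono (fun _ h => h) (fun _ h => h)) h2
  | whileFalse _ => exact Frame.refl _ _
  | singular x d y z s =>
    refine ⟨fun y _ => rfl, fun w hw => ?_⟩
    simp only [Cmd.setsReal, Bool.or_eq_false_iff, beq_eq_false_iff_ne] at hw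
    rw [Mem.setColumn, Mem.setBlock_real_ne _ _ (Ne.symm hw.2), Mem.setColumn,
      Mem.setBlock_real_ne _ _ (Ne.symm hw.1)]
  | spectral x d y z s =>
    refine ⟨fun y _ => rfl, fun w hw => ?_⟩
    simp only [Cmd.setsReal, Bool.or_eq_false_iff, beq_eq_false_iff_ne] at hw
    rw [Mem.setBlock_real_ne _ _ (Ne.symm hw.2), Mem.setColumn,
      Mem.setBlock_real_ne _ _ (Ne.symm hw.1)]

/-- Started in `s`, the program `c` halts after at most `c.size * T` steps in a memory that
satisfies `Q`. Measuring time in multiples of the size of the text makes all constants disappear: a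
sequence of programs with bound `T` has bound `T`, and a loop multiplies the bound by the number of
rounds. -/
def Tri (E : Env) (c : Cmd) (s : Mem) (T : ℕ) (Q : Mem → Prop) : Prop :=
  ∃ s' k, Exec E.ω E.sv E.eg c s s' k ∧ k ≤ c.size * T ∧ Q s'

variable {E : Env} {c c' : Cmd} {s : Mem} {T : ℕ} {P Q : Mem → Prop}

theorem Tri.mono {T' : ℕ} (h : Tri E c s T P) (hT : T ≤ T')
    (hQ : ∀ s', Frame c s s' → P s' → Q s') : Tri E c s T' Q := by
  obtain ⟨s', k, he, hk, hp⟩ := h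
  exact ⟨s', k, he, hk.trans (Nat.mul_le_mul_left _ hT), hQ s' he.frame hp⟩

theorem Tri.imp (h : Tri E c s T P) (hQ : ∀ s', Frame c s s' → P s' → Q s') : Tri E c s T Q :=
  h.mono le_rfl hQ

theorem Tri.skip (hT : 1 ≤ T) (hQ : Q s) : Tri E .skip s T Q :=
  ⟨s, 1, .skip s, by simpa [Cmd.size] using hT, hQ⟩

theorem Tri.setNat {x : ℕ} {i j e : NExp} (hT : 1 ≤ T)
    (hQ : Q (s.setNat x (i.val E.ω s) (j.val E.ω s) (e.val E.ω s))) :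
    Tri E (.setNat x i j e) s T Q :=
  ⟨_, _, .setNat x i j e s, Nat.le_mul_of_pos_right _ hT, hQ⟩

theorem Tri.setReal {x : ℕ} {i j : NExp} {e : RExp} (hT : 1 ≤ T)
    (hQ : Q (s.setReal x (i.val E.ω s) (j.val E.ω s) (e.val E.ω s))) :
    Tri E (.setReal x i j e) s T Q :=
  ⟨_, _, .setReal x i j e s, Nat.le_mul_of_pos_right _ hT, hQ⟩

theorem Tri.seq (h : Tri E c s T P) (h' : ∀ s', Frame c s s' → P s' → Tri E c' s' T Q) :
    Tri E (.seq c c') s T Q := by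
  obtain ⟨s', k, he, hk, hp⟩ := h
  obtain ⟨s'', k', he', hk', hq⟩ := h' s' he.frame hp
  exact ⟨s'', k + k', .seq he he', by simp only [Cmd.size, add_mul]; omega, hq⟩

theorem Tri.ite {b : BExp} (hT : 1 ≤ T) (h : b.Holds E.ω s → Tri E c s T Q)
    (h' : ¬ b.Holds E.ω s → Tri E c' s T Q) : Tri E (.ite b c c') s T Q := by
  have hb : b.cost ≤ b.cost * T := Nat.le_mul_of_pos_right _ hT
  by_cases hB : b.Holds E.ω s
  · obtain ⟨s', k, he, hk, hp⟩ := h hB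
    exact ⟨s', _, .iteTrue hB he, by simp only [Cmd.size, add_mul, one_mul]; omega, hp⟩
  · obtain ⟨s', k, he, hk, hp⟩ := h' hB
    exact ⟨s', _, .iteFalse hB he, by simp only [Cmd.size, add_mul, one_mul]; omega, hp⟩

/-- The primitive for singular pairs writes `leadingPair` of the block of size `n` at the corner of the
array `x`, at the price `sv n`. -/
theorem Tri.singular {x y z n : ℕ} {d : NExp} (hyz : y ≠ z) (hd : d.val E.ω s = n)
    (hT : E.sv n + 1 ≤ T)
    (hQ : ∀ s', Frame (.singular x d y z) s s' →
      (∀ i : Fin n, s'.real y i 0 = (leadingPair (s.block x n)).1 i) →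
      (∀ i : Fin n, s'.real z i 0 = (leadingPair (s.block x n)).2 i) → Q s') :
    Tri E (.singular x d y z) s T Q := by
  subst hd
  have he := Exec.singular (ω := E.ω) (sv := E.sv) (eg := E.eg) x d y z s
  refine ⟨_, _, he, ?_, hQ _ he.frame (fun i => ?_) (fun i => ?_)⟩
  · simp only [Cmd.size]
    nlinarith
  · rw [Mem.setColumn, Mem.setBlock_real_ne _ _ hyz]
    exact Mem.setBlock_real_self _ y _ i 0
  · exact Mem.setBlock_real_self _ z _ i 0

theorem Tri.spectral {x y z n : ℕ} {d : NExp} (hyz : y ≠ z) (hd : d.val E.ω s = n)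
    (hT : E.eg n + 1 ≤ T)
    (hQ : ∀ s', Frame (.spectral x d y z) s s' →
      (∀ i : Fin n, s'.real y i 0 = (spectralDecomposition (s.block x n)).1 i) →
      (∀ i j : Fin n, s'.real z i j = (spectralDecomposition (s.block x n)).2 i j) → Q s') :
    Tri E (.spectral x d y z) s T Q := by
  subst hd
  have he := Exec.spectral (ω := E.ω) (sv := E.sv) (eg := E.eg) x d y z s
  refine ⟨_, _, he, ?_, hQ _ he.frame (fun i => ?_) (fun i j => ?_)⟩
  · simp only [Cmd.size]
    nlinarith
  · rw [Mem.setBlock_real_ne _ _ hyz]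
    exact Mem.setBlock_real_self _ y _ i 0
  · exact Mem.setBlock_real_self _ z _ i j

/-- The rule for loops, with an invariant that is indexed by the number of completed rounds. -/
theorem Tri.whileLoop {b : BExp} {T₀ : ℕ} (Inv : ℕ → Mem → Prop) (R : ℕ) (hT : (R + 1) * T₀ ≤ T)
    (hT₀ : 1 ≤ T₀) (h0 : Inv 0 s)
    (hstep : ∀ i s', Frame (.while b c) s s' → Inv i s' → b.Holds E.ω s' →
      i < R ∧ Tri E c s' T₀ (Inv (i + 1)))
    (hQ : ∀ i s', Frame (.while b c) s s' → Inv i s' → ¬ b.Holds E.ω s' → Q s') :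
    Tri E (.while b c) s T Q := by
  have key : ∀ d i s', R - i ≤ d → Frame (.while b c) s s' → Inv i s' →
      ∃ s'' k, Exec E.ω E.sv E.eg (.while b c) s' s'' k ∧
        k ≤ d * (b.cost + 1 + c.size * T₀) + (b.cost + 1) ∧ Q s'' := by
    intro d
    induction d with
    | zero =>
      intro i s' hd hf hi
      by_cases hb : b.Holds E.ω s'
      · have := (hstep i s' hf hi hb).1
        omega
      · exact ⟨s', _, .whileFalse hb, by simp, hQ i s' hf hi hb⟩
    | succ d ih =>
      intro i s' hd hf hi
      by_cases hb : b.Holds E.ω s'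
      · obtain ⟨hiR, s₁, k₁, he, hk₁, hi₁⟩ := hstep i s' hf hi hb
        have hf₁ : Frame (.while b c) s' s₁ := he.frame.mono (fun _ h => h) (fun _ h => h)
        obtain ⟨s₂, k₂, he₂, hk₂, hq⟩ := ih (i + 1) s₁ (by omega) (hf.trans hf₁) hi₁
        refine ⟨s₂, _, .whileTrue hb he he₂, ?_, hq⟩
        rw [add_mul, one_mul]
        omega
      · exact ⟨s', _, .whileFalse hb, by omega, hQ i s' hf hi hb⟩
  obtain ⟨s'', k, he, hk, hq⟩ := key R 0 s (by omega) (Frame.refl _ _) h0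
  refine ⟨s'', k, he, hk.trans ?_, hq⟩
  refine le_trans ?_ (Nat.mul_le_mul_left _ hT)
  have h1 : R * (b.cost + 1) ≤ R * (b.cost + 1) * T₀ := Nat.le_mul_of_pos_right _ hT₀
  have h2 : (b.cost + 1) ≤ (b.cost + 1) * T₀ := Nat.le_mul_of_pos_right _ hT₀
  simp only [Cmd.size]
  nlinarith [Nat.zero_le (c.size * T₀)]

/-- The value of a scalar variable. -/
def nv (x : ℕ) : NExp := .get x (.const 0) (.const 0)

/-- The value of a real scalar variable. -/
def rv (x : ℕ) : RExp := .get x (.const 0) (.const 0)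

@[simp] theorem nv_val (ω : Tape) (s : Mem) (x : ℕ) : (nv x).val ω s = s.nat x 0 0 := rfl

@[simp] theorem rv_val (ω : Tape) (s : Mem) (x : ℕ) : (rv x).val ω s = s.real x 0 0 := rfl

attribute [simp] NExp.val RExp.val BExp.Holds

/-- `for x = 0, …, b - 1 do c`. -/
def forN (x : ℕ) (b : NExp) (c : Cmd) : Cmd :=
  .seq (.setNat x (.const 0) (.const 0) (.const 0))
    (.while (.natLe (.add (nv x) (.const 1)) b)
      (.seq c (.setNat x (.const 0) (.const 0) (.add (nv x) (.const 1)))))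

theorem forN_setsNat (x y : ℕ) (b : NExp) (c : Cmd) :
    (forN x b c).setsNat y = (c.setsNat y || (x == y)) := by
  simp only [forN, Cmd.setsNat]
  cases c.setsNat y <;> cases (x == y) <;> rfl

theorem forN_setsReal (x y : ℕ) (b : NExp) (c : Cmd) :
    (forN x b c).setsReal y = c.setsReal y := by
  simp [forN, Cmd.setsReal]

/-- The rule for counting loops. The body must not assign to the loop variable, and the invariant
must not depend on its value, since the loop resets and increases it. -/
theorem Tri.forN {x : ℕ} {b : NExp} {T₀ : ℕ} (N : ℕ) (Inv : ℕ → Mem → Prop)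
    (hT : (N + 1) * T₀ ≤ T) (hT₀ : 1 ≤ T₀) (hc : c.setsNat x = false)
    (hb : ∀ s', Frame (forN x b c) s s' → b.val E.ω s' = N)
    (hI : ∀ i s' v, Inv i s' → Inv i (s'.setNat x 0 0 v))
    (h0 : Inv 0 s)
    (hstep : ∀ i < N, ∀ s', Frame (RobustMatching.forN x b c) s s' → s'.nat x 0 0 = i → Inv i s' →
      Tri E c s' T₀ (Inv (i + 1)))
    (hQ : ∀ s', Frame (RobustMatching.forN x b c) s s' → s'.nat x 0 0 = N → Inv N s' → Q s') :
    Tri E (RobustMatching.forN x b c) s T Q := by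
  have hT1 : 1 ≤ T := le_trans (Nat.one_le_iff_ne_zero.2 (by positivity)) hT
  unfold RobustMatching.forN
  have hfr0 : Frame (RobustMatching.forN x b c) s (s.setNat x 0 0 0) := by
    refine ⟨fun y hy => ?_, fun y _ => rfl⟩
    rw [forN_setsNat] at hy
    simp only [Bool.or_eq_false_iff, beq_eq_false_iff_ne] at hy
    exact Mem.setNat_nat_ne _ _ _ _ (Ne.symm hy.2)
  refine Tri.seq (P := fun s' => s' = s.setNat x 0 0 0) (Tri.setNat hT1 (by simp)) ?_
  rintro s' - rfl
  have hfw : ∀ s', Frame (.while (.natLe (.add (nv x) (.const 1)) b)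
      (.seq c (.setNat x (.const 0) (.const 0) (.add (nv x) (.const 1)))))
      (s.setNat x 0 0 0) s' → Frame (RobustMatching.forN x b c) s s' := by
    intro s' h
    refine hfr0.trans (h.mono ?_ ?_)
    · intro y hy
      simp only [RobustMatching.forN, Cmd.setsNat, Bool.or_eq_false_iff] at hy ⊢
      exact hy.2
    · intro y hy
      simpa [RobustMatching.forN, Cmd.setsReal] using hy
  refine Tri.whileLoop (fun i s' => s'.nat x 0 0 = i ∧ i ≤ N ∧ Inv i s') N hT hT₀ ?_ ?_ ?_
  · exact ⟨Mem.setNat_nat_self _ _ _ _ _, Nat.zero_le _, hI _ _ _ h0⟩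
  · rintro i s' hf ⟨hx, hi, hinv⟩ hcond
    have hf' := hfw s' hf
    simp only [BExp.Holds, NExp.val, nv_val, hx, hb s' hf'] at hcond
    refine ⟨by omega, Tri.seq (hstep i (by omega) s' hf' hx hinv) ?_⟩
    intro s'' hf'' hinv'
    refine Tri.setNat hT₀ ?_
    simp only [NExp.val, nv_val]
    have : s''.nat x 0 0 = i := by rw [hf''.nat x hc, hx]
    rw [this]
    exact ⟨Mem.setNat_nat_self _ _ _ _ _, by omega, hI _ _ _ hinv'⟩
  · rintro i s' hf ⟨hx, hi, hinv⟩ hcond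
    have hf' := hfw s' hf
    simp only [BExp.Holds, NExp.val, nv_val, hx, hb s' hf'] at hcond
    obtain rfl : i = N := by omega
    exact hQ s' hf' hx hinv

/-! ### Tables and sums -/

/-- `for i < N do for j < M do c`, with `i` and `j` in the variables `20` and `21`. -/
def table (N M : NExp) (c : Cmd) : Cmd := forN 20 N (forN 21 M c)

/-- A double loop whose body computes the entry `(i, j)` of a table. The table is presented by an
arbitrary view of the memory. -/
theorem Tri.table {α : Type} (view : Mem → ℕ → ℕ → α)
    (hview : ∀ s x v, x = 20 ∨ x = 21 → view (s.setNat x 0 0 v) = view s)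
    {N M : NExp} {T₀ : ℕ} (n m : ℕ) (F : ℕ → ℕ → α) (hT : (n + 1) * ((m + 1) * T₀) ≤ T)
    (hT₀ : 1 ≤ T₀) (hc0 : c.setsNat 20 = false) (hc1 : c.setsNat 21 = false)
    (hN : ∀ s', Frame (table N M c) s s' → N.val E.ω s' = n)
    (hM : ∀ s', Frame (table N M c) s s' → M.val E.ω s' = m)
    (hF : ∀ i < n, ∀ j < m, ∀ s', Frame (table N M c) s s' → view s' i j = view s i j →
      s'.nat 20 0 0 = i → s'.nat 21 0 0 = j → Tri E c s' T₀ (fun s'' => view s'' i j = F i j ∧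
        ∀ i' j', (i' ≠ i ∨ j' ≠ j) → view s'' i' j' = view s' i' j'))
    (hQ : ∀ s', Frame (RobustMatching.table N M c) s s' → (∀ i < n, ∀ j < m, view s' i j = F i j) →
      (∀ i j, ¬ (i < n ∧ j < m) → view s' i j = view s i j) → Q s') :
    Tri E (RobustMatching.table N M c) s T Q := by
  classical
  refine Tri.forN n (fun i s' => ∀ i' j', view s' i' j' =
    if i' < i ∧ j' < m then F i' j' else view s i' j') hT ?_ ?_ hN ?_ ?_ ?_ ?_
  · exact Nat.mul_pos (Nat.succ_pos _) hT₀
  · rw [forN_setsNat, hc0]; rfl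
  · intro i s' v h; rw [hview _ _ _ (Or.inl rfl)]; exact h
  · simp
  · intro i hi s' hf hi' hinv
    have hf2 : ∀ s'', Frame (RobustMatching.forN 21 M c) s' s'' →
        Frame (RobustMatching.table N M c) s s'' := fun s'' h => hf.trans (h.mono
          (fun y hy => by
            simp only [forN_setsNat, Bool.or_eq_false_iff] at hy ⊢
            exact hy.1)
          (fun y hy => by simpa only [RobustMatching.table, forN_setsReal] using hy))
    refine Tri.forN m (fun j s'' => ∀ i' j', view s'' i' j' =
      if (i' < i ∧ j' < m) ∨ (i' = i ∧ j' < j) then F i' j' else view s i' j') le_rfl hT₀ hc1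
      (fun s'' h => hM s'' (hf2 s'' h)) ?_ ?_ ?_ ?_
    · intro j s' v h; rw [hview _ _ _ (Or.inr rfl)]; exact h
    · intro i' j'; rw [hinv]; simp
    · intro j hj s'' hf' hj' hinv'
      have h20 : s''.nat 20 0 0 = i := by
        rw [hf'.nat 20 (by rw [forN_setsNat, hc0]; rfl), hi']
      refine (hF i hi j hj s'' (hf2 _ hf') ?_ h20 hj').imp ?_
      · rw [hinv']; simp
      · rintro s₃ - ⟨h1, h2⟩ i' j'
        by_cases h : i' = i ∧ j' = j
        · obtain ⟨rfl, rfl⟩ := h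
          rw [h1, if_pos (Or.inr ⟨rfl, by omega⟩)]
        · rw [h2 i' j' (by tauto), hinv']
          refine if_congr ?_ rfl rfl
          omega
    · intro s'' _ _ hinv' i' j'
      rw [hinv']
      refine if_congr ?_ rfl rfl
      omega
  · intro s' hf _ hinv
    refine hQ s' hf (fun i hi j hj => ?_) (fun i j hij => ?_)
    · rw [hinv, if_pos ⟨hi, hj⟩]
    · rw [hinv, if_neg hij]

/-- `z[i, j] := if b then e else e'` for all `i < N`, `j < M`, for an array of reals. -/
def tabR (z : ℕ) (N M : NExp) (b : BExp) (e e' : RExp) : Cmd :=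
  table N M (.ite b (.setReal z (nv 20) (nv 21) e) (.setReal z (nv 20) (nv 21) e'))

/-- `z[i, j] := if b then e else e'` for all `i < N`, `j < M`, for an array of naturals. -/
def tabN (z : ℕ) (N M : NExp) (b : BExp) (e e' : NExp) : Cmd :=
  table N M (.ite b (.setNat z (nv 20) (nv 21) e) (.setNat z (nv 20) (nv 21) e'))

/-- `z[i, j] := ∑ k < K, e` for all `i < N`, `j < M`, with `k` in the variable `22` and with the
real variable `6` as accumulator. -/
def sumTab (z : ℕ) (N M K : NExp) (e : RExp) : Cmd :=
  table N M (.seq (.setReal 6 (.const 0) (.const 0) (.const 0))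
    (.seq (forN 22 K (.setReal 6 (.const 0) (.const 0) (.add (rv 6) e)))
      (.setReal z (nv 20) (nv 21) (rv 6))))

theorem Tri.tabR {z : ℕ} {N M : NExp} {b : BExp} {e e' : RExp} (n m : ℕ) (F : ℕ → ℕ → ℝ)
    (hT : (n + 1) * (m + 1) ≤ T)
    (hN : ∀ s', Frame (tabR z N M b e e') s s' → N.val E.ω s' = n)
    (hM : ∀ s', Frame (tabR z N M b e e') s s' → M.val E.ω s' = m)
    (hF : ∀ i < n, ∀ j < m, ∀ s', Frame (tabR z N M b e e') s s' → s'.real z i j = s.real z i j →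
      s'.nat 20 0 0 = i → s'.nat 21 0 0 = j →
      (b.Holds E.ω s' → e.val E.ω s' = F i j) ∧ (¬ b.Holds E.ω s' → e'.val E.ω s' = F i j))
    (hQ : ∀ s', Frame (RobustMatching.tabR z N M b e e') s s' →
      (∀ i < n, ∀ j < m, s'.real z i j = F i j) →
      (∀ i j, ¬ (i < n ∧ j < m) → s'.real z i j = s.real z i j) → Q s') :
    Tri E (RobustMatching.tabR z N M b e e') s T Q := by
  refine Tri.table (fun s => s.real z) (fun _ _ _ _ => rfl) (T₀ := 1) n m F
    (by simpa using hT) le_rfl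
    rfl rfl hN hM ?_ hQ
  intro i hi j hj s' hf hv h0 h1
  refine Tri.ite le_rfl (fun hb => Tri.setReal le_rfl ?_) (fun hb => Tri.setReal le_rfl ?_) <;>
    simp only [nv_val, h0, h1]
  · refine ⟨?_, fun i' j' h => ?_⟩
    · rw [Mem.setReal_real_self]; exact (hF i hi j hj s' hf hv h0 h1).1 hb
    · rw [Mem.setReal_real, if_neg (by tauto)]
  · refine ⟨?_, fun i' j' h => ?_⟩
    · rw [Mem.setReal_real_self]; exact (hF i hi j hj s' hf hv h0 h1).2 hb
    · rw [Mem.setReal_real, if_neg (by tauto)]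

theorem Tri.tabN {z : ℕ} {N M : NExp} {b : BExp} {e e' : NExp} (n m : ℕ) (F : ℕ → ℕ → ℕ)
    (hz : z ≠ 20 ∧ z ≠ 21) (hT : (n + 1) * (m + 1) ≤ T)
    (hN : ∀ s', Frame (tabN z N M b e e') s s' → N.val E.ω s' = n)
    (hM : ∀ s', Frame (tabN z N M b e e') s s' → M.val E.ω s' = m)
    (hF : ∀ i < n, ∀ j < m, ∀ s', Frame (tabN z N M b e e') s s' → s'.nat z i j = s.nat z i j →
      s'.nat 20 0 0 = i → s'.nat 21 0 0 = j →
      (b.Holds E.ω s' → e.val E.ω s' = F i j) ∧ (¬ b.Holds E.ω s' → e'.val E.ω s' = F i j))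
    (hQ : ∀ s', Frame (RobustMatching.tabN z N M b e e') s s' →
      (∀ i < n, ∀ j < m, s'.nat z i j = F i j) →
      (∀ i j, ¬ (i < n ∧ j < m) → s'.nat z i j = s.nat z i j) → Q s') :
    Tri E (RobustMatching.tabN z N M b e e') s T Q := by
  refine Tri.table (fun s => s.nat z) ?_ (T₀ := 1) n m F (by simpa using hT) le_rfl
    (by simpa [Cmd.setsNat] using hz.1) (by simpa [Cmd.setsNat] using hz.2) hN hM ?_ hQ
  · rintro s x v (rfl | rfl)
    · exact Mem.setNat_nat_ne _ _ _ _ hz.1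
    · exact Mem.setNat_nat_ne _ _ _ _ hz.2
  intro i hi j hj s' hf hv h0 h1
  refine Tri.ite le_rfl (fun hb => Tri.setNat le_rfl ?_) (fun hb => Tri.setNat le_rfl ?_) <;>
    simp only [nv_val, h0, h1]
  · refine ⟨?_, fun i' j' h => ?_⟩
    · rw [Mem.setNat_nat_self]; exact (hF i hi j hj s' hf hv h0 h1).1 hb
    · rw [Mem.setNat_nat, if_neg (by tauto)]
  · refine ⟨?_, fun i' j' h => ?_⟩
    · rw [Mem.setNat_nat_self]; exact (hF i hi j hj s' hf hv h0 h1).2 hb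
    · rw [Mem.setNat_nat, if_neg (by tauto)]

theorem Tri.sumTab {z : ℕ} {N M K : NExp} {e : RExp} (n m k : ℕ) (F : ℕ → ℕ → ℕ → ℝ) (hz : z ≠ 6)
    (hT : (n + 1) * (m + 1) * (k + 1) ≤ T)
    (hN : ∀ s', Frame (sumTab z N M K e) s s' → N.val E.ω s' = n)
    (hM : ∀ s', Frame (sumTab z N M K e) s s' → M.val E.ω s' = m)
    (hK : ∀ s', Frame (sumTab z N M K e) s s' → K.val E.ω s' = k)
    (hF : ∀ i < n, ∀ j < m, ∀ l < k, ∀ s', Frame (sumTab z N M K e) s s' →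
      s'.real z i j = s.real z i j → s'.nat 20 0 0 = i →
      s'.nat 21 0 0 = j → s'.nat 22 0 0 = l → e.val E.ω s' = F i j l)
    (hQ : ∀ s', Frame (RobustMatching.sumTab z N M K e) s s' →
      (∀ i < n, ∀ j < m, s'.real z i j = ∑ l ∈ Finset.range k, F i j l) →
      (∀ i j, ¬ (i < n ∧ j < m) → s'.real z i j = s.real z i j) → Q s') :
    Tri E (RobustMatching.sumTab z N M K e) s T Q := by
  refine Tri.table (fun s => s.real z) (fun _ _ _ _ => rfl) (T₀ := k + 1) n m
    (fun i j => ∑ l ∈ Finset.range k, F i j l) (by rw [← mul_assoc]; exact hT) (by omega)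
    rfl rfl hN hM ?_ hQ
  intro i hi j hj s' hf hv h0 h1
  refine Tri.seq (P := fun s₁ => s₁ = s'.setReal 6 0 0 0) (Tri.setReal (by omega) (by simp)) ?_
  rintro s₁ hf₁ rfl
  have hsub : ∀ s₂, Frame (RobustMatching.forN 22 K
      (.setReal 6 (.const 0) (.const 0) (.add (rv 6) e))) (s'.setReal 6 0 0 0) s₂ →
      Frame (RobustMatching.sumTab z N M K e) s s₂ := by
    intro s₂ h₂
    refine hf.trans ((hf₁.mono ?_ ?_).trans (h₂.mono ?_ ?_)) <;> intro y hy <;>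
      simp only [RobustMatching.table, forN_setsNat, forN_setsReal,
        Cmd.setsNat, Cmd.setsReal, Bool.or_eq_false_iff] at hy ⊢ <;> tauto
  refine Tri.seq (P := fun s₂ => s₂.real 6 0 0 = ∑ l ∈ Finset.range k, F i j l ∧
    s₂.real z = s'.real z ∧ s₂.nat 20 = s'.nat 20 ∧ s₂.nat 21 = s'.nat 21) ?_ ?_
  · refine Tri.forN k (fun l s₂ => s₂.real 6 0 0 = ∑ l ∈ Finset.range l, F i j l)
      (by simp) le_rfl rfl
      (fun s₂ h₂ => hK s₂ (hsub s₂ h₂)) (fun _ _ _ h => h) ?_ ?_ ?_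
    · simp [Mem.setReal_real]
    · intro l hl s₂ hf₂ hl' hinv
      refine Tri.setReal le_rfl ?_
      simp only [NExp.val, RExp.val, rv_val]
      rw [Mem.setReal_real_self, hinv, Finset.sum_range_succ]
      congr 1
      refine hF i hi j hj l hl s₂ (hsub s₂ hf₂) ?_ ?_ ?_ hl'
      · rw [hf₂.real z (by simpa [forN_setsReal, Cmd.setsReal] using Ne.symm hz),
          Mem.setReal_real_ne _ _ _ _ hz, hv]
      · rw [hf₂.nat 20 rfl]; exact h0
      · rw [hf₂.nat 21 rfl]; exact h1
    · intro s₂ hf₂ _ hinv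
      refine ⟨hinv, ?_, ?_, ?_⟩
      · rw [hf₂.real z (by simpa [forN_setsReal, Cmd.setsReal] using Ne.symm hz),
          Mem.setReal_real_ne _ _ _ _ hz]
      · rw [hf₂.nat 20 rfl]; rfl
      · rw [hf₂.nat 21 rfl]; rfl
  · rintro s₂ - ⟨h6, hz2, h20, h21⟩
    refine Tri.setReal (by omega) ?_
    simp only [nv_val, rv_val, h20, h21, h0, h1]
    refine ⟨by rw [Mem.setReal_real_self, h6], fun i' j' h => ?_⟩
    rw [Mem.setReal_real, if_neg (by tauto), hz2]

/-- The test that always succeeds. -/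
def btrue : BExp := .natLe (.const 0) (.const 0)

/-- `1` if `e < e'` and `0` otherwise. -/
def nlt (e e' : NExp) : NExp := .sub (.const 1) (.sub (.const 1) (.sub e' e))

theorem nlt_val (ω : Tape) (s : Mem) (e e' : NExp) :
    (nlt e e').val ω s = if e.val ω s < e'.val ω s then 1 else 0 := by
  simp only [nlt, NExp.val]
  split_ifs <;> omega

/-- The test `e < e'` for naturals. -/
def natLt (e e' : NExp) : BExp := .natLe (.add e (.const 1)) e'

theorem natLt_holds (ω : Tape) (s : Mem) (e e' : NExp) :
    (natLt e e').Holds ω s ↔ e.val ω s < e'.val ω s := by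
  simp only [natLt, BExp.Holds, NExp.val]; omega

/-- The test `e = e'` for naturals. -/
def natEq (e e' : NExp) : BExp := .and (.natLe e e') (.natLe e' e)

theorem natEq_holds (ω : Tape) (s : Mem) (e e' : NExp) :
    (natEq e e').Holds ω s ↔ e.val ω s = e'.val ω s := by
  simp [natEq, le_antisymm_iff]

/-- The test `e < e'` for reals. -/
def realLt (e e' : RExp) : BExp := .not (.realLe e' e)

theorem realLt_holds (ω : Tape) (s : Mem) (e e' : RExp) :
    (realLt e e').Holds ω s ↔ e.val ω s < e'.val ω s := by
  simp [realLt]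

/-- The leading block of the array `x` is the matrix `M`. -/
def Mem.Holds (s : Mem) (x : ℕ) {a b : ℕ} (M : Matrix (Fin a) (Fin b) ℝ) : Prop :=
  ∀ (i : Fin a) (j : Fin b), s.real x i j = M i j

theorem Mem.Holds.congr {s s' : Mem} {x a b : ℕ} {M : Matrix (Fin a) (Fin b) ℝ} (h : s.Holds x M)
    (hs : s'.real x = s.real x) : s'.Holds x M := fun i j => by rw [hs]; exact h i j

theorem Mem.Holds.apply {s : Mem} {x a b : ℕ} {M : Matrix (Fin a) (Fin b) ℝ} (h : s.Holds x M)
    {i j : ℕ} (hi : i < a) (hj : j < b) : s.real x i j = M ⟨i, hi⟩ ⟨j, hj⟩ := h ⟨i, hi⟩ ⟨j, hj⟩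

theorem Mem.Holds.block {s : Mem} {x a : ℕ} {M : Matrix (Fin a) (Fin a) ℝ} (h : s.Holds x M) :
    s.block x a = M := by ext i j; exact h i j

end

section

/-! ### Leading singular pairs -/

theorem opNorm_nonneg {n : ℕ} (M : Matrix (Fin n) (Fin n) ℝ) : 0 ≤ opNorm M := norm_nonneg _

theorem opNorm_zero {n : ℕ} : opNorm (0 : Matrix (Fin n) (Fin n) ℝ) = 0 := by simp [opNorm]

theorem opNorm_transpose {n : ℕ} (M : Matrix (Fin n) (Fin n) ℝ) : opNorm Mᵀ = opNorm M := by
  rw [opNorm, ← Matrix.conjTranspose_eq_transpose_of_trivial, ← Matrix.star_eq_conjTranspose,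
    map_star, ContinuousLinearMap.star_eq_adjoint, LinearIsometryEquiv.norm_map, opNorm]

theorem norm_toLp_sq {n : ℕ} (x : Fin n → ℝ) : ‖WithLp.toLp 2 x‖ ^ 2 = x ⬝ᵥ x := by
  rw [EuclideanSpace.norm_sq_eq]
  simp [dotProduct, sq]

theorem dotProduct_mulVec_self_le {n : ℕ} (M : Matrix (Fin n) (Fin n) ℝ) (x : Fin n → ℝ) :
    (M *ᵥ x) ⬝ᵥ (M *ᵥ x) ≤ opNorm M ^ 2 * (x ⬝ᵥ x) := by
  have h := (Matrix.toEuclideanCLM (n := Fin n) (𝕜 := ℝ) M).le_opNorm (WithLp.toLp 2 x)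
  rw [Matrix.toEuclideanCLM_toLp] at h
  rw [← norm_toLp_sq, ← norm_toLp_sq, opNorm, ← mul_pow]
  exact pow_le_pow_left₀ (norm_nonneg _) h 2

/-- A maximizer `w` of `‖M x‖` on the unit sphere is a right singular vector, and `M w`, normalized,
is the left one. -/
theorem exists_isLeadingPair {n : ℕ} (hn : 0 < n) (M : Matrix (Fin n) (Fin n) ℝ) :
    ∃ p : (Fin n → ℝ) × (Fin n → ℝ), IsLeadingPair M p.1 p.2 := by
  have : Nonempty (Fin n) := ⟨⟨0, hn⟩⟩
  have : Nontrivial (EuclideanSpace ℝ (Fin n)) := inferInstance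
  set L := Matrix.toEuclideanCLM (n := Fin n) (𝕜 := ℝ) M with hL
  obtain ⟨w, hw, hmax⟩ := (isCompact_sphere (0 : EuclideanSpace ℝ (Fin n)) 1).exists_isMaxOn
    (NormedSpace.sphere_nonempty.2 zero_le_one) (f := fun x => ‖L x‖) (by fun_prop)
  have hw1 : ‖w‖ = 1 := by simpa using hw
  have hLw : ‖L w‖ = opNorm M := by
    refine le_antisymm ((L.le_opNorm w).trans_eq (by rw [hw1, mul_one]; rfl)) ?_
    refine ContinuousLinearMap.opNorm_le_of_unit_norm (norm_nonneg _) fun x hx => ?_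
    exact hmax (by simpa using hx)
  obtain ⟨w, rfl⟩ : ∃ x : Fin n → ℝ, w = WithLp.toLp 2 x := ⟨w.ofLp, rfl⟩
  have hww : w ⬝ᵥ w = 1 := by rw [← norm_toLp_sq, hw1, one_pow]
  have hMw : (M *ᵥ w) ⬝ᵥ (M *ᵥ w) = opNorm M ^ 2 := by
    rw [← norm_toLp_sq, ← Matrix.toEuclideanCLM_toLp, ← hL, hLw]
  by_cases h0 : opNorm M = 0
  · have hM : M = 0 := by
      have : L = 0 := norm_eq_zero.1 h0
      simpa [hL] using this
    -- every pair of unit vectors is a leading pair of the zero matrix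
    subst hM
    exact ⟨(w, w), hww, hww, by simp [opNorm_zero], by simp [opNorm_zero]⟩
  · refine ⟨((opNorm M)⁻¹ • (M *ᵥ w), w), ?_, hww, ?_, ?_⟩
    · simp only [smul_dotProduct, dotProduct_smul, smul_eq_mul, hMw]
      field_simp
    · simp only [smul_smul, mul_inv_cancel₀ h0, one_smul]
    · -- equality in the Cauchy-Schwarz inequality for `Mᵀ v` and `w`
      set v := (opNorm M)⁻¹ • (M *ᵥ w) with hv
      have hvv : v ⬝ᵥ v = 1 := by
        simp only [hv, smul_dotProduct, dotProduct_smul, smul_eq_mul, hMw]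
        field_simp
      have h1 : (Mᵀ *ᵥ v) ⬝ᵥ (Mᵀ *ᵥ v) ≤ opNorm M ^ 2 := by
        have := dotProduct_mulVec_self_le Mᵀ v
        rwa [opNorm_transpose, hvv, mul_one] at this
      have h2 : (Mᵀ *ᵥ v) ⬝ᵥ w = opNorm M := by
        rw [Matrix.mulVec_transpose, ← Matrix.dotProduct_mulVec, hv, smul_dotProduct, hMw,
          smul_eq_mul]
        field_simp
      have h3 : (Mᵀ *ᵥ v - opNorm M • w) ⬝ᵥ (Mᵀ *ᵥ v - opNorm M • w) ≤ 0 := by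
        simp only [sub_dotProduct, dotProduct_sub, smul_dotProduct, dotProduct_smul, smul_eq_mul,
          hww, h2, dotProduct_comm w]
        linarith
      have h4 := dotProduct_self_eq_zero.1 (le_antisymm h3 (by
        rw [← norm_toLp_sq]; positivity))
      exact sub_eq_zero.1 h4

theorem isLeadingPair_leadingPair {n : ℕ} (hn : 0 < n) (M : Matrix (Fin n) (Fin n) ℝ) :
    IsLeadingPair M (leadingPair M).1 (leadingPair M).2 := by
  have h := exists_isLeadingPair hn M
  rw [leadingPair, dif_pos h]
  exact h.choose_spec

theorem opNorm_sq_eq {n : ℕ} (hn : 0 < n) (M : Matrix (Fin n) (Fin n) ℝ) :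
    opNorm M ^ 2 = (M *ᵥ (leadingPair M).2) ⬝ᵥ (M *ᵥ (leadingPair M).2) := by
  obtain ⟨h1, -, h3, -⟩ := isLeadingPair_leadingPair hn M
  rw [h3, smul_dotProduct, dotProduct_smul, h1]
  simp [sq]

/-! ### Spectral cleaning takes at most `n` rounds -/

theorem sum_leverage {n : ℕ} (hn : 0 < n) (M : Matrix (Fin n) (Fin n) ℝ) :
    ∑ i, leverage M i = 1 := by
  obtain ⟨h1, h2, -, -⟩ := isLeadingPair_leadingPair hn M
  simp only [dotProduct, ← sq] at h1 h2
  simp only [leverage, ← Finset.sum_div, Finset.sum_add_distrib, h1, h2]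
  norm_num

theorem sum_Iio_eq {n : ℕ} (p : Fin n → ℝ) (g : ℕ → ℝ) (hg : ∀ i : Fin n, g i = p i) (i : Fin n) :
    ∑ j ∈ Finset.Iio i, p j = ∑ j ∈ Finset.range i, g j := by
  refine Finset.sum_bij (fun j _ => (j : ℕ)) ?_ ?_ ?_ ?_
  · intro j hj; simpa using hj
  · intro j _ k _ h; exact Fin.ext h
  · intro k hk
    have hk' : k < i := by simpa using hk
    exact ⟨⟨k, hk'.trans i.2⟩, by simpa [Fin.lt_def] using hk', rfl⟩
  · intro j _; exact (hg j).symm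

theorem sum_Iic_eq {n : ℕ} (p : Fin n → ℝ) (g : ℕ → ℝ) (hg : ∀ i : Fin n, g i = p i) (i : Fin n) :
    ∑ j ∈ Finset.Iic i, p j = ∑ j ∈ Finset.range (i + 1), g j := by
  rw [Finset.sum_range_succ, ← sum_Iio_eq p g hg, ← Finset.Iio_insert, Finset.sum_insert (by simp),
    hg, add_comm]

/-- The intervals of length `p i`, laid out in order, cover `[0, 1)`. -/
theorem exists_drawn {n : ℕ} (p : Fin n → ℝ) (hp : ∑ i, p i = 1) {r : ℝ} (h0 : 0 ≤ r) (h1 : r < 1) :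
    ∃ i, Drawn p r i := by
  classical
  set g : ℕ → ℝ := fun j => if h : j < n then p ⟨j, h⟩ else 0
  have hg : ∀ i : Fin n, g i = p i := fun i => by simp [g]
  have hn : ∑ j ∈ Finset.range n, g j = 1 := by
    rw [Finset.sum_range, ← hp]; exact Finset.sum_congr rfl fun i _ => hg i
  have hex : ∃ m, r < ∑ j ∈ Finset.range m, g j := ⟨n, by rw [hn]; exact h1⟩
  have hpos : Nat.find hex ≠ 0 := fun h => by
    have := Nat.find_spec hex
    rw [h] at this
    simp at this
    linarith
  obtain ⟨k, hk⟩ := Nat.exists_eq_succ_of_ne_zero hpos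
  have hkn : k < n := by
    have := Nat.find_min' hex (m := n) (by rw [hn]; exact h1)
    omega
  refine ⟨⟨k, hkn⟩, ?_, ?_⟩
  · rw [sum_Iio_eq p g hg]
    exact not_lt.1 (Nat.find_min hex (m := k) (by omega))
  · rw [sum_Iic_eq p g hg]
    have := Nat.find_spec hex
    rwa [hk] at this

theorem Drawn.pos {n : ℕ} {p : Fin n → ℝ} {r : ℝ} {i : Fin n} (h : Drawn p r i) : 0 < p i := by
  have := h.1.trans_lt h.2
  rw [← Finset.Iio_insert, Finset.sum_insert (by simp)] at this
  linarith

open Classical in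
/-- The indices whose row or column is not zero. -/
noncomputable def alive {n : ℕ} (M : Matrix (Fin n) (Fin n) ℝ) : Finset (Fin n) :=
  Finset.univ.filter fun i => ∃ j, M i j ≠ 0 ∨ M j i ≠ 0

theorem mem_alive {n : ℕ} {M : Matrix (Fin n) (Fin n) ℝ} {i : Fin n} :
    i ∈ alive M ↔ ∃ j, M i j ≠ 0 ∨ M j i ≠ 0 := by
  simp [alive]

/-- A drawn index has a positive coordinate in a singular vector, hence a nonzero row or column. -/
theorem mem_alive_of_leverage_pos {n : ℕ} (hn : 0 < n) {M : Matrix (Fin n) (Fin n) ℝ}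
    (hM : 0 < opNorm M) {i : Fin n} (hi : 0 < leverage M i) : i ∈ alive M := by
  obtain ⟨-, -, h3, h4⟩ := isLeadingPair_leadingPair hn M
  by_contra hc
  simp only [mem_alive, not_exists, not_or, not_not] at hc
  have e1 := congrFun h3 i
  have e2 := congrFun h4 i
  simp only [Matrix.mulVec, dotProduct, Matrix.transpose_apply, (hc _).1, (hc _).2, zero_mul,
    Finset.sum_const_zero, Pi.smul_apply, smul_eq_mul] at e1 e2
  have e1' := (mul_eq_zero.1 e1.symm).resolve_left hM.ne'
  have e2' := (mul_eq_zero.1 e2.symm).resolve_left hM.ne'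
  simp [leverage, e1', e2'] at hi

/-- A round of cleaning sets a nonzero row or column to zero and creates no new one. -/
theorem alive_cleanStep {n : ℕ} (hn : 0 < n) {M : Matrix (Fin n) (Fin n) ℝ} (hM : 0 < opNorm M)
    {r : ℝ} (h0 : 0 ≤ r) (h1 : r < 1) : (alive (cleanStep M r)).card < (alive M).card := by
  classical
  obtain ⟨i, hi⟩ := exists_drawn (leverage M) (sum_leverage hn M) h0 h1
  refine Finset.card_lt_card (Finset.ssubset_iff_of_subset ?_ |>.2
    ⟨i, mem_alive_of_leverage_pos hn hM hi.pos, ?_⟩)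
  · intro j hj
    obtain ⟨k, hk⟩ := mem_alive.1 hj
    refine mem_alive.2 ⟨k, ?_⟩
    simp only [cleanStep] at hk
    rcases hk with hk | hk <;> [left; right] <;> (intro h; simp [h] at hk)
  · simp [alive, cleanStep, hi]

/-- Each round removes an index, so that `n` rounds leave the matrix `0`, whose norm is below the
threshold. -/
theorem card_alive_cleanSeq {n : ℕ} (hn : 0 < n) (M : Matrix (Fin n) (Fin n) ℝ) {r : ℕ → ℝ}
    (hr : ∀ s, 0 ≤ r s ∧ r s < 1) (s : ℕ)
    (hs : ∀ s' < s, 10 * √(n : ℝ) ≤ opNorm (cleanSeq M r s')) :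
    (alive (cleanSeq M r s)).card + s ≤ n := by
  induction s with
  | zero => simpa using (Finset.card_le_univ (alive (cleanSeq M r 0)))
  | succ s ih =>
    have h1 := ih fun s' h' => hs s' (by omega)
    have h2 : 0 < opNorm (cleanSeq M r s) :=
      lt_of_lt_of_le (by positivity) (hs s (by omega))
    have h3 := alive_cleanStep hn h2 (hr s).1 (hr s).2
    simp only [cleanSeq]
    omega

/-! ### The program for preprocessing and cleaning -/

/-- The matrix in the array `2` becomes the perturbation of the matrix in the array `src`. -/
noncomputable def perturbCmd (src x : ℕ) : Cmd :=
  tabR 2 (nv 0) (nv 0) btrue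
    (.div (.add (.mul (.ofNat (nlt (nv 21) (nv 20)))
        (.add (.get src (nv 20) (nv 21)) (.gauss (.const x) (nv 20) (nv 21))))
      (.mul (.ofNat (nlt (nv 20) (nv 21)))
        (.sub (.get src (nv 20) (nv 21)) (.gauss (.const x) (nv 21) (nv 20))))) (.const √2))
    (.const 0)

theorem perturbCmd_spec {E : Env} {s : Mem} {T n src x : ℕ} {A : Matrix (Fin n) (Fin n) ℝ}
    (hsrc : src ≠ 2) (hT : (n + 1) * (n + 1) ≤ T) (hn : s.nat 0 0 0 = n) (hA : s.Holds src A) :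
    Tri E (perturbCmd src x) s T (fun s' => s'.Holds 2 (perturb A (E.ω.gaussAt x))) := by
  classical
  refine Tri.tabR n n (fun i j => if h : i < n ∧ j < n then
    perturb A (E.ω.gaussAt x) ⟨i, h.1⟩ ⟨j, h.2⟩ else 0) hT ?_ ?_ ?_ ?_
  · intro s' hf; simp [hf.nat 0 rfl, hn]
  · intro s' hf; simp [hf.nat 0 rfl, hn]
  · intro i hi j hj s' hf _ h0 h1
    refine ⟨fun _ => ?_, fun h => absurd (by simp [btrue]) h⟩
    have hr : s'.real src i j = A ⟨i, hi⟩ ⟨j, hj⟩ := by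
      rw [hf.real src (by simp [tabR, table, forN, Cmd.setsReal, hsrc.symm]), hA.apply hi hj]
    simp only [RExp.val, NExp.val, nv_val, nlt_val, h0, h1, hr, hi, hj, and_self, dif_pos, perturb,
      Fin.mk_lt_mk]
    rcases lt_trichotomy i j with h | h | h
    · simp [h, h.not_gt]
    · simp [h]
    · simp [h, h.not_gt]
  · intro s' _ h _ i j
    rw [h i i.2 j j.2]; simp

/-- Leading singular pair of the matrix in the array `2` to the arrays `4` and `5`, and the square
of its operator norm to the variable `7`. -/
def normCmd : Cmd :=
  .seq (.singular 2 (nv 0) 4 5)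
    (.seq (sumTab 9 (nv 0) (.const 1) (nv 0)
        (.mul (.get 2 (nv 20) (nv 22)) (.get 5 (nv 22) (.const 0))))
      (sumTab 7 (.const 1) (.const 1) (nv 0)
        (.mul (.get 9 (nv 22) (.const 0)) (.get 9 (nv 22) (.const 0)))))

theorem normCmd_spec {E : Env} {s : Mem} {T n : ℕ} {M : Matrix (Fin n) (Fin n) ℝ} (h0 : 0 < n)
    (hT : E.sv n + 4 * (n + 2) * (n + 2) ≤ T) (hn : s.nat 0 0 0 = n) (hM : s.Holds 2 M) :
    Tri E normCmd s T (fun s' => s'.Holds 2 M ∧ s'.real 7 0 0 = opNorm M ^ 2 ∧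
      (∀ i : Fin n, s'.real 4 i 0 = (leadingPair M).1 i) ∧
      (∀ i : Fin n, s'.real 5 i 0 = (leadingPair M).2 i)) := by
  refine Tri.seq (P := fun s' => (∀ i : Fin n, s'.real 4 i 0 = (leadingPair M).1 i) ∧
      (∀ i : Fin n, s'.real 5 i 0 = (leadingPair M).2 i))
    (Tri.singular (n := n) (by norm_num) (by simpa using hn) (by nlinarith) ?_) ?_
  · intro s' _ h1 h2
    rw [hM.block] at h1 h2
    exact ⟨h1, h2⟩
  rintro s₁ f₁ ⟨h4, h5⟩
  have hn₁ : s₁.nat 0 0 0 = n := by rw [f₁.nat 0 rfl, hn]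
  have hM₁ : s₁.Holds 2 M := hM.congr (f₁.real 2 rfl)
  have h5' : ∀ i (hi : i < n), s₁.real 5 i 0 = (leadingPair M).2 ⟨i, hi⟩ := fun i hi => h5 ⟨i, hi⟩
  refine Tri.seq (P := fun s' => ∀ i : Fin n, s'.real 9 i 0 = (M *ᵥ (leadingPair M).2) i) ?_ ?_
  · refine Tri.sumTab n 1 n (fun i _ l => s₁.real 2 i l * s₁.real 5 l 0) (by norm_num)
      (by nlinarith) ?_ ?_ ?_ ?_ ?_
    · intro s' hf; simp [hf.nat 0 rfl, hn₁]
    · intro s' hf; simp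
    · intro s' hf; simp [hf.nat 0 rfl, hn₁]
    · intro i hi j hj l hl s' hf _ hi' hj' hl'
      simp [hi', hl', hf.real 2 rfl, hf.real 5 rfl]
    · intro s' hf h _ i
      rw [h i i.2 0 one_pos, Finset.sum_range]
      simp only [Matrix.mulVec, dotProduct]
      exact Finset.sum_congr rfl fun l _ => by rw [hM₁, h5]
  · intro s₂ f₂ h9
    have hn₂ : s₂.nat 0 0 0 = n := by rw [f₂.nat 0 rfl, hn₁]
    refine Tri.sumTab 1 1 n (fun _ _ l => s₂.real 9 l 0 * s₂.real 9 l 0) (by norm_num)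
      (by nlinarith) ?_ ?_ ?_ ?_ ?_
    · intro s' hf; simp
    · intro s' hf; simp
    · intro s' hf; simp [hf.nat 0 rfl, hn₂]
    · intro i hi j hj l hl s' hf _ hi' hj' hl'
      simp [hl', hf.real 9 rfl]
    · intro s' hf h _
      refine ⟨?_, ?_, ?_, ?_⟩
      · exact hM₁.congr (by rw [hf.real 2 rfl, f₂.real 2 rfl])
      · rw [h 0 one_pos 0 one_pos, Finset.sum_range, opNorm_sq_eq h0]
        simp only [dotProduct]
        exact Finset.sum_congr rfl fun l _ => by rw [h9]
      · intro i; rw [hf.real 4 rfl, f₂.real 4 rfl, h4]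
      · intro i; rw [hf.real 5 rfl, f₂.real 5 rfl, h5]

/-- One round of cleaning with the uniform variable in position `(x, round)`, the number of the
round being in the variable `23`. -/
noncomputable def cleanStepCmd (x : ℕ) : Cmd :=
  .seq (sumTab 8 (.add (nv 0) (.const 1)) (.const 1) (nv 0)
      (.mul (.ofNat (nlt (nv 22) (nv 20)))
        (.div (.add (.mul (.get 4 (nv 22) (.const 0)) (.get 4 (nv 22) (.const 0)))
          (.mul (.get 5 (nv 22) (.const 0)) (.get 5 (nv 22) (.const 0)))) (.const 2))))
    (.seq (tabN 24 (nv 0) (.const 1)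
        (.and (.realLe (.get 8 (nv 20) (.const 0)) (.unif (.const x) (nv 23)))
          (realLt (.unif (.const x) (nv 23)) (.get 8 (.add (nv 20) (.const 1)) (.const 0))))
        (.const 1) (.const 0))
      (tabR 2 (nv 0) (nv 0)
        (.natLe (.const 1) (.add (.get 24 (nv 20) (.const 0)) (.get 24 (nv 21) (.const 0))))
        (.const 0) (.get 2 (nv 20) (nv 21))))

theorem cleanStepCmd_spec {E : Env} {s : Mem} {T n x r : ℕ} {M : Matrix (Fin n) (Fin n) ℝ}
    (hT : 4 * (n + 2) * (n + 2) ≤ T) (hn : s.nat 0 0 0 = n) (hr : s.nat 23 0 0 = r)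
    (hM : s.Holds 2 M) (h4 : ∀ i : Fin n, s.real 4 i 0 = (leadingPair M).1 i)
    (h5 : ∀ i : Fin n, s.real 5 i 0 = (leadingPair M).2 i) :
    Tri E (cleanStepCmd x) s T (fun s' => s'.Holds 2 (cleanStep M (E.ω.unifAt x r))) := by
  classical
  set g : ℕ → ℝ := fun l => (s.real 4 l 0 * s.real 4 l 0 + s.real 5 l 0 * s.real 5 l 0) / 2 with hg
  have hgl : ∀ i : Fin n, g i = leverage M i := fun i => by
    simp only [hg, h4, h5, leverage, sq]
  refine Tri.seq (P := fun s' => ∀ i ≤ n, s'.real 8 i 0 = ∑ l ∈ Finset.range i, g l) ?_ ?_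
  · refine Tri.sumTab (n + 1) 1 n (fun i _ l => if l < i then g l else 0) (by norm_num)
      (by nlinarith) ?_ ?_ ?_ ?_ ?_
    · intro s' hf; simp [hf.nat 0 rfl, hn]
    · intro s' hf; simp
    · intro s' hf; simp [hf.nat 0 rfl, hn]
    · intro i hi j hj l hl s' hf _ hi' hj' hl'
      simp [nlt_val, hi', hl', hf.real 4 rfl, hf.real 5 rfl, hg]
    · intro s' hf h _ i hi
      rw [h i (by omega) 0 one_pos, ← Finset.sum_filter]
      congr 1
      ext l
      simp only [Finset.mem_filter, Finset.mem_range]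
      omega
  intro s₁ f₁ h8
  have hn₁ : s₁.nat 0 0 0 = n := by rw [f₁.nat 0 rfl, hn]
  have hr₁ : s₁.nat 23 0 0 = r := by rw [f₁.nat 23 rfl, hr]
  refine Tri.seq (P := fun s' => ∀ i : Fin n, s'.nat 24 i 0 =
    if Drawn (leverage M) (E.ω.unifAt x r) i then 1 else 0) ?_ ?_
  · refine Tri.tabN n 1 (fun i _ => if h : i < n then
      if Drawn (leverage M) (E.ω.unifAt x r) ⟨i, h⟩ then 1 else 0 else 0) (by norm_num)
      (by nlinarith) ?_ ?_ ?_ ?_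
    · intro s' hf; simp [hf.nat 0 rfl, hn₁]
    · intro s' hf; simp
    · intro i hi j hj s' hf _ hi' hj'
      have hD : Drawn (leverage M) (E.ω.unifAt x r) ⟨i, hi⟩ ↔
          s'.real 8 i 0 ≤ E.ω.unifAt x r ∧ E.ω.unifAt x r < s'.real 8 (i + 1) 0 := by
        rw [Drawn, sum_Iio_eq _ g hgl, sum_Iic_eq _ g hgl, hf.real 8 rfl, h8 i hi.le,
          h8 (i + 1) hi]
      have h23 : s'.nat 23 0 0 = r := by rw [hf.nat 23 rfl, hr₁]
      simp only [BExp.Holds, realLt_holds, RExp.val, NExp.val, nv_val, hi', h23, hi, dif_pos, hD]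
      exact ⟨fun h => by rw [if_pos h], fun h => by rw [if_neg h]⟩
    · intro s' _ h _ i
      rw [h i i.2 0 one_pos]; simp
  intro s₂ f₂ h24
  have hn₂ : s₂.nat 0 0 0 = n := by rw [f₂.nat 0 rfl, hn₁]
  have hM₂ : s₂.Holds 2 M := hM.congr (by rw [f₂.real 2 rfl, f₁.real 2 rfl])
  refine Tri.tabR n n (fun i j => if h : i < n ∧ j < n then
    cleanStep M (E.ω.unifAt x r) ⟨i, h.1⟩ ⟨j, h.2⟩ else 0) (by nlinarith) ?_ ?_ ?_ ?_
  · intro s' hf; simp [hf.nat 0 rfl, hn₂]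
  · intro s' hf; simp [hf.nat 0 rfl, hn₂]
  · intro i hi j hj s' hf h2 hi' hj'
    have e1 := h24 ⟨i, hi⟩
    have e2 := h24 ⟨j, hj⟩
    rw [hM₂.apply hi hj] at h2
    simp only at e1 e2
    simp only [BExp.Holds, RExp.val, NExp.val, nv_val, hi', hj', hf.nat 24 rfl, e1, e2, h2, hi, hj,
      and_self, dif_pos, cleanStep]
    constructor
    · intro h
      rw [if_pos]
      by_contra hc
      push Not at hc
      simp [hc.1, hc.2] at h
    · intro h
      rw [if_neg]
      rintro (hc | hc) <;> simp [hc] at h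
  · intro s' _ h _ i j
    rw [h i i.2 j j.2]; simp

/-- Spectral cleaning of the matrix in the array `2`. -/
noncomputable def cleanCmd (x : ℕ) : Cmd :=
  .seq (.setNat 23 (.const 0) (.const 0) (.const 0))
    (.seq normCmd
      (.while (.realLe (.mul (.const 100) (.ofNat (nv 0))) (rv 7))
        (.seq (cleanStepCmd x)
          (.seq (.setNat 23 (.const 0) (.const 0) (.add (nv 23) (.const 1))) normCmd))))

/-- The stopping test for the cleaning, in terms of the squared norm, which is `‖M w‖ ^ 2` for the
right singular vector `w`. -/
theorem ten_sqrt_le_iff {n : ℕ} {a : ℝ} (ha : 0 ≤ a) :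
    10 * √(n : ℝ) ≤ a ↔ 100 * (n : ℝ) ≤ a ^ 2 := by
  rw [← abs_of_nonneg ha, ← abs_of_nonneg (by positivity : (0 : ℝ) ≤ 10 * √(n : ℝ)), ← sq_le_sq,
    mul_pow, Real.sq_sqrt (Nat.cast_nonneg _), abs_of_nonneg ha]
  norm_num

theorem cleanCmd_spec {E : Env} {s : Mem} {T n x : ℕ} {M : Matrix (Fin n) (Fin n) ℝ} (h0 : 0 < n)
    (hω : ∀ r, 0 ≤ E.ω.unifAt x r ∧ E.ω.unifAt x r < 1)
    (hT : (n + 1) * (E.sv n + 4 * (n + 2) * (n + 2)) ≤ T) (hn : s.nat 0 0 0 = n)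
    (hM : s.Holds 2 M) :
    Tri E (cleanCmd x) s T (fun s' => s'.Holds 2 (clean M (E.ω.unifAt x))) := by
  classical
  have hT1 : E.sv n + 4 * (n + 2) * (n + 2) ≤ T :=
    le_trans (Nat.le_mul_of_pos_left _ (Nat.succ_pos n)) hT
  refine Tri.seq (P := fun s' => s' = s.setNat 23 0 0 0) (Tri.setNat (by nlinarith) (by simp)) ?_
  rintro s₁ f₁ rfl
  set r := E.ω.unifAt x
  refine Tri.seq (P := fun s' => s'.Holds 2 M ∧ s'.real 7 0 0 = opNorm M ^ 2 ∧
      (∀ i : Fin n, s'.real 4 i 0 = (leadingPair M).1 i) ∧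
      (∀ i : Fin n, s'.real 5 i 0 = (leadingPair M).2 i)) (normCmd_spec h0 hT1 hn hM) ?_
  rintro s₂ f₂ ⟨hM₂, h7₂, h4₂, h5₂⟩
  have hn₂ : s₂.nat 0 0 0 = n := by rw [f₂.nat 0 rfl, f₁.nat 0 rfl, hn]
  refine Tri.whileLoop (T₀ := E.sv n + 4 * (n + 2) * (n + 2)) (fun i s' => s'.nat 23 0 0 = i ∧
    (∀ i' < i, 10 * √(n : ℝ) ≤ opNorm (cleanSeq M r i')) ∧ s'.Holds 2 (cleanSeq M r i) ∧
    s'.real 7 0 0 = opNorm (cleanSeq M r i) ^ 2 ∧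
    (∀ j : Fin n, s'.real 4 j 0 = (leadingPair (cleanSeq M r i)).1 j) ∧
      (∀ j : Fin n, s'.real 5 j 0 = (leadingPair (cleanSeq M r i)).2 j)) n hT (by nlinarith)
    ?_ ?_ ?_
  · refine ⟨?_, by simp, hM₂, h7₂, h4₂, h5₂⟩
    rw [f₂.nat 23 rfl, Mem.setNat_nat_self]
  · rintro i s' hf ⟨h23, hi, hM', h7, h4, h5⟩ hc
    have hn' : s'.nat 0 0 0 = n := by rw [hf.nat 0 rfl, hn₂]
    simp only [BExp.Holds, RExp.val, nv_val, rv_val, hn', h7] at hc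
    rw [← ten_sqrt_le_iff (opNorm_nonneg _)] at hc
    have hi' : ∀ i' < i + 1, 10 * √(n : ℝ) ≤ opNorm (cleanSeq M r i') := fun i' h' => by
      rcases Nat.lt_succ_iff_lt_or_eq.1 h' with h | rfl
      · exact hi i' h
      · exact hc
    refine ⟨by have := card_alive_cleanSeq h0 M hω (i + 1) hi'; omega, ?_⟩
    refine Tri.seq (cleanStepCmd_spec (by omega) hn' h23 hM' h4 h5) ?_
    intro s₃ f₃ hM₃
    have h23₃ : s₃.nat 23 0 0 = i := by rw [f₃.nat 23 rfl, h23]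
    refine Tri.seq (P := fun s' => s' = s₃.setNat 23 0 0 (i + 1))
      (Tri.setNat (by nlinarith) (by simp [h23₃])) ?_
    rintro s₄ f₄ rfl
    refine (normCmd_spec h0 le_rfl ?_ (M := cleanSeq M r (i + 1))
      (hM₃.congr (f₄.real 2 rfl))).imp ?_
    · rw [f₄.nat 0 rfl, f₃.nat 0 rfl, hn']
    · rintro s₅ f₅ ⟨a, b, c, d⟩
      exact ⟨by rw [f₅.nat 23 rfl, Mem.setNat_nat_self], hi', a, b, c, d⟩
  · rintro i s' hf ⟨h23, hi, hM', h7, h4, h5⟩ hc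
    have hn' : s'.nat 0 0 0 = n := by rw [hf.nat 0 rfl, hn₂]
    simp only [BExp.Holds, RExp.val, nv_val, rv_val, hn', h7] at hc
    rw [← ten_sqrt_le_iff (opNorm_nonneg _), not_le] at hc
    have : sInf {s : ℕ | opNorm (cleanSeq M r s) < 10 * √(n : ℝ)} = i :=
      le_antisymm (Nat.sInf_le hc) (le_csInf ⟨i, hc⟩ fun j hj => by
        by_contra hji
        exact absurd hj (not_lt.2 (hi j (not_le.1 hji))))
    rw [clean, this]
    exact hM'

end

section

/-! ### The assignment problem: duality and alternating trees -/

/-- A dual feasible pair `u`, `v` for the costs `c`, and a partial matching `R` of the rows below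
`r` that uses tight edges only. -/
structure PrimalDual (n r : ℕ) (c : ℕ → ℕ → ℝ) (u v : ℕ → ℝ) (R : ℕ → ℕ) : Prop where
  feas : ∀ i < n, ∀ j < n, u i + v j ≤ c i j
  lt : ∀ i < r, R i < n
  inj : ∀ i < r, ∀ i' < r, R i = R i' → i = i'
  tight : ∀ i < r, u i + v (R i) = c i (R i)

/-- A matching of all rows by tight edges is optimal. -/
theorem PrimalDual.optimal {n : ℕ} {c : ℕ → ℕ → ℝ} {u v : ℕ → ℝ} {R : ℕ → ℕ}
    (h : PrimalDual n n c u v R) : ∃ π : Equiv.Perm (Fin n), (∀ i : Fin n, R i = (π i : ℕ)) ∧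
      ∀ τ : Equiv.Perm (Fin n), ∑ i : Fin n, c i (π i : ℕ) ≤ ∑ i : Fin n, c i (τ i : ℕ) := by
  have hinj : Function.Injective fun i : Fin n => (⟨R i, h.lt i i.2⟩ : Fin n) := fun i i' hi =>
    Fin.ext (h.inj i i.2 i' i'.2 (Fin.mk.inj_iff.1 hi))
  refine ⟨Equiv.ofBijective _ (Finite.injective_iff_bijective.1 hinj), fun i => rfl, fun τ => ?_⟩
  have key : ∀ σ : Equiv.Perm (Fin n), ∑ i : Fin n, (u i + v (σ i : ℕ)) =
      ∑ i : Fin n, u i + ∑ i : Fin n, v i := fun σ => by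
    rw [Finset.sum_add_distrib, Equiv.sum_comp σ fun j : Fin n => v j]
  calc ∑ i : Fin n, c i _ = ∑ i : Fin n, (u i + v (R i)) :=
        Finset.sum_congr rfl fun i _ => (h.tight i i.2).symm
    _ = ∑ i : Fin n, (u i + v (τ i : ℕ)) := by
        rw [key τ]
        exact key (Equiv.ofBijective _ (Finite.injective_iff_bijective.1 hinj))
    _ ≤ _ := Finset.sum_le_sum fun i _ => h.feas i i.2 _ (τ i).2

/-- The columns that are matched to rows of the alternating tree `S` with root `r`. -/
def UsedCol (r : ℕ) (R : ℕ → ℕ) (S : Finset ℕ) (j : ℕ) : Prop := ∃ i ∈ S, i < r ∧ R i = j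

/-- An alternating tree with root `r` and set of rows `S`. For each row `i` in the tree, `alt i` is
the matching obtained by shifting along the path from the root to `i`: it uses tight edges, and it
covers all rows up to `r` except `i`. Storing these matchings makes it unnecessary to follow the
path back when the matching is augmented. -/
structure AltTree (n r : ℕ) (c : ℕ → ℕ → ℝ) (u v : ℕ → ℝ) (R : ℕ → ℕ) (S : Finset ℕ)
    (alt : ℕ → ℕ → ℕ) : Prop extends PrimalDual n r c u v R where
  root_lt : r < n
  root_mem : r ∈ S
  le : ∀ i ∈ S, i ≤ r
  alt_tight : ∀ i ∈ S, ∀ x ≤ r, x ≠ i → u x + v (alt i x) = c x (alt i x)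
  alt_inj : ∀ i ∈ S, ∀ x ≤ r, ∀ y ≤ r, x ≠ i → y ≠ i → alt i x = alt i y → x = y
  alt_mem : ∀ i ∈ S, ∀ x ∈ S, x ≠ i → UsedCol r R S (alt i x)
  alt_notMem : ∀ i ∈ S, ∀ x < r, x ∉ S → alt i x = R x

variable {n r : ℕ} {c : ℕ → ℕ → ℝ} {u v : ℕ → ℝ} {R : ℕ → ℕ} {S : Finset ℕ} {alt : ℕ → ℕ → ℕ}

theorem PrimalDual.start (h : PrimalDual n r c u v R) (hr : r < n)
    (ha : ∀ i < n, alt r i = R i) : AltTree n r c u v R {r} alt where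
  toPrimalDual := h
  root_lt := hr
  root_mem := by simp
  le := by simp
  alt_tight := by
    intro i hi x hx hxi
    obtain rfl := Finset.mem_singleton.1 hi
    rw [ha x (by omega)]
    exact h.tight x (by omega)
  alt_inj := by
    intro i hi x hx y hy hxi hyi
    obtain rfl := Finset.mem_singleton.1 hi
    rw [ha x (by omega), ha y (by omega)]
    exact h.inj x (by omega) y (by omega)
  alt_mem := by
    intro i hi x hx hxi
    simp only [Finset.mem_singleton] at hi hx
    omega
  alt_notMem := by
    intro i hi x hx _
    obtain rfl := Finset.mem_singleton.1 hi
    exact ha x (by omega)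

theorem AltTree.alt_lt (h : AltTree n r c u v R S alt) {i x : ℕ} (hi : i ∈ S) (hx : x ≤ r)
    (hxi : x ≠ i) : alt i x < n := by
  by_cases hxS : x ∈ S
  · obtain ⟨y, -, hy, hyx⟩ := h.alt_mem i hi x hxS hxi
    rw [← hyx]; exact h.lt y hy
  · have hxr : x < r := lt_of_le_of_ne hx fun e => hxS (e ▸ h.root_mem)
    rw [h.alt_notMem i hi x hxr hxS]
    exact h.lt x hxr

theorem AltTree.alt_eq (h : AltTree n r c u v R S alt) {i x : ℕ} (hi : i ∈ S) (hx : x ≤ r)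
    (hxi : x ≠ i) : ∃ y < r, alt i x = R y := by
  by_cases hxS : x ∈ S
  · obtain ⟨y, -, hy, hyx⟩ := h.alt_mem i hi x hxS hxi
    exact ⟨y, hy, hyx.symm⟩
  · have hxr : x < r := lt_of_le_of_ne hx fun e => hxS (e ▸ h.root_mem)
    exact ⟨x, hxr, h.alt_notMem i hi x hxr hxS⟩

theorem AltTree.usedCol_iff (h : AltTree n r c u v R S alt) {x : ℕ} (hx : x < r) :
    UsedCol r R S (R x) ↔ x ∈ S := by
  constructor
  · rintro ⟨y, hyS, hy, hyx⟩
    rwa [← h.inj y hy x hx hyx]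
  · exact fun hxS => ⟨x, hxS, hx, rfl⟩

/-- There is a column outside the tree. -/
theorem AltTree.exists_not_usedCol (h : AltTree n r c u v R S alt) :
    ∃ j < n, ¬ UsedCol r R S j := by
  by_contra hc
  push Not at hc
  have hsub : Finset.range n ⊆ (Finset.range r).image R := fun j hj => by
    obtain ⟨i, -, hi, hij⟩ := hc j (Finset.mem_range.1 hj)
    exact Finset.mem_image.2 ⟨i, Finset.mem_range.2 hi, hij⟩
  have := (Finset.card_le_card hsub).trans Finset.card_image_le
  simp only [Finset.card_range] at this
  have := h.root_lt
  omega

/-- Raising the potentials of the rows of the tree and lowering those of its columns by the smallest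
slack keeps everything in order. -/
theorem AltTree.dualStep (h : AltTree n r c u v R S alt) {δ : ℝ} (hδ : 0 ≤ δ)
    (hmin : ∀ i ∈ S, ∀ j < n, ¬ UsedCol r R S j → u i + v j + δ ≤ c i j) {u' v' : ℕ → ℝ}
    (hu : ∀ i < n, i ∈ S → u' i = u i + δ) (hu' : ∀ i < n, i ∉ S → u' i = u i)
    (hv : ∀ j < n, UsedCol r R S j → v' j = v j - δ)
    (hv' : ∀ j < n, ¬ UsedCol r R S j → v' j = v j) : AltTree n r c u' v' R S alt := by
  have hr := h.root_lt
  have htight : ∀ x ≤ r, ∀ j < n, (x ∈ S ↔ UsedCol r R S j) → u x + v j = c x j →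
      u' x + v' j = c x j := by
    intro x hx j hj hxj he
    by_cases hxS : x ∈ S
    · rw [hu x (by omega) hxS, hv j hj (hxj.1 hxS)]; linarith
    · rw [hu' x (by omega) hxS, hv' j hj (fun e => hxS (hxj.2 e))]; exact he
  refine { h with feas := ?_, tight := ?_, alt_tight := ?_ }
  · intro i hi j hj
    have := h.feas i hi j hj
    by_cases hiS : i ∈ S <;> by_cases hjU : UsedCol r R S j
    · rw [hu i hi hiS, hv j hj hjU]; linarith
    · rw [hu i hi hiS, hv' j hj hjU]; linarith [hmin i hiS j hj hjU]
    · rw [hu' i hi hiS, hv j hj hjU]; linarith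
    · rw [hu' i hi hiS, hv' j hj hjU]; exact this
  · intro i hi
    exact htight i hi.le _ (h.lt i hi) (h.usedCol_iff hi).symm (h.tight i hi)
  · intro i hi x hx hxi
    refine htight x hx _ (h.alt_lt hi hx hxi) ⟨fun hxS => h.alt_mem i hi x hxS hxi, fun hU => ?_⟩
      (h.alt_tight i hi x hx hxi)
    by_contra hxS
    have hxr : x < r := lt_of_le_of_ne hx fun e => hxS (e ▸ h.root_mem)
    rw [h.alt_notMem i hi x hxr hxS] at hU
    exact hxS ((h.usedCol_iff hxr).1 hU)

/-- A tight edge from the tree to a free column completes the matching. -/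
theorem AltTree.augment (h : AltTree n r c u v R S alt) {w j : ℕ} (hw : w ∈ S) (hj : j < n)
    (ht : u w + v j = c w j) (hfree : ∀ i < r, R i ≠ j) {R' : ℕ → ℕ}
    (hR : ∀ x < n, R' x = if x = w then j else alt w x) : PrimalDual n (r + 1) c u v R' := by
  have hr := h.root_lt
  have hne : ∀ x ≤ r, x ≠ w → alt w x ≠ j := fun x hx hxw e => by
    obtain ⟨y, hy, hyx⟩ := h.alt_eq hw hx hxw
    exact hfree y hy (hyx.symm.trans e)
  refine ⟨h.feas, ?_, ?_, ?_⟩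
  · intro i hi
    rw [hR i (by omega)]
    split_ifs with hiw
    · exact hj
    · exact h.alt_lt hw (by omega) hiw
  · intro i hi i' hi'
    rw [hR i (by omega), hR i' (by omega)]
    split_ifs with h1 h2 h2
    · intro _; omega
    · intro e; exact absurd e.symm (hne i' (by omega) h2)
    · intro e; exact absurd e (hne i (by omega) h1)
    · exact h.alt_inj w hw i (by omega) i' (by omega) h1 h2
  · intro i hi
    rw [hR i (by omega)]
    split_ifs with hiw
    · rw [hiw]; exact ht
    · exact h.alt_tight w hw i (by omega) hiw

/-- A tight edge from the tree to a matched column outside extends the tree. -/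
theorem AltTree.extend (h : AltTree n r c u v R S alt) {w j o : ℕ} (hw : w ∈ S)
    (ht : u w + v j = c w j) (ho : o < r) (hoj : R o = j) (hoS : o ∉ S) {alt' : ℕ → ℕ → ℕ}
    (ha : ∀ x < n, alt' o x = if x = w then j else alt w x)
    (ha' : ∀ i, i ≠ o → ∀ x < n, alt' i x = alt i x) :
    AltTree n r c u v R (insert o S) alt' := by
  have hr := h.root_lt
  have hmono : ∀ {j}, UsedCol r R S j → UsedCol r R (insert o S) j := fun ⟨i, hi, hir, hij⟩ =>
    ⟨i, Finset.mem_insert_of_mem hi, hir, hij⟩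
  have huo : UsedCol r R (insert o S) j := ⟨o, Finset.mem_insert_self _ _, ho, hoj⟩
  have hS : ∀ i ∈ S, i ≠ o := fun i hi e => hoS (e ▸ hi)
  have hjw : ∀ x ≤ r, x ≠ w → x ≠ o → alt w x ≠ j := fun x hx hxw hxo e => by
    refine hxo (h.alt_inj w hw x hx o ho.le hxw (hS w hw).symm ?_)
    rw [e, h.alt_notMem w hw o ho hoS, hoj]
  refine ⟨h.toPrimalDual, hr, Finset.mem_insert_of_mem h.root_mem, ?_, ?_, ?_, ?_, ?_⟩
  · intro i hi
    rcases Finset.mem_insert.1 hi with rfl | hi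
    · exact ho.le
    · exact h.le i hi
  · intro i hi x hx hxi
    rcases Finset.mem_insert.1 hi with rfl | hi
    · rw [ha x (by omega)]
      split_ifs with hxw
      · rw [hxw]; exact ht
      · exact h.alt_tight w hw x hx hxw
    · rw [ha' i (hS i hi) x (by omega)]
      exact h.alt_tight i hi x hx hxi
  · intro i hi x hx y hy hxi hyi
    rcases Finset.mem_insert.1 hi with rfl | hi
    · rw [ha x (by omega), ha y (by omega)]
      split_ifs with h1 h2 h2
      · intro _; omega
      · intro e; exact absurd e.symm (hjw y hy h2 hyi)
      · intro e; exact absurd e (hjw x hx h1 hxi)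
      · exact h.alt_inj w hw x hx y hy h1 h2
    · rw [ha' i (hS i hi) x (by omega), ha' i (hS i hi) y (by omega)]
      exact h.alt_inj i hi x hx y hy hxi hyi
  · intro i hi x hx hxi
    have hxr : x ≤ r := by
      rcases Finset.mem_insert.1 hx with rfl | hx
      · exact ho.le
      · exact h.le x hx
    rcases Finset.mem_insert.1 hi with rfl | hiS
    · rw [ha x (by omega)]
      split_ifs with hxw
      · exact huo
      · exact hmono (h.alt_mem w hw x ((Finset.mem_insert.1 hx).resolve_left hxi) hxw)
    · rw [ha' i (hS i hiS) x (by omega)]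
      rcases Finset.mem_insert.1 hx with rfl | hx
      · rw [h.alt_notMem i hiS x ho hoS, hoj]; exact huo
      · exact hmono (h.alt_mem i hiS x hx hxi)
  · intro i hi x hx hxS
    rw [Finset.mem_insert, not_or] at hxS
    rcases Finset.mem_insert.1 hi with rfl | hiS
    · rw [ha x (by omega), if_neg fun e : x = w => hxS.2 (by rw [e]; exact hw)]
      exact h.alt_notMem w hw x hx hxS.2
    · rw [ha' i (hS i hiS) x (by omega)]
      exact h.alt_notMem i hiS x hx hxS.2

/-! ### The assignment problem: the program -/

/-- `z[row, j] := if b then e else e'` for all `j < M`, with `j` in the variable `40`. -/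
def rowN (z : ℕ) (row M : NExp) (b : BExp) (e e' : NExp) : Cmd :=
  forN 40 M (.ite b (.setNat z row (nv 40) e) (.setNat z row (nv 40) e'))

theorem Tri.rowN {E : Env} {s : Mem} {T z m ρ : ℕ} {row M : NExp} {b : BExp} {e e' : NExp}
    {Q : Mem → Prop} (F : ℕ → ℕ) (hz : z ≠ 40) (hT : m + 1 ≤ T)
    (hrow : ∀ s', Frame (rowN z row M b e e') s s' → row.val E.ω s' = ρ)
    (hM : ∀ s', Frame (rowN z row M b e e') s s' → M.val E.ω s' = m)
    (hF : ∀ j < m, ∀ s', Frame (rowN z row M b e e') s s' →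
      (∀ i', i' ≠ ρ → s'.nat z i' = s.nat z i') → s'.nat 40 0 0 = j →
      (b.Holds E.ω s' → e.val E.ω s' = F j) ∧ (¬ b.Holds E.ω s' → e'.val E.ω s' = F j))
    (hQ : ∀ s', Frame (RobustMatching.rowN z row M b e e') s s' → (∀ j < m, s'.nat z ρ j = F j) →
      (∀ i', i' ≠ ρ → s'.nat z i' = s.nat z i') → Q s') :
    Tri E (RobustMatching.rowN z row M b e e') s T Q := by
  refine Tri.forN m (fun j s' => (∀ j' < j, s'.nat z ρ j' = F j') ∧
    ∀ i', i' ≠ ρ → s'.nat z i' = s.nat z i') (by simpa using hT) le_rfl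
    (by simpa [Cmd.setsNat] using hz) hM ?_ (by simp) ?_ ?_
  · intro j s' x h
    rwa [Mem.setNat_nat_ne _ _ _ _ hz]
  · intro j hj s' hf hj' ⟨h1, h2⟩
    have hF' := hF j hj s' hf h2 hj'
    refine Tri.ite le_rfl (fun hb => Tri.setNat le_rfl ?_) (fun hb => Tri.setNat le_rfl ?_) <;>
      simp only [nv_val, hrow s' hf, hj']
    · refine ⟨fun j' hj'' => ?_, fun i' hi' => ?_⟩
      · rw [Mem.setNat_nat]
        split_ifs with h
        · rw [h.2.2]; exact hF'.1 hb
        · exact h1 j' (by omega)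
      · rw [← h2 i' hi']; funext y; rw [Mem.setNat_nat, if_neg (by tauto)]
    · refine ⟨fun j' hj'' => ?_, fun i' hi' => ?_⟩
      · rw [Mem.setNat_nat]
        split_ifs with h
        · rw [h.2.2]; exact hF'.2 hb
        · exact h1 j' (by omega)
      · rw [← h2 i' hi']; funext y; rw [Mem.setNat_nat, if_neg (by tauto)]
  · intro s' hf _ h
    exact hQ s' hf h.1 h.2

/-- The slack of the column in the variable `40`. -/
def slackExp : RExp :=
  .sub (.sub (.get 30 (.get 33 (nv 40) (.const 0)) (nv 40))
    (.get 31 (.get 33 (nv 40) (.const 0)) (.const 0))) (.get 32 (nv 40) (.const 0))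

/-- The column of least slack among those outside the tree to the variable `37`, and its slack to
the real variable `33`. -/
def minSlackCmd (n : NExp) : Cmd :=
  .seq (.setNat 42 (.const 0) (.const 0) (.const 0))
    (forN 40 n
      (.ite (.and (natEq (.get 32 (nv 40) (.const 0)) (.const 0))
          (.not (.and (natEq (nv 42) (.const 1)) (.realLe (rv 33) slackExp))))
        (.seq (.setNat 37 (.const 0) (.const 0) (nv 40))
          (.seq (.setReal 33 (.const 0) (.const 0) slackExp)
            (.setNat 42 (.const 0) (.const 0) (.const 1))))
        .skip))

theorem minSlackCmd_spec {E : Env} {s : Mem} {T n : ℕ} (hT : n + 1 ≤ T) (hn : s.nat 0 0 0 = n)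
    (sl : ℕ → ℝ) (hsl : ∀ j < n, sl j = s.real 30 (s.nat 33 j 0) j - s.real 31 (s.nat 33 j 0) 0 -
      s.real 32 j 0) (hex : ∃ j < n, s.nat 32 j 0 = 0) :
    Tri E (minSlackCmd (nv 0)) s T (fun s' => s'.nat 37 0 0 < n ∧ s.nat 32 (s'.nat 37 0 0) 0 = 0 ∧
      s'.real 33 0 0 = sl (s'.nat 37 0 0) ∧ ∀ j < n, s.nat 32 j 0 = 0 → s'.real 33 0 0 ≤ sl j) := by
  refine Tri.seq (P := fun s' => s' = s.setNat 42 0 0 0) (Tri.setNat (by omega) (by simp)) ?_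
  rintro s₁ f₁ rfl
  refine Tri.forN n (fun i s' => (s'.nat 42 0 0 = 0 ∧ ∀ j < i, s.nat 32 j 0 ≠ 0) ∨
    (s'.nat 42 0 0 = 1 ∧ s'.nat 37 0 0 < i ∧ s.nat 32 (s'.nat 37 0 0) 0 = 0 ∧
      s'.real 33 0 0 = sl (s'.nat 37 0 0) ∧ ∀ j < i, s.nat 32 j 0 = 0 → s'.real 33 0 0 ≤ sl j))
    (by simpa using hT) le_rfl rfl ?_ ?_ ?_ ?_ ?_
  · intro s' hf; simp [hf.nat 0 rfl, Mem.setNat_nat, hn]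
  · intro i s' x h
    rwa [Mem.setNat_nat_ne _ _ _ _ (by norm_num), Mem.setNat_nat_ne _ _ _ _ (by norm_num)]
  · exact Or.inl ⟨Mem.setNat_nat_self _ _ _ _ _, by simp⟩
  · intro i hi s' hf hi' hinv
    have hslv : slackExp.val E.ω s' = sl i := by
      rw [hsl i hi]
      simp only [slackExp, RExp.val, NExp.val, nv_val, hi', hf.nat 33 rfl, hf.real 30 rfl,
        hf.real 31 rfl, hf.real 32 rfl]
      rfl
    have hus : s'.nat 32 i 0 = s.nat 32 i 0 := by rw [hf.nat 32 rfl]; rfl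
    refine Tri.ite le_rfl (fun hb => ?_) (fun hb => Tri.skip le_rfl ?_)
    · simp only [BExp.Holds, natEq_holds, NExp.val, nv_val, rv_val, hi', hslv, hus] at hb
      refine Tri.seq (P := fun s₂ => s₂ = s'.setNat 37 0 0 i)
        (Tri.setNat le_rfl (by simp [hi'])) ?_
      rintro s₂ f₂ rfl
      refine Tri.seq (P := fun s₃ => s₃ = (s'.setNat 37 0 0 i).setReal 33 0 0 (sl i))
        (Tri.setReal le_rfl ?_) ?_
      · rw [← hslv]; rfl
      rintro s₃ f₃ rfl
      refine Tri.setNat le_rfl (Or.inr ?_)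
      simp only [NExp.val, Mem.setNat_nat, Mem.setNat_real, Mem.setReal_real, Mem.setReal_nat]
      simp only [and_self, if_true, show (37 : ℕ) ≠ 42 by norm_num, false_and, if_false, true_and]
      refine ⟨by omega, hb.1, fun j hj hj0 => ?_⟩
      rcases Nat.lt_succ_iff_lt_or_eq.1 hj with hj | rfl
      · rcases hinv with ⟨_, h2⟩ | ⟨h1, _, _, _, h5⟩
        · exact absurd hj0 (h2 j hj)
        · have := hb.2
          rw [not_and, not_le] at this
          exact (this h1).le.trans (h5 j hj hj0)
      · exact le_rfl
    · simp only [BExp.Holds, natEq_holds, NExp.val, nv_val, rv_val, hi', hslv, hus] at hb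
      rcases hinv with ⟨h1, h2⟩ | ⟨h1, h2, h3, h4, h5⟩
      · refine Or.inl ⟨h1, fun j hj => ?_⟩
        rcases Nat.lt_succ_iff_lt_or_eq.1 hj with hj | rfl
        · exact h2 j hj
        · intro h0
          exact hb ⟨h0, fun h => by rw [h1] at h; exact absurd h.1 (by norm_num)⟩
      · refine Or.inr ⟨h1, by omega, h3, h4, fun j hj hj0 => ?_⟩
        rcases Nat.lt_succ_iff_lt_or_eq.1 hj with hj | rfl
        · exact h5 j hj hj0
        · by_contra hlt
          exact hb ⟨hj0, fun h => hlt h.2⟩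
  · intro s' hf _ hinv
    rcases hinv with ⟨h1, h2⟩ | ⟨h1, h2, h3, h4, h5⟩
    · obtain ⟨j, hj, hj0⟩ := hex
      exact absurd hj0 (h2 j hj)
    · exact ⟨h2, h3, h4, h5⟩

/-- The row below `r` (variable `39`) that is matched to the column in the variable `37` is written
to the variable `38`, and `n` if there is none. -/
def ownerCmd : Cmd :=
  .seq (.setNat 38 (.const 0) (.const 0) (nv 0))
    (forN 40 (nv 39) (.ite (natEq (.get 30 (nv 40) (.const 0)) (nv 37))
      (.setNat 38 (.const 0) (.const 0) (nv 40)) .skip))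

theorem ownerCmd_spec {E : Env} {s : Mem} {T n r : ℕ} (hT : n + 1 ≤ T) (hr : r < n)
    (hn : s.nat 0 0 0 = n) (hr' : s.nat 39 0 0 = r) :
    Tri E ownerCmd s T (fun s' =>
      (s'.nat 38 0 0 = n ∧ ∀ i < r, s.nat 30 i 0 ≠ s.nat 37 0 0) ∨
      (s'.nat 38 0 0 < r ∧ s.nat 30 (s'.nat 38 0 0) 0 = s.nat 37 0 0)) := by
  refine Tri.seq (P := fun s' => s' = s.setNat 38 0 0 n) (Tri.setNat (by omega) (by simp [hn])) ?_
  rintro s₁ f₁ rfl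
  refine Tri.forN r (fun i s' =>
      (s'.nat 38 0 0 = n ∧ ∀ i' < i, s.nat 30 i' 0 ≠ s.nat 37 0 0) ∨
      (s'.nat 38 0 0 < r ∧ s.nat 30 (s'.nat 38 0 0) 0 = s.nat 37 0 0)) (by omega) le_rfl rfl
      ?_ ?_ ?_ ?_ ?_
  · intro s' hf; simp [hf.nat 39 rfl, Mem.setNat_nat, hr']
  · intro i s' x h
    rwa [Mem.setNat_nat_ne _ _ _ _ (by norm_num)]
  · exact Or.inl ⟨Mem.setNat_nat_self _ _ _ _ _, by simp⟩
  · intro i hi s' hf hi' hinv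
    have h30 : s'.nat 30 = s.nat 30 := by rw [hf.nat 30 rfl]; rfl
    have h37 : s'.nat 37 = s.nat 37 := by rw [hf.nat 37 rfl]; rfl
    refine Tri.ite le_rfl (fun hb => Tri.setNat le_rfl (Or.inr ?_)) (fun hb => Tri.skip le_rfl ?_)
    · simp only [natEq_holds, NExp.val, nv_val, hi', h30, h37] at hb
      simp only [NExp.val, nv_val, hi', Mem.setNat_nat_self]
      exact ⟨hi, hb⟩
    · simp only [natEq_holds, NExp.val, nv_val, hi', h30, h37] at hb
      rcases hinv with ⟨h1, h2⟩ | h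
      · refine Or.inl ⟨h1, fun i' hi'' => ?_⟩
        rcases Nat.lt_succ_iff_lt_or_eq.1 hi'' with h | rfl
        · exact h2 i' h
        · exact hb
      · exact Or.inr h
  · intro s' hf _ hinv
    exact hinv

end

section

/-- One step in the search for an augmenting path: the row in the variable `35` has just been added
to the tree. The pointers `33` to the rows of least slack and the potentials `31`, `32` are updated,
and the tree `31`, `32`, `34` is extended, or else the matching `30` is augmented and the flag `36`
is raised. -/
def treeStepCmd : Cmd :=
  .seq (tabN 33 (nv 0) (.const 1)
      (realLt (.sub (.get 30 (nv 35) (nv 20)) (.get 31 (nv 35) (.const 0)))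
        (.sub (.get 30 (.get 33 (nv 20) (.const 0)) (nv 20))
          (.get 31 (.get 33 (nv 20) (.const 0)) (.const 0))))
      (nv 35) (.get 33 (nv 20) (.const 0)))
    (.seq (minSlackCmd (nv 0))
    (.seq (tabR 31 (nv 0) (.const 1) (natEq (.get 31 (nv 20) (.const 0)) (.const 1))
      (.add (.get 31 (nv 20) (.const 0)) (rv 33)) (.get 31 (nv 20) (.const 0)))
    (.seq (tabR 32 (nv 0) (.const 1) (natEq (.get 32 (nv 20) (.const 0)) (.const 1))
      (.sub (.get 32 (nv 20) (.const 0)) (rv 33)) (.get 32 (nv 20) (.const 0)))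
    (.seq ownerCmd
    (.seq (.setNat 41 (.const 0) (.const 0) (.get 33 (nv 37) (.const 0)))
    (.ite (natEq (nv 38) (nv 0))
      (.seq (tabN 30 (nv 0) (.const 1) (natEq (nv 20) (nv 41)) (nv 37)
          (.get 34 (nv 41) (nv 20)))
        (.setNat 36 (.const 0) (.const 0) (.const 1)))
      (.seq (rowN 34 (nv 38) (nv 0) (natEq (nv 40) (nv 41)) (nv 37) (.get 34 (nv 41) (nv 40)))
        (.seq (.setNat 32 (nv 37) (.const 0) (.const 1))
          (.seq (.setNat 31 (nv 38) (.const 0) (.const 1))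
            (.setNat 35 (.const 0) (.const 0) (nv 38)))))))))))

open Classical in
/-- The memory holds an alternating tree with set of rows `S` together with its dual solution; the
pointers `33` take into account all rows of the tree but the one in the variable `35`. -/
structure TreeMem (n r : ℕ) (c : ℕ → ℕ → ℝ) (S : Finset ℕ) (s : Mem) : Prop where
  tree : AltTree n r c (fun i => s.real 31 i 0) (fun j => s.real 32 j 0) (fun i => s.nat 30 i 0) S
    (s.nat 34)
  rows : ∀ i < n, s.nat 31 i 0 = 1 ↔ i ∈ S
  cols : ∀ j < n, s.nat 32 j 0 = if UsedCol r (fun i => s.nat 30 i 0) S j then 1 else 0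
  cur : s.nat 35 0 0 ∈ S
  way_mem : ∀ j < n, s.nat 33 j 0 ∈ S
  way_le : ∀ j < n, ∀ i ∈ S, i ≠ s.nat 35 0 0 →
    c (s.nat 33 j 0) j - s.real 31 (s.nat 33 j 0) 0 ≤ c i j - s.real 31 i 0

theorem treeStepCmd_spec {E : Env} {s : Mem} {T n r : ℕ} {c : ℕ → ℕ → ℝ} {S : Finset ℕ}
    (hT : 2 * (n + 1) ≤ T) (hn : s.nat 0 0 0 = n) (hr : s.nat 39 0 0 = r) (hc : s.real 30 = c)
    (h : TreeMem n r c S s) :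
    Tri E treeStepCmd s T (fun s' =>
      (s'.nat 36 0 0 = 1 ∧ PrimalDual n (r + 1) c (fun i => s'.real 31 i 0)
        (fun j => s'.real 32 j 0) (fun i => s'.nat 30 i 0)) ∨
      (s'.nat 36 0 0 = s.nat 36 0 0 ∧ ∃ o, o ∉ S ∧ TreeMem n r c (insert o S) s')) := by
  classical
  obtain ⟨htree, hrows, hcols, hcur, hwm, hwl⟩ := h
  have hrn := htree.root_lt
  have hSn : ∀ i ∈ S, i < n := fun i hi => (htree.le i hi).trans_lt hrn
  -- pointers to the rows of least slack
  refine Tri.seq (P := fun s' => ∀ j < n, s'.nat 33 j 0 ∈ S ∧ ∀ i ∈ S,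
    c (s'.nat 33 j 0) j - s.real 31 (s'.nat 33 j 0) 0 ≤ c i j - s.real 31 i 0) ?_ ?_
  · refine Tri.tabN n 1 (fun j _ => if c (s.nat 35 0 0) j - s.real 31 (s.nat 35 0 0) 0 <
      c (s.nat 33 j 0) j - s.real 31 (s.nat 33 j 0) 0 then s.nat 35 0 0 else s.nat 33 j 0)
      (by norm_num) (by omega) ?_ ?_ ?_ ?_
    · intro s' hf; simp [hf.nat 0 rfl, hn]
    · intro s' hf; simp
    · intro i hi j hj s' hf h33 hi' hj'
      obtain rfl : j = 0 := by omega
      simp only [realLt_holds, RExp.val, NExp.val, nv_val, hi', h33, hf.real 30 rfl,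
        hf.real 31 rfl, hf.nat 35 rfl, hc]
      exact ⟨fun hb => (if_pos hb).symm, fun hb => (if_neg hb).symm⟩
    · intro s' hf h1 _ j hj
      rw [h1 j hj 0 one_pos]
      split_ifs with hlt
      · refine ⟨hcur, fun i hi => ?_⟩
        by_cases hic : i = s.nat 35 0 0
        · rw [hic]
        · exact hlt.le.trans (hwl j hj i hi hic)
      · refine ⟨hwm j hj, fun i hi => ?_⟩
        by_cases hic : i = s.nat 35 0 0
        · rw [hic]; exact not_lt.1 hlt
        · exact hwl j hj i hi hic
  intro s₁ f₁ hway
  have hn₁ : s₁.nat 0 0 0 = n := by rw [f₁.nat 0 rfl, hn]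
  have hcols₁ : ∀ j < n, s₁.nat 32 j 0 = 0 ↔ ¬ UsedCol r (fun i => s.nat 30 i 0) S j := by
    intro j hj
    rw [f₁.nat 32 rfl, hcols j hj]
    split_ifs with hU <;> simp [hU]
  -- the column of least slack
  refine Tri.seq (minSlackCmd_spec (by omega) hn₁ (fun j => c (s₁.nat 33 j 0) j -
    s.real 31 (s₁.nat 33 j 0) 0 - s.real 32 j 0) ?_ ?_) ?_
  · intro j hj
    rw [f₁.real 30 rfl, f₁.real 31 rfl, f₁.real 32 rfl, hc]
  · obtain ⟨j, hj, hU⟩ := htree.exists_not_usedCol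
    exact ⟨j, hj, (hcols₁ j hj).2 hU⟩
  rintro s₂ f₂ ⟨hj1, hU1, hδ, hmin⟩
  set j₁ := s₂.nat 37 0 0 with hj₁
  set δ := s₂.real 33 0 0 with hδ'
  rw [hcols₁ j₁ hj1] at hU1
  have hδ0 : 0 ≤ δ := by
    have h1 := htree.feas _ (hSn _ (hway j₁ hj1).1) j₁ hj1
    rw [hδ]; linarith
  have hmin' : ∀ i ∈ S, ∀ j < n, ¬ UsedCol r (fun i => s.nat 30 i 0) S j →
      s.real 31 i 0 + s.real 32 j 0 + δ ≤ c i j := fun i hi j hj hU => by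
    have h1 := hmin j hj ((hcols₁ j hj).2 hU)
    have h2 := (hway j hj).2 i hi
    linarith
  -- the new potentials
  refine Tri.seq (P := fun s' => (∀ i < n, i ∈ S → s'.real 31 i 0 = s.real 31 i 0 + δ) ∧
    ∀ i < n, i ∉ S → s'.real 31 i 0 = s.real 31 i 0) ?_ ?_
  · refine Tri.tabR n 1 (fun i _ => if i ∈ S then s.real 31 i 0 + δ else s.real 31 i 0)
      (by omega) ?_ ?_ ?_ ?_
    · intro s' hf; simp [hf.nat 0 rfl, f₂.nat 0 rfl, hn₁]
    · intro s' hf; simp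
    · intro i hi j hj s' hf h31 hi' hj'
      obtain rfl : j = 0 := by omega
      rw [f₂.real 31 rfl, f₁.real 31 rfl] at h31
      simp only [natEq_holds, RExp.val, NExp.val, nv_val, rv_val, hi', h31, hf.nat 31 rfl,
        f₂.nat 31 rfl, f₁.nat 31 rfl, hf.real 33 rfl, hrows i hi, ← hδ']
      exact ⟨fun hb => (if_pos hb).symm, fun hb => (if_neg hb).symm⟩
    · intro s' _ h1 _
      refine ⟨fun i hi hiS => ?_, fun i hi hiS => ?_⟩ <;> rw [h1 i hi 0 one_pos]
      · rw [if_pos hiS]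
      · rw [if_neg hiS]
  rintro s₃ f₃ ⟨hu, hu'⟩
  refine Tri.seq (P := fun s' => (∀ j < n, UsedCol r (fun i => s.nat 30 i 0) S j →
      s'.real 32 j 0 = s.real 32 j 0 - δ) ∧
    ∀ j < n, ¬ UsedCol r (fun i => s.nat 30 i 0) S j → s'.real 32 j 0 = s.real 32 j 0) ?_ ?_
  · refine Tri.tabR n 1 (fun j _ => if UsedCol r (fun i => s.nat 30 i 0) S j then
      s.real 32 j 0 - δ else s.real 32 j 0) (by omega) ?_ ?_ ?_ ?_
    · intro s' hf; simp [hf.nat 0 rfl, f₃.nat 0 rfl, f₂.nat 0 rfl, hn₁]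
    · intro s' hf; simp
    · intro i hi j hj s' hf h32 hi' hj'
      obtain rfl : j = 0 := by omega
      rw [f₃.real 32 rfl, f₂.real 32 rfl, f₁.real 32 rfl] at h32
      simp only [natEq_holds, RExp.val, NExp.val, nv_val, rv_val, hi', h32, hf.nat 32 rfl,
        f₃.nat 32 rfl, f₂.nat 32 rfl, f₁.nat 32 rfl, hf.real 33 rfl, f₃.real 33 rfl, hcols i hi,
        ← hδ']
      split_ifs with hU <;> simp
    · intro s' _ h1 _
      refine ⟨fun i hi hiS => ?_, fun i hi hiS => ?_⟩ <;> rw [h1 i hi 0 one_pos]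
      · rw [if_pos hiS]
      · rw [if_neg hiS]
  rintro s₄ f₄ ⟨hv, hv'⟩
  have h31₄ : s₄.real 31 = s₃.real 31 := f₄.real 31 rfl
  have htree₄ := htree.dualStep hδ0 hmin' (u' := fun i => s₄.real 31 i 0)
    (v' := fun j => s₄.real 32 j 0) (by simpa only [h31₄] using hu) (by simpa only [h31₄] using hu')
    hv hv'
  have hn₄ : s₄.nat 0 0 0 = n := by rw [f₄.nat 0 rfl, f₃.nat 0 rfl, f₂.nat 0 rfl, hn₁]
  have hr₄ : s₄.nat 39 0 0 = r := by
    rw [f₄.nat 39 rfl, f₃.nat 39 rfl, f₂.nat 39 rfl, f₁.nat 39 rfl, hr]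
  have h37₄ : s₄.nat 37 0 0 = j₁ := by rw [f₄.nat 37 rfl, f₃.nat 37 rfl]
  have h30₄ : s₄.nat 30 = s.nat 30 := by
    rw [f₄.nat 30 rfl, f₃.nat 30 rfl, f₂.nat 30 rfl, f₁.nat 30 rfl]
  have h33₄ : s₄.nat 33 = s₁.nat 33 := by rw [f₄.nat 33 rfl, f₃.nat 33 rfl, f₂.nat 33 rfl]
  have h34₄ : s₄.nat 34 = s.nat 34 := by
    rw [f₄.nat 34 rfl, f₃.nat 34 rfl, f₂.nat 34 rfl, f₁.nat 34 rfl]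
  have h36₄ : s₄.nat 36 = s.nat 36 := by
    rw [f₄.nat 36 rfl, f₃.nat 36 rfl, f₂.nat 36 rfl, f₁.nat 36 rfl]
  have hrows₄ : s₄.nat 31 = s.nat 31 := by
    rw [f₄.nat 31 rfl, f₃.nat 31 rfl, f₂.nat 31 rfl, f₁.nat 31 rfl]
  have hcols₄ : s₄.nat 32 = s.nat 32 := by
    rw [f₄.nat 32 rfl, f₃.nat 32 rfl, f₂.nat 32 rfl, f₁.nat 32 rfl]
  refine Tri.seq (ownerCmd_spec (by omega) hrn hn₄ hr₄) ?_
  intro s₅ f₅ howner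
  rw [h37₄, h30₄] at howner
  set w := s₁.nat 33 j₁ 0 with hw
  obtain ⟨hwS, hwmin⟩ := hway j₁ hj1
  have htight : s₄.real 31 w 0 + s₄.real 32 j₁ 0 = c w j₁ := by
    rw [h31₄, hu w (hSn w hwS) hwS, hv' j₁ hj1 hU1, hδ]
    ring
  refine Tri.seq (P := fun s' => s' = s₅.setNat 41 0 0 w) (Tri.setNat (by omega) ?_) ?_
  · simp only [NExp.val, nv_val, f₅.nat 37 rfl, f₅.nat 33 rfl, h37₄, h33₄]
    rfl
  rintro s₆ f₆ rfl
  refine Tri.ite (by omega) (fun hb => ?_) (fun hb => ?_)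
  · -- the column is free
    simp only [natEq_holds, nv_val, Mem.setNat_nat_ne s₅ _ _ _ (show 38 ≠ 41 by norm_num),
      Mem.setNat_nat_ne s₅ _ _ _ (show 0 ≠ 41 by norm_num), f₅.nat 0 rfl, hn₄] at hb
    have hfree : ∀ i < r, s.nat 30 i 0 ≠ j₁ := by
      rcases howner with ⟨-, h1⟩ | ⟨h1, -⟩
      · exact h1
      · omega
    refine Tri.seq (P := fun s' => ∀ x < n, s'.nat 30 x 0 = if x = w then j₁ else s.nat 34 w x)
      ?_ ?_
    · refine Tri.tabN n 1 (fun x _ => if x = w then j₁ else s.nat 34 w x) (by norm_num) (by omega)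
        ?_ ?_ ?_ ?_
      · intro s' hf; simp [hf.nat 0 rfl, Mem.setNat_nat, f₅.nat 0 rfl, hn₄]
      · intro s' hf; simp
      · intro i hi j hj s' hf _ hi' hj'
        have e1 : s'.nat 41 0 0 = w := by rw [hf.nat 41 rfl, Mem.setNat_nat_self]
        have e2 : s'.nat 37 0 0 = j₁ := by
          rw [hf.nat 37 rfl, Mem.setNat_nat_ne _ _ _ _ (by norm_num), f₅.nat 37 rfl, h37₄]
        have e3 : s'.nat 34 = s.nat 34 := by
          rw [hf.nat 34 rfl, Mem.setNat_nat_ne _ _ _ _ (by norm_num), f₅.nat 34 rfl, h34₄]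
        simp only [natEq_holds, NExp.val, nv_val, hi', e1, e2, e3]
        exact ⟨fun hb => (if_pos hb).symm, fun hb => (if_neg hb).symm⟩
      · intro s' _ h1 _ x hx
        rw [h1 x hx 0 one_pos]
    · intro s₇ f₇ hR
      refine Tri.setNat (by omega) (Or.inl ⟨by simp [Mem.setNat_nat], ?_⟩)
      have e31 : s₇.real 31 = s₄.real 31 := by rw [f₇.real 31 rfl, Mem.setNat_real, f₅.real 31 rfl]
      have e32 : s₇.real 32 = s₄.real 32 := by rw [f₇.real 32 rfl, Mem.setNat_real, f₅.real 32 rfl]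
      have := htree₄.augment hwS hj1 htight hfree hR
      simpa only [Mem.setNat_real, Mem.setNat_nat_ne _ _ _ _ (show 30 ≠ 36 by norm_num), e31, e32]
        using this
  · -- the column is matched to the row `o`
    simp only [natEq_holds, nv_val, Mem.setNat_nat_ne s₅ _ _ _ (show 38 ≠ 41 by norm_num),
      Mem.setNat_nat_ne s₅ _ _ _ (show 0 ≠ 41 by norm_num), f₅.nat 0 rfl, hn₄] at hb
    obtain ⟨ho, hoj⟩ := howner.resolve_left fun h1 => hb h1.1
    set o := s₅.nat 38 0 0 with ho'
    have hoS : o ∉ S := fun hoS => hU1 ⟨o, hoS, ho, hoj⟩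
    refine Tri.seq (P := fun s' => (∀ x < n, s'.nat 34 o x = if x = w then j₁ else s.nat 34 w x) ∧
      ∀ i, i ≠ o → s'.nat 34 i = s.nat 34 i) ?_ ?_
    · refine Tri.rowN (m := n) (ρ := o) (fun x => if x = w then j₁ else s.nat 34 w x) (by norm_num)
        (by omega) ?_ ?_ ?_ ?_
      · intro s' hf
        rw [nv_val, hf.nat 38 rfl, Mem.setNat_nat_ne _ _ _ _ (by norm_num)]
      · intro s' hf; simp [hf.nat 0 rfl, Mem.setNat_nat, f₅.nat 0 rfl, hn₄]
      · intro j hj s' hf h34 hj'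
        have e1 : s'.nat 41 0 0 = w := by rw [hf.nat 41 rfl, Mem.setNat_nat_self]
        have e2 : s'.nat 37 0 0 = j₁ := by
          rw [hf.nat 37 rfl, Mem.setNat_nat_ne _ _ _ _ (by norm_num), f₅.nat 37 rfl, h37₄]
        have e3 : s'.nat 34 w = s.nat 34 w := by
          rw [h34 w (fun e => hoS (e ▸ hwS)), Mem.setNat_nat_ne _ _ _ _ (by norm_num),
            f₅.nat 34 rfl, h34₄]
        simp only [natEq_holds, NExp.val, nv_val, hj', e1, e2, e3]
        exact ⟨fun hb => (if_pos hb).symm, fun hb => (if_neg hb).symm⟩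
      · intro s' _ h1 h2
        refine ⟨h1, fun i hi => ?_⟩
        rw [h2 i hi, Mem.setNat_nat_ne _ _ _ _ (by norm_num), f₅.nat 34 rfl, h34₄]
    rintro s₇ f₇ ⟨halt, halt'⟩
    have e37 : s₇.nat 37 0 0 = j₁ := by
      rw [f₇.nat 37 rfl, Mem.setNat_nat_ne _ _ _ _ (by norm_num), f₅.nat 37 rfl, h37₄]
    have e38 : s₇.nat 38 0 0 = o := by
      rw [f₇.nat 38 rfl, Mem.setNat_nat_ne _ _ _ _ (by norm_num)]
    have e30 : s₇.nat 30 = s.nat 30 := by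
      rw [f₇.nat 30 rfl, Mem.setNat_nat_ne _ _ _ _ (by norm_num), f₅.nat 30 rfl, h30₄]
    have e31 : s₇.nat 31 = s.nat 31 := by
      rw [f₇.nat 31 rfl, Mem.setNat_nat_ne _ _ _ _ (by norm_num), f₅.nat 31 rfl, hrows₄]
    have e32 : s₇.nat 32 = s.nat 32 := by
      rw [f₇.nat 32 rfl, Mem.setNat_nat_ne _ _ _ _ (by norm_num), f₅.nat 32 rfl, hcols₄]
    have e33 : s₇.nat 33 = s₁.nat 33 := by
      rw [f₇.nat 33 rfl, Mem.setNat_nat_ne _ _ _ _ (by norm_num), f₅.nat 33 rfl, h33₄]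
    have e36 : s₇.nat 36 = s.nat 36 := by
      rw [f₇.nat 36 rfl, Mem.setNat_nat_ne _ _ _ _ (by norm_num), f₅.nat 36 rfl, h36₄]
    have eu : s₇.real 31 = s₄.real 31 := by rw [f₇.real 31 rfl, Mem.setNat_real, f₅.real 31 rfl]
    have ev : s₇.real 32 = s₄.real 32 := by rw [f₇.real 32 rfl, Mem.setNat_real, f₅.real 32 rfl]
    refine Tri.seq (P := fun s' => s' = s₇.setNat 32 j₁ 0 1)
      (Tri.setNat (by omega) (by simp [e37])) ?_
    rintro s₈ - rfl
    refine Tri.seq (P := fun s' => s' = (s₇.setNat 32 j₁ 0 1).setNat 31 o 0 1)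
      (Tri.setNat (by omega) (by simp [Mem.setNat_nat, e38])) ?_
    rintro s₉ - rfl
    refine Tri.setNat (by omega) (Or.inr ⟨?_, o, hoS, ?_⟩)
    · simp [Mem.setNat_nat, e36]
    · have hs : ((s₇.setNat 32 j₁ 0 1).setNat 31 o 0 1).nat 38 0 0 = o := by
        simp [Mem.setNat_nat, e38]
      simp only [NExp.val, nv_val, hs]
      have hext := htree₄.extend hwS htight ho hoj hoS halt (fun i hi x _ => by rw [halt' i hi])
      constructor
      · have e34 : (((s₇.setNat 32 j₁ 0 1).setNat 31 o 0 1).setNat 35 0 0 o).nat 34 =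
            s₇.nat 34 := by
          rw [Mem.setNat_nat_ne _ _ _ _ (by norm_num), Mem.setNat_nat_ne _ _ _ _ (by norm_num),
            Mem.setNat_nat_ne _ _ _ _ (by norm_num)]
        rw [e34]
        simpa [Mem.setNat_real, Mem.setNat_nat, eu, ev, e30] using hext
      · intro i hi
        simp only [Mem.setNat_nat, e31, and_true, Finset.mem_insert, ← hrows i hi]
        by_cases hio : i = o <;> simp [hio]
      · intro j hj
        have hcj := hcols j hj
        simp only [Mem.setNat_nat, e30, e32, and_true]
        by_cases hjj : j = j₁
        · subst hjj
          simp only [show ¬(32 = 35) by norm_num, show ¬(32 = 31) by norm_num,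
            show ¬(30 = 35) by norm_num, show ¬(30 = 31) by norm_num, show ¬(30 = 32) by norm_num,
            false_and, if_false, if_true, and_self]
          rw [if_pos ⟨o, Finset.mem_insert_self _ _, ho, hoj⟩]
        · have : UsedCol r (fun i => s.nat 30 i 0) (insert o S) j ↔
              UsedCol r (fun i => s.nat 30 i 0) S j := by
            constructor
            · rintro ⟨i, hi, hir, hij⟩
              rcases Finset.mem_insert.1 hi with rfl | hi
              · exact absurd (hij.symm.trans hoj) hjj
              · exact ⟨i, hi, hir, hij⟩
            · rintro ⟨i, hi, hir, hij⟩
              exact ⟨i, Finset.mem_insert_of_mem hi, hir, hij⟩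
          simp only [show ¬(32 = 35) by norm_num, show ¬(32 = 31) by norm_num,
            show ¬(30 = 35) by norm_num, show ¬(30 = 31) by norm_num, show ¬(30 = 32) by norm_num,
            false_and, if_false, hjj, and_false, this]
          exact hcj
      · simp [Mem.setNat_nat]
      · intro j hj
        simp only [Mem.setNat_nat, e33, show ¬(33 = 35) by norm_num, show ¬(33 = 31) by norm_num,
          show ¬(33 = 32) by norm_num, false_and, if_false]
        exact Finset.mem_insert_of_mem (hway j hj).1
      · intro j hj i hi hi'
        simp only [Mem.setNat_nat, and_self, if_true] at hi'
        have hiS := (Finset.mem_insert.1 hi).resolve_left hi'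
        simp only [Mem.setNat_nat, Mem.setNat_real, e33, eu, h31₄, show ¬(33 = 35) by norm_num,
          show ¬(33 = 31) by norm_num, show ¬(33 = 32) by norm_num, false_and, if_false]
        have h1 := hway j hj
        rw [hu _ (hSn _ h1.1) h1.1, hu _ (hSn _ hiS) hiS]
        linarith [h1.2 i hiS]

/-- The body of the algorithm for the assignment problem: one row is added to the matching. -/
def phaseCmd : Cmd :=
  .seq (tabN 31 (nv 0) (.const 1) (natEq (nv 20) (nv 39)) (.const 1) (.const 0))
    (.seq (tabN 32 (nv 0) (.const 1) btrue (.const 0) (.const 0))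
    (.seq (tabN 33 (nv 0) (.const 1) btrue (nv 39) (.const 0))
    (.seq (rowN 34 (nv 39) (nv 0) btrue (.get 30 (nv 40) (.const 0)) (.const 0))
    (.seq (.setNat 36 (.const 0) (.const 0) (.const 0))
    (.seq (.setNat 35 (.const 0) (.const 0) (nv 39))
    (.while (natEq (nv 36) (.const 0)) treeStepCmd))))))

theorem phaseCmd_spec {E : Env} {s : Mem} {T n r : ℕ} {c : ℕ → ℕ → ℝ}
    (hT : (n + 1) * (2 * (n + 1)) ≤ T) (hn : s.nat 0 0 0 = n) (hr : s.nat 39 0 0 = r)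
    (hrn : r < n) (hc : s.real 30 = c)
    (h : PrimalDual n r c (fun i => s.real 31 i 0) (fun j => s.real 32 j 0)
      (fun i => s.nat 30 i 0)) :
    Tri E phaseCmd s T (fun s' => PrimalDual n (r + 1) c (fun i => s'.real 31 i 0)
      (fun j => s'.real 32 j 0) (fun i => s'.nat 30 i 0)) := by
  classical
  have hT1 : 2 * (n + 1) ≤ T := le_trans (Nat.le_mul_of_pos_left _ (Nat.succ_pos n)) hT
  refine Tri.seq (P := fun s' => ∀ i < n, s'.nat 31 i 0 = if i = r then 1 else 0) ?_ ?_
  · refine Tri.tabN n 1 (fun i _ => if i = r then 1 else 0) (by norm_num) (by omega) ?_ ?_ ?_ ?_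
    · intro s' hf; simp [hf.nat 0 rfl, hn]
    · intro s' hf; simp
    · intro i hi j hj s' hf _ hi' hj'
      simp only [natEq_holds, NExp.val, nv_val, hi', hf.nat 39 rfl, hr]
      exact ⟨fun hb => (if_pos hb).symm, fun hb => (if_neg hb).symm⟩
    · intro s' _ h1 _ i hi
      rw [h1 i hi 0 one_pos]
  intro s₁ f₁ h31
  refine Tri.seq (P := fun s' => ∀ i < n, s'.nat 32 i 0 = 0) ?_ ?_
  · refine Tri.tabN n 1 (fun i _ => 0) (by norm_num) (by omega) ?_ ?_ ?_ ?_
    · intro s' hf; simp [hf.nat 0 rfl, f₁.nat 0 rfl, hn]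
    · intro s' hf; simp
    · intro i hi j hj s' hf _ hi' hj'; simp
    · intro s' _ h1 _ i hi
      rw [h1 i hi 0 one_pos]
  intro s₂ f₂ h32
  refine Tri.seq (P := fun s' => ∀ i < n, s'.nat 33 i 0 = r) ?_ ?_
  · refine Tri.tabN n 1 (fun i _ => r) (by norm_num) (by omega) ?_ ?_ ?_ ?_
    · intro s' hf; simp [hf.nat 0 rfl, f₂.nat 0 rfl, f₁.nat 0 rfl, hn]
    · intro s' hf; simp
    · intro i hi j hj s' hf _ hi' hj'
      simp [btrue, hf.nat 39 rfl, f₂.nat 39 rfl, f₁.nat 39 rfl, hr]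
    · intro s' _ h1 _ i hi
      rw [h1 i hi 0 one_pos]
  intro s₃ f₃ h33
  have e30 : s₃.nat 30 = s.nat 30 := by rw [f₃.nat 30 rfl, f₂.nat 30 rfl, f₁.nat 30 rfl]
  have e39 : s₃.nat 39 0 0 = r := by rw [f₃.nat 39 rfl, f₂.nat 39 rfl, f₁.nat 39 rfl, hr]
  have e0 : s₃.nat 0 0 0 = n := by rw [f₃.nat 0 rfl, f₂.nat 0 rfl, f₁.nat 0 rfl, hn]
  refine Tri.seq (P := fun s' => ∀ i < n, s'.nat 34 r i = s.nat 30 i 0) ?_ ?_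
  · refine Tri.rowN (m := n) (ρ := r) (fun i => s.nat 30 i 0) (by norm_num) (by omega) ?_ ?_ ?_ ?_
    · intro s' hf; rw [nv_val, hf.nat 39 rfl, e39]
    · intro s' hf; rw [nv_val, hf.nat 0 rfl, e0]
    · intro j hj s' hf _ hj'
      simp [btrue, hj', hf.nat 30 rfl, e30]
    · intro s' _ h1 _
      exact h1
  intro s₄ f₄ h34
  refine Tri.seq (P := fun s' => s' = s₄.setNat 36 0 0 0) (Tri.setNat (by omega) (by simp)) ?_
  rintro s₅ - rfl
  refine Tri.seq (P := fun s' => s' = (s₄.setNat 36 0 0 0).setNat 35 0 0 r)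
    (Tri.setNat (by omega) (by simp [Mem.setNat_nat, f₄.nat 39 rfl, e39])) ?_
  rintro s₆ - rfl
  set s₆ := (s₄.setNat 36 0 0 0).setNat 35 0 0 r with hs₆
  have g : ∀ x, x ≠ 35 → x ≠ 36 → s₆.nat x = s₄.nat x := fun x h1 h2 => by
    rw [hs₆, Mem.setNat_nat_ne _ _ _ _ h1, Mem.setNat_nat_ne _ _ _ _ h2]
  have greal : s₆.real = s₄.real := rfl
  have hstart : TreeMem n r c {r} s₆ := by
    have h30 : s₆.nat 30 = s.nat 30 := by
      rw [g 30 (by norm_num) (by norm_num), f₄.nat 30 rfl, e30]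
    constructor
    · rw [h30, greal, f₄.real 31 rfl, f₄.real 32 rfl, f₃.real 31 rfl, f₃.real 32 rfl,
        f₂.real 31 rfl, f₂.real 32 rfl, f₁.real 31 rfl, f₁.real 32 rfl,
        g 34 (by norm_num) (by norm_num)]
      exact h.start hrn h34
    · intro i hi
      rw [g 31 (by norm_num) (by norm_num), f₄.nat 31 rfl, f₃.nat 31 rfl, f₂.nat 31 rfl, h31 i hi]
      simp
    · intro j hj
      rw [g 32 (by norm_num) (by norm_num), f₄.nat 32 rfl, f₃.nat 32 rfl, h32 j hj, if_neg]
      rintro ⟨i, hi, hir, -⟩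
      rw [Finset.mem_singleton] at hi
      omega
    · rw [hs₆, Mem.setNat_nat_self]; simp
    · intro j hj
      rw [g 33 (by norm_num) (by norm_num), f₄.nat 33 rfl, h33 j hj]; simp
    · intro j hj i hi hi'
      rw [hs₆, Mem.setNat_nat_self] at hi'
      exact absurd (Finset.mem_singleton.1 hi) hi'
  have h36 : s₆.nat 36 0 0 = 0 := by
    rw [hs₆, Mem.setNat_nat_ne _ _ _ _ (by norm_num), Mem.setNat_nat_self]
  have hn₆ : s₆.nat 0 0 0 = n := by rw [g 0 (by norm_num) (by norm_num), f₄.nat 0 rfl, e0]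
  have hr₆ : s₆.nat 39 0 0 = r := by rw [g 39 (by norm_num) (by norm_num), f₄.nat 39 rfl, e39]
  have hc₆ : s₆.real 30 = c := by
    rw [greal, f₄.real 30 rfl, f₃.real 30 rfl, f₂.real 30 rfl, f₁.real 30 rfl, hc]
  refine Tri.whileLoop (fun i s' => (s'.nat 36 0 0 = 0 ∧ ∃ S : Finset ℕ, S.card = i + 1 ∧
      TreeMem n r c S s') ∨ (s'.nat 36 0 0 = 1 ∧ PrimalDual n (r + 1) c (fun i => s'.real 31 i 0)
      (fun j => s'.real 32 j 0) (fun i => s'.nat 30 i 0))) n hT (by omega) ?_ ?_ ?_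
  · exact Or.inl ⟨h36, {r}, rfl, hstart⟩
  · intro i s' hf hinv hb
    simp only [natEq_holds, NExp.val, nv_val] at hb
    obtain ⟨-, S, hS, htm⟩ := hinv.resolve_right fun h1 => by omega
    refine ⟨?_, (treeStepCmd_spec le_rfl ?_ ?_ ?_ htm).imp ?_⟩
    · have : S ⊆ Finset.range (r + 1) := fun x hx =>
        Finset.mem_range.2 (Nat.lt_succ_of_le (htm.tree.le x hx))
      have := Finset.card_le_card this
      rw [Finset.card_range] at this
      omega
    · rw [hf.nat 0 rfl, hn₆]
    · rw [hf.nat 39 rfl, hr₆]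
    · rw [hf.real 30 rfl, hc₆]
    · rintro s'' - (h1 | ⟨h1, o, hoS, ho⟩)
      · exact Or.inr h1
      · exact Or.inl ⟨h1.trans hb, insert o S, by rw [Finset.card_insert_of_notMem hoS, hS], ho⟩
  · intro i s' _ hinv hb
    simp only [natEq_holds, NExp.val, nv_val] at hb
    exact (hinv.resolve_left fun h1 => hb h1.1).2

/-- An optimal solution of the assignment problem with the costs in the array `30` of reals is
written to the array `30` of naturals. The rows are matched one after the other, starting from the
dual variables `u i = -∑ j, |c i j|` and `v = 0`. -/
def assignCmd : Cmd :=
  .seq (sumTab 31 (nv 0) (.const 1) (nv 0)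
      (.sub (.const 0) (.sqrt (.mul (.get 30 (nv 20) (nv 22)) (.get 30 (nv 20) (nv 22))))))
    (.seq (tabR 32 (nv 0) (.const 1) btrue (.const 0) (.const 0))
      (forN 39 (nv 0) phaseCmd))

theorem assignCmd_spec {E : Env} {s : Mem} {T n : ℕ} (hn : s.nat 0 0 0 = n)
    (hT : (n + 1) * ((n + 1) * (2 * (n + 1))) ≤ T) :
    Tri E assignCmd s T (fun s' => ∃ π : Equiv.Perm (Fin n), (∀ i : Fin n, s'.nat 30 i 0 = π i) ∧
      ∀ τ : Equiv.Perm (Fin n), ∑ i : Fin n, s.real 30 i (π i) ≤ ∑ i : Fin n,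
        s.real 30 i (τ i)) := by
  have hT1 : (n + 1) * (2 * (n + 1)) ≤ T :=
    le_trans (Nat.le_mul_of_pos_left _ (Nat.succ_pos n)) hT
  refine Tri.seq (P := fun s' => ∀ i < n, s'.real 31 i 0 =
    ∑ j ∈ Finset.range n, -|s.real 30 i j|) ?_ ?_
  · refine Tri.sumTab n 1 n (fun i _ j => -|s.real 30 i j|) (by norm_num) (by nlinarith)
      ?_ ?_ ?_ ?_ ?_
    · intro s' hf; simp [hf.nat 0 rfl, hn]
    · intro s' hf; simp
    · intro s' hf; simp [hf.nat 0 rfl, hn]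
    · intro i hi j hj l hl s' hf _ hi' hj' hl'
      simp [hi', hl', hf.real 30 rfl, Real.sqrt_mul_self_eq_abs]
    · intro s' _ h1 _ i hi
      rw [h1 i hi 0 one_pos]
  intro s₁ f₁ h31
  refine Tri.seq (P := fun s' => ∀ i < n, s'.real 32 i 0 = 0) ?_ ?_
  · refine Tri.tabR n 1 (fun i _ => 0) (by nlinarith) ?_ ?_ ?_ ?_
    · intro s' hf; simp [hf.nat 0 rfl, f₁.nat 0 rfl, hn]
    · intro s' hf; simp
    · intro i hi j hj s' hf _ hi' hj'; simp
    · intro s' _ h1 _ i hi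
      rw [h1 i hi 0 one_pos]
  intro s₂ f₂ h32
  have hn₂ : s₂.nat 0 0 0 = n := by rw [f₂.nat 0 rfl, f₁.nat 0 rfl, hn]
  have hc₂ : s₂.real 30 = s.real 30 := by rw [f₂.real 30 rfl, f₁.real 30 rfl]
  refine Tri.forN n (fun r s' => PrimalDual n r (s.real 30) (fun i => s'.real 31 i 0)
      (fun j => s'.real 32 j 0) (fun i => s'.nat 30 i 0)) hT (by nlinarith) rfl ?_ ?_ ?_ ?_ ?_
  · intro s' hf; simp [hf.nat 0 rfl, hn₂]
  · intro i s' x h1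
    rwa [Mem.setNat_nat_ne _ _ _ _ (by norm_num), Mem.setNat_real]
  -- the initial dual variables are feasible, since `-∑ j, |c i j| ≤ c i j`
  · refine ⟨?_, by simp, by simp, by simp⟩
    intro i hi j hj
    rw [f₂.real 31 rfl, h31 i hi, h32 j hj, Finset.sum_neg_distrib, add_zero]
    have := Finset.single_le_sum (f := fun j => |s.real 30 i j|) (fun _ _ => abs_nonneg _)
      (Finset.mem_range.2 hj)
    linarith [neg_abs_le (s.real 30 i j)]
  · intro i hi s' hf hi' hinv
    exact phaseCmd_spec le_rfl (by rw [hf.nat 0 rfl, hn₂]) hi' hi (by rw [hf.real 30 rfl, hc₂]) hinv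
  · intro s' _ _ hinv
    exact hinv.optimal

end

section

/-! ### The assignment problem with prescribed values -/

variable {n K0 : ℕ}

/-- The extension of a bijection outside the seeds by `U k ↦ V k`. -/
theorem exists_perm_extending (U V : Fin K0 ↪ Fin n) (σ : Rest U ≃ Rest V) :
    ∃ τ : Equiv.Perm (Fin n), (∀ k, τ (U k) = V k) ∧ ∀ i : Rest U, τ i = σ i := by
  classical
  let f : Fin n → Fin n := fun x =>
    if h : ∃ k, U k = x then V h.choose else σ ⟨x, fun k hk => h ⟨k, hk⟩⟩
  have hU : ∀ k, f (U k) = V k := fun k => by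
    have h : ∃ k', U k' = U k := ⟨k, rfl⟩
    simp only [f, dif_pos h]
    rw [U.injective h.choose_spec]
  have hR : ∀ i : Rest U, f i = σ i := fun i => by
    have h : ¬ ∃ k, U k = i := fun ⟨k, hk⟩ => i.2 k hk
    simp only [f, dif_neg h]
  have hf : Function.Injective f := by
    intro x y hxy
    by_cases hx : ∃ k, U k = x <;> by_cases hy : ∃ k, U k = y
    · obtain ⟨k, rfl⟩ := hx
      obtain ⟨l, rfl⟩ := hy
      rw [hU, hU] at hxy
      rw [V.injective hxy]
    · obtain ⟨k, rfl⟩ := hx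
      have h := hR ⟨y, fun k hk => hy ⟨k, hk⟩⟩
      rw [hU] at hxy
      exact absurd (hxy.trans h) ((σ _).2 k)
    · obtain ⟨k, rfl⟩ := hy
      have h := hR ⟨x, fun k hk => hx ⟨k, hk⟩⟩
      rw [hU] at hxy
      exact absurd (hxy.symm.trans h) ((σ _).2 k)
    · have h1 := hR ⟨x, fun k hk => hx ⟨k, hk⟩⟩
      have h2 := hR ⟨y, fun k hk => hy ⟨k, hk⟩⟩
      have := σ.injective (Subtype.ext (h1.symm.trans (hxy.trans h2)))
      exact congrArg Subtype.val this
  exact ⟨Equiv.ofBijective f (Finite.injective_iff_bijective.1 hf), hU, hR⟩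

theorem exists_restrict (U V : Fin K0 ↪ Fin n) {π : Equiv.Perm (Fin n)} (h : ∀ k, π (U k) = V k) :
    ∃ σ : Rest U ≃ Rest V, ∀ i : Rest U, π i = σ i := by
  refine ⟨π.subtypeEquiv fun i => ?_, fun i => rfl⟩
  constructor
  · intro hi k hk
    exact hi k (π.injective (by rw [h, hk]))
  · intro hi k hk
    exact hi k (by rw [← h, hk])

/-- Rewarding the pairs `(U k, V k)` with more than twice the sum of all other weights forces an
optimal assignment to use all of them. -/
theorem solvesAssignment_of_forced {l : ℕ} (U V : Fin K0 ↪ Fin n) (h : Matrix (Rest U) (Fin l) ℝ)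
    (ℓ : Matrix (Rest V) (Fin l) ℝ) {a sd : Fin n → Fin n → ℝ} {B : ℝ}
    (ha : ∀ (i : Rest U) (j : Rest V), a i j = ∑ k, h i k * ℓ j k)
    (haU : ∀ k y, a (U k) y = 0)
    (hsd : ∀ x y, sd x y = ∑ k : Fin K0, if U k = x ∧ V k = y then 1 else 0)
    (hB : 2 * ∑ x, ∑ y, |a x y| < B) {π : Equiv.Perm (Fin n)}
    (hπ : ∀ τ : Equiv.Perm (Fin n), ∑ x, (-a x (π x) - B * sd x (π x)) ≤
      ∑ x, (-a x (τ x) - B * sd x (τ x))) : SolvesAssignment U V h ℓ π := by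
  classical
  have hhits : ∀ τ : Equiv.Perm (Fin n), ∑ x, sd x (τ x) =
      ((Finset.univ.filter fun k : Fin K0 => τ (U k) = V k).card : ℝ) := fun τ => by
    simp only [hsd]
    rw [Finset.sum_comm, ← Finset.sum_boole]
    refine Finset.sum_congr rfl fun k _ => ?_
    rw [Finset.sum_eq_single (U k) (fun x _ hx => if_neg fun e => hx e.1.symm) (by simp)]
    simp [eq_comm]
  have hbound : ∀ τ : Equiv.Perm (Fin n), |∑ x, a x (τ x)| ≤ ∑ x, ∑ y, |a x y| := fun τ =>
    (Finset.abs_sum_le_sum_abs _ _).trans (Finset.sum_le_sum fun x _ =>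
      Finset.single_le_sum (f := fun y => |a x y|) (fun _ _ => abs_nonneg _) (Finset.mem_univ _))
  have hval : ∀ τ : Equiv.Perm (Fin n), ∑ x, (-a x (τ x) - B * sd x (τ x)) =
      -∑ x, a x (τ x) - B * ∑ x, sd x (τ x) := fun τ => by
    rw [Finset.sum_sub_distrib, Finset.sum_neg_distrib, Finset.mul_sum]
  have hfull : ∀ τ : Equiv.Perm (Fin n), (∀ k, τ (U k) = V k) → ∑ x, sd x (τ x) = K0 :=
    fun τ hτ => by
      rw [hhits, Finset.filter_true_of_mem (by simpa using hτ)]; simp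
  have hassign : ∀ (τ : Equiv.Perm (Fin n)) (σ : Rest U ≃ Rest V), (∀ i : Rest U, τ i = σ i) →
      ∑ x, a x (τ x) = assignmentValue h ℓ σ := fun τ σ hτ => by
    rw [assignmentValue, ← Fintype.sum_subtype_add_sum_subtype (fun x => ∀ k, U k ≠ x)]
    have h0 : ∑ x : {x // ¬ ∀ k, U k ≠ x}, a x (τ x) = 0 := Finset.sum_eq_zero fun x _ => by
      obtain ⟨k, hk⟩ := not_forall.1 x.2
      rw [← not_not.1 hk, haU]
    rw [h0, add_zero]
    refine Finset.sum_congr rfl fun i _ => ?_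
    rw [hτ i, ha]
  have hB0 : 0 < B := lt_of_le_of_lt (by positivity) hB
  -- some permutation uses all pairs
  have hcard : Fintype.card (Rest U) = Fintype.card (Rest V) := by
    have e : ∀ W : Fin K0 ↪ Fin n, Fintype.card (Rest W) = n - K0 := fun W => by
      have h1 : Fintype.card {i : Fin n // ¬ ∀ k, W k ≠ i} = K0 := by
        rw [Fintype.card_congr (Equiv.subtypeEquivRight (q := fun i => i ∈ Set.range W)
          fun i => by simp), ← Fintype.card_congr (Equiv.ofInjective W W.injective),
          Fintype.card_fin]
      have h2 := Fintype.card_subtype_compl (fun i : Fin n => ∀ k, W k ≠ i)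
      have h3 := Fintype.card_subtype_le (fun i : Fin n => ∀ k, W k ≠ i)
      rw [Fintype.card_fin] at h2 h3
      rw [h1] at h2
      change Fintype.card {i : Fin n // ∀ k, W k ≠ i} = _
      omega
    rw [e U, e V]
  obtain ⟨τ₀, hτ₀, -⟩ := exists_perm_extending U V (Fintype.equivOfCardEq hcard)
  have hπU : ∀ k, π (U k) = V k := by
    by_contra hc
    obtain ⟨k, hk⟩ := not_forall.1 hc
    have h1 : (Finset.univ.filter fun k : Fin K0 => π (U k) = V k).card + 1 ≤ K0 := by
      have : (Finset.univ.filter fun k : Fin K0 => π (U k) = V k) ⊂ Finset.univ :=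
        Finset.filter_ssubset.2 ⟨k, Finset.mem_univ _, hk⟩
      have := Finset.card_lt_card this
      rw [Finset.card_univ, Fintype.card_fin] at this
      omega
    have h1' : ((Finset.univ.filter fun k : Fin K0 => π (U k) = V k).card : ℝ) + 1 ≤ K0 := by
      exact_mod_cast h1
    have h2 := hπ τ₀
    rw [hval, hval, hhits π, hfull τ₀ hτ₀] at h2
    have h3 := abs_le.1 (hbound π)
    have h4 := abs_le.1 (hbound τ₀)
    nlinarith
  obtain ⟨σ, hσ⟩ := exists_restrict U V hπU
  refine ⟨hπU, σ, hσ, fun τ => ?_⟩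
  obtain ⟨τ', h1, h2⟩ := exists_perm_extending U V τ
  have h3 := hπ τ'
  rw [hval, hval, hfull τ' h1, hfull π hπU, hassign τ' τ h2, hassign π σ hσ] at h3
  linarith

/-! ### The program for the candidate matching -/

/-- `1` if `e = e'` and `0` otherwise. -/
def neq (e e' : NExp) : NExp := .sub (.sub (.const 1) (.sub e e')) (.sub e' e)

theorem neq_val (ω : Tape) (s : Mem) (e e' : NExp) :
    (neq e e').val ω s = if e.val ω s = e'.val ω s then 1 else 0 := by
  simp only [neq, NExp.val]
  split_ifs <;> omega

/-- The indicators of the seeds in the arrays `1` and `2` of naturals to the arrays `50` and `51` of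
reals. -/
def seedCmd (K0 : ℕ) : Cmd :=
  .seq (sumTab 50 (nv 0) (.const 1) (.const K0) (.ofNat (neq (.get 1 (nv 22) (.const 0)) (nv 20))))
    (sumTab 51 (nv 0) (.const 1) (.const K0) (.ofNat (neq (.get 2 (nv 22) (.const 0)) (nv 20))))

/-- The array `x` of naturals holds the values of `U`. -/
def Mem.HoldsSeeds (s : Mem) (x : ℕ) (U : Fin K0 ↪ Fin n) : Prop := ∀ k : Fin K0, s.nat x k 0 = U k

theorem Mem.HoldsSeeds.congr {s s' : Mem} {x : ℕ} {U : Fin K0 ↪ Fin n} (h : s.HoldsSeeds x U)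
    (hs : s'.nat x = s.nat x) : s'.HoldsSeeds x U := fun k => by rw [hs]; exact h k

/-- The array `x` of reals holds the indicator of the seeds `U`. -/
structure Mem.HoldsMask (s : Mem) (x : ℕ) (U : Fin K0 ↪ Fin n) : Prop where
  seed : ∀ k, s.real x (U k) 0 = 1
  rest : ∀ i : Rest U, s.real x i 0 = 0

theorem Mem.HoldsMask.congr {s s' : Mem} {x : ℕ} {U : Fin K0 ↪ Fin n} (h : s.HoldsMask x U)
    (hs : s'.real x = s.real x) : s'.HoldsMask x U :=
  ⟨fun k => by rw [hs]; exact h.seed k, fun k => by rw [hs]; exact h.rest k⟩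

theorem sum_seed_indicator (U : Fin K0 ↪ Fin n) {f : ℕ → ℕ} (hf : ∀ k : Fin K0, f k = U k)
    (i : ℕ) : (∑ k ∈ Finset.range K0, (((if f k = i then 1 else 0 : ℕ)) : ℝ)) =
      ∑ k : Fin K0, if (U k : ℕ) = i then 1 else 0 := by
  rw [Finset.sum_range]
  exact Finset.sum_congr rfl fun k _ => by rw [hf]; push_cast; rfl

theorem holdsMask_of_sum {s : Mem} {x : ℕ} (U : Fin K0 ↪ Fin n)
    (h : ∀ i < n, s.real x i 0 = ∑ k : Fin K0, if (U k : ℕ) = i then 1 else 0) :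
    s.HoldsMask x U := by
  constructor
  · intro k
    rw [h _ (U k).2, Finset.sum_eq_single k ?_ (by simp)]
    · simp
    · intro k' _ hk
      rw [if_neg]
      intro e
      exact hk (U.injective (Fin.ext e))
  · intro i
    rw [h _ i.1.2]
    exact Finset.sum_eq_zero fun k _ => if_neg fun e => i.2 k (Fin.ext e)

theorem seedCmd_spec {E : Env} {s : Mem} {T : ℕ} {U V : Fin K0 ↪ Fin n}
    (hT : 2 * (n + 1) * (K0 + 1) ≤ T) (hn : s.nat 0 0 0 = n) (hU : s.HoldsSeeds 1 U)
    (hV : s.HoldsSeeds 2 V) :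
    Tri E (seedCmd K0) s T (fun s' => s'.HoldsMask 50 U ∧ s'.HoldsMask 51 V) := by
  refine Tri.seq (P := fun s' => s'.HoldsMask 50 U) ?_ ?_
  · refine Tri.sumTab n 1 K0 (fun i _ k => ((if s.nat 1 k 0 = i then 1 else 0 : ℕ) : ℝ))
      (by norm_num) (by nlinarith) ?_ ?_ ?_ ?_ ?_
    · intro s' hf; simp [hf.nat 0 rfl, hn]
    · intro s' hf; simp
    · intro s' hf; simp
    · intro i hi j hj l hl s' hf _ hi' hj' hl'
      simp [neq_val, hi', hl', hf.nat 1 rfl]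
    · intro s' _ h _
      refine holdsMask_of_sum U fun i hi => ?_
      rw [h i hi 0 one_pos, sum_seed_indicator U (f := fun k => s.nat 1 k 0) hU]
  intro s₁ f₁ h₁
  refine Tri.sumTab n 1 K0 (fun i _ k => ((if s.nat 2 k 0 = i then 1 else 0 : ℕ) : ℝ))
    (by norm_num) (by nlinarith) ?_ ?_ ?_ ?_ ?_
  · intro s' hf; simp [hf.nat 0 rfl, f₁.nat 0 rfl, hn]
  · intro s' hf; simp
  · intro s' hf; simp
  · intro i hi j hj l hl s' hf _ hi' hj' hl'
    simp [neq_val, hi', hl', hf.nat 2 rfl, f₁.nat 2 rfl]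
  · intro s' hf h _
    refine ⟨h₁.congr (hf.real 50 rfl), holdsMask_of_sum V fun i hi => ?_⟩
    rw [h i hi 0 one_pos, sum_seed_indicator V (f := fun k => s.nat 2 k 0) hV]

/-- The candidate matching, computed from the arrays `41` and `43` with as many columns as the
variable `5` says, is written to the array `3`. The weights vanish in the rows and columns of the
seeds, except that a pair of corresponding seeds has a weight larger than twice the sum of all
absolute weights, which forces it into the optimum. -/
def matchCmd (K0 : ℕ) : Cmd :=
  .seq (sumTab 52 (nv 0) (nv 0) (nv 5) (.mul (.get 41 (nv 20) (nv 22)) (.get 43 (nv 21) (nv 22))))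
    (.seq (tabR 52 (nv 0) (nv 0) btrue
      (.mul (.mul (.sub (.const 1) (.get 50 (nv 20) (.const 0)))
        (.sub (.const 1) (.get 51 (nv 21) (.const 0)))) (.get 52 (nv 20) (nv 21))) (.const 0))
    (.seq (sumTab 53 (nv 0) (.const 1) (nv 0)
      (.sqrt (.mul (.get 52 (nv 20) (nv 22)) (.get 52 (nv 20) (nv 22)))))
    (.seq (sumTab 54 (.const 1) (.const 1) (nv 0) (.get 53 (nv 22) (.const 0)))
    (.seq (sumTab 55 (nv 0) (nv 0) (.const K0)
      (.mul (.ofNat (neq (.get 1 (nv 22) (.const 0)) (nv 20)))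
        (.ofNat (neq (.get 2 (nv 22) (.const 0)) (nv 21)))))
    (.seq (tabR 30 (nv 0) (nv 0) btrue
      (.sub (.sub (.const 0) (.get 52 (nv 20) (nv 21)))
        (.mul (.add (.const 1) (.mul (.const 2) (rv 54))) (.get 55 (nv 20) (nv 21)))) (.const 0))
    (.seq assignCmd
      (tabN 3 (nv 0) (.const 1) btrue (.get 30 (nv 20) (.const 0)) (.const 0))))))))

theorem matchCmd_spec {E : Env} {s : Mem} {T l : ℕ} {U V : Fin K0 ↪ Fin n}
    {h : Matrix (Rest U) (Fin l) ℝ} {ℓ : Matrix (Rest V) (Fin l) ℝ}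
    (hT : 4 * (n + 1) * (n + 1) * (n + l + K0 + 1) ≤ T) (hn : s.nat 0 0 0 = n)
    (hU : s.HoldsSeeds 1 U) (hV : s.HoldsSeeds 2 V) (hmU : s.HoldsMask 50 U)
    (hmV : s.HoldsMask 51 V) (hl : s.nat 5 0 0 = l)
    (hh : ∀ (i : Rest U) (j : Fin l), s.real 41 i j = h i j)
    (hℓ : ∀ (i : Rest V) (j : Fin l), s.real 43 i j = ℓ i j) :
    Tri E (matchCmd K0) s T (fun s' => ∃ π : Equiv.Perm (Fin n), SolvesAssignment U V h ℓ π ∧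
      s'.Stores 3 π) := by
  have hT0 : (n + 1) * (n + 1) * 1 ≤ T := le_trans (by
    rw [mul_assoc 4, mul_assoc 4]
    exact le_trans (Nat.mul_le_mul_left _ (by omega)) (Nat.le_mul_of_pos_left _ four_pos)) hT
  have hTl : (n + 1) * (n + 1) * (l + 1) ≤ T := le_trans (by
    rw [mul_assoc 4, mul_assoc 4]
    exact le_trans (Nat.mul_le_mul_left _ (by omega)) (Nat.le_mul_of_pos_left _ four_pos)) hT
  have hTK : (n + 1) * (n + 1) * (K0 + 1) ≤ T := le_trans (by
    rw [mul_assoc 4, mul_assoc 4]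
    exact le_trans (Nat.mul_le_mul_left _ (by omega)) (Nat.le_mul_of_pos_left _ four_pos)) hT
  have hTn : 4 * ((n + 1) * (n + 1) * (n + 1)) ≤ T := le_trans (by
    rw [mul_assoc 4, mul_assoc 4]
    exact Nat.mul_le_mul_left _ (Nat.mul_le_mul_left _ (by omega))) hT
  -- the products
  refine Tri.seq (P := fun s' => ∀ i < n, ∀ j < n, s'.real 52 i j =
    ∑ k ∈ Finset.range l, s.real 41 i k * s.real 43 j k) ?_ ?_
  · refine Tri.sumTab n n l (fun i j k => s.real 41 i k * s.real 43 j k) (by norm_num) hTl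
      ?_ ?_ ?_ ?_ ?_
    · intro s' hf; simp [hf.nat 0 rfl, hn]
    · intro s' hf; simp [hf.nat 0 rfl, hn]
    · intro s' hf; simp [hf.nat 5 rfl, hl]
    · intro i hi j hj k hk s' hf _ hi' hj' hk'
      simp [hi', hj', hk', hf.real 41 rfl, hf.real 43 rfl]
    · intro s' _ h1 _; exact h1
  intro s₁ f₁ h52
  -- the weights outside the seeds
  set a : ℕ → ℕ → ℝ := fun i j => (1 - s.real 50 i 0) * (1 - s.real 51 j 0) *
    ∑ k ∈ Finset.range l, s.real 41 i k * s.real 43 j k with ha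
  refine Tri.seq (P := fun s' => ∀ i < n, ∀ j < n, s'.real 52 i j = a i j) ?_ ?_
  · refine Tri.tabR n n a (by linarith) ?_ ?_ ?_ ?_
    · intro s' hf; simp [hf.nat 0 rfl, f₁.nat 0 rfl, hn]
    · intro s' hf; simp [hf.nat 0 rfl, f₁.nat 0 rfl, hn]
    · intro i hi j hj s' hf h1 hi' hj'
      simp [btrue, hi', hj', h1, h52 i hi j hj, ha, hf.real 50 rfl, hf.real 51 rfl, f₁.real 50 rfl,
        f₁.real 51 rfl]
    · intro s' _ h1 _; exact h1
  intro s₂ f₂ ha₂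
  have hn₂ : s₂.nat 0 0 0 = n := by rw [f₂.nat 0 rfl, f₁.nat 0 rfl, hn]
  refine Tri.seq (P := fun s' => ∀ i < n, s'.real 53 i 0 = ∑ j ∈ Finset.range n, |a i j|) ?_ ?_
  · refine Tri.sumTab n 1 n (fun i _ j => |a i j|) (by norm_num) (by nlinarith) ?_ ?_ ?_ ?_ ?_
    · intro s' hf; simp [hf.nat 0 rfl, hn₂]
    · intro s' hf; simp
    · intro s' hf; simp [hf.nat 0 rfl, hn₂]
    · intro i hi j hj k hk s' hf _ hi' hj' hk'
      simp [hi', hk', hf.real 52 rfl, ha₂ i hi k hk, Real.sqrt_mul_self_eq_abs]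
    · intro s' _ h1 _ i hi; exact h1 i hi 0 one_pos
  intro s₃ f₃ h53
  have hn₃ : s₃.nat 0 0 0 = n := by rw [f₃.nat 0 rfl, hn₂]
  refine Tri.seq (P := fun s' => s'.real 54 0 0 =
    ∑ i ∈ Finset.range n, ∑ j ∈ Finset.range n, |a i j|) ?_ ?_
  · refine Tri.sumTab 1 1 n (fun _ _ i => ∑ j ∈ Finset.range n, |a i j|) (by norm_num)
      (by nlinarith) ?_ ?_ ?_ ?_ ?_
    · intro s' hf; simp
    · intro s' hf; simp
    · intro s' hf; simp [hf.nat 0 rfl, hn₃]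
    · intro i hi j hj k hk s' hf _ hi' hj' hk'
      simp [hk', hf.real 53 rfl, h53 k hk]
    · intro s' _ h1 _; exact h1 0 one_pos 0 one_pos
  intro s₄ f₄ h54
  have hn₄ : s₄.nat 0 0 0 = n := by rw [f₄.nat 0 rfl, hn₃]
  have hU₄ : s₄.HoldsSeeds 1 U :=
    hU.congr (by rw [f₄.nat 1 rfl, f₃.nat 1 rfl, f₂.nat 1 rfl, f₁.nat 1 rfl])
  have hV₄ : s₄.HoldsSeeds 2 V :=
    hV.congr (by rw [f₄.nat 2 rfl, f₃.nat 2 rfl, f₂.nat 2 rfl, f₁.nat 2 rfl])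
  set sd : Fin n → Fin n → ℝ := fun x y => ∑ k : Fin K0, if U k = x ∧ V k = y then 1 else 0 with hsd
  refine Tri.seq (P := fun s' => ∀ x y : Fin n, s'.real 55 x y = sd x y) ?_ ?_
  · refine Tri.sumTab n n K0 (fun i j k => ((if s₄.nat 1 k 0 = i then 1 else 0 : ℕ) : ℝ) *
      ((if s₄.nat 2 k 0 = j then 1 else 0 : ℕ) : ℝ)) (by norm_num) hTK ?_ ?_ ?_ ?_ ?_
    · intro s' hf; simp [hf.nat 0 rfl, hn₄]
    · intro s' hf; simp [hf.nat 0 rfl, hn₄]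
    · intro s' hf; simp
    · intro i hi j hj k hk s' hf _ hi' hj' hk'
      simp only [RExp.val, NExp.val, neq_val, nv_val, hi', hj', hk', hf.nat 1 rfl, hf.nat 2 rfl]
    · intro s' _ h1 _ x y
      rw [h1 x x.2 y y.2, Finset.sum_range]
      refine Finset.sum_congr rfl fun k _ => ?_
      rw [hU₄ k, hV₄ k]
      by_cases e1 : U k = x <;> by_cases e2 : V k = y <;> simp [e1, e2, Fin.val_inj]
  intro s₅ f₅ h55
  set B : ℝ := 1 + 2 * ∑ i ∈ Finset.range n, ∑ j ∈ Finset.range n, |a i j| with hB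
  refine Tri.seq (P := fun s' => ∀ x y : Fin n, s'.real 30 x y = -a x y - B * sd x y) ?_ ?_
  · refine Tri.tabR n n (fun i j => -a i j - B * s₅.real 55 i j) (by linarith) ?_ ?_ ?_ ?_
    · intro s' hf; simp [hf.nat 0 rfl, f₅.nat 0 rfl, hn₄]
    · intro s' hf; simp [hf.nat 0 rfl, f₅.nat 0 rfl, hn₄]
    · intro i hi j hj s' hf _ hi' hj'
      refine ⟨fun _ => ?_, fun h => absurd (by simp [btrue]) h⟩
      have e52 : s'.real 52 i j = a i j := by
        rw [hf.real 52 rfl, f₅.real 52 rfl, f₄.real 52 rfl, f₃.real 52 rfl, ha₂ i hi j hj]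
      have e54 : s'.real 54 0 0 = ∑ i ∈ Finset.range n, ∑ j ∈ Finset.range n, |a i j| := by
        rw [hf.real 54 rfl, f₅.real 54 rfl, h54]
      simp only [RExp.val, nv_val, rv_val, hi', hj', e52, e54, hf.real 55 rfl, hB]
      ring
    · intro s' _ h1 _ x y
      rw [h1 x x.2 y y.2, h55]
  intro s₆ f₆ h30
  have hn₆ : s₆.nat 0 0 0 = n := by rw [f₆.nat 0 rfl, f₅.nat 0 rfl, hn₄]
  refine Tri.seq (assignCmd_spec hn₆ (by nlinarith)) ?_
  rintro s₇ f₇ ⟨π, hπ, hopt⟩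
  refine Tri.tabN n 1 (fun i _ => s₇.nat 30 i 0) (by norm_num) (by nlinarith) ?_ ?_ ?_ ?_
  · intro s' hf; simp [hf.nat 0 rfl, f₇.nat 0 rfl, hn₆]
  · intro s' hf; simp
  · intro i hi j hj s' hf _ hi' hj'
    simp [btrue, hi', hf.nat 30 rfl]
  · intro s' _ h1 _
    refine ⟨π, ?_, fun i => by rw [h1 i i.2 0 one_pos, hπ]⟩
    refine solvesAssignment_of_forced U V h ℓ (a := fun x y => a x y) (sd := sd) (B := B)
      ?_ ?_ (fun x y => rfl) ?_ ?_
    · intro i j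
      simp only [ha, hmU.rest i, hmV.rest j, Finset.sum_range, hh, hℓ]
      ring
    · intro k y
      simp only [ha, hmU.seed k]
      ring
    · simp only [hB, Finset.sum_range]
      linarith
    · intro τ
      have := hopt τ
      simpa only [h30] using this

end

section

/-! ### Refinement -/

variable {n : ℕ}

/-- The rows whose present score is not small. Their number grows with every modification. -/
noncomputable def settled (N : Fin n → Fin n → ℝ) (Δ : ℝ) (σ : Equiv.Perm (Fin n)) : Finset
    (Fin n) :=
  Finset.univ.filter fun u => Δ / 10 ≤ N u (σ u)

theorem mem_settled {N : Fin n → Fin n → ℝ} {Δ : ℝ} {σ : Equiv.Perm (Fin n)} {u : Fin n} :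
    u ∈ settled N Δ σ ↔ Δ / 10 ≤ N u (σ u) := by
  simp [settled]

/-- A modification gives the row `u` the score `Δ`. It changes one other row, the former preimage of
`v`, which was not settled. So refinement ends after at most `n` modifications. -/
theorem settled_step {N : Fin n → Fin n → ℝ} {Δ : ℝ} (hΔ : 0 ≤ Δ) {σ : Equiv.Perm (Fin n)}
    {u v : Fin n} (h1 : Δ ≤ N u v) (h2 : N u (σ u) < Δ / 10) (h3 : N (σ⁻¹ v) v < Δ / 10) :
    (settled N Δ σ).card + 1 ≤ (settled N Δ (Equiv.swap (σ u) v * σ)).card := by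
  refine Finset.card_lt_card (Finset.ssubset_iff_of_subset ?_ |>.2 ⟨u, ?_, ?_⟩)
  · intro x hx
    rw [mem_settled] at hx ⊢
    have hxu : σ x ≠ σ u := fun e => by
      rw [σ.injective e] at hx; linarith
    have hxv : σ x ≠ v := fun e => by
      have : σ⁻¹ v = x := by rw [← e]; simp
      rw [this, ← e] at h3; linarith
    simpa [Equiv.swap_apply_of_ne_of_ne hxu hxv] using hx
  · rw [mem_settled]
    simp only [Equiv.Perm.coe_mul, Function.comp_apply, Equiv.swap_apply_left]
    linarith
  · rw [mem_settled]
    linarith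

/-- A pair `u, v < n` for which the test `b` holds, with `u` and `v` in the variables `43` and `44`,
is written to the variables `45` and `46`, and the flag `47` is raised. -/
def searchCmd (b : BExp) : Cmd :=
  .seq (.setNat 47 (.const 0) (.const 0) (.const 0))
    (forN 43 (nv 0) (forN 44 (nv 0) (.ite b
      (.seq (.setNat 45 (.const 0) (.const 0) (nv 43))
        (.seq (.setNat 46 (.const 0) (.const 0) (nv 44))
          (.setNat 47 (.const 0) (.const 0) (.const 1)))) .skip)))

theorem searchCmd_spec {E : Env} {s : Mem} {T : ℕ} {b : BExp} (p : ℕ → ℕ → Prop)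
    (hT : (n + 1) * (n + 1) ≤ T) (hn : s.nat 0 0 0 = n)
    (hp : ∀ i < n, ∀ j < n, ∀ s', Frame (searchCmd b) s s' → s'.nat 43 0 0 = i →
      s'.nat 44 0 0 = j → (b.Holds E.ω s' ↔ p i j)) :
    Tri E (searchCmd b) s T (fun s' => (s'.nat 47 0 0 = 0 ∧ ∀ i < n, ∀ j < n, ¬ p i j) ∨
      (s'.nat 47 0 0 = 1 ∧ s'.nat 45 0 0 < n ∧ s'.nat 46 0 0 < n ∧
        p (s'.nat 45 0 0) (s'.nat 46 0 0))) := by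
  have hT1 : n + 1 ≤ T := by nlinarith
  refine Tri.seq (P := fun s' => s' = s.setNat 47 0 0 0) (Tri.setNat (by omega) (by simp)) ?_
  rintro s₁ f₁ rfl
  have f₁' : Frame (searchCmd b) s (s.setNat 47 0 0 0) := f₁.mono
    (fun x hx => by simp only [searchCmd, Cmd.setsNat, Bool.or_eq_false_iff] at hx ⊢; exact hx.1)
    (fun x hx => rfl)
  refine Tri.forN n (fun i s' => (s'.nat 47 0 0 = 0 ∧ ∀ i' < i, ∀ j < n, ¬ p i' j) ∨
      (s'.nat 47 0 0 = 1 ∧ s'.nat 45 0 0 < n ∧ s'.nat 46 0 0 < n ∧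
        p (s'.nat 45 0 0) (s'.nat 46 0 0))) hT (by omega) rfl ?_ ?_ ?_ ?_ ?_
  · intro s' hf; simp [hf.nat 0 rfl, Mem.setNat_nat, hn]
  · intro i s' x h
    rwa [Mem.setNat_nat_ne _ _ _ _ (by norm_num), Mem.setNat_nat_ne _ _ _ _ (by norm_num),
      Mem.setNat_nat_ne _ _ _ _ (by norm_num)]
  · exact Or.inl ⟨Mem.setNat_nat_self _ _ _ _ _, by simp⟩
  · intro i hi s₂ f₂ hi' hinv
    refine Tri.forN n (fun j s' => (s'.nat 47 0 0 = 0 ∧ (∀ i' < i, ∀ j < n, ¬ p i' j) ∧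
        ∀ j' < j, ¬ p i j') ∨
      (s'.nat 47 0 0 = 1 ∧ s'.nat 45 0 0 < n ∧ s'.nat 46 0 0 < n ∧
        p (s'.nat 45 0 0) (s'.nat 46 0 0))) (by simp) le_rfl rfl ?_ ?_ ?_ ?_ ?_
    · intro s' hf; simp [hf.nat 0 rfl, f₂.nat 0 rfl, Mem.setNat_nat, hn]
    · intro i s' x h
      rwa [Mem.setNat_nat_ne _ _ _ _ (by norm_num), Mem.setNat_nat_ne _ _ _ _ (by norm_num),
        Mem.setNat_nat_ne _ _ _ _ (by norm_num)]
    · rcases hinv with h | h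
      · exact Or.inl ⟨h.1, h.2, by simp⟩
      · exact Or.inr h
    · intro j hj s₃ f₃ hj' hinv'
      have h43 : s₃.nat 43 0 0 = i := by rw [f₃.nat 43 rfl, hi']
      have hb := hp i hi j hj s₃ (f₁'.trans ((f₂.mono ?_ ?_).trans (f₃.mono ?_ ?_))) h43 hj'
      · refine Tri.ite le_rfl (fun hB => ?_) (fun hB => Tri.skip le_rfl ?_)
        · refine Tri.seq (P := fun s' => s' = s₃.setNat 45 0 0 i)
            (Tri.setNat le_rfl (by simp [h43])) ?_
          rintro s₄ - rfl
          refine Tri.seq (P := fun s' => s' = (s₃.setNat 45 0 0 i).setNat 46 0 0 j)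
            (Tri.setNat le_rfl (by simp [Mem.setNat_nat, hj'])) ?_
          rintro s₅ - rfl
          refine Tri.setNat le_rfl (Or.inr ?_)
          simp only [NExp.val, Mem.setNat_nat]
          simpa using ⟨hi, hj, hb.1 hB⟩
        · rcases hinv' with ⟨h1, h2, h3⟩ | h
          · refine Or.inl ⟨h1, h2, fun j' hj'' => ?_⟩
            rcases Nat.lt_succ_iff_lt_or_eq.1 hj'' with h | rfl
            · exact h3 j' h
            · exact fun h => hB (hb.2 h)
          · exact Or.inr h
      all_goals
        intro x hx
        simp only [searchCmd, forN_setsNat, forN_setsReal, Cmd.setsNat, Cmd.setsReal,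
          Bool.or_eq_false_iff] at hx ⊢
        tauto
    · intro s' _ _ hinv'
      rcases hinv' with ⟨h1, h2, h3⟩ | h
      · refine Or.inl ⟨h1, fun i' hi'' j hj => ?_⟩
        rcases Nat.lt_succ_iff_lt_or_eq.1 hi'' with h | rfl
        · exact h2 i' h j hj
        · exact h3 j hj
      · exact Or.inr h
  · intro s' _ _ h; exact h

/-- The search for the next modification. -/
def scanCmd : Cmd :=
  .seq (sumTab 63 (nv 0) (.const 1) (nv 0)
      (.mul (.ofNat (neq (.get 4 (nv 22) (.const 0)) (nv 20))) (.get 60 (nv 22) (nv 20))))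
    (searchCmd (.and (.realLe (rv 64) (.get 60 (nv 43) (nv 44)))
      (.and (realLt (.get 60 (nv 43) (.get 4 (nv 43) (.const 0))) (.div (rv 64) (.const 10)))
        (realLt (.get 63 (nv 44) (.const 0)) (.div (rv 64) (.const 10))))))

theorem scanCmd_spec {E : Env} {s : Mem} {T : ℕ} {N : Fin n → Fin n → ℝ} {Δ : ℝ}
    {σ : Equiv.Perm (Fin n)} (hT : 2 * (n + 1) * (n + 1) ≤ T) (hn : s.nat 0 0 0 = n)
    (hN : ∀ u v : Fin n, s.real 60 u v = N u v) (hΔ : s.real 64 0 0 = Δ) (hσ : s.Stores 4 σ) :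
    Tri E scanCmd s T (fun s' =>
      (s'.nat 47 0 0 = 0 ∧ ∀ u v, ¬ (Δ ≤ N u v ∧ N u (σ u) < Δ / 10 ∧ N (σ⁻¹ v) v < Δ / 10)) ∨
      (s'.nat 47 0 0 = 1 ∧ ∃ u v : Fin n, s'.nat 45 0 0 = u ∧ s'.nat 46 0 0 = v ∧
        Δ ≤ N u v ∧ N u (σ u) < Δ / 10 ∧ N (σ⁻¹ v) v < Δ / 10)) := by
  refine Tri.seq (P := fun s' => ∀ v : Fin n, s'.real 63 v 0 = N (σ⁻¹ v) v) ?_ ?_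
  · refine Tri.sumTab n 1 n (fun i _ x => ((if s.nat 4 x 0 = i then 1 else 0 : ℕ) : ℝ) *
      s.real 60 x i) (by norm_num) (by nlinarith) ?_ ?_ ?_ ?_ ?_
    · intro s' hf; simp [hf.nat 0 rfl, hn]
    · intro s' hf; simp
    · intro s' hf; simp [hf.nat 0 rfl, hn]
    · intro i hi j hj k hk s' hf _ hi' hj' hk'
      simp only [RExp.val, NExp.val, neq_val, nv_val, hi', hk', hf.nat 4 rfl, hf.real 60 rfl]
    · intro s' _ h1 _ v
      rw [h1 v v.2 0 one_pos, Finset.sum_range, Finset.sum_eq_single (σ⁻¹ v)]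
      · rw [hσ, hN]; simp
      · intro x _ hx
        rw [hσ, if_neg]
        · simp
        · intro e
          exact hx (by rw [← Fin.ext e]; simp)
      · simp
  intro s₁ f₁ h63
  refine (searchCmd_spec (n := n) (fun i j => ∃ (hi : i < n) (hj : j < n), Δ ≤ N ⟨i, hi⟩ ⟨j, hj⟩ ∧
    N ⟨i, hi⟩ (σ ⟨i, hi⟩) < Δ / 10 ∧ N (σ⁻¹ ⟨j, hj⟩) ⟨j, hj⟩ < Δ / 10) (by nlinarith)
    (by rw [f₁.nat 0 rfl, hn]) ?_).imp ?_
  · intro i hi j hj s' hf h43 h44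
    have e1 := hN ⟨i, hi⟩ ⟨j, hj⟩
    have e2 := hN ⟨i, hi⟩ (σ ⟨i, hi⟩)
    have e3 := h63 ⟨j, hj⟩
    have e4 := hσ ⟨i, hi⟩
    simp only at e1 e2 e3 e4
    simp only [BExp.Holds, realLt_holds, RExp.val, NExp.val, nv_val, rv_val, h43, h44,
      hf.real 60 rfl, hf.real 63 rfl, hf.real 64 rfl, hf.nat 4 rfl, f₁.real 60 rfl, f₁.real 64 rfl,
      f₁.nat 4 rfl, e1, e2, e3, e4, hΔ, hi, hj, exists_true_left]
  · rintro s' - (⟨h1, h2⟩ | ⟨h1, h2, h3, h4, h5, h6⟩)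
    · exact Or.inl ⟨h1, fun u v h => h2 u u.2 v v.2 ⟨u.2, v.2, h⟩⟩
    · exact Or.inr ⟨h1, ⟨_, h2⟩, ⟨_, h3⟩, rfl, rfl, h6⟩

/-- The refinement of the permutation in the array `3` is written to the array `4`. -/
noncomputable def refineCmd (ρ : ℝ) : Cmd :=
  .seq (tabR 61 (nv 0) (nv 0) (.realLe (.const 1) (.get 0 (nv 20) (nv 21)))
      (.const (1 - tailProb)) (.const (0 - tailProb)))
    (.seq (tabR 62 (nv 0) (nv 0) (.realLe (.const 1) (.get 1 (nv 20) (.get 3 (nv 21) (.const 0))))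
      (.const (1 - tailProb)) (.const (0 - tailProb)))
    (.seq (sumTab 60 (nv 0) (nv 0) (nv 0)
      (.mul (.get 61 (nv 20) (nv 22)) (.get 62 (nv 21) (nv 22))))
    (.seq (.setReal 64 (.const 0) (.const 0)
      (.div (.mul (.const (jointTailProb ρ)) (.ofNat (nv 0))) (.const 10)))
    (.seq (tabN 4 (nv 0) (.const 1) btrue (.get 3 (nv 20) (.const 0)) (.const 0))
    (.seq scanCmd
      (.while (natEq (nv 47) (.const 1))
        (.seq (tabN 61 (nv 0) (.const 1) (natEq (.get 4 (nv 20) (.const 0)) (nv 46))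
            (.get 4 (nv 45) (.const 0)) (.get 4 (nv 20) (.const 0)))
          (.seq (tabN 4 (nv 0) (.const 1) (natEq (nv 20) (nv 45)) (nv 46)
            (.get 61 (nv 20) (.const 0)))
          scanCmd))))))))

theorem indicator_Ici_one (x : ℝ) :
    Set.indicator (Set.Ici (1 : ℝ)) (1 : ℝ → ℝ) x = if 1 ≤ x then 1 else 0 := by
  simp [Set.indicator_apply]

theorem jointTailProb_nonneg (ρ : ℝ) : 0 ≤ jointTailProb ρ := ENNReal.toReal_nonneg

theorem refineCmd_spec {E : Env} {s : Mem} {T : ℕ} {ρ : ℝ} {A B : Matrix (Fin n) (Fin n) ℝ}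
    {π : Equiv.Perm (Fin n)} (hT : 4 * (n + 1) * (n + 1) * (n + 1) ≤ T) (hn : s.nat 0 0 0 = n)
    (hA : s.Holds 0 A) (hB : s.Holds 1 B) (hπ : s.Stores 3 π) :
    Tri E (refineCmd ρ) s T (fun s' => ∃ σ : Equiv.Perm (Fin n), IsRefinement ρ A B π σ ∧
      s'.Stores 4 σ) := by
  have hT2 : 4 * ((n + 1) * (n + 1)) ≤ T := le_trans (by nlinarith) hT
  refine Tri.seq (P := fun s' => ∀ i j : Fin n, s'.real 61 i j =
    Set.indicator (Set.Ici 1) 1 (A i j) - tailProb) ?_ ?_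
  · refine Tri.tabR n n (fun i j => (if 1 ≤ s.real 0 i j then 1 else 0) - tailProb) (by linarith)
      ?_ ?_ ?_ ?_
    · intro s' hf; simp [hf.nat 0 rfl, hn]
    · intro s' hf; simp [hf.nat 0 rfl, hn]
    · intro i hi j hj s' hf _ hi' hj'
      simp only [BExp.Holds, RExp.val, nv_val, hi', hj', hf.real 0 rfl]
      exact ⟨fun h => by rw [if_pos h], fun h => by rw [if_neg h]⟩
    · intro s' _ h1 _ i j
      rw [h1 i i.2 j j.2, hA, indicator_Ici_one]
  intro s₁ f₁ h61
  refine Tri.seq (P := fun s' => ∀ i j : Fin n, s'.real 62 i j =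
    Set.indicator (Set.Ici 1) 1 (B i (π j)) - tailProb) ?_ ?_
  · refine Tri.tabR n n (fun i j => (if 1 ≤ s.real 1 i (s.nat 3 j 0) then 1 else 0) - tailProb)
      (by linarith) ?_ ?_ ?_ ?_
    · intro s' hf; simp [hf.nat 0 rfl, f₁.nat 0 rfl, hn]
    · intro s' hf; simp [hf.nat 0 rfl, f₁.nat 0 rfl, hn]
    · intro i hi j hj s' hf _ hi' hj'
      simp only [BExp.Holds, RExp.val, NExp.val, nv_val, hi', hj', hf.real 1 rfl, hf.nat 3 rfl,
        f₁.real 1 rfl, f₁.nat 3 rfl]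
      exact ⟨fun h => by rw [if_pos h], fun h => by rw [if_neg h]⟩
    · intro s' _ h1 _ i j
      rw [h1 i i.2 j j.2, hπ, hB, indicator_Ici_one]
  intro s₂ f₂ h62
  have hn₂ : s₂.nat 0 0 0 = n := by rw [f₂.nat 0 rfl, f₁.nat 0 rfl, hn]
  refine Tri.seq (P := fun s' => ∀ u v : Fin n, s'.real 60 u v = neighborhood A B π u v) ?_ ?_
  · refine Tri.sumTab n n n (fun i j k => s₂.real 61 i k * s₂.real 62 j k) (by norm_num)
      (by nlinarith) ?_ ?_ ?_ ?_ ?_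
    · intro s' hf; simp [hf.nat 0 rfl, hn₂]
    · intro s' hf; simp [hf.nat 0 rfl, hn₂]
    · intro s' hf; simp [hf.nat 0 rfl, hn₂]
    · intro i hi j hj k hk s' hf _ hi' hj' hk'
      simp [hi', hj', hk', hf.real 61 rfl, hf.real 62 rfl]
    · intro s' _ h1 _ u v
      rw [h1 u u.2 v v.2, Finset.sum_range, neighborhood]
      refine Finset.sum_congr rfl fun k _ => ?_
      rw [f₂.real 61 rfl, h61, h62]
  intro s₃ f₃ h60
  set Δ := jointTailProb ρ * n / 10 with hΔ
  have hΔ0 : 0 ≤ Δ := by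
    have := jointTailProb_nonneg ρ
    positivity
  refine Tri.seq (P := fun s' => s' = s₃.setReal 64 0 0 Δ) (Tri.setReal (by nlinarith) ?_) ?_
  · simp [f₃.nat 0 rfl, hn₂, hΔ]
  rintro s₄ f₄ rfl
  refine Tri.seq (P := fun s' => s'.Stores 4 π) ?_ ?_
  · refine Tri.tabN n 1 (fun i _ => s.nat 3 i 0) (by norm_num) (by nlinarith) ?_ ?_ ?_ ?_
    · intro s' hf; simp [hf.nat 0 rfl, Mem.setReal_nat, f₃.nat 0 rfl, hn₂]
    · intro s' hf; simp
    · intro i hi j hj s' hf _ hi' hj'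
      simp [btrue, hi', hf.nat 3 rfl, Mem.setReal_nat, f₃.nat 3 rfl, f₂.nat 3 rfl, f₁.nat 3 rfl]
    · intro s' _ h1 _ i
      rw [h1 i i.2 0 one_pos, hπ]
  intro s₅ f₅ hσ₅
  have hn₅ : s₅.nat 0 0 0 = n := by rw [f₅.nat 0 rfl, f₄.nat 0 rfl, f₃.nat 0 rfl, hn₂]
  have h60₅ : ∀ u v : Fin n, s₅.real 60 u v = neighborhood A B π u v := fun u v => by
    rw [f₅.real 60 rfl, f₄.real 60 rfl, h60]
  have h64₅ : s₅.real 64 0 0 = Δ := by rw [f₅.real 64 rfl, Mem.setReal_real_self]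
  refine Tri.seq (scanCmd_spec (by linarith) hn₅ h60₅ h64₅ hσ₅) ?_
  intro s₆ f₆ hscan
  have hn₆ : s₆.nat 0 0 0 = n := by rw [f₆.nat 0 rfl, hn₅]
  refine Tri.whileLoop (T₀ := 4 * (n + 1) * (n + 1)) (fun i s' => ∃ σ : Equiv.Perm (Fin n),
    i ≤ (settled (neighborhood A B π) Δ σ).card ∧ s'.Stores 4 σ ∧
    Relation.ReflTransGen (SeededStep (neighborhood A B π) Δ) π σ ∧
    ((s'.nat 47 0 0 = 0 ∧ ∀ u v, ¬ (Δ ≤ neighborhood A B π u v ∧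
        neighborhood A B π u (σ u) < Δ / 10 ∧ neighborhood A B π (σ⁻¹ v) v < Δ / 10)) ∨
      (s'.nat 47 0 0 = 1 ∧ ∃ u v : Fin n, s'.nat 45 0 0 = u ∧ s'.nat 46 0 0 = v ∧
        Δ ≤ neighborhood A B π u v ∧ neighborhood A B π u (σ u) < Δ / 10 ∧
        neighborhood A B π (σ⁻¹ v) v < Δ / 10))) n (by linarith) (by nlinarith) ?_ ?_ ?_
  · refine ⟨π, Nat.zero_le _, fun i => ?_, Relation.ReflTransGen.refl, hscan⟩
    rw [f₆.nat 4 rfl, hσ₅]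
  · rintro i s' hf ⟨σ, hi, hσ, hreach, hsc⟩ hb
    simp only [natEq_holds, NExp.val, nv_val] at hb
    obtain ⟨-, u, v, hu, hv, h1, h2, h3⟩ := hsc.resolve_left fun h => by omega
    have hstep := settled_step hΔ0 h1 h2 h3
    have hn' : s'.nat 0 0 0 = n := by rw [hf.nat 0 rfl, hn₆]
    refine ⟨?_, ?_⟩
    · have := Finset.card_le_univ (settled (neighborhood A B π) Δ (Equiv.swap (σ u) v * σ))
      rw [Fintype.card_fin] at this
      omega
    refine Tri.seq (P := fun s'' => ∀ x : Fin n, s''.nat 61 x 0 =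
      if σ x = v then (σ u : ℕ) else (σ x : ℕ)) ?_ ?_
    · refine Tri.tabN n 1 (fun x _ => if s'.nat 4 x 0 = v then (σ u : ℕ) else s'.nat 4 x 0)
        (by norm_num) (by nlinarith) ?_ ?_ ?_ ?_
      · intro s'' hf'; simp [hf'.nat 0 rfl, hn']
      · intro s'' hf'; simp
      · intro x hx j hj s'' hf' _ hi' hj'
        simp only [natEq_holds, NExp.val, nv_val, hi', hf'.nat 4 rfl, hf'.nat 45 rfl,
          hf'.nat 46 rfl, hu, hv, hσ u]
        exact ⟨fun h => (if_pos h).symm, fun h => (if_neg h).symm⟩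
      · intro s'' _ h1 _ x
        rw [h1 x x.2 0 one_pos, hσ]
        simp only [Fin.val_inj]
    intro s₇ f₇ h61'
    refine Tri.seq (P := fun s'' => s''.Stores 4 (Equiv.swap (σ u) v * σ)) ?_ ?_
    · refine Tri.tabN n 1 (fun x _ => if x = u then (v : ℕ) else s₇.nat 61 x 0)
        (by norm_num) (by nlinarith) ?_ ?_ ?_ ?_
      · intro s'' hf'; simp [hf'.nat 0 rfl, f₇.nat 0 rfl, hn']
      · intro s'' hf'; simp
      · intro x hx j hj s'' hf' _ hi' hj'
        simp only [natEq_holds, NExp.val, nv_val, hi', hf'.nat 61 rfl, hf'.nat 45 rfl,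
          hf'.nat 46 rfl, f₇.nat 45 rfl, f₇.nat 46 rfl, hu, hv]
        exact ⟨fun h => (if_pos h).symm, fun h => (if_neg h).symm⟩
      · intro s'' _ h1 _ x
        rw [h1 x x.2 0 one_pos, h61']
        simp only [Equiv.Perm.coe_mul, Function.comp_apply, Fin.val_inj]
        by_cases hxu : x = u
        · rw [if_pos hxu, hxu, Equiv.swap_apply_left]
        · rw [if_neg hxu]
          have : σ x ≠ σ u := fun e => hxu (σ.injective e)
          by_cases hxv : σ x = v
          · rw [if_pos hxv, hxv, Equiv.swap_apply_right]
          · rw [if_neg hxv, Equiv.swap_apply_of_ne_of_ne this hxv]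
    intro s₈ f₈ hσ₈
    refine (scanCmd_spec (N := neighborhood A B π) (Δ := Δ) (by nlinarith) ?_ ?_ ?_ hσ₈).imp ?_
    · rw [f₈.nat 0 rfl, f₇.nat 0 rfl, hn']
    · intro x y
      rw [f₈.real 60 rfl, f₇.real 60 rfl, hf.real 60 rfl, f₆.real 60 rfl, h60₅]
    · rw [f₈.real 64 rfl, f₇.real 64 rfl, hf.real 64 rfl, f₆.real 64 rfl, h64₅]
    · intro s₉ f₉ hsc'
      exact ⟨_, le_trans (by omega) hstep, fun x => by rw [f₉.nat 4 rfl, hσ₈],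
        hreach.tail ⟨u, v, h1, h2, h3, rfl⟩, hsc'⟩
  · rintro i s' hf ⟨σ, hi, hσ, hreach, hsc⟩ hb
    simp only [natEq_holds, NExp.val, nv_val] at hb
    obtain ⟨-, h0⟩ := hsc.resolve_right fun h => hb h.1
    exact ⟨σ, ⟨hreach, fun σ' ⟨u, v, h1, h2, h3, _⟩ => h0 u v ⟨h1, h2, h3⟩⟩, hσ⟩

/-! ### The overlap -/

/-- The overlap of the permutation in the array `4` is written to the real variable `67`. -/
def overlapCmd : Cmd :=
  .seq (tabR 65 (nv 0) (nv 0) (.and (natLt (nv 20) (nv 21))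
      (.and (.realLe (.const 1) (.get 0 (nv 20) (nv 21)))
        (.realLe (.const 1) (.get 1 (.get 4 (nv 20) (.const 0)) (.get 4 (nv 21) (.const 0))))))
      (.const 1) (.const 0))
    (.seq (sumTab 66 (nv 0) (.const 1) (nv 0) (.get 65 (nv 20) (nv 22)))
      (sumTab 67 (.const 1) (.const 1) (nv 0) (.get 66 (nv 22) (.const 0))))

theorem overlapCmd_spec {E : Env} {s : Mem} {T : ℕ} {A B : Matrix (Fin n) (Fin n) ℝ}
    {σ : Equiv.Perm (Fin n)} (hT : 4 * (n + 1) * (n + 1) ≤ T) (hn : s.nat 0 0 0 = n)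
    (hA : s.Holds 0 A) (hB : s.Holds 1 B) (hσ : s.Stores 4 σ) :
    Tri E overlapCmd s T (fun s' => s'.real 67 0 0 = overlap A B σ) := by
  classical
  refine Tri.seq (P := fun s' => ∀ i j : Fin n, s'.real 65 i j =
    if i < j ∧ 1 ≤ A i j ∧ 1 ≤ B (σ i) (σ j) then 1 else 0) ?_ ?_
  · refine Tri.tabR n n (fun i j => if i < j ∧ 1 ≤ s.real 0 i j ∧
      1 ≤ s.real 1 (s.nat 4 i 0) (s.nat 4 j 0) then 1 else 0) (by nlinarith) ?_ ?_ ?_ ?_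
    · intro s' hf; simp [hf.nat 0 rfl, hn]
    · intro s' hf; simp [hf.nat 0 rfl, hn]
    · intro i hi j hj s' hf _ hi' hj'
      simp only [BExp.Holds, natLt_holds, RExp.val, NExp.val, nv_val, hi', hj', hf.real 0 rfl,
        hf.real 1 rfl, hf.nat 4 rfl]
      exact ⟨fun h => (if_pos h).symm, fun h => (if_neg h).symm⟩
    · intro s' _ h1 _ i j
      rw [h1 i i.2 j j.2, hσ, hσ, hA, hB]
      rfl
  intro s₁ f₁ h65
  have hn₁ : s₁.nat 0 0 0 = n := by rw [f₁.nat 0 rfl, hn]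
  refine Tri.seq (P := fun s' => ∀ i : Fin n, s'.real 66 i 0 = ∑ j : Fin n, s₁.real 65 i j) ?_ ?_
  · refine Tri.sumTab n 1 n (fun i _ j => s₁.real 65 i j) (by norm_num) (by nlinarith)
      ?_ ?_ ?_ ?_ ?_
    · intro s' hf; simp [hf.nat 0 rfl, hn₁]
    · intro s' hf; simp
    · intro s' hf; simp [hf.nat 0 rfl, hn₁]
    · intro i hi j hj k hk s' hf _ hi' hj' hk'
      simp [hi', hk', hf.real 65 rfl]
    · intro s' _ h1 _ i
      rw [h1 i i.2 0 one_pos, Finset.sum_range]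
  intro s₂ f₂ h66
  refine Tri.sumTab 1 1 n (fun _ _ i => s₂.real 66 i 0) (by norm_num) (by nlinarith)
    ?_ ?_ ?_ ?_ ?_
  · intro s' hf; simp
  · intro s' hf; simp
  · intro s' hf; simp [hf.nat 0 rfl, f₂.nat 0 rfl, hn₁]
  · intro i hi j hj k hk s' hf _ hi' hj' hk'
    simp [hk', hf.real 66 rfl]
  · intro s' _ h1 _
    rw [h1 0 one_pos 0 one_pos, Finset.sum_range, overlap, ← Finset.sum_boole,
      Fintype.sum_prod_type]
    refine Finset.sum_congr rfl fun i _ => ?_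
    rw [h66]
    exact Finset.sum_congr rfl fun j _ => h65 i j

end

section

/-! ### Spectral decompositions and selection of eigenvectors -/

variable {k l : ℕ}

theorem isSpectralDecomposition_spectralDecomposition {M : Matrix (Fin k) (Fin k) ℝ}
    (hM : M.IsSymm) :
    IsSpectralDecomposition M (spectralDecomposition M).1 (spectralDecomposition M).2 := by
  have h : ∃ p : (Fin k → ℝ) × Matrix (Fin k) (Fin k) ℝ, IsSpectralDecomposition M p.1 p.2 := by
    have hH : M.IsHermitian := by
      rw [Matrix.IsHermitian, Matrix.conjTranspose_eq_transpose_of_trivial]; exact hM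
    have hU : (hH.eigenvectorUnitary : Matrix (Fin k) (Fin k) ℝ)ᵀ * hH.eigenvectorUnitary = 1 := by
      have := Unitary.coe_star_mul_self hH.eigenvectorUnitary
      rwa [Matrix.star_eq_conjTranspose, Matrix.conjTranspose_eq_transpose_of_trivial] at this
    refine ⟨(hH.eigenvalues, hH.eigenvectorUnitary), hU, ?_⟩
    have hs := hH.spectral_theorem
    rw [Unitary.conjStarAlgAut_apply] at hs
    have h1 := congrArg (· * (hH.eigenvectorUnitary : Matrix (Fin k) (Fin k) ℝ)) hs
    simp only [mul_assoc, Unitary.coe_star_mul_self, mul_one] at h1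
    exact h1
  rw [spectralDecomposition, dif_pos h]
  exact h.choose_spec

theorem IsSpectralDecomposition.mul_transpose {M Q : Matrix (Fin k) (Fin k) ℝ} {x : Fin k → ℝ}
    (h : IsSpectralDecomposition M x Q) : Q * Qᵀ = 1 := mul_eq_one_comm.1 h.1

theorem IsSpectralDecomposition.conj {M Q : Matrix (Fin k) (Fin k) ℝ} {x : Fin k → ℝ}
    (h : IsSpectralDecomposition M x Q) : Qᵀ * M * Q = Matrix.diagonal x := by
  rw [mul_assoc, h.2, ← mul_assoc, h.1, one_mul]

/-- The coordinates of an eigenvector in an eigenbasis vanish at all other eigenvalues. -/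
theorem IsSpectralDecomposition.coord_eq_zero {M Q : Matrix (Fin k) (Fin k) ℝ} {x : Fin k → ℝ}
    (h : IsSpectralDecomposition M x Q) {v : Fin k → ℝ} {y : ℝ} (hv : M *ᵥ v = y • v) {j : Fin k}
    (hj : x j ≠ y) : (Qᵀ *ᵥ v) j = 0 := by
  have h1 : Qᵀ * M = Matrix.diagonal x * Qᵀ := by
    rw [← h.conj, mul_assoc, h.mul_transpose, mul_one]
  have h2 : Qᵀ *ᵥ (M *ᵥ v) = Matrix.diagonal x *ᵥ (Qᵀ *ᵥ v) := by
    rw [Matrix.mulVec_mulVec, h1, ← Matrix.mulVec_mulVec]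
  rw [hv, Matrix.mulVec_smul] at h2
  have h3 := congrFun h2 j
  rw [Matrix.mulVec_diagonal, Pi.smul_apply, smul_eq_mul] at h3
  have h4 : (x j - y) * (Qᵀ *ᵥ v) j = 0 := by linarith
  exact (mul_eq_zero.1 h4).resolve_left (sub_ne_zero.2 hj)

/-- A subspace spanned by eigenvectors with eigenvalues in `p` has at most as many dimensions as
there are eigenvalues in `p`. -/
theorem IsSpectralDecomposition.finrank_le {Q : Matrix (Fin k) (Fin k) ℝ} (hQ : Qᵀ * Q = 1)
    (p : Fin k → Prop) [DecidablePred p] (W : Submodule ℝ (Fin k → ℝ))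
    (hW : ∀ v ∈ W, ∀ j, ¬ p j → (Qᵀ *ᵥ v) j = 0) :
    Module.finrank ℝ W ≤ (Finset.univ.filter p).card := by
  let f : W →ₗ[ℝ] ({j // p j} → ℝ) :=
    (LinearMap.funLeft ℝ ℝ (Subtype.val : {j // p j} → Fin k)) ∘ₗ Matrix.mulVecLin Qᵀ ∘ₗ W.subtype
  have hf : Function.Injective f := by
    rw [← LinearMap.ker_eq_bot, LinearMap.ker_eq_bot']
    intro v hv
    have h0 : Qᵀ *ᵥ (v : Fin k → ℝ) = 0 := by
      funext j
      by_cases hj : p j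
      · exact congrFun hv ⟨j, hj⟩
      · exact hW v v.2 j hj
    have h1 : Q *ᵥ (Qᵀ *ᵥ (v : Fin k → ℝ)) = v := by
      rw [Matrix.mulVec_mulVec, mul_eq_one_comm.1 hQ, Matrix.one_mulVec]
    rw [h0, Matrix.mulVec_zero] at h1
    exact Subtype.ext h1.symm
  have := LinearMap.finrank_le_finrank_of_injective hf
  rwa [Module.finrank_fintype_fun_eq_card, Fintype.card_subtype] at this

theorem linearIndependent_of_dotProduct {ν : Fin l → Fin k → ℝ}
    (h : ∀ i j, ν i ⬝ᵥ ν j = if i = j then 1 else 0) : LinearIndependent ℝ ν := by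
  rw [Fintype.linearIndependent_iff]
  intro g hg i
  have h1 : (∑ j, g j • ν j) ⬝ᵥ ν i = g i := by
    simp [sum_dotProduct, h]
  rw [← h1, hg, zero_dotProduct]

/-- Orthonormal eigenvectors with eigenvalues in `(a, b)` lie in the span of the columns of `Q` with
eigenvalues in `(a, b)`, so there are at least as many such columns. -/
theorem EigenFamily.le_card {M Q : Matrix (Fin k) (Fin k) ℝ} {x : Fin k → ℝ} {a b : ℝ}
    {ν : Fin l → Fin k → ℝ} (h : EigenFamily M a b ν) (hQ : IsSpectralDecomposition M x Q) :
    l ≤ (Finset.univ.filter fun j => a < x j ∧ x j < b).card := by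
  have h1 := finrank_span_eq_card (linearIndependent_of_dotProduct h.1)
  rw [Fintype.card_fin] at h1
  rw [← h1]
  refine IsSpectralDecomposition.finrank_le hQ.1 _ _ fun v hv j hj => ?_
  induction hv using Submodule.span_induction with
  | mem v hv =>
    obtain ⟨i, rfl⟩ := hv
    obtain ⟨y, hy, hν⟩ := h.2 i
    exact hQ.coord_eq_zero hν fun e => hj (e ▸ hy)
  | zero => simp
  | add v w _ _ hv hw => rw [Matrix.mulVec_add, Pi.add_apply, hv, hw, add_zero]
  | smul c v _ hv => rw [Matrix.mulVec_smul, Pi.smul_apply, hv, smul_zero]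

/-- The predicate `p` on `Fin k`, extended by `False` to the natural numbers. -/
def extend (p : Fin k → Prop) (j : ℕ) : Prop := ∃ h : j < k, p ⟨j, h⟩

theorem count_extend (p : Fin k → Prop) [DecidablePred p] [DecidablePred (extend p)] :
    Nat.count (extend p) k = (Finset.univ.filter p).card := by
  rw [Nat.count_eq_card_filter_range]
  symm
  refine Finset.card_bij (fun j _ => (j : ℕ)) ?_ ?_ ?_
  · intro j hj
    simp only [Finset.mem_filter, Finset.mem_univ, true_and] at hj
    exact Finset.mem_filter.2 ⟨Finset.mem_range.2 j.2, j.2, hj⟩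
  · intro i _ j _ h; exact Fin.ext h
  · intro j hj
    obtain ⟨-, h, hp⟩ := Finset.mem_filter.1 hj
    exact ⟨⟨j, h⟩, Finset.mem_filter.2 ⟨Finset.mem_univ _, hp⟩, rfl⟩

theorem nth_extend {p : Fin k → Prop} [DecidablePred (extend p)] {c : ℕ}
    (hc : c < Nat.count (extend p) k) :
    ∃ h : Nat.nth (extend p) c < k, p ⟨_, h⟩ ∧ Nat.count (extend p) (Nat.nth (extend p) c) = c := by
  have hfin : ∀ hf : {j | extend p j}.Finite, c < hf.toFinset.card := fun hf =>
    lt_of_lt_of_le hc (by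
      rw [Nat.count_eq_card_filter_range]
      exact Finset.card_le_card fun j hj => hf.mem_toFinset.2 (Finset.mem_filter.1 hj).2)
  obtain ⟨h, hp⟩ := Nat.nth_mem c hfin
  exact ⟨h, hp, Nat.count_nth hfin⟩

/-- The first `l` columns of `Q` whose indices satisfy `p`, in order. (Missing columns are `0`.) -/
noncomputable def selCols (Q : Matrix (Fin k) (Fin k) ℝ) (p : Fin k → Prop) (l : ℕ) :
    Matrix (Fin k) (Fin l) ℝ := fun i c =>
  if h : Nat.nth (extend p) c < k then Q i ⟨_, h⟩ else 0

/-- The selected columns are orthonormal columns of `Q` that satisfy `p`, provided that there are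
enough of them. -/
theorem selCols_spec {Q : Matrix (Fin k) (Fin k) ℝ} {p : Fin k → Prop} [DecidablePred p]
    (hQ : Qᵀ * Q = 1)
    (hl : l ≤ (Finset.univ.filter p).card) :
    (selCols Q p l)ᵀ * selCols Q p l = 1 ∧
      ∀ c, ∃ j, p j ∧ (fun i => selCols Q p l i c) = fun i => Q i j := by
  classical
  rw [← count_extend] at hl
  have hcol : ∀ c : Fin l, ∃ j : Fin k, (j : ℕ) = Nat.nth (extend p) c ∧ p j ∧
      (fun i => selCols Q p l i c) = fun i => Q i j := fun c => by
    obtain ⟨h, hp, -⟩ := nth_extend (p := p) (c := c) (lt_of_lt_of_le c.2 hl)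
    exact ⟨⟨_, h⟩, rfl, hp, by funext i; simp only [selCols, dif_pos h]⟩
  refine ⟨?_, fun c => ?_⟩
  · ext c d
    obtain ⟨i, hi, -, hci⟩ := hcol c
    obtain ⟨j, hj, -, hcj⟩ := hcol d
    have h1 := congrFun (congrFun hQ i) j
    have h2 : ((selCols Q p l)ᵀ * selCols Q p l) c d = (Qᵀ * Q) i j := by
      simp only [Matrix.mul_apply, Matrix.transpose_apply]
      exact Finset.sum_congr rfl fun a _ => by
        rw [show selCols Q p l a c = Q a i from congrFun hci a,
          show selCols Q p l a d = Q a j from congrFun hcj a]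
    rw [h2, h1, Matrix.one_apply, Matrix.one_apply]
    refine if_congr ⟨fun e => ?_, fun e => ?_⟩ rfl rfl
    · obtain ⟨-, -, hc⟩ := nth_extend (p := p) (c := c) (lt_of_lt_of_le c.2 hl)
      obtain ⟨-, -, hd⟩ := nth_extend (p := p) (c := d) (lt_of_lt_of_le d.2 hl)
      rw [← hi, e] at hc
      rw [← hj, hc] at hd
      exact Fin.ext hd
    · rw [Fin.ext_iff, hi, hj, e]
  · obtain ⟨j, -, hp, h⟩ := hcol c
    exact ⟨j, hp, h⟩

theorem mulVec_col {M Q : Matrix (Fin k) (Fin k) ℝ} {x : Fin k → ℝ}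
    (h : IsSpectralDecomposition M x Q) (j : Fin k) :
    (M *ᵥ fun i => Q i j) = x j • fun i => Q i j := by
  funext i
  have := congrFun (congrFun h.2 i) j
  rw [Matrix.mul_apply, Matrix.mul_diagonal] at this
  simp only [Matrix.mulVec, dotProduct, this, Pi.smul_apply, smul_eq_mul]
  ring

theorem eigenFamily_selCols {M Q : Matrix (Fin k) (Fin k) ℝ} {x : Fin k → ℝ} {a b : ℝ}
    (hQ : IsSpectralDecomposition M x Q)
    (hl : l ≤ (Finset.univ.filter fun j => a < x j ∧ x j < b).card) :
    EigenFamily M a b fun c i => selCols Q (fun j => a < x j ∧ x j < b) l i c := by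
  obtain ⟨h1, h2⟩ := selCols_spec hQ.1 hl
  refine ⟨fun i j => ?_, fun c => ?_⟩
  · have := congrFun (congrFun h1 i) j
    rwa [Matrix.mul_apply, Matrix.one_apply] at this
  · obtain ⟨j, hj, h⟩ := h2 c
    refine ⟨x j, hj, ?_⟩
    change (M *ᵥ fun i => selCols Q _ l i c) = x j • fun i => selCols Q _ l i c
    rw [h, mulVec_col hQ]

/-- The spectral assumption speaks of some families of eigenvectors; one spectral decomposition of
each matrix decides it. -/
theorem spectralAssumption_iff {Φ Ψ : Matrix (Fin k) (Fin k) ℝ} {ε : ℝ} (hΦ : Φ.IsSymm)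
    (hΨ : Ψ.IsSymm) : SpectralAssumption Φ Ψ ε ↔
      3 * k / 4 ≤ (Finset.univ.filter fun j =>
        0.9 < (spectralDecomposition Φ).1 j ∧ (spectralDecomposition Φ).1 j < 1.1).card ∧
      3 * k / 4 ≤ (Finset.univ.filter fun j => 0.9 * ε < (spectralDecomposition Ψ).1 j ∧
        (spectralDecomposition Ψ).1 j < 1.1 * ε).card := by
  have h1 := isSpectralDecomposition_spectralDecomposition hΦ
  have h2 := isSpectralDecomposition_spectralDecomposition hΨ
  constructor
  · rintro ⟨⟨ν, hν⟩, ζ, hζ⟩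
    exact ⟨hν.le_card h1, hζ.le_card h2⟩
  · rintro ⟨h3, h4⟩
    exact ⟨⟨_, eigenFamily_selCols h1 h3⟩, _, eigenFamily_selCols h2 h4⟩

/-! ### A computable rule for `Ξ` -/

/-- The selected eigenvectors of `Φ` with eigenvalues in `(a, b)`. -/
noncomputable def goodVecs (Φ : Matrix (Fin k) (Fin k) ℝ) (a b : ℝ) (l : ℕ) :
    Matrix (Fin k) (Fin l) ℝ :=
  selCols (spectralDecomposition Φ).2
    (fun j => a < (spectralDecomposition Φ).1 j ∧ (spectralDecomposition Φ).1 j < b) l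

/-- Orthonormal vectors in the intersection of the column spaces of `N` and `Z`, found as
eigenvectors of the sum of the two projections with eigenvalue at least (hence equal to) `2`. -/
noncomputable def commonVecs {a b : ℕ} (N : Matrix (Fin k) (Fin a) ℝ) (Z : Matrix (Fin k) (Fin b) ℝ)
    (l : ℕ) : Matrix (Fin k) (Fin l) ℝ :=
  selCols (spectralDecomposition (N * Nᵀ + Z * Zᵀ)).2
    (fun j => 2 ≤ (spectralDecomposition (N * Nᵀ + Z * Zᵀ)).1 j) l

/-- The columns of `E` are changed to vectors that are orthonormal with respect to `Φ`. -/
noncomputable def whiten (Φ : Matrix (Fin k) (Fin k) ℝ) (E : Matrix (Fin k) (Fin l) ℝ) :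
    Matrix (Fin k) (Fin l) ℝ :=
  fun i c => (E * (spectralDecomposition (Eᵀ * Φ * E)).2) i c /
    √((spectralDecomposition (Eᵀ * Φ * E)).1 c)

/-- The rule for `Ξ`: common vectors of the two spans, made orthonormal with respect to `Φ` and then
rotated to make `Ψ` diagonal. -/
noncomputable def rule : XiRule := fun k Φ Ψ ε =>
  whiten Φ (commonVecs (goodVecs Φ 0.9 1.1 (3 * k / 4)) (goodVecs Ψ (0.9 * ε) (1.1 * ε) (3 * k / 4))
    (k / 12)) *
  (spectralDecomposition ((whiten Φ (commonVecs (goodVecs Φ 0.9 1.1 (3 * k / 4))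
    (goodVecs Ψ (0.9 * ε) (1.1 * ε) (3 * k / 4)) (k / 12)))ᵀ * Ψ *
    (whiten Φ (commonVecs (goodVecs Φ 0.9 1.1 (3 * k / 4))
    (goodVecs Ψ (0.9 * ε) (1.1 * ε) (3 * k / 4)) (k / 12))))).2

theorem dotProduct_self_nonneg' (v : Fin k → ℝ) : 0 ≤ v ⬝ᵥ v := by
  rw [← norm_toLp_sq]; positivity

/-- Bessel's inequality, and its case of equality. -/
theorem eq_of_norm_transpose {N : Matrix (Fin k) (Fin l) ℝ} (hN : Nᵀ * N = 1) (v : Fin k → ℝ) :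
    (Nᵀ *ᵥ v) ⬝ᵥ (Nᵀ *ᵥ v) ≤ v ⬝ᵥ v ∧
      ((Nᵀ *ᵥ v) ⬝ᵥ (Nᵀ *ᵥ v) = v ⬝ᵥ v → N *ᵥ (Nᵀ *ᵥ v) = v) := by
  set a := Nᵀ *ᵥ v with ha
  have h1 : (N *ᵥ a) ⬝ᵥ (N *ᵥ a) = a ⬝ᵥ a := by
    rw [Matrix.dotProduct_mulVec, ← Matrix.mulVec_transpose, Matrix.mulVec_mulVec, hN,
      Matrix.one_mulVec]
  have h2 : v ⬝ᵥ (N *ᵥ a) = a ⬝ᵥ a := by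
    rw [Matrix.dotProduct_mulVec, ← Matrix.mulVec_transpose]
  have h3 : (v - N *ᵥ a) ⬝ᵥ (v - N *ᵥ a) = v ⬝ᵥ v - a ⬝ᵥ a := by
    rw [sub_dotProduct, dotProduct_sub, dotProduct_sub, h1, h2, dotProduct_comm (N *ᵥ a) v, h2]
    ring
  refine ⟨by linarith [dotProduct_self_nonneg' (v - N *ᵥ a)], fun h => ?_⟩
  rw [h, sub_self] at h3
  exact (sub_eq_zero.1 (dotProduct_self_eq_zero.1 h3)).symm

theorem mulVec_mem_span (N : Matrix (Fin k) (Fin l) ℝ) (a : Fin l → ℝ) :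
    N *ᵥ a ∈ Submodule.span ℝ (Set.range fun c i => N i c) := by
  have : N *ᵥ a = ∑ c, a c • fun i => N i c := by
    funext i
    simp [Matrix.mulVec, dotProduct, mul_comm]
  rw [this]
  exact Submodule.sum_mem _ fun c _ => Submodule.smul_mem _ _ (Submodule.subset_span ⟨c, rfl⟩)

theorem mulVec_transpose_of_mem_span {N : Matrix (Fin k) (Fin l) ℝ} (hN : Nᵀ * N = 1)
    {v : Fin k → ℝ} (hv : v ∈ Submodule.span ℝ (Set.range fun c i => N i c)) :
    N *ᵥ (Nᵀ *ᵥ v) = v := by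
  induction hv using Submodule.span_induction with
  | mem v hv =>
    obtain ⟨c, rfl⟩ := hv
    have : (fun i => N i c) = N *ᵥ Pi.single c 1 := by
      funext i; simp
    simp only [this]
    rw [Matrix.mulVec_mulVec _ Nᵀ, hN, Matrix.one_mulVec]
  | zero => simp
  | add v w _ _ hv hw => rw [Matrix.mulVec_add, Matrix.mulVec_add, hv, hw]
  | smul c v _ hv => rw [Matrix.mulVec_smul, Matrix.mulVec_smul, hv]

theorem EigenFamily.transpose_mul {M : Matrix (Fin k) (Fin k) ℝ} {a b : ℝ}
    {N : Matrix (Fin k) (Fin l) ℝ} (h : EigenFamily M a b fun c i => N i c) : Nᵀ * N = 1 := by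
  ext c d
  rw [Matrix.mul_apply, Matrix.one_apply, ← h.1 c d]
  rfl

/-- The quadratic form of `M` on the span of eigenvectors with eigenvalues in `(a, b)`. -/
theorem EigenFamily.rayleigh {M : Matrix (Fin k) (Fin k) ℝ} {a b : ℝ}
    {N : Matrix (Fin k) (Fin l) ℝ} (h : EigenFamily M a b fun c i => N i c) {v : Fin k → ℝ}
    (hv : N *ᵥ (Nᵀ *ᵥ v) = v) (hv0 : 0 < v ⬝ᵥ v) :
    a * (v ⬝ᵥ v) < v ⬝ᵥ (M *ᵥ v) ∧ v ⬝ᵥ (M *ᵥ v) < b * (v ⬝ᵥ v) := by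
  choose y hy hν using h.2
  set c := Nᵀ *ᵥ v with hc
  have h1 : M * N = N * Matrix.diagonal y := by
    ext i j
    have := congrFun (hν j) i
    rw [Matrix.mul_diagonal, Matrix.mul_apply]
    simp only [Matrix.mulVec, dotProduct, Pi.smul_apply, smul_eq_mul] at this
    rw [this, mul_comm]
  have h2 : v ⬝ᵥ v = ∑ i, c i * c i := by
    conv_lhs => rw [← hv]
    rw [Matrix.dotProduct_mulVec, ← Matrix.mulVec_transpose, hv]
    rfl
  have h3 : v ⬝ᵥ (M *ᵥ v) = ∑ i, y i * (c i * c i) := by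
    conv_lhs => rw [← hv]
    rw [Matrix.mulVec_mulVec _ M, h1, ← Matrix.mulVec_mulVec, Matrix.dotProduct_mulVec,
      ← Matrix.mulVec_transpose, hv, ← hc]
    simp only [dotProduct, Matrix.mulVec_diagonal]
    exact Finset.sum_congr rfl fun i _ => by ring
  rw [h2] at hv0
  obtain ⟨i, -, hi⟩ := Finset.exists_lt_of_sum_lt (s := Finset.univ) (f := fun _ => (0 : ℝ))
    (g := fun i => c i * c i) (by simpa using hv0)
  rw [h2, h3, Finset.mul_sum, Finset.mul_sum]
  refine ⟨Finset.sum_lt_sum (fun j _ => ?_) ⟨i, Finset.mem_univ _, ?_⟩,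
    Finset.sum_lt_sum (fun j _ => ?_) ⟨i, Finset.mem_univ _, ?_⟩⟩
  · exact mul_le_mul_of_nonneg_right (hy j).1.le (mul_self_nonneg _)
  · exact mul_lt_mul_of_pos_right (hy i).1 hi
  · exact mul_le_mul_of_nonneg_right (hy j).2.le (mul_self_nonneg _)
  · exact mul_lt_mul_of_pos_right (hy i).2 hi

theorem isSymm_mul_transpose (N : Matrix (Fin k) (Fin l) ℝ) : (N * Nᵀ).IsSymm := by
  rw [Matrix.IsSymm, Matrix.transpose_mul, Matrix.transpose_transpose]

theorem isSymm_conj {M : Matrix (Fin k) (Fin k) ℝ} (hM : M.IsSymm) (N : Matrix (Fin k) (Fin l) ℝ) :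
    (Nᵀ * M * N).IsSymm := by
  rw [Matrix.IsSymm, Matrix.transpose_mul, Matrix.transpose_mul, Matrix.transpose_transpose, hM,
    Matrix.mul_assoc]

/-- The sum of two projections has many eigenvalues at least `2`, by counting dimensions. -/
theorem le_card_common {a b : ℕ} {N : Matrix (Fin k) (Fin a) ℝ} {Z : Matrix (Fin k) (Fin b) ℝ}
    (hN : Nᵀ * N = 1) (hZ : Zᵀ * Z = 1) (hl : k + l ≤ a + b) :
    l ≤ (Finset.univ.filter fun j => 2 ≤ (spectralDecomposition (N * Nᵀ + Z * Zᵀ)).1 j).card := by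
  have hQ := isSpectralDecomposition_spectralDecomposition
    ((isSymm_mul_transpose N).add (isSymm_mul_transpose Z))
  have hdim : ∀ {m : ℕ} {N : Matrix (Fin k) (Fin m) ℝ}, Nᵀ * N = 1 →
      Module.finrank ℝ (Submodule.span ℝ (Set.range fun c i => N i c)) = m := fun {m N} hN => by
    rw [finrank_span_eq_card (linearIndependent_of_dotProduct fun i j => ?_), Fintype.card_fin]
    have := congrFun (congrFun hN i) j
    rwa [Matrix.mul_apply, Matrix.one_apply] at this
  have h1 := Submodule.finrank_sup_add_finrank_inf_eq
    (Submodule.span ℝ (Set.range fun c i => N i c)) (Submodule.span ℝ (Set.range fun c i => Z i c))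
  have h2 := Submodule.finrank_le (Submodule.span ℝ (Set.range fun c i => N i c) ⊔
    Submodule.span ℝ (Set.range fun c i => Z i c))
  rw [hdim hN, hdim hZ] at h1
  rw [Module.finrank_fintype_fun_eq_card, Fintype.card_fin] at h2
  refine le_trans (by omega) (IsSpectralDecomposition.finrank_le hQ.1 _
    (Submodule.span ℝ (Set.range fun c i => N i c) ⊓
      Submodule.span ℝ (Set.range fun c i => Z i c)) fun v hv j hj => ?_)
  refine hQ.coord_eq_zero (y := 2) ?_ fun e => hj e.ge
  rw [Matrix.add_mulVec, ← Matrix.mulVec_mulVec, ← Matrix.mulVec_mulVec,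
    mulVec_transpose_of_mem_span hN hv.1, mulVec_transpose_of_mem_span hZ hv.2, two_smul]

/-- The vectors `commonVecs N Z l` are orthonormal, and both projections fix them: as each
projection is at most `1`, a unit vector with eigenvalue `2` for their sum is fixed by both. -/
theorem commonVecs_spec {a b : ℕ} {N : Matrix (Fin k) (Fin a) ℝ} {Z : Matrix (Fin k) (Fin b) ℝ}
    (hN : Nᵀ * N = 1) (hZ : Zᵀ * Z = 1) (hl : k + l ≤ a + b) :
    (commonVecs N Z l)ᵀ * commonVecs N Z l = 1 ∧
      N * (Nᵀ * commonVecs N Z l) = commonVecs N Z l ∧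
      Z * (Zᵀ * commonVecs N Z l) = commonVecs N Z l := by
  have hcard := le_card_common hN hZ hl
  set R := N * Nᵀ + Z * Zᵀ with hR
  have hsymm : R.IsSymm := (isSymm_mul_transpose N).add (isSymm_mul_transpose Z)
  have hQ := isSpectralDecomposition_spectralDecomposition hsymm
  set Q := (spectralDecomposition R).2
  set z := (spectralDecomposition R).1
  obtain ⟨h1, h2⟩ := selCols_spec hQ.1 hcard
  have key : ∀ c, N *ᵥ (Nᵀ *ᵥ fun i => commonVecs N Z l i c) = (fun i => commonVecs N Z l i c) ∧
      Z *ᵥ (Zᵀ *ᵥ fun i => commonVecs N Z l i c) = fun i => commonVecs N Z l i c := fun c => by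
    obtain ⟨j, hj, hc⟩ := h2 c
    have hc' : (fun i => commonVecs N Z l i c) = fun i => Q i j := hc
    have hnorm : (fun i => Q i j) ⬝ᵥ (fun i => Q i j) = 1 := by
      have := congrFun (congrFun hQ.1 j) j
      rwa [Matrix.mul_apply, Matrix.one_apply_eq] at this
    rw [hc']
    set e := fun i => Q i j
    have h3 : e ⬝ᵥ (R *ᵥ e) = z j := by
      rw [mulVec_col hQ, dotProduct_smul, hnorm, smul_eq_mul, mul_one]
    have h4 : e ⬝ᵥ (R *ᵥ e) = (Nᵀ *ᵥ e) ⬝ᵥ (Nᵀ *ᵥ e) + (Zᵀ *ᵥ e) ⬝ᵥ (Zᵀ *ᵥ e) := by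
      rw [hR, Matrix.add_mulVec, dotProduct_add, ← Matrix.mulVec_mulVec, ← Matrix.mulVec_mulVec,
        Matrix.dotProduct_mulVec e N, Matrix.dotProduct_mulVec e Z, ← Matrix.mulVec_transpose N,
        ← Matrix.mulVec_transpose Z]
    have h5 := eq_of_norm_transpose hN e
    have h6 := eq_of_norm_transpose hZ e
    rw [hnorm] at h5 h6
    exact ⟨h5.2 (by linarith [h5.1, h6.1]), h6.2 (by linarith [h5.1, h6.1])⟩
  refine ⟨h1, ?_, ?_⟩
  · ext i c
    have := congrFun (key c).1 i
    simpa [Matrix.mul_apply, Matrix.mulVec, dotProduct] using this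
  · ext i c
    have := congrFun (key c).2 i
    simpa [Matrix.mul_apply, Matrix.mulVec, dotProduct] using this

/-- If the form `Φ` is positive on the span of `E`, the eigenvalues by whose roots `whiten` divides are
positive. -/
theorem whiten_spec {Φ : Matrix (Fin k) (Fin k) ℝ} {E : Matrix (Fin k) (Fin l) ℝ} (hΦ : Φ.IsSymm)
    (hE : Eᵀ * E = 1)
    (hpos : ∀ v : Fin l → ℝ, 0 < (E *ᵥ v) ⬝ᵥ (E *ᵥ v) → 0 < (E *ᵥ v) ⬝ᵥ (Φ *ᵥ (E *ᵥ v))) :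
    (whiten Φ E)ᵀ * Φ * whiten Φ E = 1 ∧ ∃ Y : Matrix (Fin l) (Fin l) ℝ, whiten Φ E = E * Y := by
  have hQ := isSpectralDecomposition_spectralDecomposition (isSymm_conj hΦ E)
  set Q := (spectralDecomposition (Eᵀ * Φ * E)).2 with hQd
  set x := (spectralDecomposition (Eᵀ * Φ * E)).1 with hxd
  set D : Matrix (Fin l) (Fin l) ℝ := Matrix.diagonal fun c => (√(x c))⁻¹ with hD
  have hW : whiten Φ E = E * (Q * D) := by
    ext i c
    rw [← Matrix.mul_assoc, hD, Matrix.mul_diagonal, whiten, div_eq_mul_inv]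
  have hx : ∀ c, 0 < x c := fun c => by
    have hnorm : (fun i => Q i c) ⬝ᵥ (fun i => Q i c) = 1 := by
      have := congrFun (congrFun hQ.1 c) c
      rwa [Matrix.mul_apply, Matrix.one_apply_eq] at this
    have h1 : (E *ᵥ fun i => Q i c) ⬝ᵥ (E *ᵥ fun i => Q i c) = 1 := by
      rw [Matrix.dotProduct_mulVec, ← Matrix.mulVec_transpose, Matrix.mulVec_mulVec, hE,
        Matrix.one_mulVec, hnorm]
    have h2 := hpos (fun i => Q i c) (by rw [h1]; exact one_pos)
    have h3 : (E *ᵥ fun i => Q i c) ⬝ᵥ (Φ *ᵥ (E *ᵥ fun i => Q i c)) =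
        (fun i => Q i c) ⬝ᵥ ((Eᵀ * Φ * E) *ᵥ fun i => Q i c) := by
      rw [← Matrix.mulVec_mulVec, ← Matrix.mulVec_mulVec, Matrix.dotProduct_mulVec _ Eᵀ,
        ← Matrix.mulVec_transpose, Matrix.transpose_transpose]
    rw [h3, mulVec_col hQ, dotProduct_smul, hnorm, smul_eq_mul, mul_one] at h2
    exact h2
  refine ⟨?_, Q * D, hW⟩
  have h1 : (E * (Q * D))ᵀ * Φ * (E * (Q * D)) = Dᵀ * (Qᵀ * (Eᵀ * Φ * E) * Q) * D := by
    simp only [Matrix.transpose_mul, Matrix.mul_assoc]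
  rw [hW, h1, hQ.conj, hD, Matrix.diagonal_transpose, Matrix.diagonal_mul_diagonal,
    Matrix.diagonal_mul_diagonal, ← Matrix.diagonal_one]
  congr 1
  funext c
  have h2 := Real.mul_self_sqrt (hx c).le
  have h3 := (Real.sqrt_pos.2 (hx c)).ne'
  calc (√(x c))⁻¹ * x c * (√(x c))⁻¹ = (√(x c))⁻¹ * (√(x c) * √(x c)) * (√(x c))⁻¹ := by rw [h2]
    _ = 1 := by field_simp

/-- The two spans have dimension `3 k / 4` each, so they share at least `k / 2` and in particular `k
/ 12` dimensions; and on the common vectors, the Rayleigh quotients of `Φ` and `Ψ` lie in the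
intervals of the two families, which locates the diagonal entries. -/
theorem rule_valid : rule.Valid := by
  classical
  intro k Φ Ψ ε hk hΦ hΨ hsa
  obtain ⟨hc1, hc2⟩ := (spectralAssumption_iff hΦ hΨ).1 hsa
  have hν := eigenFamily_selCols (isSpectralDecomposition_spectralDecomposition hΦ) hc1
  have hζ := eigenFamily_selCols (isSpectralDecomposition_spectralDecomposition hΨ) hc2
  have hεpos : ∀ _ : Fin (k / 12), 0 < ε := fun j => by
    have : 0 < 3 * k / 4 := by have := j.2; omega
    obtain ⟨y, hy, -⟩ := hζ.2 ⟨0, this⟩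
    have := hy.1.trans hy.2
    linarith
  set N := goodVecs Φ 0.9 1.1 (3 * k / 4) with hNd
  set Z := goodVecs Ψ (0.9 * ε) (1.1 * ε) (3 * k / 4) with hZd
  have hν' : EigenFamily Φ 0.9 1.1 fun c i => N i c := hν
  have hζ' : EigenFamily Ψ (0.9 * ε) (1.1 * ε) fun c i => Z i c := hζ
  obtain ⟨hE, hEN, hEZ⟩ := commonVecs_spec hν'.transpose_mul hζ'.transpose_mul (l := k / 12)
    (by omega)
  set E := commonVecs N Z (k / 12) with hEd
  have hEN' : ∀ v, N *ᵥ (Nᵀ *ᵥ (E *ᵥ v)) = E *ᵥ v := fun v => by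
    rw [Matrix.mulVec_mulVec, Matrix.mulVec_mulVec, Matrix.mul_assoc, hEN]
  have hEZ' : ∀ v, Z *ᵥ (Zᵀ *ᵥ (E *ᵥ v)) = E *ᵥ v := fun v => by
    rw [Matrix.mulVec_mulVec, Matrix.mulVec_mulVec, Matrix.mul_assoc, hEZ]
  obtain ⟨hW, Y, hY⟩ := whiten_spec hΦ hE fun v hv =>
    lt_trans (by positivity) (hν'.rayleigh (hEN' v) hv).1
  set W := whiten Φ E with hWd
  have hQ := isSpectralDecomposition_spectralDecomposition (isSymm_conj hΨ W)
  set Q := (spectralDecomposition (Wᵀ * Ψ * W)).2 with hQd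
  have hrule : rule k Φ Ψ ε = W * Q := rfl
  have hconj : ∀ M : Matrix (Fin k) (Fin k) ℝ, (W * Q)ᵀ * M * (W * Q) = Qᵀ * (Wᵀ * M * W) * Q :=
    fun M => by simp only [Matrix.transpose_mul, Matrix.mul_assoc]
  have hcol : ∀ j, (fun i => (W * Q) i j) = E *ᵥ fun i => (Y * Q) i j := fun j => by
    funext i
    rw [hY, Matrix.mul_assoc, Matrix.mul_apply]
    rfl
  have hone : (W * Q)ᵀ * Φ * (W * Q) = 1 := by rw [hconj, hW, mul_one, hQ.1]
  have hent : ∀ (M : Matrix (Fin k) (Fin k) ℝ) j, ((W * Q)ᵀ * M * (W * Q)) j j =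
      (fun i => (W * Q) i j) ⬝ᵥ (M *ᵥ fun i => (W * Q) i j) := fun M j => by
    rw [Matrix.mul_assoc, Matrix.mul_apply]
    simp only [dotProduct, Matrix.mulVec, Matrix.transpose_apply]
    exact Finset.sum_congr rfl fun i _ => congrArg _ Matrix.mul_apply
  rw [hrule]
  refine ⟨⟨fun c i => N i c, fun c i => Z i c, hν', hζ', fun j => ?_⟩, hone, ?_, fun j => ?_⟩
  · rw [hcol]
    exact ⟨by rw [← hEN']; exact mulVec_mem_span _ _, by rw [← hEZ']; exact mulVec_mem_span _ _⟩
  · rw [hconj, hQ.conj]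
    exact Matrix.isDiag_diagonal _
  · have h1 := congrFun (congrFun hone j) j
    rw [hent, Matrix.one_apply_eq] at h1
    rw [hent]
    rw [hcol] at h1 ⊢
    set ξ := E *ᵥ fun i => (Y * Q) i j
    have hξ0 : 0 < ξ ⬝ᵥ ξ := by
      refine lt_of_le_of_ne (dotProduct_self_nonneg' ξ) fun h => ?_
      rw [dotProduct_self_eq_zero.1 h.symm] at h1
      simp at h1
    obtain ⟨h2, h3⟩ := hν'.rayleigh (hEN' _) hξ0
    obtain ⟨h4, h5⟩ := hζ'.rayleigh (hEZ' _) hξ0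
    have hε := hεpos j
    rw [h1] at h2 h3
    constructor
    · refine lt_of_le_of_lt ?_ h4
      have : 1 / 1.1 ≤ ξ ⬝ᵥ ξ := by rw [div_le_iff₀ (by norm_num)]; linarith
      calc 0.9 / 1.1 * ε = 0.9 * ε * (1 / 1.1) := by ring
        _ ≤ _ := by gcongr
    · refine lt_of_lt_of_le h5 ?_
      have : ξ ⬝ᵥ ξ ≤ 1 / 0.9 := by rw [le_div_iff₀ (by norm_num)]; linarith
      calc 1.1 * ε * (ξ ⬝ᵥ ξ) ≤ 1.1 * ε * (1 / 0.9) := by gcongr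
        _ = _ := by ring

end

section

/-! ### The correlation function of the denoiser -/

instance : IsProbabilityMeasure gauss := by unfold gauss; infer_instance

theorem integrable_of_continuous_of_bounded {X : Type*} [TopologicalSpace X] [MeasurableSpace X]
    [BorelSpace X] [SecondCountableTopology X] {μ : Measure X} [IsFiniteMeasure μ] {f : X → ℝ}
    (hf : Continuous f) (C : ℝ) (h : ∀ x, |f x| ≤ C) : Integrable f μ :=
  Integrable.of_bound hf.aestronglyMeasurable C (Eventually.of_forall h)

theorem integral_exp_gauss (t : ℝ) :
    (∫ x, Real.cos (t * x) ∂gauss = Real.exp (-(t ^ 2) / 2)) ∧ ∫ x, Real.sin (t * x) ∂gauss =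
      0 := by
  have h := charFun_gaussianReal (μ := 0) (v := 1) t
  rw [charFun_apply_real] at h
  have hc : Integrable (fun x : ℝ => Real.cos (t * x)) gauss :=
    integrable_of_continuous_of_bounded (by fun_prop) 1 fun x => Real.abs_cos_le_one _
  have hs : Integrable (fun x : ℝ => Real.sin (t * x)) gauss :=
    integrable_of_continuous_of_bounded (by fun_prop) 1 fun x => Real.abs_sin_le_one _
  have h2 : ∫ x, Complex.exp (t * x * Complex.I) ∂gauss =
      ((∫ x, Real.cos (t * x) ∂gauss : ℝ) : ℂ) + ((∫ x, Real.sin (t * x) ∂gauss : ℝ) : ℂ) *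
        Complex.I := by
    rw [← integral_complex_ofReal, ← integral_complex_ofReal, ← integral_mul_const,
      ← integral_add hc.ofReal (hs.ofReal.mul_const _)]
    refine integral_congr_ae (Eventually.of_forall fun x => ?_)
    simp only [Complex.exp_mul_I]
    push_cast
    rfl
  have h3 : Complex.exp (t * (0 : ℝ) * Complex.I - ((1 : NNReal) : ℝ) * t ^ 2 / 2) =
      ((Real.exp (-(t ^ 2) / 2) : ℝ) : ℂ) := by
    push_cast
    congr 1
    ring
  unfold gauss at h2 ⊢
  rw [h2] at h
  erw [h3] at h
  constructor
  · have := congrArg Complex.re h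
    rw [Complex.ofReal_re] at this
    simpa using this
  · have := congrArg Complex.im h
    rw [Complex.ofReal_im] at this
    simpa using this

/-- The characteristic function of a Gaussian in the plane. -/
theorem integral_cos_prod (α β : ℝ) :
    ∫ p : ℝ × ℝ, Real.cos (α * p.1 + β * p.2) ∂(gauss.prod gauss) =
      Real.exp (-(α ^ 2 + β ^ 2) / 2) := by
  have h1 : Integrable (fun p : ℝ × ℝ => Real.cos (α * p.1) * Real.cos (β * p.2))
      (gauss.prod gauss) := integrable_of_continuous_of_bounded (by fun_prop) 1 fun p => by
    rw [abs_mul]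
    exact mul_le_one₀ (Real.abs_cos_le_one _) (abs_nonneg _) (Real.abs_cos_le_one _)
  have h2 : Integrable (fun p : ℝ × ℝ => Real.sin (α * p.1) * Real.sin (β * p.2))
      (gauss.prod gauss) := integrable_of_continuous_of_bounded (by fun_prop) 1 fun p => by
    rw [abs_mul]
    exact mul_le_one₀ (Real.abs_sin_le_one _) (abs_nonneg _) (Real.abs_sin_le_one _)
  simp only [Real.cos_add]
  rw [integral_sub h1 h2, integral_prod_mul (fun x => Real.cos (α * x)) fun x => Real.cos (β * x),
    integral_prod_mul (fun x => Real.sin (α * x)) fun x => Real.sin (β * x),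
    (integral_exp_gauss α).1, (integral_exp_gauss β).1,
    (integral_exp_gauss α).2, zero_mul, sub_zero,
    ← Real.exp_add]
  congr 1
  ring

/-- A closed form of the correlation function, valid for all arguments; it is what a program
evaluates. -/
theorem corr_eq (φ : Denoiser) (u : ℝ) : φ.corr u = ∑ i, ∑ j, φ.a i * φ.a j *
    (Real.exp (-((φ.b i + φ.b j * u) ^ 2 + (φ.b j * √(1 - u ^ 2)) ^ 2) / 2) +
      Real.exp (-((φ.b i - φ.b j * u) ^ 2 + (φ.b j * √(1 - u ^ 2)) ^ 2) / 2)) / 2 := by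
  have hi : ∀ α β : ℝ, Integrable (fun p : ℝ × ℝ => Real.cos (α * p.1 + β * p.2))
      (gauss.prod gauss) := fun α β =>
    integrable_of_continuous_of_bounded (by fun_prop) 1 fun p => Real.abs_cos_le_one _
  have hadd : ∀ α β γ δ : ℝ, Integrable (fun p : ℝ × ℝ => Real.cos (α * p.1 + β * p.2) +
      Real.cos (γ * p.1 + δ * p.2)) (gauss.prod gauss) := fun α β γ δ => (hi α β).add (hi γ δ)
  have h1 : ∀ p : ℝ × ℝ, φ.eval p.1 * φ.eval (u * p.1 + √(1 - u ^ 2) * p.2) =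
      ∑ i, ∑ j, φ.a i * φ.a j / 2 *
        (Real.cos ((φ.b i + φ.b j * u) * p.1 + φ.b j * √(1 - u ^ 2) * p.2) +
          Real.cos ((φ.b i - φ.b j * u) * p.1 + (-(φ.b j * √(1 - u ^ 2))) * p.2)) := by
    intro p
    simp only [Denoiser.eval]
    rw [Finset.sum_mul_sum]
    refine Finset.sum_congr rfl fun i _ => Finset.sum_congr rfl fun j _ => ?_
    have e1 : (φ.b i + φ.b j * u) * p.1 + φ.b j * √(1 - u ^ 2) * p.2 =
      φ.b i * p.1 + φ.b j * (u * p.1 + √(1 - u ^ 2) * p.2) := by ring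
    have e2 : (φ.b i - φ.b j * u) * p.1 + (-(φ.b j * √(1 - u ^ 2))) * p.2 =
      φ.b i * p.1 - φ.b j * (u * p.1 + √(1 - u ^ 2) * p.2) := by ring
    rw [e1, e2, Real.cos_add, Real.cos_sub]
    ring
  unfold Denoiser.corr
  simp only [h1]
  rw [integral_finsetSum _ fun i _ => integrable_finsetSum _ fun j _ => (hadd _ _ _ _).const_mul _]
  refine Finset.sum_congr rfl fun i _ => ?_
  rw [integral_finsetSum _ fun j _ => (hadd _ _ _ _).const_mul _]
  refine Finset.sum_congr rfl fun j _ => ?_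
  rw [integral_const_mul, integral_add (hi _ _) (hi _ _), integral_cos_prod, integral_cos_prod,
    neg_sq]
  ring

/-- The amplitudes of the denoiser after averaging each term over a Gaussian. -/
noncomputable def Denoiser.wt (φ : Denoiser) (i : Fin φ.L) : ℝ :=
    φ.a i * Real.exp (-(φ.b i) ^ 2 / 2)

/-- For a correlation `u` the squares in `corr_eq` combine, and the dependence on `u` is through
`cosh (b i * b j * u)` alone. -/
theorem corr_eq_cosh (φ : Denoiser) {u : ℝ} (hu : |u| ≤ 1) :
    φ.corr u = ∑ i, ∑ j, φ.wt i * φ.wt j * Real.cosh (φ.b i * φ.b j * u) := by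
  have hs : √(1 - u ^ 2) ^ 2 = 1 - u ^ 2 :=
    Real.sq_sqrt (by nlinarith [abs_le.1 hu, sq_abs u, abs_nonneg u])
  rw [corr_eq]
  refine Finset.sum_congr rfl fun i _ => Finset.sum_congr rfl fun j _ => ?_
  rw [mul_pow _ (√(1 - u ^ 2)), hs, Real.cosh_eq, Denoiser.wt, Denoiser.wt]
  have e1 : -((φ.b i + φ.b j * u) ^ 2 + φ.b j ^ 2 * (1 - u ^ 2)) / 2 =
      -(φ.b i) ^ 2 / 2 + -(φ.b j) ^ 2 / 2 + -(φ.b i * φ.b j * u) := by ring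
  have e2 : -((φ.b i - φ.b j * u) ^ 2 + φ.b j ^ 2 * (1 - u ^ 2)) / 2 =
      -(φ.b i) ^ 2 / 2 + -(φ.b j) ^ 2 / 2 + (φ.b i * φ.b j * u) := by ring
  rw [e1, e2]
  simp only [Real.exp_add]
  ring

/-- The Taylor coefficient of `u ^ (2 n)` in the correlation function. -/
noncomputable def Denoiser.coef (φ : Denoiser) (n : ℕ) : ℝ :=
  (∑ i, φ.wt i * φ.b i ^ (2 * n)) ^ 2 / ((2 * n).factorial : ℝ)

theorem coef_nonneg (φ : Denoiser) (n : ℕ) : 0 ≤ φ.coef n := by unfold Denoiser.coef; positivity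

/-- The correlation function is an even power series. Its coefficients `coef` are nonnegative since
the double sum of `wt i * wt j * (b i * b j) ^ (2 n)` is a square. -/
theorem hasSum_corr (φ : Denoiser) {u : ℝ} (hu : |u| ≤ 1) :
    HasSum (fun n => φ.coef n * u ^ (2 * n)) (φ.corr u) := by
  rw [corr_eq_cosh φ hu]
  have h : HasSum (fun n => ∑ i, ∑ j, φ.wt i * φ.wt j *
      ((φ.b i * φ.b j * u) ^ (2 * n) / ((2 * n).factorial : ℝ)))
      (∑ i, ∑ j, φ.wt i * φ.wt j * Real.cosh (φ.b i * φ.b j * u)) :=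
    hasSum_sum fun i _ => hasSum_sum fun j _ => (Real.hasSum_cosh _).mul_left _
  convert h using 2 with n
  rw [Denoiser.coef, sq, Finset.sum_mul_sum, div_mul_eq_mul_div, Finset.sum_mul, Finset.sum_div]
  refine Finset.sum_congr rfl fun i _ => ?_
  rw [Finset.sum_mul, Finset.sum_div]
  refine Finset.sum_congr rfl fun j _ => ?_
  rw [mul_pow, mul_pow]
  ring

theorem curv_eq (φ : Denoiser) : φ.curv = 2 * φ.coef 1 := by
  have h0 : φ.corr =ᶠ[𝓝 0] fun u => ∑ i, ∑ j, φ.wt i * φ.wt j * Real.cosh (φ.b i * φ.b j * u) := by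
    filter_upwards [Metric.ball_mem_nhds (0 : ℝ) one_pos] with u hu
    exact corr_eq_cosh φ (by simpa using (mem_ball_zero_iff.1 hu).le)
  have h1 : ∀ u, HasDerivAt (fun u => ∑ i, ∑ j, φ.wt i * φ.wt j * Real.cosh (φ.b i * φ.b j * u))
      (∑ i, ∑ j, φ.wt i * φ.wt j * (φ.b i * φ.b j) * Real.sinh (φ.b i * φ.b j * u)) u := fun u => by
    refine HasDerivAt.fun_sum fun i _ => HasDerivAt.fun_sum fun j _ => ?_
    exact (((hasDerivAt_id' u).const_mul (φ.b i * φ.b j)).cosh.const_mul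
      (φ.wt i * φ.wt j)).congr_deriv (by ring)
  have h2 : HasDerivAt (fun u => ∑ i, ∑ j, φ.wt i * φ.wt j * (φ.b i * φ.b j) *
      Real.sinh (φ.b i * φ.b j * u)) (∑ i, ∑ j, φ.wt i * φ.wt j * (φ.b i * φ.b j) ^ 2) 0 := by
    refine HasDerivAt.fun_sum fun i _ => HasDerivAt.fun_sum fun j _ => ?_
    exact (((hasDerivAt_id' (0 : ℝ)).const_mul (φ.b i * φ.b j)).sinh.const_mul
      (φ.wt i * φ.wt j * (φ.b i * φ.b j))).congr_deriv
        (by rw [mul_zero, Real.cosh_zero]; ring)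
  rw [Denoiser.curv, h0.iteratedDeriv_eq, iteratedDeriv_succ, iteratedDeriv_one,
    show deriv (fun u => ∑ i, ∑ j, φ.wt i * φ.wt j * Real.cosh (φ.b i * φ.b j * u)) = _ from
      funext fun u => (h1 u).deriv, h2.deriv, Denoiser.coef, sq (∑ i, _), Finset.sum_mul_sum,
    show ((2 * 1 : ℕ).factorial : ℝ) = 2 by norm_num, mul_div_cancel₀ _ (two_ne_zero : (2 : ℝ) ≠ 0)]
  exact Finset.sum_congr rfl fun i _ => Finset.sum_congr rfl fun j _ => by ring

section Standing

variable {m : Params} (hm : m.Standing)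
include hm

/-- The constant term is the square of the mean of the denoiser. -/
theorem coef_zero : m.φ.coef 0 = 0 := by
  have h : ∫ x, m.φ.eval x ∂gauss = ∑ i, m.φ.wt i := by
    simp only [Denoiser.eval]
    rw [integral_finsetSum _ fun i _ => (integrable_of_continuous_of_bounded (by fun_prop) 1
      fun x => Real.abs_cos_le_one _).const_mul _]
    refine Finset.sum_congr rfl fun i _ => ?_
    rw [integral_const_mul, (integral_exp_gauss _).1, Denoiser.wt]
  rw [hm.admissible.mean_zero] at h
  simp [Denoiser.coef, ← h]

/-- At correlation `1` the correlation function is the second moment of the denoiser. -/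
theorem corr_one : m.φ.corr 1 = 1 := by
  have h : ∀ p : ℝ × ℝ, m.φ.eval p.1 * m.φ.eval (1 * p.1 + √(1 - 1 ^ 2) * p.2) =
      m.φ.eval p.1 ^ 2 * 1 := fun p => by simp [sq]
  simp only [Denoiser.corr, h]
  rw [integral_prod_mul (fun x => m.φ.eval x ^ 2) fun _ => 1, hm.admissible.variance_one]
  simp

theorem coef_one_pos : 0 < m.φ.coef 1 := by
  refine lt_of_le_of_ne (coef_nonneg _ _) fun h => hm.curv_ne_zero ?_
  rw [curv_eq, ← h, mul_zero]

/-- The nonnegative coefficients sum to `corr 1 = 1`. -/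
theorem coef_one_le_one : m.φ.coef 1 ≤ 1 := by
  have h := hasSum_corr m.φ (u := 1) (by simp)
  simp only [one_pow, mul_one, corr_one hm] at h
  exact le_hasSum h 1 fun n _ => coef_nonneg _ n

theorem coef_one_le_Lam : m.φ.coef 1 ≤ 4 * m.Λ := by
  have h := hm.coeff_le 2
  have h2 := curv_eq m.φ
  rw [Denoiser.curv] at h2
  rw [h2, show ((2 : ℕ).factorial : ℝ) = 2 by norm_num, mul_div_cancel_left₀ _ two_ne_zero,
    abs_of_nonneg (coef_nonneg _ _)] at h
  linarith

/-- On `[-1, 1]` the correlation function is its quadratic term, up to a fourth power. -/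
theorem corr_bounds {u : ℝ} (hu : |u| ≤ 1) :
    m.φ.coef 1 * u ^ 2 ≤ m.φ.corr u ∧ m.φ.corr u ≤ m.φ.coef 1 * u ^ 2 + u ^ 4 ∧ m.φ.corr u ≤ 1 := by
  have h := hasSum_corr m.φ hu
  have h1 := hasSum_corr m.φ (u := 1) (by simp)
  simp only [one_pow, mul_one, corr_one hm] at h1
  have hu2 : u ^ 2 ≤ 1 := by rw [← sq_abs]; exact pow_le_one₀ (abs_nonneg _) hu
  have hpow : ∀ n, 0 ≤ u ^ (2 * n) ∧ u ^ (2 * n) ≤ 1 := fun n => by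
    rw [pow_mul]; exact ⟨by positivity, pow_le_one₀ (sq_nonneg u) hu2⟩
  refine ⟨?_, ?_, hasSum_le (fun n => mul_le_of_le_one_right (coef_nonneg _ n) (hpow n).2) h h1⟩
  · exact le_hasSum h 1 fun n _ => mul_nonneg (coef_nonneg _ n) (hpow n).1
  · have h2 : HasSum (fun n => if n = 1 then m.φ.coef 1 * u ^ 2 else 0) (m.φ.coef 1 * u ^ 2) := by
      convert hasSum_ite_eq 1 (m.φ.coef 1 * u ^ 2) using 1
    have h4 := h2.add (h1.mul_right (u ^ 4))
    rw [one_mul] at h4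
    refine hasSum_le (fun n => ?_) h h4
    have h3 : 0 ≤ m.φ.coef n * u ^ 4 := mul_nonneg (coef_nonneg _ n) (by positivity)
    match n with
    | 0 => simp [coef_zero hm]
    | 1 => simp only [if_true, mul_one]; linarith
    | n + 2 =>
      simp only [show n + 2 ≠ 1 by omega, if_false, zero_add]
      refine mul_le_mul_of_nonneg_left ?_ (coef_nonneg _ _)
      rw [show 2 * (n + 2) = 2 * n + 4 by ring, pow_add]
      exact mul_le_of_le_one_left (by positivity) (hpow n).2

theorem corr_sq_le {u : ℝ} (hu : |u| ≤ 1) :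
    m.φ.corr u ^ 2 ≤ 2 * m.φ.coef 1 ^ 2 * u ^ 4 + 2 * u ^ 6 := by
  obtain ⟨h1, h2, -⟩ := corr_bounds hm hu
  have h0 : 0 ≤ m.φ.coef 1 * u ^ 2 := mul_nonneg (coef_nonneg _ _) (sq_nonneg _)
  have hu2 : u ^ 2 ≤ 1 := by rw [← sq_abs]; exact pow_le_one₀ (abs_nonneg _) hu
  have h3 : u ^ 8 ≤ u ^ 6 := by
    rw [show u ^ 8 = u ^ 6 * u ^ 2 by ring]
    exact mul_le_of_le_one_right (by positivity) hu2
  calc m.φ.corr u ^ 2 ≤ (m.φ.coef 1 * u ^ 2 + u ^ 4) ^ 2 := pow_le_pow_left₀ (h0.trans h1) h2 2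
    _ ≤ 2 * (m.φ.coef 1 * u ^ 2) ^ 2 + 2 * (u ^ 4) ^ 2 := by
      nlinarith [sq_nonneg (m.φ.coef 1 * u ^ 2 - u ^ 4)]
    _ = 2 * m.φ.coef 1 ^ 2 * u ^ 4 + 2 * u ^ 8 := by ring
    _ ≤ _ := by linarith

end Standing

/-! ### Expressions that evaluate the denoiser and its correlation function -/

/-- The sum of a finite family of expressions. -/
noncomputable def sumExp : {L : ℕ} → (Fin L → RExp) → RExp
  | 0, _ => .const 0
  | _ + 1, e => .add (e 0) (sumExp fun i => e i.succ)

theorem sumExp_val (ω : Tape) (s : Mem) {L : ℕ} (e : Fin L → RExp) :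
    (sumExp e).val ω s = ∑ i, (e i).val ω s := by
  induction L with
  | zero => simp [sumExp]
  | succ L ih => rw [Fin.sum_univ_succ, ← ih]; rfl

/-- An expression for `φ (e)`. -/
noncomputable def evalExp (φ : Denoiser) (e : RExp) : RExp :=
  sumExp fun i => .mul (.const (φ.a i)) (.cos (.mul (.const (φ.b i)) e))

theorem evalExp_val (φ : Denoiser) (ω : Tape) (s : Mem) (e : RExp) :
    (evalExp φ e).val ω s = φ.eval (e.val ω s) := by
  simp [evalExp, sumExp_val, Denoiser.eval]

/-- An expression for the exponential in the closed form of the correlation function. -/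
noncomputable def corrTerm (p q : ℝ) (e : RExp) : RExp :=
  .exp
    (.div (.add (.mul (.add (.const p) (.mul (.const q) e)) (.add (.const p) (.mul (.const q) e)))
    (.mul (.mul (.const q) (.sqrt (.sub (.const 1) (.mul e e))))
      (.mul (.const q) (.sqrt (.sub (.const 1) (.mul e e)))))) (.const (-2)))

/-- An expression for `corr (e)`. -/
noncomputable def corrExp (φ : Denoiser) (e : RExp) : RExp :=
  sumExp fun i => sumExp fun j => .mul (.const (φ.a i * φ.a j / 2))
    (.add (corrTerm (φ.b i) (φ.b j) e) (corrTerm (φ.b i) (-φ.b j) e))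

theorem corrExp_val (φ : Denoiser) (ω : Tape) (s : Mem) (e : RExp) :
    (corrExp φ e).val ω s = φ.corr (e.val ω s) := by
  rw [corr_eq]
  simp only [corrExp, sumExp_val, RExp.val, corrTerm]
  refine Finset.sum_congr rfl fun i _ => Finset.sum_congr rfl fun j _ => ?_
  rw [mul_div_right_comm (φ.a i * φ.a j)]
  congr 2
  · congr 1
    ring_nf
  · congr 1
    ring_nf

end

section

/-! ### Moments of random sign sums -/

/-- Moment bounds for `∑ a, d a * x a` with signs `x a` on a finite probability space. Independence
of the signs enters through measure preserving maps `τ a` that flip the sign `x a` alone. -/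
theorem sign_moments {Ω ι : Type*} [Fintype Ω] [DecidableEq ι] (x : ι → Ω → ℝ) (τ : ι → Ω ≃ Ω)
    (hx : ∀ a ω, x a ω ^ 2 = 1) (hτ : ∀ a ω, x a (τ a ω) = -x a ω)
    (hτ' : ∀ a a', a' ≠ a → ∀ ω, x a' (τ a ω) = x a' ω) (d : ι → ℝ) (A : Finset ι) :
    ∑ ω, (∑ a ∈ A, d a * x a ω) ^ 2 ≤ Fintype.card Ω * ∑ a ∈ A, d a ^ 2 ∧
    ∑ ω, (∑ a ∈ A, d a * x a ω) ^ 4 ≤ Fintype.card Ω * (3 * (∑ a ∈ A, d a ^ 2) ^ 2) ∧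
    ∑ ω, (∑ a ∈ A, d a * x a ω) ^ 6 ≤ Fintype.card Ω * (15 * (∑ a ∈ A, d a ^ 2) ^ 3) := by
  induction A using Finset.induction_on with
  | empty => simp
  | insert a A ha ih =>
    obtain ⟨h2, h4, h6⟩ := ih
    simp only [Finset.sum_insert ha]
    set S : Ω → ℝ := fun ω => ∑ a ∈ A, d a * x a ω with hS
    set V := ∑ a ∈ A, d a ^ 2
    have hV : 0 ≤ V := Finset.sum_nonneg fun _ _ => sq_nonneg _
    have hN : (0 : ℝ) ≤ Fintype.card Ω := Nat.cast_nonneg _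
    -- flipping `x a` leaves `S` unchanged, so terms with an odd power of `x a` cancel
    have hodd : ∀ F : ℝ → ℝ, ∑ ω, x a ω * F (S ω) = 0 := fun F => by
      have h := Equiv.sum_comp (τ a) fun ω => x a ω * F (S ω)
      have hST : ∀ ω, S (τ a ω) = S ω := fun ω =>
        Finset.sum_congr rfl fun a' ha' => by rw [hτ' a a' (fun e => ha (e ▸ ha'))]
      simp only [hτ, hST, neg_mul, Finset.sum_neg_distrib] at h
      linarith
    have e2 : ∀ ω, (d a * x a ω + S ω) ^ 2 = S ω ^ 2 + d a ^ 2 + x a ω * (2 * d a * S ω) :=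
      fun ω => by linear_combination d a ^ 2 * hx a ω
    have e4 : ∀ ω, (d a * x a ω + S ω) ^ 4 = S ω ^ 4 + 6 * d a ^ 2 * S ω ^ 2 + d a ^ 4 +
        x a ω * (4 * d a * S ω ^ 3 + 4 * d a ^ 3 * S ω) := fun ω => by
      linear_combination (6 * S ω ^ 2 * d a ^ 2 + 4 * S ω * d a ^ 3 * x a ω +
        d a ^ 4 * (x a ω ^ 2 + 1)) * hx a ω
    have e6 : ∀ ω, (d a * x a ω + S ω) ^ 6 = S ω ^ 6 + 15 * d a ^ 2 * S ω ^ 4 +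
        15 * d a ^ 4 * S ω ^ 2 + d a ^ 6 +
        x a ω * (6 * d a * S ω ^ 5 + 20 * d a ^ 3 * S ω ^ 3 + 6 * d a ^ 5 * S ω) := fun ω => by
      linear_combination (15 * S ω ^ 4 * d a ^ 2 + 20 * S ω ^ 3 * d a ^ 3 * x a ω +
        15 * S ω ^ 2 * d a ^ 4 * (x a ω ^ 2 + 1) + 6 * S ω * d a ^ 5 * x a ω * (x a ω ^ 2 + 1) +
        d a ^ 6 * (x a ω ^ 4 + x a ω ^ 2 + 1)) * hx a ω
    have o2 := hodd fun y => 2 * d a * y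
    have o4 := hodd fun y => 4 * d a * y ^ 3 + 4 * d a ^ 3 * y
    have o6 := hodd fun y => 6 * d a * y ^ 5 + 20 * d a ^ 3 * y ^ 3 + 6 * d a ^ 5 * y
    simp only [hS] at e2 e4 e6 o2 o4 o6
    simp only [e2, e4, e6, Finset.sum_add_distrib, o2, o4, o6, ← Finset.mul_sum, Finset.sum_const,
      Finset.card_univ, nsmul_eq_mul, add_zero]
    refine ⟨by linarith, ?_, ?_⟩
    · have := mul_le_mul_of_nonneg_left h2 (show 0 ≤ 6 * d a ^ 2 by positivity)
      have h0 : 0 ≤ (Fintype.card Ω : ℝ) * d a ^ 4 := by positivity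
      calc _ ≤ Fintype.card Ω * (3 * V ^ 2) + 6 * d a ^ 2 * (Fintype.card Ω * V) +
            Fintype.card Ω * d a ^ 4 := by linarith
        _ ≤ _ := by linarith
    · have h7 := mul_le_mul_of_nonneg_left h2 (show 0 ≤ 15 * d a ^ 4 by positivity)
      have h8 := mul_le_mul_of_nonneg_left h4 (show 0 ≤ 15 * d a ^ 2 by positivity)
      have h0 : 0 ≤ (Fintype.card Ω : ℝ) * d a ^ 6 := by positivity
      have h9 : 0 ≤ (Fintype.card Ω : ℝ) * (d a ^ 4 * V) := by positivity
      calc _ ≤ Fintype.card Ω * (15 * V ^ 3) + 15 * d a ^ 2 * (Fintype.card Ω * (3 * V ^ 2)) +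
            15 * d a ^ 4 * (Fintype.card Ω * V) + Fintype.card Ω * d a ^ 6 := by linarith
        _ ≤ _ := by linarith

/-- The sign of a coin. -/
def sgn (b : Bool) : ℝ := if b then 1 else -1

theorem sgn_sq (b : Bool) : sgn b ^ 2 = 1 := by cases b <;> simp [sgn]

theorem sgn_not (b : Bool) : sgn (!b) = -sgn b := by cases b <;> simp [sgn]

variable {k l q : ℕ}

theorem abs_sum_sgn_le {d : Fin q → ℝ} (hd : ∑ a, |d a| ≤ 1) (b : Fin q → Fin l → Bool)
    (i j : Fin l) : |∑ a, d a * (sgn (b a i) * sgn (b a j))| ≤ 1 := by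
  refine (Finset.abs_sum_le_sum_abs _ _).trans ((Finset.sum_le_sum fun a _ => ?_).trans hd)
  rw [abs_mul]
  refine mul_le_of_le_one_right (abs_nonneg _) (le_of_eq ?_)
  rw [← sq_eq_sq₀ (abs_nonneg _) zero_le_one, sq_abs, mul_pow, sgn_sq, sgn_sq]
  norm_num

/-- Off the diagonal, the correlation function of the form `∑ a, d a * β a i * β a j` in a random
sign matrix `β` is small in mean square. -/
theorem sum_corr_sq_le {m : Params} (hm : m.Standing) {d : Fin q → ℝ} (hd : ∑ a, |d a| ≤ 1)
    {i j : Fin l} (hij : i ≠ j) :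
    ∑ b : Fin q → Fin l → Bool, m.φ.corr (∑ a, d a * (sgn (b a i) * sgn (b a j))) ^ 2 ≤
      Fintype.card (Fin q → Fin l → Bool) * (6 * m.φ.coef 1 ^ 2 * (∑ a, d a ^ 2) ^ 2 +
        30 * (∑ a, d a ^ 2) ^ 3) := by
  have hflip : ∀ a : Fin q, Function.Involutive fun b : Fin q → Fin l → Bool =>
      Function.update b a (Function.update (b a) i (!b a i)) := fun a b => by
    simp
  obtain ⟨-, h4, h6⟩ := sign_moments (fun (a : Fin q) (b : Fin q → Fin l → Bool) =>
    sgn (b a i) * sgn (b a j)) (fun a => (hflip a).toPerm)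
    (fun a b => by rw [mul_pow, sgn_sq, sgn_sq, one_mul])
    (fun a b => by simp [Function.Involutive.coe_toPerm, hij.symm, sgn_not])
    (fun a a' h b => by simp [Function.Involutive.coe_toPerm, h]) d Finset.univ
  calc _ ≤ ∑ b : Fin q → Fin l → Bool,
        (2 * m.φ.coef 1 ^ 2 * (∑ a, d a * (sgn (b a i) * sgn (b a j))) ^ 4 +
          2 * (∑ a, d a * (sgn (b a i) * sgn (b a j))) ^ 6) :=
        Finset.sum_le_sum fun b _ => corr_sq_le hm (abs_sum_sgn_le hd b i j)
    _ ≤ _ := by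
      rw [Finset.sum_add_distrib, ← Finset.mul_sum, ← Finset.mul_sum]
      have := mul_le_mul_of_nonneg_left h4 (show 0 ≤ 2 * m.φ.coef 1 ^ 2 by positivity)
      linarith

/-! ### The spectral assumption holds with probability at least one half -/

/-- The squared Frobenius distance to `c` times the identity is the sum of the squares of the
deviations of the eigenvalues from `c`. -/
theorem sum_eigenvalue_dev {M Q : Matrix (Fin k) (Fin k) ℝ} {x : Fin k → ℝ}
    (h : IsSpectralDecomposition M x Q) (c : ℝ) :
    ∑ j, (x j - c) ^ 2 = ∑ i, ∑ j, (M i j - if i = j then c else 0) ^ 2 := by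
  have htr : ∀ N : Matrix (Fin k) (Fin k) ℝ, ∑ i, ∑ j, N i j ^ 2 = (Nᵀ * N).trace := fun N => by
    rw [Finset.sum_comm]
    simp only [Matrix.trace, Matrix.diag_apply, Matrix.mul_apply, Matrix.transpose_apply, sq]
  have h1 : (M - c • 1) * Q = Q * Matrix.diagonal fun j => x j - c := by
    rw [sub_mul, h.2, smul_mul_assoc, one_mul]
    ext i j
    simp [Matrix.mul_diagonal]
    ring
  have h2 : M - c • 1 = Q * (Matrix.diagonal fun j => x j - c) * Qᵀ := by
    rw [← h1, mul_assoc, h.mul_transpose, mul_one]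
  have h3 : ∑ i, ∑ j, (M i j - if i = j then c else 0) ^ 2 =
      ∑ i, ∑ j, (M - c • 1) i j ^ 2 := by
    simp [Matrix.one_apply]
  rw [h3, htr, h2, Matrix.transpose_mul, Matrix.transpose_mul, Matrix.transpose_transpose,
    Matrix.diagonal_transpose, show Q * (Matrix.diagonal (fun j => x j - c) * Qᵀ) *
      (Q * Matrix.diagonal (fun j => x j - c) * Qᵀ) = Q * (Matrix.diagonal (fun j => x j - c) *
      (Qᵀ * Q) * Matrix.diagonal (fun j => x j - c)) * Qᵀ by simp only [mul_assoc], h.1, mul_one,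
    Matrix.diagonal_mul_diagonal, Matrix.trace_mul_comm, ← mul_assoc, h.1, one_mul,
    Matrix.trace_diagonal]
  exact Finset.sum_congr rfl fun i _ => sq _

/-- A symmetric matrix that is close to `c` times the identity in the Frobenius norm has few
eigenvalues outside `(0.9 c, 1.1 c)`. -/
theorem le_card_eigenvalues {M : Matrix (Fin k) (Fin k) ℝ} (hM : M.IsSymm) {c : ℝ} (hc : 0 < c)
    (hk : 12 ∣ k)
    (h : ∑ i, ∑ j, (M i j - if i = j then c else 0) ^ 2 ≤ 0.01 * c ^ 2 * (k / 4)) :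
    3 * k / 4 ≤ (Finset.univ.filter fun j => 0.9 * c < (spectralDecomposition M).1 j ∧
      (spectralDecomposition M).1 j < 1.1 * c).card := by
  have hQ := isSpectralDecomposition_spectralDecomposition hM
  rw [← sum_eigenvalue_dev hQ] at h
  set x := (spectralDecomposition M).1
  have h1 : ((Finset.univ.filter fun j => ¬ (0.9 * c < x j ∧ x j < 1.1 * c)).card : ℝ) *
      (0.01 * c ^ 2) ≤ 0.01 * c ^ 2 * (k / 4) := by
    refine le_trans ?_ h
    rw [← nsmul_eq_mul, ← Finset.sum_const]
    refine le_trans (Finset.sum_le_sum (g := fun j => (x j - c) ^ 2) fun j hj => ?_)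
      (Finset.sum_le_sum_of_subset_of_nonneg (Finset.subset_univ _) fun _ _ _ => sq_nonneg _)
    rw [Finset.mem_filter, not_and_or, not_lt, not_lt] at hj
    rcases hj.2 with h | h <;> nlinarith
  have h2 : ((Finset.univ.filter fun j => ¬ (0.9 * c < x j ∧ x j < 1.1 * c)).card : ℝ) ≤ k / 4 := by
    refine le_of_mul_le_mul_right ?_ (show 0 < 0.01 * c ^ 2 by positivity)
    linarith
  have h3 := Finset.card_filter_add_card_filter_not (s := Finset.univ)
    (fun j => 0.9 * c < x j ∧ x j < 1.1 * c)
  rw [Finset.card_univ, Fintype.card_fin] at h3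
  rw [le_div_iff₀ (by norm_num)] at h2
  have h4 : (Finset.univ.filter fun j => ¬ (0.9 * c < x j ∧ x j < 1.1 * c)).card * 4 ≤ k := by
    exact_mod_cast h2
  omega

/-- The sign matrix of a finite table of coins. -/
noncomputable def signTable (k : ℕ) (b : Fin (k / 12) → Fin l → Bool) :
    Matrix (Fin (k / 12)) (Fin l) ℝ :=
  fun i j => if b i j then √(12 / (k : ℝ)) else -√(12 / (k : ℝ))

/-- The forms in the definition of the next triple are weighted sums of signs. -/
theorem signTable_form {D : Matrix (Fin (k / 12)) (Fin (k / 12)) ℝ} (hD : D.IsDiag)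
    (b : Fin (k / 12) → Fin l → Bool) (i j : Fin l) :
    ((signTable k b)ᵀ * D * signTable k b) i j =
      ∑ a, 12 / (k : ℝ) * D a a * (sgn (b a i) * sgn (b a j)) := by
  have hs : ∀ a i, signTable k b a i = √(12 / (k : ℝ)) * sgn (b a i) := fun a i => by
    unfold signTable sgn; split_ifs <;> ring
  have h2 : √(12 / (k : ℝ)) * √(12 / (k : ℝ)) = 12 / k := Real.mul_self_sqrt (by positivity)
  rw [Matrix.mul_apply]
  refine Finset.sum_congr rfl fun a _ => ?_
  rw [Matrix.mul_apply, Finset.sum_eq_single a (fun c _ hc => by rw [hD hc, mul_zero]) (by simp),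
    Matrix.transpose_apply, hs, hs]
  calc _ = √(12 / (k : ℝ)) * √(12 / (k : ℝ)) * D a a * (sgn (b a i) * sgn (b a j)) := by ring
    _ = _ := by rw [h2]

/-- Markov's inequality for the deviation from a multiple of the identity. -/
theorem card_bad_le {m : Params} (hm : m.Standing) {d : Fin q → ℝ} (hd : ∑ a, |d a| ≤ 1) {V c : ℝ}
    (hV : ∑ a, d a ^ 2 ≤ V) (hc : 0 < c) (hcd : c = m.φ.corr (∑ a, d a)) (hl : 0 < l)
    (hsmall : 1600 * l * (6 * m.φ.coef 1 ^ 2 * V ^ 2 + 30 * V ^ 3) ≤ c ^ 2)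
    (p : (Fin q → Fin l → Bool) → Prop)
    [DecidablePred p] (hp : ∀ b, p b → 0.01 * c ^ 2 * (l / 4) < ∑ i, ∑ j,
      (m.φ.corr (∑ a, d a * (sgn (b a i) * sgn (b a j))) - if i = j then c else 0) ^ 2) :
    4 * (Finset.univ.filter p).card ≤ Fintype.card (Fin q → Fin l → Bool) := by
  set N := Fintype.card (Fin q → Fin l → Bool)
  have hV0 : 0 ≤ ∑ a, d a ^ 2 := Finset.sum_nonneg fun _ _ => sq_nonneg _
  have h1 : ((Finset.univ.filter p).card : ℝ) * (0.01 * c ^ 2 * (l / 4)) ≤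
      N * (l ^ 2 * (6 * m.φ.coef 1 ^ 2 * V ^ 2 + 30 * V ^ 3)) := by
    rw [← nsmul_eq_mul, ← Finset.sum_const]
    refine le_trans (Finset.sum_le_sum fun b hb => (hp b (Finset.mem_filter.1 hb).2).le) ?_
    refine le_trans (Finset.sum_le_sum_of_subset_of_nonneg (Finset.subset_univ _) fun _ _ _ =>
      Finset.sum_nonneg fun _ _ => Finset.sum_nonneg fun _ _ => sq_nonneg _) ?_
    rw [Finset.sum_comm]
    have h2 : ∀ i j : Fin l, ∑ b : Fin q → Fin l → Bool,
        (m.φ.corr (∑ a, d a * (sgn (b a i) * sgn (b a j))) - if i = j then c else 0) ^ 2 ≤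
        N * (6 * m.φ.coef 1 ^ 2 * V ^ 2 + 30 * V ^ 3) := fun i j => by
      have hV0' := hV0.trans hV
      by_cases hij : i = j
      · subst hij
        have h3 : ∀ b : Fin q → Fin l → Bool,
            (m.φ.corr (∑ a, d a * (sgn (b a i) * sgn (b a i))) - if i = i then c else 0) ^ 2 = 0 :=
          fun b => by simp [← sq, sgn_sq, hcd]
        rw [Finset.sum_congr rfl fun b _ => h3 b, Finset.sum_const_zero]
        positivity
      · simp only [if_neg hij, sub_zero]
        refine (sum_corr_sq_le hm hd hij).trans ?_
        gcongr
    calc _ = ∑ i, ∑ j, ∑ b : Fin q → Fin l → Bool,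
        (m.φ.corr (∑ a, d a * (sgn (b a i) * sgn (b a j))) - if i = j then c else 0) ^ 2 :=
          Finset.sum_congr rfl fun i _ => Finset.sum_comm
      _ ≤ ∑ _i : Fin l, ∑ _j : Fin l, N * (6 * m.φ.coef 1 ^ 2 * V ^ 2 + 30 * V ^ 3) :=
          Finset.sum_le_sum fun i _ => Finset.sum_le_sum fun j _ => h2 i j
      _ = _ := by simp; ring
  have hl' : (0 : ℝ) < l := by exact_mod_cast hl
  have h4 : ((Finset.univ.filter p).card : ℝ) * (4 * (c ^ 2 * l)) ≤ N * (c ^ 2 * l) := by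
    have h5 := mul_le_mul_of_nonneg_left hsmall (show (0 : ℝ) ≤ N * l by positivity)
    linarith
  have h6 : (0 : ℝ) < c ^ 2 * l := by positivity
  have h7 : (4 * (Finset.univ.filter p).card : ℝ) ≤ N := by
    refine le_of_mul_le_mul_right ?_ h6
    linarith
  exact_mod_cast h7

/-- The properties of a triple and of `Ξ` that make the next triple satisfy the spectral assumption
with probability at least one half. -/
structure Healthy {k : ℕ} (s : SpecState k) (Ξ : Matrix (Fin k) (Fin (k / 12)) ℝ) : Prop where
  psi_symm : s.Psi.IsSymm
  eps_pos : 0 < s.eps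
  eps_le : s.eps ≤ 1
  diag : (Ξᵀ * s.Psi * Ξ).IsDiag
  mem : ∀ j, (Ξᵀ * s.Psi * Ξ) j j ∈ Set.Ioo (0.9 / 1.1 * s.eps) (1.1 / 0.9 * s.eps)

theorem next_phi_symm (m : Params) (s : SpecState k) (Ξ : Matrix (Fin k) (Fin (k / 12)) ℝ)
    (β : Matrix (Fin (k / 12)) (Fin l) ℝ) : (s.next m Ξ β).Phi.IsSymm := by
  ext i j
  have h : (βᵀ * β)ᵀ = βᵀ * β := by rw [Matrix.transpose_mul, Matrix.transpose_transpose]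
  exact congrArg m.φ.corr (congrFun (congrFun h i) j)

theorem next_psi_symm (m : Params) {s : SpecState k} (hs : s.Psi.IsSymm)
    (Ξ : Matrix (Fin k) (Fin (k / 12)) ℝ) (β : Matrix (Fin (k / 12)) (Fin l) ℝ) :
    (s.next m Ξ β).Psi.IsSymm := by
  ext i j
  have h := isSymm_conj (isSymm_conj hs Ξ) β
  exact congrArg (fun x => m.φ.corr (m.ρ / 2 * x)) (congrFun (congrFun h i) j)

section Healthy

variable {m : Params} (hm : m.Standing) {s : SpecState k}
  {Ξ : Matrix (Fin k) (Fin (k / 12)) ℝ} (hs : Healthy s Ξ) (hk : 12 ∣ k) (hk0 : 0 < k)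
include hm hs hk hk0

/-- The argument at which the next `ε` is evaluated. -/
theorem Healthy.arg_bounds : 0.8 * (m.ρ / 2 * s.eps) ≤
      m.ρ / 2 * (12 / (k : ℝ) * (Ξᵀ * s.Psi * Ξ).trace) ∧
    m.ρ / 2 * (12 / (k : ℝ) * (Ξᵀ * s.Psi * Ξ).trace) ≤ 1.25 * (m.ρ / 2 * s.eps) := by
  have hq : (0 : ℝ) < (k / 12 : ℕ) := by
    have : 0 < k / 12 := by omega
    exact_mod_cast this
  have hkq : (k : ℝ) = 12 * (k / 12 : ℕ) := by
    have : k = 12 * (k / 12) := by omega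
    exact_mod_cast this
  have hρ := hm.rho_pos
  have hε := hs.eps_pos
  have h1 : (k / 12 : ℕ) * (0.8 * s.eps) ≤ (Ξᵀ * s.Psi * Ξ).trace := by
    have e : ((k / 12 : ℕ) : ℝ) * (0.8 * s.eps) = ∑ _j : Fin (k / 12), 0.8 * s.eps := by simp
    rw [Matrix.trace, e]
    refine Finset.sum_le_sum fun j _ => ?_
    have h := (hs.mem j).1
    have e : 0.8 * s.eps ≤ 0.9 / 1.1 * s.eps := by gcongr; norm_num
    exact e.trans h.le
  have h2 : (Ξᵀ * s.Psi * Ξ).trace ≤ (k / 12 : ℕ) * (1.25 * s.eps) := by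
    have e : ((k / 12 : ℕ) : ℝ) * (1.25 * s.eps) = ∑ _j : Fin (k / 12), 1.25 * s.eps := by simp
    rw [Matrix.trace, e]
    refine Finset.sum_le_sum fun j _ => ?_
    have h := (hs.mem j).2
    have e : 1.1 / 0.9 * s.eps ≤ 1.25 * s.eps := by gcongr; norm_num
    exact h.le.trans e
  have h3 : 12 / (k : ℝ) * (Ξᵀ * s.Psi * Ξ).trace = (Ξᵀ * s.Psi * Ξ).trace / (k / 12 : ℕ) := by
    rw [hkq]; field_simp
  rw [h3, show 0.8 * (m.ρ / 2 * s.eps) = m.ρ / 2 * (0.8 * s.eps) by ring,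
    show 1.25 * (m.ρ / 2 * s.eps) = m.ρ / 2 * (1.25 * s.eps) by ring]
  exact ⟨mul_le_mul_of_nonneg_left (by rw [le_div_iff₀ hq]; linarith) (by linarith),
    mul_le_mul_of_nonneg_left (by rw [div_le_iff₀ hq]; linarith) (by linarith)⟩

theorem Healthy.arg_abs_le : |m.ρ / 2 * (12 / (k : ℝ) * (Ξᵀ * s.Psi * Ξ).trace)| ≤ 1 := by
  obtain ⟨h1, h2⟩ := hs.arg_bounds hm hk hk0
  have h3 : 0 < m.ρ / 2 * s.eps := mul_pos (by linarith [hm.rho_pos]) hs.eps_pos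
  have h4 : m.ρ / 2 * s.eps ≤ 1 / 2 * 1 := mul_le_mul (by linarith [hm.rho_lt_one]) hs.eps_le
    hs.eps_pos.le (by norm_num)
  rw [abs_le]
  constructor <;> linarith

/-- The next `ε` stays positive, and it is of the order of `(ρ / 2 * ε) ^ 2`: the deviations of the
next `Ψ` are compared with it. -/
theorem Healthy.eps_next (β : Matrix (Fin (k / 12)) (Fin l) ℝ) :
    0.64 * m.φ.coef 1 * (m.ρ / 2 * s.eps) ^ 2 ≤ (s.next m Ξ β).eps ∧
    0 < (s.next m Ξ β).eps ∧ (s.next m Ξ β).eps ≤ 1 := by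
  obtain ⟨h1, h2⟩ := hs.arg_bounds hm hk hk0
  obtain ⟨h3, -, h4⟩ := corr_bounds hm (hs.arg_abs_le hm hk hk0)
  have h5 : 0 < m.ρ / 2 * s.eps := mul_pos (by linarith [hm.rho_pos]) hs.eps_pos
  have h6 := coef_one_pos hm
  have h7 : 0.64 * m.φ.coef 1 * (m.ρ / 2 * s.eps) ^ 2 ≤ (s.next m Ξ β).eps := by
    refine le_trans ?_ h3
    calc _ = m.φ.coef 1 * (0.8 * (m.ρ / 2 * s.eps)) ^ 2 := by ring
      _ ≤ _ := by gcongr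
  exact ⟨h7, lt_of_lt_of_le (by positivity) h7, h4⟩

open Classical in
/-- Two bad events of probability at most one quarter each: the next `Φ` deviates from the identity,
or the next `Ψ` from the next `ε` times the identity. With `q = k / 12` rows, the expected squared
deviation of `Φ` is of order `l ^ 2 / q ^ 2`, and that of `Ψ`, relative to `ε ^ 2`, is of order
`l ^ 2 / q ^ 2 + l ^ 2 / (coef 1 ^ 2 * q ^ 3)`. By `h1` and `h2`, both are small multiples of `l`. -/
theorem card_not_good_le (hl0 : 0 < l) (hl : 12 ∣ l)
    (h1 : (l : ℝ) ≤ 10⁻¹ ^ 16 * (k / 12 : ℕ) ^ 2)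
    (h2 : (l : ℝ) ≤ 10⁻¹ ^ 10 * m.φ.coef 1 ^ 2 * (k / 12 : ℕ) ^ 3) :
    2 * (Finset.univ.filter fun b : Fin (k / 12) → Fin l → Bool =>
      ¬ (s.next m Ξ (signTable k b)).Good).card ≤
      Fintype.card (Fin (k / 12) → Fin l → Bool) := by
  have hq : (1 : ℝ) ≤ (k / 12 : ℕ) := by
    have : 1 ≤ k / 12 := by omega
    exact_mod_cast this
  have hkq : 12 / (k : ℝ) = ((k / 12 : ℕ) : ℝ)⁻¹ := by
    have : (k : ℝ) = 12 * (k / 12 : ℕ) := by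
      have : k = 12 * (k / 12) := by omega
      exact_mod_cast this
    rw [this]; field_simp
  set D := Ξᵀ * s.Psi * Ξ with hD
  have hcp := coef_one_pos hm
  have hc1 := coef_one_le_one hm
  set c1 := m.φ.coef 1
  have hρ := hm.rho_pos
  have hρ1 := hm.rho_lt_one
  have hε := hs.eps_pos
  have hε1 := hs.eps_le
  set r := m.ρ / 2 * s.eps with hr
  have hr0 : 0 < r := by positivity
  have hr1 : r ≤ 1 / 2 := by
    calc r ≤ 1 / 2 * 1 := mul_le_mul (by linarith) hε1 hε.le (by norm_num)
      _ = _ := by norm_num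
  have hDa : ∀ a, 0 ≤ D a a ∧ D a a ≤ 1.25 * s.eps := fun a => by
    obtain ⟨h3, h4⟩ := hs.mem a
    refine ⟨le_trans (by positivity) h3.le, h4.le.trans ?_⟩
    gcongr; norm_num
  have hl0' : (0 : ℝ) < l := by exact_mod_cast hl0
  have hq0 : (0 : ℝ) < (k / 12 : ℕ) := by linarith
  -- the two deviations from multiples of the identity
  obtain ⟨p₁, hp₁, bad1⟩ : ∃ p₁ : (Fin (k / 12) → Fin l → Bool) → Prop,
      (∀ b, ¬ p₁ b → ∑ i, ∑ j, (m.φ.corr (∑ a, ((k / 12 : ℕ) : ℝ)⁻¹ * (sgn (b a i) * sgn (b a j))) -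
        if i = j then 1 else 0) ^ 2 ≤ 0.01 * (1 : ℝ) ^ 2 * (l / 4)) ∧
      4 * (Finset.univ.filter p₁).card ≤ Fintype.card (Fin (k / 12) → Fin l → Bool) :=
    ⟨_, fun b h => not_lt.1 h, card_bad_le (l := l) hm (d := fun _ : Fin (k / 12) =>
      ((k / 12 : ℕ) : ℝ)⁻¹) (V := ((k / 12 : ℕ) : ℝ)⁻¹) (c := 1)
    (by simp [abs_of_pos hq0, hq0.ne'])
    (by simp only [Finset.sum_const, Finset.card_univ, Fintype.card_fin, nsmul_eq_mul]
        rw [sq, ← mul_assoc, mul_inv_cancel₀ hq0.ne', one_mul])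
    one_pos (by simp [hq0.ne', corr_one hm]) hl0
    (by
      have e : 1600 * (l : ℝ) *
        (6 * c1 ^ 2 * ((k / 12 : ℕ) : ℝ)⁻¹ ^ 2 + 30 * ((k / 12 : ℕ) : ℝ)⁻¹ ^ 3) =
          1600 * ((6 * c1 ^ 2 + 30 * ((k / 12 : ℕ) : ℝ)⁻¹) *
            (l / ((k / 12 : ℕ) : ℝ) ^ 2)) := by field_simp
      have e1 : l / ((k / 12 : ℕ) : ℝ) ^ 2 ≤ 10⁻¹ ^ 16 := by
        rw [div_le_iff₀ (by positivity)]; exact h1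
      have e2 : 6 * c1 ^ 2 + 30 * ((k / 12 : ℕ) : ℝ)⁻¹ ≤ 6 * 1 ^ 2 + 30 * 1 := by
        have : ((k / 12 : ℕ) : ℝ)⁻¹ ≤ 1 := inv_le_one_of_one_le₀ hq
        gcongr
      rw [e]
      calc _ ≤ 1600 * ((6 * 1 ^ 2 + 30 * 1) * (10⁻¹ ^ 16 : ℝ)) := by gcongr
        _ ≤ _ := by norm_num)
    (fun b => 0.01 * (1 : ℝ) ^ 2 * (l / 4) < ∑ i, ∑ j, (m.φ.corr (∑ a, ((k / 12 : ℕ) : ℝ)⁻¹ *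
      (sgn (b a i) * sgn (b a j))) - if i = j then 1 else 0) ^ 2) (fun b h => h)⟩
  have heq : ∀ b : Fin (k / 12) → Fin l → Bool, (s.next m Ξ (signTable k b)).eps =
      m.φ.corr (m.ρ / 2 * (12 / (k : ℝ) * D.trace)) := fun b => rfl
  obtain ⟨hlow, hpos, -⟩ :=
    hs.eps_next hm hk hk0 (signTable k fun (_ : Fin (k / 12)) (_ : Fin l) => true)
  rw [heq] at hlow hpos
  set ε' := m.φ.corr (m.ρ / 2 * (12 / (k : ℝ) * D.trace)) with hε'
  have hd : ∀ a, 0 ≤ m.ρ / 2 * (((k / 12 : ℕ) : ℝ)⁻¹ * D a a) ∧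
      m.ρ / 2 * (((k / 12 : ℕ) : ℝ)⁻¹ * D a a) ≤ 1.25 * r * ((k / 12 : ℕ) : ℝ)⁻¹ := fun a => by
    have := (hDa a).1
    refine ⟨by positivity, ?_⟩
    calc m.ρ / 2 * (((k / 12 : ℕ) : ℝ)⁻¹ * D a a) ≤ m.ρ / 2 *
            (((k / 12 : ℕ) : ℝ)⁻¹ * (1.25 * s.eps)) := by
          have := (hDa a).2
          gcongr
      _ = _ := by rw [hr]; ring
  obtain ⟨p₂, hp₂, bad2⟩ : ∃ p₂ : (Fin (k / 12) → Fin l → Bool) → Prop,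
      (∀ b, ¬ p₂ b → ∑ i, ∑ j, (m.φ.corr (∑ a, m.ρ / 2 * (((k / 12 : ℕ) : ℝ)⁻¹ * D a a) *
        (sgn (b a i) * sgn (b a j))) - if i = j then ε' else 0) ^ 2 ≤ 0.01 * ε' ^ 2 * (l / 4)) ∧
      4 * (Finset.univ.filter p₂).card ≤ Fintype.card (Fin (k / 12) → Fin l → Bool) :=
    ⟨_, fun b h => not_lt.1 h, card_bad_le (l := l) hm (d := fun a : Fin (k / 12) => m.ρ / 2 *
      (((k / 12 : ℕ) : ℝ)⁻¹ * D a a))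
    (V := 1.5625 * r ^ 2 * ((k / 12 : ℕ) : ℝ)⁻¹) (c := ε')
    (by
      calc _ ≤ ∑ _a : Fin (k / 12), 1.25 * r * ((k / 12 : ℕ) : ℝ)⁻¹ :=
              Finset.sum_le_sum fun a _ => by
            rw [abs_of_nonneg (hd a).1]; exact (hd a).2
        _ = 1.25 * r := by simp; field_simp
        _ ≤ 1 := by linarith)
    (by
      calc _ ≤ ∑ _a : Fin (k / 12), (1.25 * r * ((k / 12 : ℕ) : ℝ)⁻¹) ^ 2 :=
              Finset.sum_le_sum fun a _ =>
            pow_le_pow_left₀ (hd a).1 (hd a).2 2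
        _ = _ := by
          simp only [Finset.sum_const, Finset.card_univ, Fintype.card_fin, nsmul_eq_mul]
          field_simp
          norm_num)
    hpos (by rw [hε', hkq, ← Finset.mul_sum, ← Finset.mul_sum]; rfl) hl0
    (by
      have e : 1600 * (l : ℝ) * (6 * c1 ^ 2 * (1.5625 * r ^ 2 * ((k / 12 : ℕ) : ℝ)⁻¹) ^ 2 +
          30 * (1.5625 * r ^ 2 * ((k / 12 : ℕ) : ℝ)⁻¹) ^ 3) =
          1600 * r ^ 4 * (6 * 1.5625 ^ 2 * c1 ^ 2 * (l / ((k / 12 : ℕ) : ℝ) ^ 2) +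
            30 * 1.5625 ^ 3 * r ^ 2 * (l / ((k / 12 : ℕ) : ℝ) ^ 3)) := by
        field_simp
      have e1 : l / ((k / 12 : ℕ) : ℝ) ^ 2 ≤ 10⁻¹ ^ 16 := by
        rw [div_le_iff₀ (by positivity)]; exact h1
      have e2 : l / ((k / 12 : ℕ) : ℝ) ^ 3 ≤ 10⁻¹ ^ 10 * c1 ^ 2 := by
        rw [div_le_iff₀ (by positivity)]; exact h2
      have e3 : r ^ 2 ≤ (1 / 2) ^ 2 := pow_le_pow_left₀ hr0.le hr1 2
      rw [e]
      calc _ ≤ 1600 * r ^ 4 * (6 * 1.5625 ^ 2 * c1 ^ 2 * 10⁻¹ ^ 16 +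
            30 * 1.5625 ^ 3 * (1 / 2) ^ 2 * (10⁻¹ ^ 10 * c1 ^ 2)) := by gcongr
        _ = (1600 * (6 * 1.5625 ^ 2 * 10⁻¹ ^ 16 + 30 * 1.5625 ^ 3 * (1 / 2) ^ 2 * 10⁻¹ ^ 10)) *
            (c1 ^ 2 * r ^ 4) := by ring
        _ ≤ 0.4096 * (c1 ^ 2 * r ^ 4) := by gcongr; norm_num
        _ = (0.64 * c1 * r ^ 2) ^ 2 := by ring
        _ ≤ _ := pow_le_pow_left₀ (by positivity) hlow 2)
    (fun b => 0.01 * ε' ^ 2 * (l / 4) < ∑ i, ∑ j,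
      (m.φ.corr (∑ a, m.ρ / 2 * (((k / 12 : ℕ) : ℝ)⁻¹ * D a a) *
      (sgn (b a i) * sgn (b a j))) - if i = j then ε' else 0) ^ 2) (fun b h => h)⟩
  have hun := Finset.card_union_le (Finset.univ.filter p₁) (Finset.univ.filter p₂)
  refine le_trans (Nat.mul_le_mul_left 2 ((Finset.card_le_card (fun b hb => ?_)).trans hun))
    (by linarith [bad1, bad2])
  have hb' := (Finset.mem_filter.1 hb).2
  rw [Finset.mem_union, Finset.mem_filter, Finset.mem_filter]
  by_contra hcon
  simp only [Finset.mem_univ, true_and, not_or] at hcon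
  have hcon : _ ∧ _ := ⟨hp₁ b hcon.1, hp₂ b hcon.2⟩
  refine hb' ((spectralAssumption_iff (next_phi_symm m s Ξ _)
    (next_psi_symm m hs.psi_symm Ξ _)).2 ⟨?_, ?_⟩)
  · have h3 := le_card_eigenvalues (next_phi_symm m s Ξ (signTable k b)) one_pos hl (by
      have h5 : ∀ i j, (s.next m Ξ (signTable k b)).Phi i j =
          m.φ.corr (∑ a, ((k / 12 : ℕ) : ℝ)⁻¹ * (sgn (b a i) * sgn (b a j))) := fun i j => by
        have h4 := signTable_form (k := k) (l := l) Matrix.isDiag_one b i j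
        rw [Matrix.mul_one] at h4
        simp only [SpecState.next, h4, Matrix.one_apply_eq, mul_one, hkq]
      simp only [h5]
      exact hcon.1)
    simpa only [mul_one] using h3
  · refine le_card_eigenvalues (next_psi_symm m hs.psi_symm Ξ (signTable k b)) hpos hl ?_
    have h5 : ∀ i j, (s.next m Ξ (signTable k b)).Psi i j = m.φ.corr (∑ a,
        m.ρ / 2 * (((k / 12 : ℕ) : ℝ)⁻¹ * D a a) * (sgn (b a i) * sgn (b a j))) := fun i j => by
      have h4 := signTable_form (k := k) (l := l) hs.diag b i j
      simp only [SpecState.next, h4, hkq, Finset.mul_sum, ← mul_assoc]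
      rfl
    simp only [h5]
    exact hcon.2

end Healthy
end

section

/-! ### The dimensions -/

/-- The constant in the recursion for the dimensions. -/
noncomputable def Params.growth (m : Params) : ℝ :=
  10⁻¹ ^ 20 * m.ρ ^ 20 * |m.φ.curv| ^ 2 * m.Λ⁻¹ ^ 2

/-- The properties of the dimensions that the algorithm relies on. -/
structure Dims (m : Params) (K0 : ℕ) : Prop where
  dvd : ∀ t, 12 ∣ m.K K0 t
  pos : ∀ t, 12 ≤ m.K K0 t
  double : ∀ t, 2 * m.K K0 t ≤ m.K K0 (t + 1)
  upper : ∀ t, (m.K K0 (t + 1) : ℝ) ≤ m.growth * (m.K K0 t : ℝ) ^ 2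
  small : ∀ t, (m.K K0 (t + 1) : ℝ) ≤ 10⁻¹ ^ 16 * ((m.K K0 t / 12 : ℕ) : ℝ) ^ 2
  small' : ∀ t, (m.K K0 (t + 1) : ℝ) ≤ 10⁻¹ ^ 10 * m.φ.coef 1 ^ 2 * ((m.K K0 t / 12 : ℕ) : ℝ) ^ 3

/-- All properties of the dimensions hold for large `K0`: the dimension at level `t + 1` is below a
small multiple of the square at level `t`, and from `K0` on the recursion at least doubles. -/
theorem exists_dims {m : Params} (hm : m.Standing) :
    ∃ Kmin : ℕ, ∀ K0, Kmin ≤ K0 → 12 ∣ K0 → Dims m K0 := by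
  have hρ := hm.rho_pos
  have hρ1 := hm.rho_lt_one
  have hΛ := hm.Lam_pos
  have hc := coef_one_pos hm
  have hg : m.growth = 4 * 10⁻¹ ^ 20 * m.ρ ^ 20 * m.φ.coef 1 ^ 2 * m.Λ⁻¹ ^ 2 := by
    rw [Params.growth, sq_abs, curv_eq]; ring
  have hg0 : 0 < m.growth := by rw [hg]; positivity
  have hr1 : m.ρ ^ 20 ≤ 1 := pow_le_one₀ hρ.le hρ1.le
  have hg1 : m.growth ≤ 64 * 10⁻¹ ^ 20 := by
    have h : m.φ.coef 1 * m.Λ⁻¹ ≤ 4 := by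
      rw [← div_eq_mul_inv, div_le_iff₀ hΛ]; exact coef_one_le_Lam hm
    calc m.growth = 4 * 10⁻¹ ^ 20 * m.ρ ^ 20 * (m.φ.coef 1 * m.Λ⁻¹) ^ 2 := by rw [hg]; ring
      _ ≤ 4 * 10⁻¹ ^ 20 * 1 * 4 ^ 2 := by gcongr
      _ = _ := by norm_num
  -- `3 / growth` makes the recursion double, and `Λ⁻¹ ^ 2` turns the quadratic bound, with its
  -- factor `Λ⁻¹ ^ 2` in `growth`, into a cubic one with the factor `coef 1 ^ 2`
  refine ⟨12 + ⌈3 / m.growth⌉₊ + ⌈m.Λ⁻¹ ^ 2⌉₊, fun K0 hK0 hdvd => ?_⟩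
  have hrec : ∀ t, m.K K0 (t + 1) = 12 * ⌊m.growth * (m.K K0 t : ℝ) ^ 2 / 12⌋₊ := fun t => rfl
  have hd : ∀ t, 12 ∣ m.K K0 t := fun t => by
    cases t with
    | zero => exact hdvd
    | succ t => exact ⟨_, hrec t⟩
  have hupper : ∀ t, (m.K K0 (t + 1) : ℝ) ≤ m.growth * (m.K K0 t : ℝ) ^ 2 := fun t => by
    rw [hrec, Nat.cast_mul]
    have := Nat.floor_le (show 0 ≤ m.growth * (m.K K0 t : ℝ) ^ 2 / 12 by positivity)
    push_cast
    linarith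
  have hdouble : ∀ t, K0 ≤ m.K K0 t → 2 * m.K K0 t ≤ m.K K0 (t + 1) := fun t h => by
    have h1 := Nat.lt_floor_add_one (m.growth * (m.K K0 t : ℝ) ^ 2 / 12)
    have h2 : 3 / m.growth ≤ (m.K K0 t : ℝ) := (Nat.le_ceil _).trans (by exact_mod_cast by omega)
    rw [div_le_iff₀ hg0] at h2
    have h3 : (12 : ℝ) ≤ m.K K0 t := by exact_mod_cast (by omega : 12 ≤ m.K K0 t)
    have h4 : (2 * m.K K0 t : ℝ) ≤ m.K K0 (t + 1) := by
      rw [hrec]; push_cast; nlinarith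
    exact_mod_cast h4
  have hge : ∀ t, K0 ≤ m.K K0 t := fun t => by
    induction t with
    | zero => exact le_rfl
    | succ t ih => have := hdouble t ih; omega
  have hq : ∀ t, (m.K K0 t : ℝ) = 12 * ((m.K K0 t / 12 : ℕ) : ℝ) := fun t => by
    have : m.K K0 t = 12 * (m.K K0 t / 12) := by have := hd t; omega
    exact_mod_cast this
  refine ⟨hd, fun t => by have := hge t; omega, fun t => hdouble t (hge t), hupper,
    fun t => (hupper t).trans ?_, fun t => (hupper t).trans ?_⟩
  · rw [hq]
    calc _ ≤ 64 * 10⁻¹ ^ 20 * (12 * ((m.K K0 t / 12 : ℕ) : ℝ)) ^ 2 := by gcongr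
      _ = (64 * 144 * 10⁻¹ ^ 20) * ((m.K K0 t / 12 : ℕ) : ℝ) ^ 2 := by ring
      _ ≤ _ := by gcongr; norm_num
  · have h1 : m.Λ⁻¹ ^ 2 ≤ (m.K K0 t : ℝ) :=
      (Nat.le_ceil _).trans (by have := hge t; exact_mod_cast by omega)
    rw [hq] at h1 ⊢
    calc _ ≤ 4 * 10⁻¹ ^ 20 * 1 * m.φ.coef 1 ^ 2 * (12 * ((m.K K0 t / 12 : ℕ) : ℝ)) *
          (12 * ((m.K K0 t / 12 : ℕ) : ℝ)) ^ 2 := by rw [hg]; gcongr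
      _ = (4 * 1728 * 10⁻¹ ^ 20) * (m.φ.coef 1 ^ 2 * ((m.K K0 t / 12 : ℕ) : ℝ) ^ 3) := by ring
      _ ≤ 10⁻¹ ^ 10 * (m.φ.coef 1 ^ 2 * ((m.K K0 t / 12 : ℕ) : ℝ) ^ 3) := by gcongr; norm_num
      _ = _ := by ring

/-! ### Triples reached by the spectral subroutine -/

variable {m : Params} {K0 k l : ℕ}

/-- The properties of a triple that the spectral subroutine maintains. They imply `Healthy` for the
matrix that the rule selects. -/
structure Sound {k : ℕ} (s : SpecState k) : Prop where
  phi_symm : s.Phi.IsSymm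
  psi_symm : s.Psi.IsSymm
  eps_pos : 0 < s.eps
  eps_le : s.eps ≤ 1
  good : s.Good

theorem Sound.healthy {s : SpecState k} (hs : Sound s) (hk : 12 ∣ k) : Healthy s (rule.app s) := by
  obtain ⟨-, -, h2, h3⟩ := rule_valid k s.Phi s.Psi s.eps hk hs.phi_symm hs.psi_symm hs.good
  exact ⟨hs.psi_symm, hs.eps_pos, hs.eps_le, h2, h3⟩

theorem Sound.next (hm : m.Standing) {s : SpecState k} (hs : Sound s) (hk : 12 ∣ k) (hk0 : 0 < k)
    {β : Matrix (Fin (k / 12)) (Fin l) ℝ} (hg : (s.next m (rule.app s) β).Good) :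
    Sound (s.next m (rule.app s) β) := by
  obtain ⟨-, h1, h2⟩ := (hs.healthy hk).eps_next hm hk hk0 β
  exact ⟨next_phi_symm _ _ _ _, next_psi_symm _ hs.psi_symm _ _, h1, h2, hg⟩

/-- The initial matrices are multiples of the identity, so all eigenvalues are in the intervals. -/
theorem sound_zero (hm : m.Standing) (hd : Dims m K0) (ω : Tape) : Sound
    (specSeq m K0 rule ω 0) := by
  have hρ := hm.rho_pos
  have hρ1 := hm.rho_lt_one
  obtain ⟨h1, -, h2⟩ := corr_bounds hm (u := m.ρ / 2) (by rw [abs_of_pos (by linarith)]; linarith)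
  have h0 : 0 < m.eps0 := lt_of_lt_of_le (mul_pos (coef_one_pos hm) (by positivity)) h1
  have hs1 : (1 : Matrix (Fin (m.K K0 0)) (Fin (m.K K0 0)) ℝ).IsSymm := Matrix.isSymm_one
  have hs2 : (m.eps0 • 1 : Matrix (Fin (m.K K0 0)) (Fin (m.K K0 0)) ℝ).IsSymm := hs1.smul _
  refine ⟨hs1, hs2, h0, h2, (spectralAssumption_iff hs1 hs2).2 ⟨?_, ?_⟩⟩
  · have := le_card_eigenvalues hs1 one_pos (hd.dvd 0) (by
      simp only [Matrix.one_apply, sub_self]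
      simp
      positivity)
    simpa only [mul_one] using this
  · refine le_card_eigenvalues hs2 h0 (hd.dvd 0) ?_
    have : ∀ i j, (m.eps0 • 1 : Matrix (Fin (m.K K0 0)) (Fin (m.K K0 0)) ℝ) i j =
      if i = j then m.eps0 else 0 := fun i j => by simp [Matrix.one_apply]
    refine le_trans (le_of_eq (Finset.sum_eq_zero fun i _ => Finset.sum_eq_zero fun j _ => ?_))
      (by positivity)
    rw [this, show (specSeq m K0 rule ω 0).eps = m.eps0 from rfl, sub_self, zero_pow two_ne_zero]

/-- The `r`-th sample at level `t` is rejected. -/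
def Rejected (m : Params) (K0 : ℕ) (ω : Tape) (t r : ℕ) : Prop :=
  ¬ ((specSeq m K0 rule ω t).next m (rule.app (specSeq m K0 rule ω t))
    (signMatrix (m.K K0 t) (m.K K0 (t + 1)) (ω.coinAt t r))).Good

/-- The index of the sample that is accepted at level `t`. -/
noncomputable def accepted (m : Params) (K0 : ℕ) (ω : Tape) (t : ℕ) : ℕ :=
  sInf {r | ¬ Rejected m K0 ω t r}

theorem specSeq_succ (ω : Tape) (t : ℕ) : specSeq m K0 rule ω (t + 1) =
    (specSeq m K0 rule ω t).next m (rule.app (specSeq m K0 rule ω t))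
      (signMatrix (m.K K0 t) (m.K K0 (t + 1)) (ω.coinAt t (accepted m K0 ω t))) := by
  simp only [accepted, Rejected, not_not]
  rfl

theorem betaSeq_eq (ω : Tape) (t : ℕ) : betaSeq m K0 rule ω t =
    signMatrix (m.K K0 t) (m.K K0 (t + 1)) (ω.coinAt t (accepted m K0 ω t)) := by
  simp only [accepted, Rejected, not_not]
  rfl

/-- The accepted sample is good by choice; symmetry and the bounds on `ε` hold for every sample. -/
theorem sound_succ (hm : m.Standing) (hd : Dims m K0) {ω : Tape} {t : ℕ}
    (hs : Sound (specSeq m K0 rule ω t)) (h : ∃ r, ¬ Rejected m K0 ω t r) :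
    Sound (specSeq m K0 rule ω (t + 1)) := by
  rw [specSeq_succ]
  refine hs.next hm (hd.dvd t) (by have := hd.pos t; omega) ?_
  have : accepted m K0 ω t ∈ {r | ¬ Rejected m K0 ω t r} := Nat.sInf_mem h
  exact not_not.1 this

/-! ### The law of the coins -/

instance : IsProbabilityMeasure tapeLaw := by unfold tapeLaw; infer_instance

theorem map_coins : tapeLaw.map (fun ω => ω.2.2) =
    Measure.infinitePi (fun _ : ℕ × ℕ × ℕ × ℕ => (PMF.uniformOfFintype Bool).toMeasure) := by
  have h1 : (fun ω : Tape => ω.2.2) = Prod.snd ∘ Prod.snd := rfl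
  rw [h1, ← Measure.map_map measurable_snd measurable_snd, tapeLaw, Measure.map_snd_prod,
    measure_univ, one_smul, Measure.map_snd_prod, measure_univ, one_smul]

theorem measurable_coin (i : ℕ × ℕ × ℕ × ℕ) : Measurable fun ω : Tape => ω.2.2 i := by fun_prop

/-- The information carried by one coin. -/
abbrev coinAlg (i : ℕ × ℕ × ℕ × ℕ) : MeasurableSpace Tape :=
  MeasurableSpace.comap (fun ω : Tape => ω.2.2 i) inferInstance

theorem iIndep_coinAlg : iIndep coinAlg tapeLaw := by
  have h : iIndepFun (fun (i : ℕ × ℕ × ℕ × ℕ) (ω : Tape) => ω.2.2 i) tapeLaw := by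
    rw [iIndepFun_iff_map_fun_eq_infinitePi_map measurable_coin]
    have h2 : ∀ i, tapeLaw.map (fun ω : Tape => ω.2.2 i) =
        (PMF.uniformOfFintype Bool).toMeasure := fun i => by
      have : (fun ω : Tape => ω.2.2 i) = (fun x => x i) ∘ fun ω : Tape => ω.2.2 := rfl
      rw [this, ← Measure.map_map (by fun_prop) (by fun_prop), map_coins]
      exact Measure.infinitePi_map_eval _ i
    simp only [h2]
    exact map_coins
  exact h

/-- The information carried by a set of coins. -/
abbrev coinsAlg (S : Set (ℕ × ℕ × ℕ × ℕ)) : MeasurableSpace Tape := ⨆ i ∈ S, coinAlg i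

theorem coinsAlg_le (S : Set (ℕ × ℕ × ℕ × ℕ)) : coinsAlg S ≤
    (Prod.instMeasurableSpace : MeasurableSpace Tape) :=
  iSup₂_le fun i _ => (measurable_coin i).comap_le

theorem coinsAlg_mono {S S' : Set (ℕ × ℕ × ℕ × ℕ)} (h : S ⊆ S') : coinsAlg S ≤ coinsAlg S' :=
  biSup_mono h

/-- Events that depend on disjoint sets of coins are independent. -/
theorem measure_inter_of_disjoint {S S' : Set (ℕ × ℕ × ℕ × ℕ)} (h : Disjoint S S') {A B : Set Tape}
    (hA : MeasurableSet[coinsAlg S] A) (hB : MeasurableSet[coinsAlg S'] B) :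
    tapeLaw (A ∩ B) = tapeLaw A * tapeLaw B :=
  (Indep_iff _ _ _).1
  (indep_iSup_of_disjoint (fun i => (measurable_coin i).comap_le) iIndep_coinAlg h)
    A B hA hB

/-- The coins of the `r`-th sample at level `t`. -/
def coinBlock (t r q l : ℕ) (ω : Tape) : Fin q → Fin l → Bool := fun i j => ω.coinAt t r i j

theorem measurableSet_coinBlock {t r q l : ℕ} (p : (Fin q → Fin l → Bool) → Prop) :
    MeasurableSet[coinsAlg {i | i.1 = t ∧ i.2.1 = r}] {ω | p (coinBlock t r q l ω)} := by
  have h : @Measurable _ _ (coinsAlg {i | i.1 = t ∧ i.2.1 = r}) _ (coinBlock t r q l) := by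
    refine @measurable_pi_lambda _ _ _ (_) _ _ fun i => @measurable_pi_lambda _ _ _ (_) _ _ fun j =>
      ?_
    refine Measurable.mono
      (comap_measurable fun ω : Tape => ω.2.2 (t, r, (i : ℕ), (j : ℕ))) ?_ le_rfl
    exact le_iSup₂_of_le (f := fun i _ => coinAlg i) (t, r, (i : ℕ), (j : ℕ)) ⟨rfl, rfl⟩ le_rfl
  exact h (Set.toFinite {b | p b}).measurableSet

/-- A block of coins is uniformly distributed, which turns counts of sign tables into probabilities.
-/
theorem measure_coinBlock_eq {t r q l : ℕ} (b : Fin q → Fin l → Bool) :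
    tapeLaw {ω | coinBlock t r q l ω = b} =
      ((Fintype.card (Fin q → Fin l → Bool) : ℕ) : ℝ≥0∞)⁻¹ := by
  classical
  let e : Fin q × Fin l ↪ ℕ × ℕ × ℕ × ℕ := ⟨fun p => (t, r, p.1, p.2), fun p p' h => by
    simp only [Prod.mk.injEq, true_and] at h
    exact Prod.ext (Fin.ext h.1) (Fin.ext h.2)⟩
  let f : ℕ × ℕ × ℕ × ℕ → Set Bool := fun i =>
    {x | ∀ (h : i.2.2.1 < q) (h' : i.2.2.2 < l), x = b ⟨_, h⟩ ⟨_, h'⟩}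
  have h1 : {ω | coinBlock t r q l ω = b} =
      (fun ω : Tape => ω.2.2) ⁻¹' (Set.pi ((Finset.univ.map e : Finset _) : Set _) f) := by
    ext ω
    simp only [Set.mem_preimage, Set.mem_pi, Finset.coe_map, Finset.coe_univ, Set.image_univ,
      Set.mem_range, forall_exists_index, Set.mem_ofPred_eq, funext_iff]
    constructor
    · rintro h _ p rfl _ _
      exact h p.1 p.2
    · intro h i j
      exact h _ (i, j) rfl i.2 j.2
  rw [h1, ← Measure.map_apply (by fun_prop) (MeasurableSet.pi (Finset.countable_toSet _) fun _ _ =>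
    (Set.toFinite _).measurableSet), map_coins,
    Measure.infinitePi_pi _ fun _ _ => (Set.toFinite _).measurableSet, Finset.prod_map]
  have h2 : ∀ p : Fin q × Fin l, (PMF.uniformOfFintype Bool).toMeasure (f (e p)) = 2⁻¹ :=
    fun p => by
    have : f (e p) = {b p.1 p.2} := by
      ext x
      simp only [f, Set.mem_ofPred_eq, Set.mem_singleton_iff]
      exact ⟨fun h => h p.1.2 p.2.2, fun h _ _ => h⟩
    rw [this, PMF.toMeasure_apply_singleton _ _ (measurableSet_singleton _)]
    simp
  simp only [h2, Finset.prod_const, Finset.card_univ, Fintype.card_prod, Fintype.card_fin,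
    Fintype.card_fun, Fintype.card_bool]
  rw [← ENNReal.inv_pow, ← pow_mul, mul_comm l q]
  push_cast
  rfl

theorem measure_coinBlock_le {t r q l : ℕ} {p : (Fin q → Fin l → Bool) → Prop} [DecidablePred p]
    (hp : 2 * (Finset.univ.filter p).card ≤ Fintype.card (Fin q → Fin l → Bool)) :
    tapeLaw {ω | p (coinBlock t r q l ω)} ≤ 2⁻¹ := by
  have h1 : {ω | p (coinBlock t r q l ω)} =
      ⋃ b ∈ Finset.univ.filter p, {ω | coinBlock t r q l ω = b} := by
    ext ω; simp
  rw [h1]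
  refine (measure_biUnion_finset_le _ _).trans ?_
  simp only [measure_coinBlock_eq, Finset.sum_const, nsmul_eq_mul]
  have hN : (Fintype.card (Fin q → Fin l → Bool) : ℝ≥0∞) ≠ 0 := by
    exact_mod_cast Fintype.card_ne_zero
  rw [← div_eq_mul_inv]
  refine ENNReal.div_le_of_le_mul ?_
  rw [mul_comm, ← div_eq_mul_inv, ENNReal.le_div_iff_mul_le (by simp) (by simp), mul_comm]
  exact_mod_cast hp

end

section

variable {m : Params} {K0 : ℕ}

/-! ### The number of samples drawn -/

/-- A set that is defined from a variable with countably many values. -/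
theorem measurableSet_of_countable_range {Ω α : Type*} (mΩ : MeasurableSpace Ω) (f : Ω → α)
    {R : Set α} (hR : R.Countable) (hf : ∀ ω, f ω ∈ R)
    (hσ : ∀ σ ∈ R, MeasurableSet[mΩ] {ω | f ω = σ}) (p : α → Ω → Prop)
    (hp : ∀ σ ∈ R, MeasurableSet[mΩ] {ω | p σ ω}) : MeasurableSet[mΩ] {ω | p (f ω) ω} := by
  have : {ω | p (f ω) ω} = ⋃ σ ∈ R, {ω | f ω = σ} ∩ {ω | p σ ω} := by
    ext ω
    simp only [Set.mem_ofPred_eq, Set.mem_iUnion, Set.mem_inter_iff, exists_prop]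
    exact ⟨fun h => ⟨f ω, hf ω, rfl, h⟩, by rintro ⟨σ, -, rfl, h⟩; exact h⟩
  rw [this]
  exact MeasurableSet.biUnion hR fun σ h => (hσ σ h).inter (hp σ h)

theorem measurableSet_sInf_eq {Ω : Type*} (mΩ : MeasurableSpace Ω) (g : ℕ → Ω → Prop)
    (hg : ∀ r, MeasurableSet[mΩ] {ω | g r ω}) (n : ℕ) :
    MeasurableSet[mΩ] {ω | sInf {r | g r ω} = n} := by
  have : {ω | sInf {r | g r ω} = n} = ({ω | g n ω} ∩ ⋂ r ∈ Finset.range n, {ω | g r ω}ᶜ) ∪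
      if n = 0 then ⋂ r, {ω | g r ω}ᶜ else ∅ := by
    ext ω
    simp only [Set.mem_union, Set.mem_inter_iff, Set.mem_iInter, Set.mem_compl_iff,
      Set.mem_ofPred_eq, Finset.mem_range]
    constructor
    · rintro rfl
      by_cases h : ∃ r, g r ω
      · exact Or.inl ⟨Nat.sInf_mem (s := {r | g r ω}) h, fun r hr => Nat.notMem_of_lt_sInf hr⟩
      · right
        push Not at h
        have h0 : {r | g r ω} = ∅ := Set.eq_empty_iff_forall_notMem.2 h
        rw [h0, Nat.sInf_empty, if_pos rfl]
        exact Set.mem_iInter.2 h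
    · rintro (⟨h1, h2⟩ | h)
      · refine le_antisymm (Nat.sInf_le h1) (not_lt.1 fun h => h2 _ h ?_)
        exact Nat.sInf_mem (s := {r | g r ω}) ⟨n, h1⟩
      · split_ifs at h with hn
        · have h0 : {r | g r ω} = ∅ := Set.eq_empty_iff_forall_notMem.2 (Set.mem_iInter.1 h)
          rw [h0, Nat.sInf_empty, hn]
        · exact h.elim
  rw [this]
  refine ((hg n).inter (Finset.measurableSet_biInter _ fun r _ => (hg r).compl)).union ?_
  split_ifs
  · exact MeasurableSet.iInter fun r => (hg r).compl
  · exact MeasurableSet.empty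

/-- The possible values of the triple at level `t`. -/
def reach (m : Params) (K0 : ℕ) : (t : ℕ) → Set (SpecState (m.K K0 t))
  | 0 => {{ Phi := 1, Psi := m.eps0 • 1, eps := m.eps0 }}
  | t + 1 => ⋃ σ ∈ reach m K0 t,
      Set.range fun b : Fin (m.K K0 t / 12) → Fin (m.K K0 (t + 1)) → Bool =>
        σ.next m (rule.app σ) (signTable (m.K K0 t) b)

theorem finite_reach (t : ℕ) : (reach m K0 t).Finite := by
  induction t with
  | zero => exact Set.finite_singleton _
  | succ t ih => exact ih.biUnion fun σ _ => Set.finite_range _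

theorem specSeq_mem_reach (ω : Tape) (t : ℕ) : specSeq m K0 rule ω t ∈ reach m K0 t := by
  induction t with
  | zero => exact rfl
  | succ t ih =>
    rw [specSeq_succ]
    exact Set.mem_biUnion ih ⟨coinBlock t (accepted m K0 ω t) _ _ ω, rfl⟩

/-- The `r`-th sample at level `t` would be rejected if the triple was `σ`. -/
def RejectedAt (m : Params) (K0 t r : ℕ) (σ : SpecState (m.K K0 t)) (ω : Tape) : Prop :=
  ¬ (σ.next m (rule.app σ) (signTable (m.K K0 t) (coinBlock t r _ (m.K K0 (t + 1)) ω))).Good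

theorem measurableSet_rejectedAt (t r : ℕ) (σ : SpecState (m.K K0 t)) :
    MeasurableSet[coinsAlg {i | i.1 = t ∧ i.2.1 = r}] {ω | RejectedAt m K0 t r σ ω} :=
  measurableSet_coinBlock fun b => ¬ (σ.next m (rule.app σ) (signTable (m.K K0 t) b)).Good

/-- The triple at level `t` is a function of the coins of the lower levels. -/
theorem measurableSet_specSeq (t : ℕ) : ∀ σ : SpecState (m.K K0 t),
    MeasurableSet[coinsAlg {i | i.1 < t}] {ω | specSeq m K0 rule ω t = σ} := by
  induction t with
  | zero =>
    intro σ
    by_cases h : ({ Phi := 1, Psi := m.eps0 • 1, eps := m.eps0 } : SpecState (m.K K0 0)) = σ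
    · convert MeasurableSet.univ using 1
      exact Set.eq_univ_of_forall fun ω => h
    · convert MeasurableSet.empty using 1
      exact Set.eq_empty_of_forall_notMem fun ω => h
  | succ t ih =>
    intro σ'
    have hle : ∀ r, coinsAlg {i | i.1 = t ∧ i.2.1 = r} ≤ coinsAlg {i | i.1 < t + 1} := fun r =>
      coinsAlg_mono fun i hi => by
        have : i.1 = t := hi.1
        exact Set.mem_ofPred_eq ▸ (by omega : i.1 < t + 1)
    have h1 := measurableSet_of_countable_range (coinsAlg {i | i.1 < t + 1})
      (fun ω => specSeq m K0 rule ω t) (finite_reach t).countable (fun ω => specSeq_mem_reach ω t)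
      (fun σ _ => coinsAlg_mono (fun i hi => lt_trans hi (Nat.lt_succ_self t)) _ (ih σ))
      (fun σ ω => σ.next m (rule.app σ) (signTable (m.K K0 t)
        (coinBlock t (sInf {r | ¬ RejectedAt m K0 t r σ ω}) _ (m.K K0 (t + 1)) ω)) = σ')
      fun σ _ => measurableSet_of_countable_range (coinsAlg {i | i.1 < t + 1})
        (fun ω => sInf {r | ¬ RejectedAt m K0 t r σ ω}) Set.countable_univ (fun _ => Set.mem_univ _)
        (fun n _ => measurableSet_sInf_eq _ _
          (fun r => (hle r _ (measurableSet_rejectedAt t r σ)).compl) n)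
        (fun r ω => σ.next m (rule.app σ) (signTable (m.K K0 t)
          (coinBlock t r _ (m.K K0 (t + 1)) ω)) = σ')
        fun r _ => hle r _ (measurableSet_coinBlock fun b =>
          σ.next m (rule.app σ) (signTable (m.K K0 t) b) = σ')
    simp only [specSeq_succ]
    exact h1

theorem rejected_iff (ω : Tape) (t r : ℕ) :
    Rejected m K0 ω t r ↔ RejectedAt m K0 t r (specSeq m K0 rule ω t) ω := Iff.rfl

/-- The event that the first `r` samples at level `t` are rejected. -/
def rejEvent (m : Params) (K0 t r : ℕ) : Set Tape := {ω | ∀ r' < r, Rejected m K0 ω t r'}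

theorem measurableSet_rejEvent (t r : ℕ) : MeasurableSet (rejEvent m K0 t r) := by
  refine measurableSet_of_countable_range Prod.instMeasurableSpace
    (fun ω => specSeq m K0 rule ω t) (finite_reach t).countable (fun ω => specSeq_mem_reach ω t)
    (fun σ _ => coinsAlg_le _ _ (measurableSet_specSeq t σ))
    (fun σ ω => ∀ r' < r, RejectedAt m K0 t r' σ ω) fun σ _ => ?_
  have : {ω | ∀ r' < r, RejectedAt m K0 t r' σ ω} =
      ⋂ r' ∈ Finset.range r, {ω | RejectedAt m K0 t r' σ ω} := by ext ω; simp
  rw [this]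
  exact Finset.measurableSet_biInter _ fun r' _ => coinsAlg_le _ _ (measurableSet_rejectedAt t r' σ)

/-- Given that the triple at level `t` is `σ`, the samples at level `t` are independent of this
event and of each other, and each of them is rejected with probability at most one half. -/
theorem measure_rejectedAt_le (hm : m.Standing) (hd : Dims m K0) {t : ℕ} {σ : SpecState (m.K K0 t)}
    (hσ : Sound σ) (r : ℕ) : tapeLaw ({ω | specSeq m K0 rule ω t = σ} ∩
      {ω | ∀ r' < r, RejectedAt m K0 t r' σ ω}) ≤ 2⁻¹ ^ r *
        tapeLaw {ω | specSeq m K0 rule ω t = σ} := by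
  classical
  induction r with
  | zero => simp
  | succ r ih =>
    have h1 : {ω | specSeq m K0 rule ω t = σ} ∩ {ω | ∀ r' < r + 1, RejectedAt m K0 t r' σ ω} =
        ({ω | specSeq m K0 rule ω t = σ} ∩ {ω | ∀ r' < r, RejectedAt m K0 t r' σ ω}) ∩
          {ω | RejectedAt m K0 t r σ ω} := by
      ext ω
      simp only [Set.mem_inter_iff, Set.mem_ofPred_eq, and_assoc, Nat.lt_succ_iff_lt_or_eq, or_imp,
        forall_and, forall_eq]
    have h2 : {ω | ∀ r' < r, RejectedAt m K0 t r' σ ω} =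
        ⋂ r' ∈ Finset.range r, {ω | RejectedAt m K0 t r' σ ω} := by ext ω; simp
    have hS : MeasurableSet[coinsAlg {i | i.1 < t ∨ (i.1 = t ∧ i.2.1 < r)}]
        ({ω | specSeq m K0 rule ω t = σ} ∩ {ω | ∀ r' < r, RejectedAt m K0 t r' σ ω}) := by
      rw [h2]
      refine MeasurableSet.inter
        (coinsAlg_mono (fun i hi => Or.inl hi) _ (measurableSet_specSeq t σ))
        (Finset.measurableSet_biInter _ fun r' hr' =>
          coinsAlg_mono (fun i hi => Or.inr ⟨hi.1, ?_⟩) _ (measurableSet_rejectedAt t r' σ))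
      rw [hi.2]
      exact Finset.mem_range.1 hr'
    have hk0 := hd.pos t
    rw [h1, measure_inter_of_disjoint ?_ hS (measurableSet_rejectedAt t r σ), pow_succ', mul_assoc,
      mul_comm]
    · refine mul_le_mul' ?_ ih
      have hl0 := hd.pos (t + 1)
      exact measure_coinBlock_le (card_not_good_le hm (hσ.healthy (hd.dvd t)) (hd.dvd t) (by omega)
        (by omega) (hd.dvd (t + 1)) (hd.small t) (hd.small' t))
    · rw [Set.disjoint_left]
      rintro i (hi | hi) hi'
      · exact absurd hi'.1 (ne_of_lt hi)
      · exact absurd hi'.2 (ne_of_lt hi.2)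

/-- The bound given the triple at level `t`, summed over the finitely many sound triples. -/
theorem measure_rejEvent_le (hm : m.Standing) (hd : Dims m K0) {t : ℕ}
    (hs : ∀ᵐ ω ∂tapeLaw, Sound (specSeq m K0 rule ω t)) (r : ℕ) :
    tapeLaw (rejEvent m K0 t r) ≤ 2⁻¹ ^ r := by
  classical
  have hfin := (finite_reach (m := m) (K0 := K0) t)
  set R := hfin.toFinset.filter fun σ => Sound σ
  have h1 : rejEvent m K0 t r ⊆ {ω | ¬ Sound (specSeq m K0 rule ω t)} ∪
      ⋃ σ ∈ R, ({ω | specSeq m K0 rule ω t = σ} ∩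
        {ω | ∀ r' < r, RejectedAt m K0 t r' σ ω}) := fun ω hω => by
    by_cases h : Sound (specSeq m K0 rule ω t)
    · right
      refine Set.mem_biUnion (x := specSeq m K0 rule ω t) ?_
        ⟨rfl, fun r' hr' => (rejected_iff ω t r').1 (hω r' hr')⟩
      exact Finset.mem_coe.2 (Finset.mem_filter.2 ⟨hfin.mem_toFinset.2 (specSeq_mem_reach ω t), h⟩)
    · exact Or.inl h
  calc tapeLaw (rejEvent m K0 t r) ≤ _ := measure_mono h1
    _ ≤ 0 + ∑ σ ∈ R, 2⁻¹ ^ r * tapeLaw {ω | specSeq m K0 rule ω t = σ} := by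
      refine (measure_union_le _ _).trans (add_le_add (le_of_eq (ae_iff.1 hs)) ?_)
      refine (measure_biUnion_finset_le _ _).trans (Finset.sum_le_sum fun σ hσ => ?_)
      exact measure_rejectedAt_le hm hd (Finset.mem_filter.1 hσ).2 r
    _ = 2⁻¹ ^ r * tapeLaw (⋃ σ ∈ R, {ω | specSeq m K0 rule ω t = σ}) := by
      rw [zero_add, ← Finset.mul_sum, measure_biUnion_finset]
      · intro σ _ σ' _ h
        exact Set.disjoint_left.2 fun ω h1 h2 => h (h1.symm.trans h2)
      · exact fun σ _ => coinsAlg_le _ _ (measurableSet_specSeq t σ)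
    _ ≤ 2⁻¹ ^ r * 1 := by gcongr; exact prob_le_one
    _ = _ := mul_one _

/-- Almost surely every level is reached: an infinite run of rejections has probability `0`. -/
theorem ae_accepted (hm : m.Standing) (hd : Dims m K0) :
    ∀ᵐ ω ∂tapeLaw, ∀ t, Sound (specSeq m K0 rule ω t) ∧ ∃ r, ¬ Rejected m K0 ω t r := by
  rw [ae_all_iff]
  intro t
  induction t with
  | zero =>
    have h0 : ∀ᵐ ω ∂tapeLaw, Sound (specSeq m K0 rule ω 0) :=
      Eventually.of_forall fun ω => sound_zero hm hd ω
    exact h0.and (ae_exists_of hm hd h0)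
  | succ t ih =>
    have h0 : ∀ᵐ ω ∂tapeLaw, Sound (specSeq m K0 rule ω (t + 1)) := by
      filter_upwards [ih] with ω h using sound_succ hm hd h.1 h.2
    exact h0.and (ae_exists_of hm hd h0)
where
  ae_exists_of (hm : m.Standing) (hd : Dims m K0) {t : ℕ}
      (hs : ∀ᵐ ω ∂tapeLaw, Sound (specSeq m K0 rule ω t)) :
      ∀ᵐ ω ∂tapeLaw, ∃ r, ¬ Rejected m K0 ω t r := by
    rw [ae_iff]
    refine le_antisymm (ge_of_tendsto' (ENNReal.tendsto_pow_atTop_nhds_zero_of_lt_one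
      (r := 2⁻¹) (by simp)) fun r =>
        (measure_mono ?_).trans (measure_rejEvent_le hm hd hs r)) zero_le
    intro ω hω r' _
    by_contra h
    exact hω ⟨r', h⟩

/-- The number of samples that are drawn at level `t`, as the sum over `r` of the indicators that
the first `r` samples are rejected. -/
noncomputable def samples (m : Params) (K0 t : ℕ) (ω : Tape) : ℝ≥0∞ :=
  ∑' r, (rejEvent m K0 t r).indicator 1 ω

theorem measurable_samples (t : ℕ) : Measurable (samples m K0 t) :=
  Measurable.tsum fun r => measurable_one.indicator (measurableSet_rejEvent t r)

/-- The tail of the number of samples is bounded by a geometric series with ratio one half. -/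
theorem lintegral_samples_le (hm : m.Standing) (hd : Dims m K0) (t : ℕ) :
    ∫⁻ ω, samples m K0 t ω ∂tapeLaw ≤ 2 := by
  have hs : ∀ᵐ ω ∂tapeLaw, Sound (specSeq m K0 rule ω t) :=
    (ae_accepted hm hd).mono fun ω h => (h t).1
  unfold samples
  rw [lintegral_tsum fun r => (measurable_one.indicator (measurableSet_rejEvent t r)).aemeasurable]
  calc _ ≤ ∑' r : ℕ, (2⁻¹ : ℝ≥0∞) ^ r := ENNReal.tsum_le_tsum fun r => by
        rw [lintegral_indicator_one (measurableSet_rejEvent t r)]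
        exact measure_rejEvent_le hm hd hs r
    _ = 2 := by rw [ENNReal.tsum_geometric]; simp

theorem accepted_lt_samples {ω : Tape} {t : ℕ} :
    ((accepted m K0 ω t + 1 : ℕ) : ℝ≥0∞) ≤ samples m K0 t ω := by
  refine le_trans ?_ (ENNReal.sum_le_tsum (Finset.range (accepted m K0 ω t + 1)))
  have h : ∀ r ∈ Finset.range (accepted m K0 ω t + 1),
      (rejEvent m K0 t r).indicator (1 : Tape → ℝ≥0∞) ω = 1 := fun r hr => by
    rw [Set.indicator_of_mem, Pi.one_apply]
    intro r' hr'
    have : r' ∉ {r | ¬ Rejected m K0 ω t r} := Nat.notMem_of_lt_sInf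
      (lt_of_lt_of_le hr' (Nat.lt_succ_iff.1 (Finset.mem_range.1 hr)))
    exact not_not.1 this
  rw [Finset.sum_congr rfl h]
  simp

/-- Almost surely, no uniform variable takes the value `1`. -/
theorem ae_unif : ∀ᵐ ω ∂tapeLaw, ∀ x r, 0 ≤ ω.unifAt x r ∧ ω.unifAt x r < 1 := by
  have h : ∀ x r, ∀ᵐ ω ∂tapeLaw, ω.unifAt x r < 1 := fun x r => by
    have hmap : tapeLaw.map (fun ω : Tape => ω.2.1 (x, r)) = volume := by
      have h1 : (fun ω : Tape => ω.2.1 (x, r)) = (fun y => y (x, r)) ∘ Prod.fst ∘ Prod.snd := rfl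
      rw [h1, ← Measure.map_map (by fun_prop) (by fun_prop), ← Measure.map_map (by fun_prop)
        (by fun_prop), tapeLaw, Measure.map_snd_prod, measure_univ, one_smul, Measure.map_fst_prod,
        measure_univ, one_smul]
      exact Measure.infinitePi_map_eval _ _
    have h2 : ∀ᵐ y ∂(volume : Measure unitInterval), y ≠ 1 := by
      rw [ae_iff]
      simp
    rw [← hmap] at h2
    have h3 := ae_of_ae_map (by fun_prop) h2
    filter_upwards [h3] with ω hω
    exact lt_of_le_of_ne (ω.2.1 (x, r)).2.2 fun e => hω (Subtype.ext e)
  filter_upwards [ae_all_iff.2 fun x => ae_all_iff.2 (h x)] with ω hω x r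
  exact ⟨(ω.2.1 (x, r)).2.1, hω x r⟩

end

section

/-! ### A program for the rule -/

variable {E : Env} {s : Mem} {T k l : ℕ}

theorem Frame.seq {c c' : Cmd} {s s' s'' : Mem} (h : Frame c s s') (h' : Frame c' s' s'') :
    Frame (.seq c c') s s'' := by
  refine (h.mono ?_ ?_).trans (h'.mono ?_ ?_) <;> intro x hx <;>
    simp_all [Cmd.setsNat, Cmd.setsReal]

/-- A bound `T` for the time of a matrix product whose three dimensions are at most `n + κ`, and of
a spectral decomposition in dimension at most `κ`. -/
structure Budget (E : Env) (n κ T : ℕ) : Prop where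
  cube : 4 * ((n + κ + 1) * (n + κ + 1) * (n + κ + 1)) ≤ T
  eig : ∀ d ≤ κ, E.eg d + 1 ≤ T

theorem Budget.mul {n κ a b c : ℕ} (h : Budget E n κ T) (ha : a ≤ n + κ) (hb : b ≤ n + κ)
    (hc : c ≤ n + κ) : (a + 1) * (b + 1) * (c + 1) ≤ T :=
  le_trans (Nat.mul_le_mul (Nat.mul_le_mul (by omega) (by omega)) (by omega))
    (le_trans (Nat.le_mul_of_pos_left _ four_pos) h.cube)

theorem Budget.tab {n κ a b : ℕ} (h : Budget E n κ T) (ha : a ≤ n + κ) (hb : b ≤ n + κ) :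
    (a + 1) * (b + 1) ≤ T :=
      le_trans (Nat.le_mul_of_pos_right _ (Nat.succ_pos 0)) (h.mul ha hb (Nat.zero_le _))

theorem Budget.one {n κ : ℕ} (h : Budget E n κ T) : 1 ≤ T :=
  (Nat.le_add_left 1 _).trans (h.eig 0 (Nat.zero_le _))

/-- The scalar `p` may be used as a bound of a loop: it is none of the loop variables of `tabR`,
`sumTab` and `countCmd`. -/
abbrev IsDim (p : ℕ) : Prop := p ≠ 20 ∧ p ≠ 21 ∧ p ≠ 22 ∧ p ≠ 23

/-- The matrix product of the arrays `x` and `y`, each transposed if the flag says so. The scalars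
`p`, `q` and `r` hold the numbers of rows and columns of the product and the inner dimension. -/
def mulCmd (z x y : ℕ) (tx ty : Bool) (p q r : ℕ) : Cmd :=
  sumTab z (nv p) (nv q) (nv r) (.mul
    (if tx then .get x (nv 22) (nv 20) else .get x (nv 20) (nv 22))
    (if ty then .get y (nv 21) (nv 22) else .get y (nv 22) (nv 21)))

theorem mulCmd_spec {z x y : ℕ} {tx ty : Bool} {p q r a b c : ℕ} {X : Matrix (Fin a) (Fin c) ℝ}
    {Y : Matrix (Fin c) (Fin b) ℝ} (hT : (a + 1) * (b + 1) * (c + 1) ≤ T)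
    (hX : if tx then s.Holds x Xᵀ else s.Holds x X) (hY : if ty then s.Holds y Yᵀ else s.Holds y Y)
    (hp : s.nat p 0 0 = a) (hq : s.nat q 0 0 = b) (hr : s.nat r 0 0 = c)
    (hz : z ≠ 6 ∧ z ≠ x ∧ z ≠ y ∧ x ≠ 6 ∧ y ≠ 6 := by decide)
    (hd : IsDim p ∧ IsDim q ∧ IsDim r := by decide) :
    Tri E (mulCmd z x y tx ty p q r) s T (fun s' => s'.Holds z (X * Y)) := by
  obtain ⟨hz6, hzx, hzy, hx6, hy6⟩ := hz
  have hn : ∀ p, IsDim p → (mulCmd z x y tx ty p q r).setsNat p = false := fun p hp => by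
    simp [mulCmd, sumTab, table, forN_setsNat, Cmd.setsNat, hp.1.symm, hp.2.1.symm, hp.2.2.1.symm]
  have hrl : ∀ x, z ≠ x → x ≠ 6 → (mulCmd z x y tx ty p q r).setsReal x = false := fun x h h' => by
    simp [mulCmd, sumTab, table, forN_setsReal, Cmd.setsReal, h, h'.symm]
  refine Tri.sumTab a b c (fun i j k => if h : i < a ∧ j < b ∧ k < c then
    X ⟨i, h.1⟩ ⟨k, h.2.2⟩ * Y ⟨k, h.2.2⟩ ⟨j, h.2.1⟩ else 0) hz6 hT ?_ ?_ ?_ ?_ ?_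
  · intro s' hf; rw [nv_val, hf.nat p (hn p hd.1), hp]
  · intro s' hf; rw [nv_val, hf.nat q (hn q hd.2.1), hq]
  · intro s' hf; rw [nv_val, hf.nat r (hn r hd.2.2), hr]
  · intro i hi j hj l hl s' hf _ h0 h1 h2
    have hx := hf.real x (hrl x hzx hx6)
    have hy := hf.real y (hrl y hzy hy6)
    rw [dif_pos ⟨hi, hj, hl⟩]
    cases tx <;> cases ty <;>
      simp only [if_true, Bool.false_eq_true, if_false] at hX hY ⊢ <;>
      simp only [RExp.val, nv_val, h0, h1, h2, hx, hy]
    · rw [hX.apply hi hl, hY.apply hl hj]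
    · rw [hX.apply hi hl, hY.apply hj hl]; rfl
    · rw [hX.apply hl hi, hY.apply hl hj]; rfl
    · rw [hX.apply hl hi, hY.apply hj hl]; rfl
  · intro s' _ h _ i j
    rw [h i i.2 j j.2, Finset.sum_range, Matrix.mul_apply]
    exact Finset.sum_congr rfl fun k _ => dif_pos ⟨i.2, j.2, k.2⟩

/-- Apply an expression to each entry `(i, j)` of a table. -/
theorem Tri.mapTab {z p q a b : ℕ} {e : RExp} {X : Matrix (Fin a) (Fin b) ℝ} {Q : Mem → Prop}
    (hT : (a + 1) * (b + 1) ≤ T) (hp : s.nat p 0 0 = a) (hq : s.nat q 0 0 = b)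
    (hF : ∀ (i : Fin a) (j : Fin b) (s' : Mem),
      Frame (RobustMatching.tabR z (nv p) (nv q) btrue e (.const 0)) s s' →
      s'.real z i j = s.real z i j → s'.nat 20 0 0 = i → s'.nat 21 0 0 = j → e.val E.ω s' = X i j)
    (hQ : ∀ s', Frame (RobustMatching.tabR z (nv p) (nv q) btrue e (.const 0)) s s' → s'.Holds z X →
      Q s')
    (hd : IsDim p ∧ IsDim q := by decide) :
    Tri E (RobustMatching.tabR z (nv p) (nv q) btrue e (.const 0)) s T Q := by
  have hn : ∀ p, IsDim p →
    (RobustMatching.tabR z (nv p) (nv q) btrue e (.const 0)).setsNat p = false :=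
    fun p hp => by
      simp [RobustMatching.tabR, RobustMatching.table, forN_setsNat, Cmd.setsNat, hp.1.symm,
        hp.2.1.symm]
  refine Tri.tabR a b
    (fun i j => if h : i < a ∧ j < b then X ⟨i, h.1⟩ ⟨j, h.2⟩ else 0) hT ?_ ?_ ?_ ?_
  · intro s' hf; rw [nv_val, hf.nat p (hn p hd.1), hp]
  · intro s' hf; rw [nv_val, hf.nat q (hn q hd.2), hq]
  · intro i hi j hj s' hf h h0 h1
    rw [dif_pos ⟨hi, hj⟩]
    exact ⟨fun _ => hF ⟨i, hi⟩ ⟨j, hj⟩ s' hf h h0 h1, fun h => absurd (by simp [btrue]) h⟩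
  · intro s' hf h _
    exact hQ s' hf fun i j => by rw [h i i.2 j j.2, dif_pos ⟨i.2, j.2⟩]

/-- Count the indices `j` (variable `23`) below the scalar `p` with `b`. The count goes to the
scalar `70`, the indices to the array `71`. -/
def countCmd (b : BExp) (p : ℕ) : Cmd :=
  .seq (.setNat 70 (.const 0) (.const 0) (.const 0))
    (forN 23 (nv p) (.ite b
      (.seq (.setNat 71 (nv 70) (.const 0) (nv 23))
        (.setNat 70 (.const 0) (.const 0) (.add (nv 70) (.const 1)))) .skip))

open Classical in
theorem countCmd_spec {b : BExp} {p : ℕ} {P : Fin k → Prop} (hT : k + 1 ≤ T)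
    (hp : s.nat p 0 0 = k)
    (hb : ∀ (j : Fin k) (s' : Mem), Frame (countCmd b p) s s' → s'.nat 23 0 0 = j →
      (b.Holds E.ω s' ↔ P j))
    (hd : p ≠ 23 ∧ p ≠ 70 ∧ p ≠ 71 := by decide) :
    Tri E (countCmd b p) s T (fun s' => s'.nat 70 0 0 = (Finset.univ.filter P).card ∧
      ∀ j : Fin k, P j → ∀ c, Nat.count (extend P) j = c → s'.nat 71 c 0 = j) := by
  classical
  have hnp : (countCmd b p).setsNat p = false := by
    simp [countCmd, forN_setsNat, Cmd.setsNat, hd.1.symm, hd.2.1.symm, hd.2.2.symm]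
  refine Tri.seq (P := fun s' => s' = s.setNat 70 0 0 0) (Tri.setNat (by omega) (by simp)) ?_
  rintro s₁ f₁ rfl
  have hfr : ∀ {s'}, Frame (forN 23 (nv p) (.ite b
      (.seq (.setNat 71 (nv 70) (.const 0) (nv 23))
        (.setNat 70 (.const 0) (.const 0) (.add (nv 70) (.const 1)))) .skip))
          (s.setNat 70 0 0 0) s' →
      Frame (countCmd b p) s s' := fun h => f₁.seq h
  refine Tri.forN k (fun i s' => s'.nat 70 0 0 = Nat.count (extend P) i ∧
    ∀ j : Fin k, (j : ℕ) < i → P j → s'.nat 71 (Nat.count (extend P) j) 0 = j) (T₀ := 1) (by omega)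
    le_rfl rfl (fun s' hf => by rw [nv_val, (hfr hf).nat p hnp, hp]) (fun _ _ _ h => h) ?_ ?_ ?_
  · exact ⟨by simp [Mem.setNat], fun j hj => absurd hj (Nat.not_lt_zero _)⟩
  · rintro i hi s' hf h23 ⟨h1, h2⟩
    have hB := hb ⟨i, hi⟩ s' (hfr hf) h23
    have he : extend P i ↔ P ⟨i, hi⟩ := ⟨fun h => h.2, fun h => ⟨hi, h⟩⟩
    refine Tri.ite le_rfl (fun h => ?_) (fun h => ?_)
    · refine Tri.seq (P := fun s'' => s'' = s'.setNat 71 (Nat.count (extend P) i) 0 i)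
        (Tri.setNat le_rfl (by simp [h1, h23])) ?_
      rintro s₂ - rfl
      refine Tri.setNat le_rfl ?_
      rw [Nat.count_succ, if_pos (he.2 (hB.1 h))]
      refine ⟨by simp [Mem.setNat, h1], fun j hj hPj => ?_⟩
      rw [Mem.setNat_nat_ne _ _ _ _ (by decide), Mem.setNat_nat]
      rcases Nat.lt_succ_iff_lt_or_eq.1 hj with hj' | hj'
      · have : Nat.count (extend P) j < Nat.count (extend P) i :=
          Nat.count_strict_mono (p := extend P) ⟨j.2, hPj⟩ hj'
        rw [if_neg (by omega)]
        exact h2 j hj' hPj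
      · rw [if_pos ⟨rfl, by rw [hj'], rfl⟩, hj']
    · refine Tri.skip le_rfl ?_
      rw [Nat.count_succ, if_neg (fun h' => h (hB.2 (he.1 h')))]
      refine ⟨h1, fun j hj hPj => h2 j ?_ hPj⟩
      rcases Nat.lt_succ_iff_lt_or_eq.1 hj with hj' | hj'
      · exact hj'
      · exact absurd (hB.2 (by convert hPj using 1; exact Fin.ext hj'.symm)) h
  · rintro s' hf - ⟨h1, h2⟩
    rw [count_extend] at h1
    exact ⟨h1, fun j hj c hc => hc ▸ h2 j j.2 hj⟩

/-- Write the eigenvectors (array `71`) with the indices found by `countCmd` to the array `z`. -/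
def pickCmd (z p q : ℕ) : Cmd :=
  tabR z (nv p) (nv q) btrue (.get 71 (nv 20) (.get 71 (nv 21) (.const 0))) (.const 0)

open Classical in
theorem pickCmd_spec {z p q : ℕ} {P : Fin k → Prop} {Q : Matrix (Fin k) (Fin k) ℝ}
    (hT : (k + 1) * (l + 1) ≤ T) (hp : s.nat p 0 0 = k) (hq : s.nat q 0 0 = l) (hQ : s.Holds 71 Q)
    (hc : ∀ j : Fin k, P j → ∀ c, Nat.count (extend P) j = c → s.nat 71 c 0 = j)
    (hl : l ≤ (Finset.univ.filter P).card) (hz : z ≠ 71 := by decide)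
    (hd : IsDim p ∧ IsDim q := by decide) :
    Tri E (pickCmd z p q) s T (fun s' => s'.Holds z (selCols Q P l)) := by
  classical
  refine Tri.mapTab hT hp hq ?_ (fun s' _ h => h) hd
  intro i c s' hf _ h0 h1
  obtain ⟨h, hp, hcnt⟩ :=
    nth_extend (p := P) (c := c) (by rw [count_extend]; exact lt_of_lt_of_le c.2 hl)
  have e := hc ⟨_, h⟩ hp c hcnt
  simp only [RExp.val, NExp.val, nv_val, h0, h1]
  rw [hf.real 71 (by simp [tabR, table, forN_setsReal, Cmd.setsReal, hz]),
    hf.nat 71 (by simp [tabR, table, forN_setsNat, Cmd.setsNat]), e, selCols, dif_pos h]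
  exact hQ i ⟨_, h⟩

/-- The test that the eigenvalue with index `23` (array `70`) lies strictly between two values. -/
def eigTest (a b : RExp) : BExp :=
  .and (realLt a (.get 70 (nv 23) (.const 0))) (realLt (.get 70 (nv 23) (.const 0)) b)

/-- Spectral decomposition of the array `x`, and selection of eigenvectors. -/
def eigPickCmd (x z : ℕ) (b : BExp) (q : ℕ) : Cmd :=
  .seq (.spectral x (nv 6) 70 71) (.seq (countCmd b 6) (pickCmd z 6 q))

open Classical in
theorem eigPickCmd_spec {n κ x z q : ℕ} {b : BExp} {M : Matrix (Fin k) (Fin k) ℝ} {P : ℝ → Prop}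
    (hB : Budget E n κ T) (hk : k ≤ κ) (hlk : l ≤ κ) (h6 : s.nat 6 0 0 = k)
    (hq : s.nat q 0 0 = l) (hM : s.Holds x M)
    (hb : ∀ (j : Fin k) (s' : Mem), Frame (.seq (.spectral x (nv 6) 70 71) (countCmd b 6)) s s' →
      s'.nat 23 0 0 = j → s'.real 70 j 0 = (spectralDecomposition M).1 j →
      (b.Holds E.ω s' ↔ P ((spectralDecomposition M).1 j)))
    (hl : l ≤ (Finset.univ.filter fun j => P ((spectralDecomposition M).1 j)).card)
    (hz : z ≠ 71 := by decide) (hd : IsDim q ∧ q ≠ 70 ∧ q ≠ 71 := by decide) :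
    Tri E (eigPickCmd x z b q) s T (fun s' => s'.Holds z
      (selCols (spectralDecomposition M).2 (fun j => P ((spectralDecomposition M).1 j)) l)) := by
  refine Tri.seq (P := fun s' => (∀ j : Fin k, s'.real 70 j 0 = (spectralDecomposition M).1 j) ∧
    s'.Holds 71 (spectralDecomposition M).2) (Tri.spectral (n := k) (by decide) (by simpa using h6)
      (hB.eig k hk) fun s' _ h1 h2 => ?_) ?_
  · rw [hM.block] at h1 h2
    exact ⟨h1, h2⟩
  rintro s₁ f₁ ⟨h70, h71⟩
  have hT1 := hB.tab (a := k) (b := 0) (by omega) (by omega)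
  refine Tri.seq (countCmd_spec (P := fun j => P ((spectralDecomposition M).1 j)) (by omega)
    (by rw [f₁.nat 6 rfl, h6]) fun j s' hf h23 => ?_) ?_
  · refine hb j s' (f₁.seq hf) h23 ?_
    rw [hf.real 70 (by simp [countCmd, forN_setsReal, Cmd.setsReal]), h70]
  rintro s₂ f₂ ⟨-, hc⟩
  have hq2 : s₂.nat q = s₁.nat q := f₂.nat q (by
    simp [countCmd, forN_setsNat, Cmd.setsNat, hd.1.2.2.2.symm, hd.2.1.symm, hd.2.2.symm])
  exact pickCmd_spec (hB.tab (by omega) (by omega))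
    (by rw [f₂.nat 6 (by simp [countCmd, forN_setsNat, Cmd.setsNat]), f₁.nat 6 rfl, h6])
    (by rw [hq2, f₁.nat q rfl, hq])
    (h71.congr (f₂.real 71 (by simp [countCmd, forN_setsReal, Cmd.setsReal]))) hc hl hz
    ⟨by decide, hd.1⟩

theorem eigTest_holds {a b : RExp} {s' : Mem} {j : ℕ} {x y z : ℝ} (h23 : s'.nat 23 0 0 = j)
    (h70 : s'.real 70 j 0 = x) (ha : a.val E.ω s' = y) (hb : b.val E.ω s' = z) :
    (eigTest a b).Holds E.ω s' ↔ y < x ∧ x < z := by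
  simp [eigTest, realLt_holds, h23, h70, ha, hb]

/-- Common vectors of the spans of the selected eigenvectors. The arrays `12`, `13` contain the
matrices, the scalar `14` is `ε`; the scalars `6`, `7`, `5` are `k`, `3k/4` and `k/12`. -/
noncomputable def commonCmd : Cmd :=
  .seq (eigPickCmd 12 72 (eigTest (.const 0.9) (.const 1.1)) 7)
    (.seq (eigPickCmd 13 73 (eigTest (.mul (.const 0.9) (rv 14)) (.mul (.const 1.1) (rv 14))) 7)
    (.seq (mulCmd 74 72 72 false true 6 6 7) (.seq (mulCmd 75 73 73 false true 6 6 7)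
    (.seq (tabR 74 (nv 6) (nv 6) btrue (.add (.get 74 (nv 20) (nv 21)) (.get 75 (nv 20) (nv 21)))
      (.const 0))
    (eigPickCmd 74 76 (.realLe (.const 2) (.get 70 (nv 23) (.const 0))) 5)))))

/-- The memory describes a triple. -/
structure Mem.HoldsState (s : Mem) (σ : SpecState k) : Prop where
  dim : s.nat 6 0 0 = k
  dim34 : s.nat 7 0 0 = 3 * k / 4
  dim12 : s.nat 5 0 0 = k / 12
  phi : s.Holds 12 σ.Phi
  psi : s.Holds 13 σ.Psi
  eps : s.real 14 0 0 = σ.eps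

theorem commonCmd_spec {n κ : ℕ} {σ : SpecState k} (hB : Budget E n κ T) (hk : k ≤ κ) (h12 : 12 ∣ k)
    (hσ : Sound σ) (hs : s.HoldsState σ) :
    Tri E commonCmd s T (fun s' => s'.Holds 76 (commonVecs (goodVecs σ.Phi 0.9 1.1 (3 * k / 4))
      (goodVecs σ.Psi (0.9 * σ.eps) (1.1 * σ.eps) (3 * k / 4)) (k / 12))) := by
  classical
  obtain ⟨hc1, hc2⟩ := (spectralAssumption_iff hσ.phi_symm hσ.psi_symm).1 hσ.good
  have hν : EigenFamily σ.Phi 0.9 1.1 fun c i => goodVecs σ.Phi 0.9 1.1 (3 * k / 4) i c :=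
    eigenFamily_selCols (isSpectralDecomposition_spectralDecomposition hσ.phi_symm) hc1
  have hζ : EigenFamily σ.Psi (0.9 * σ.eps) (1.1 * σ.eps) fun c i =>
      goodVecs σ.Psi (0.9 * σ.eps) (1.1 * σ.eps) (3 * k / 4) i c :=
    eigenFamily_selCols (isSpectralDecomposition_spectralDecomposition hσ.psi_symm) hc2
  have hc3 := le_card_common hν.transpose_mul hζ.transpose_mul (l := k / 12) (by omega)
  have hk34 : 3 * k / 4 ≤ κ := by omega
  refine Tri.seq (P := fun s' => s'.Holds 72 (goodVecs σ.Phi 0.9 1.1 (3 * k / 4)))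
    (eigPickCmd_spec (P := fun x => 0.9 < x ∧ x < 1.1) hB hk hk34 hs.dim hs.dim34 hs.phi
      (fun j s' _ h23 h70 => eigTest_holds h23 h70 rfl rfl) (by convert hc1)) ?_
  intro s₁ f₁ h72
  refine Tri.seq (P := fun s' => s'.Holds 73
    (goodVecs σ.Psi (0.9 * σ.eps) (1.1 * σ.eps) (3 * k / 4)))
    (eigPickCmd_spec (P := fun x => 0.9 * σ.eps < x ∧ x < 1.1 * σ.eps) hB hk hk34
      (by rw [f₁.nat 6 rfl]; exact hs.dim) (by rw [f₁.nat 7 rfl]; exact hs.dim34)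
      (hs.psi.congr (f₁.real 13 rfl)) (fun j s' f h23 h70 => ?_) (by convert hc2)) ?_
  · have e : s'.real 14 0 0 = σ.eps := by rw [f.real 14 rfl, f₁.real 14 rfl, hs.eps]
    exact eigTest_holds h23 h70 (by simp [e]) (by simp [e])
  intro s₂ f₂ h73
  have g₂ := f₁.seq f₂
  refine Tri.seq (mulCmd_spec (X := goodVecs σ.Phi 0.9 1.1 (3 * k / 4))
    (Y := (goodVecs σ.Phi 0.9 1.1 (3 * k / 4))ᵀ) (hB.mul (by omega) (by omega) (by omega))
    (h72.congr (f₂.real 72 rfl)) (h72.congr (f₂.real 72 rfl)) (by rw [g₂.nat 6 rfl]; exact hs.dim)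
    (by rw [g₂.nat 6 rfl]; exact hs.dim) (by rw [g₂.nat 7 rfl]; exact hs.dim34)) ?_
  intro s₃ f₃ h74
  have g₃ := g₂.seq f₃
  refine Tri.seq (mulCmd_spec (X := goodVecs σ.Psi (0.9 * σ.eps) (1.1 * σ.eps) (3 * k / 4))
    (Y := (goodVecs σ.Psi (0.9 * σ.eps) (1.1 * σ.eps) (3 * k / 4))ᵀ)
    (hB.mul (by omega) (by omega) (by omega))
    (h73.congr (f₃.real 73 rfl)) (h73.congr (f₃.real 73 rfl)) (by rw [g₃.nat 6 rfl]; exact hs.dim)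
    (by rw [g₃.nat 6 rfl]; exact hs.dim) (by rw [g₃.nat 7 rfl]; exact hs.dim34)) ?_
  intro s₄ f₄ h75
  have g₄ := g₃.seq f₄
  refine Tri.seq (Tri.mapTab
    (X := goodVecs σ.Phi 0.9 1.1 (3 * k / 4) * (goodVecs σ.Phi 0.9 1.1 (3 * k / 4))ᵀ +
      goodVecs σ.Psi (0.9 * σ.eps) (1.1 * σ.eps) (3 * k / 4) *
        (goodVecs σ.Psi (0.9 * σ.eps) (1.1 * σ.eps) (3 * k / 4))ᵀ)
    (Q := fun s' => s'.Holds 74 _) (hB.tab (by omega) (by omega))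
    (by rw [g₄.nat 6 rfl]; exact hs.dim) (by rw [g₄.nat 6 rfl]; exact hs.dim)
    (fun i j s' f h h0 h1 => ?_) (fun s' _ h => h)) ?_
  · simp only [RExp.val, nv_val, h0, h1]
    rw [h, f.real 75 rfl, f₄.real 74 rfl, h74 i j, h75 i j]
    rfl
  intro s₅ f₅ h74'
  have g₅ := g₄.seq f₅
  exact eigPickCmd_spec (P := fun x => 2 ≤ x) hB hk (by omega) (by rw [g₅.nat 6 rfl]; exact hs.dim)
    (by rw [g₅.nat 5 rfl]; exact hs.dim12) h74' (fun j s' f h23 h70 => by simp [h23, h70])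
    (by convert hc3)

/-- `Ξ` is written to the array `15`, and `Ξᵀ Ψ Ξ` to the array `80`. -/
def xiCmd : Cmd :=
  .seq (mulCmd 77 76 12 true false 5 6 6) (.seq (mulCmd 78 77 76 false false 5 5 6)
    (.seq (.spectral 78 (nv 5) 70 71) (.seq (mulCmd 79 76 71 false false 6 5 5)
    (.seq (tabR 79 (nv 6) (nv 5) btrue
      (.div (.get 79 (nv 20) (nv 21)) (.sqrt (.get 70 (nv 21) (.const 0)))) (.const 0))
    (.seq (mulCmd 77 79 13 true false 5 6 6) (.seq (mulCmd 78 77 79 false false 5 5 6)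
    (.seq (.spectral 78 (nv 5) 70 71) (.seq (mulCmd 15 79 71 false false 6 5 5)
    (.seq (mulCmd 77 15 13 true false 5 6 6) (mulCmd 80 77 15 false false 5 5 6))))))))))

theorem xiCmd_spec {n κ : ℕ} {σ : SpecState k} (hB : Budget E n κ T) (hk : k ≤ κ)
    (hs : s.HoldsState σ) (h76 : s.Holds 76 (commonVecs (goodVecs σ.Phi 0.9 1.1 (3 * k / 4))
      (goodVecs σ.Psi (0.9 * σ.eps) (1.1 * σ.eps) (3 * k / 4)) (k / 12))) :
    Tri E xiCmd s T (fun s' => s'.Holds 15 (rule.app σ) ∧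
      s'.Holds 80 ((rule.app σ)ᵀ * σ.Psi * rule.app σ)) := by
  set V := commonVecs (goodVecs σ.Phi 0.9 1.1 (3 * k / 4))
      (goodVecs σ.Psi (0.9 * σ.eps) (1.1 * σ.eps) (3 * k / 4)) (k / 12) with hV
  set W := whiten σ.Phi V with hW
  have hΞ : rule.app σ = W * (spectralDecomposition (Wᵀ * σ.Psi * W)).2 := rfl
  refine Tri.seq (mulCmd_spec (X := Vᵀ) (Y := σ.Phi) (hB.mul (by omega) (by omega) (by omega)) h76
    hs.phi hs.dim12 hs.dim hs.dim) ?_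
  intro s₁ f₁ h1
  refine Tri.seq
    (mulCmd_spec (X := Vᵀ * σ.Phi) (Y := V) (hB.mul (by omega) (by omega) (by omega)) h1
    (h76.congr (f₁.real 76 rfl)) (by rw [f₁.nat 5 rfl]; exact hs.dim12)
    (by rw [f₁.nat 5 rfl]; exact hs.dim12) (by rw [f₁.nat 6 rfl]; exact hs.dim)) ?_
  intro s₂ f₂ h2
  have g₂ := f₁.seq f₂
  refine Tri.seq (P := fun s' => (∀ j : Fin (k / 12), s'.real 70 j 0 =
      (spectralDecomposition (Vᵀ * σ.Phi * V)).1 j) ∧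
      s'.Holds 71 (spectralDecomposition (Vᵀ * σ.Phi * V)).2)
    (Tri.spectral (n := k / 12) (by decide) (by rw [nv_val, g₂.nat 5 rfl]; exact hs.dim12)
      (hB.eig _ (by omega))
      fun s' _ ha hb => ?_) ?_
  · rw [h2.block] at ha hb
    exact ⟨ha, hb⟩
  rintro s₃ f₃ ⟨h70, h71⟩
  have g₃ := g₂.seq f₃
  refine Tri.seq (mulCmd_spec (X := V) (Y := (spectralDecomposition (Vᵀ * σ.Phi * V)).2)
    (hB.mul (by omega) (by omega) (by omega)) (h76.congr (g₃.real 76 rfl)) h71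
    (by rw [g₃.nat 6 rfl]; exact hs.dim) (by rw [g₃.nat 5 rfl]; exact hs.dim12)
    (by rw [g₃.nat 5 rfl]; exact hs.dim12)) ?_
  intro s₄ f₄ h4
  have g₄ := g₃.seq f₄
  refine Tri.seq (Tri.mapTab (X := W) (Q := fun s' => s'.Holds 79 W) (hB.tab (by omega) (by omega))
    (by rw [g₄.nat 6 rfl]; exact hs.dim) (by rw [g₄.nat 5 rfl]; exact hs.dim12)
    (fun i j s' f h h0 h1 => ?_) (fun s' _ h => h)) ?_
  · simp only [RExp.val, NExp.val, nv_val, h0, h1]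
    rw [h, h4 i j, f.real 70 rfl, f₄.real 70 rfl, h70 j]
    rfl
  intro s₅ f₅ h5
  have g₅ := g₄.seq f₅
  refine Tri.seq (mulCmd_spec (X := Wᵀ) (Y := σ.Psi) (hB.mul (by omega) (by omega) (by omega)) h5
    (hs.psi.congr (g₅.real 13 rfl)) (by rw [g₅.nat 5 rfl]; exact hs.dim12)
    (by rw [g₅.nat 6 rfl]; exact hs.dim) (by rw [g₅.nat 6 rfl]; exact hs.dim)) ?_
  intro s₆ f₆ h6
  have g₆ := g₅.seq f₆
  refine Tri.seq
    (mulCmd_spec (X := Wᵀ * σ.Psi) (Y := W) (hB.mul (by omega) (by omega) (by omega)) h6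
    (h5.congr (f₆.real 79 rfl)) (by rw [g₆.nat 5 rfl]; exact hs.dim12)
    (by rw [g₆.nat 5 rfl]; exact hs.dim12) (by rw [g₆.nat 6 rfl]; exact hs.dim)) ?_
  intro s₇ f₇ h7
  have g₇ := g₆.seq f₇
  refine Tri.seq (P := fun s' => s'.Holds 71 (spectralDecomposition (Wᵀ * σ.Psi * W)).2)
    (Tri.spectral (n := k / 12) (by decide) (by rw [nv_val, g₇.nat 5 rfl]; exact hs.dim12)
      (hB.eig _ (by omega))
      fun s' _ ha hb => ?_) ?_
  · rw [h7.block] at hb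
    exact hb
  intro s₈ f₈ h8
  have g₈ := g₇.seq f₈
  refine Tri.seq (mulCmd_spec (X := W) (Y := (spectralDecomposition (Wᵀ * σ.Psi * W)).2)
    (hB.mul (by omega) (by omega) (by omega))
    (h5.congr (by rw [f₈.real 79 rfl, f₇.real 79 rfl, f₆.real 79 rfl])) h8
    (by rw [g₈.nat 6 rfl]; exact hs.dim) (by rw [g₈.nat 5 rfl]; exact hs.dim12)
    (by rw [g₈.nat 5 rfl]; exact hs.dim12)) ?_
  rw [← hΞ]
  intro s₉ f₉ h9
  have g₉ := g₈.seq f₉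
  refine Tri.seq (mulCmd_spec (X := (rule.app σ)ᵀ) (Y := σ.Psi)
    (hB.mul (by omega) (by omega) (by omega)) h9
    (hs.psi.congr (g₉.real 13 rfl)) (by rw [g₉.nat 5 rfl]; exact hs.dim12)
    (by rw [g₉.nat 6 rfl]; exact hs.dim) (by rw [g₉.nat 6 rfl]; exact hs.dim)) ?_
  intro s₁₀ f₁₀ h10
  have g₁₀ := g₉.seq f₁₀
  refine Tri.imp (mulCmd_spec (X := (rule.app σ)ᵀ * σ.Psi) (Y := rule.app σ)
    (hB.mul (by omega) (by omega) (by omega)) h10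
    (h9.congr (f₁₀.real 15 rfl)) (by rw [g₁₀.nat 5 rfl]; exact hs.dim12)
    (by rw [g₁₀.nat 5 rfl]; exact hs.dim12) (by rw [g₁₀.nat 6 rfl]; exact hs.dim)) ?_
  intro s' f h
  exact ⟨h9.congr (by rw [f.real 15 rfl, f₁₀.real 15 rfl]), h⟩

end

section

/-! ### Message passing steps -/

variable {E : Env} {s : Mem} {T k l n κ K0 : ℕ} {m : Params}

/-- The array `z` contains the matrix `h`, whose rows are indexed by the elements outside the seeds.
-/
def Mem.HoldsRest (s : Mem) (z : ℕ) {U : Fin K0 ↪ Fin n} (h : Matrix (Rest U) (Fin l) ℝ) : Prop :=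
  ∀ (i : Rest U) (j : Fin l), s.real z i j = h i j

open Classical in
/-- The extension of a matrix by zero rows for the seeds. -/
noncomputable def pad (U : Fin K0 ↪ Fin n) (f : Matrix (Rest U) (Fin k) ℝ) :
    Matrix (Fin n) (Fin k) ℝ := fun i j => if h : ∀ k, U k ≠ i then f ⟨i, h⟩ j else 0

/-- The product with the submatrix outside the seeds is a product with the whole matrix once the
seed rows of the other factor are set to zero. -/
theorem mul_pad (M : Matrix (Fin n) (Fin n) ℝ) (U : Fin K0 ↪ Fin n) (f : Matrix (Rest U) (Fin k) ℝ)
    (i : Fin n) (j : Fin k) : (M * pad U f) i j = ∑ x : Rest U, M i x * f x j := by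
  rw [Matrix.mul_apply]
  symm
  refine Fintype.sum_of_injective Subtype.val Subtype.val_injective _ _ ?_ ?_
  · intro x hx
    have : ¬ ∀ k, U k ≠ x := fun h => hx ⟨⟨x, h⟩, rfl⟩
    rw [pad, dif_neg this, mul_zero]
  · intro x
    rw [pad, dif_pos x.2]

/-- `z := n^{-1/2} x y Ξ`, with `Ξ` in the array `15`. -/
def ampCmd (z x y : ℕ) : Cmd :=
  .seq (mulCmd 44 x y false false 0 6 0) (.seq (mulCmd 45 44 15 false false 0 5 6)
    (tabR z (nv 0) (nv 5) btrue (.div (.get 45 (nv 20) (nv 21)) (.sqrt (.ofNat (nv 0))))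
      (.const 0)))

theorem ampCmd_spec {z x y : ℕ} {M : Matrix (Fin n) (Fin n) ℝ} {U : Fin K0 ↪ Fin n}
    {f : Matrix (Rest U) (Fin k) ℝ} {Ξ : Matrix (Fin k) (Fin l) ℝ} (hB : Budget E n κ T)
    (hk : k ≤ κ)
    (hl : l ≤ κ) (hn : s.nat 0 0 0 = n) (h6 : s.nat 6 0 0 = k) (h5 : s.nat 5 0 0 = l)
    (hM : s.Holds x M) (hf : s.Holds y (pad U f)) (hΞ : s.Holds 15 Ξ)
    (hz : z ≠ 45 ∧ (44 ≠ 6 ∧ 44 ≠ x ∧ 44 ≠ y ∧ x ≠ 6 ∧ y ≠ 6) := by decide) :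
    Tri E (ampCmd z x y) s T (fun s' => s'.HoldsRest z (ampLinear M U f Ξ)) := by
  refine Tri.seq
    (mulCmd_spec (X := M) (Y := pad U f) (hB.mul (by omega) (by omega) (by omega)) hM hf
    hn h6 hn hz.2) ?_
  intro s₁ f₁ h44
  refine Tri.seq
    (mulCmd_spec (X := M * pad U f) (Y := Ξ) (hB.mul (by omega) (by omega) (by omega)) h44
    (hΞ.congr (f₁.real 15 rfl)) (by rw [f₁.nat 0 rfl, hn]) (by rw [f₁.nat 5 rfl, h5])
    (by rw [f₁.nat 6 rfl, h6])) ?_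
  intro s₂ f₂ h45
  have g₂ := f₁.seq f₂
  refine Tri.mapTab (X := (√(n : ℝ))⁻¹ • (M * pad U f * Ξ)) (hB.tab (by omega) (by omega))
    (by rw [g₂.nat 0 rfl, hn]) (by rw [g₂.nat 5 rfl, h5]) (fun i j s' hf' _ h0 h1 => ?_)
    (fun s' _ h i j => ?_)
  · simp only [RExp.val, nv_val, h0, h1]
    rw [hf'.real 45 (by simp [tabR, table, forN_setsReal, Cmd.setsReal, hz.1]), h45 i j,
      hf'.nat 0 rfl,
      g₂.nat 0 rfl, hn, Matrix.smul_apply, smul_eq_mul, div_eq_inv_mul]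
  · rw [h i j, ampLinear, Matrix.smul_apply, Matrix.smul_apply]
    congr 1
    rw [Matrix.mul_apply, Matrix.mul_apply]
    refine Finset.sum_congr rfl fun c _ => ?_
    rw [mul_pad]
    rfl

/-- `y := φ (h β)` outside the seeds and `0` on the seeds, with `β` in the array `81`. -/
noncomputable def denoiseCmd (m : Params) (y h w : ℕ) : Cmd :=
  .seq (mulCmd 44 h 81 false false 0 9 5)
    (tabR y (nv 0) (nv 9) btrue (.mul (.sub (.const 1) (.get w (nv 20) (.const 0)))
      (evalExp m.φ (.get 44 (nv 20) (nv 21)))) (.const 0))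

theorem mask_mul {w : ℕ} {U : Fin K0 ↪ Fin n} (hw : s.HoldsMask w U) (i : Fin n) (j : Fin k)
    (f : Matrix (Rest U) (Fin k) ℝ) {a : ℝ} (ha : ∀ h : ∀ k, U k ≠ i, a = f ⟨i, h⟩ j) :
    (1 - s.real w i 0) * a = pad U f i j := by
  by_cases h : ∀ k, U k ≠ i
  · rw [pad, dif_pos h, ← ha h, hw.rest ⟨i, h⟩]; ring
  · rw [pad, dif_neg h]
    push Not at h
    obtain ⟨k, rfl⟩ := h
    rw [hw.seed k]; ring

theorem denoiseCmd_spec {y h w : ℕ} {U : Fin K0 ↪ Fin n} {H : Matrix (Rest U) (Fin l) ℝ}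
    {β : Matrix (Fin l) (Fin k) ℝ} (hB : Budget E n κ T) (hk : k ≤ κ) (hl : l ≤ κ)
    (hn : s.nat 0 0 0 = n) (h9 : s.nat 9 0 0 = k) (h5 : s.nat 5 0 0 = l) (hH : s.HoldsRest h H)
    (hβ : s.Holds 81 β) (hw : s.HoldsMask w U)
    (hd : y ≠ 44 ∧ y ≠ w ∧ 44 ≠ w ∧ 6 ≠ w ∧
      (44 ≠ 6 ∧ 44 ≠ h ∧ 44 ≠ 81 ∧ h ≠ 6 ∧ 81 ≠ 6) := by decide) :
    Tri E (denoiseCmd m y h w) s T (fun s' => s'.Holds y (pad U ((H * β).map m.φ.eval))) := by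
  let F : Matrix (Fin n) (Fin l) ℝ := fun i j => s.real h i j
  refine Tri.seq (mulCmd_spec (X := F) (Y := β) (hB.mul (by omega) (by omega) (by omega))
    (fun i j => rfl) hβ hn h9 h5 hd.2.2.2.2) ?_
  intro s₁ f₁ h44
  refine Tri.mapTab (X := pad U ((H * β).map m.φ.eval)) (hB.tab (by omega) (by omega))
    (by rw [f₁.nat 0 rfl, hn]) (by rw [f₁.nat 9 rfl, h9]) (fun i j s' hf' _ h0 h1 => ?_)
    (fun s' _ h => h)
  simp only [RExp.val, NExp.val, nv_val, h0, h1, evalExp_val]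
  rw [hf'.real 44 (by simp [tabR, table, forN_setsReal, Cmd.setsReal, hd.1]),
    hf'.real w (by simp [tabR, table, forN_setsReal, Cmd.setsReal, hd.2.1]), h44 i j,
    f₁.real w (by simp [mulCmd, sumTab, table, forN_setsReal, Cmd.setsReal, hd.2.2.1, hd.2.2.2.1])]
  refine mask_mul hw i j _ fun hi => ?_
  rw [Matrix.map_apply, Matrix.mul_apply, Matrix.mul_apply]
  exact congrArg _ (Finset.sum_congr rfl fun c _ => congrArg (· * _) (hH ⟨i, hi⟩ c))

/-- The first iterate, from the columns `u` of the array `x`. -/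
noncomputable def firstCmd (m : Params) (y x u w : ℕ) : Cmd :=
  tabR y (nv 0) (nv 6) btrue (.mul (.sub (.const 1) (.get w (nv 20) (.const 0)))
    (evalExp m.φ (.get x (nv 20) (.get u (nv 21) (.const 0))))) (.const 0)

theorem firstCmd_spec {y x u w : ℕ} {U : Fin K0 ↪ Fin n} {M : Matrix (Fin n) (Fin n) ℝ}
    (hB : Budget E n κ T) (hk : K0 ≤ κ) (hn : s.nat 0 0 0 = n) (h6 : s.nat 6 0 0 = K0)
    (hM : s.Holds x M) (hU : s.HoldsSeeds u U) (hw : s.HoldsMask w U)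
    (hd : y ≠ x ∧ y ≠ w ∧ u ≠ 20 ∧ u ≠ 21 := by decide) :
    Tri E (firstCmd m y x u w) s T (fun s' => s'.Holds y
      (pad U (fun i k => m.φ.eval (M i (U k)) : Matrix (Rest U) (Fin K0) ℝ))) := by
  refine Tri.mapTab (hB.tab (by omega) (by omega)) hn h6 (fun i j s' hf' _ h0 h1 => ?_)
    (fun s' _ h => h)
  simp only [RExp.val, NExp.val, nv_val, h0, h1, evalExp_val]
  rw [hf'.real x (by simp [tabR, table, forN_setsReal, Cmd.setsReal, hd.1]),
    hf'.real w (by simp [tabR, table, forN_setsReal, Cmd.setsReal, hd.2.1]),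
    hf'.nat u (by simp [tabR, table, forN_setsNat, Cmd.setsNat, hd.2.2.1.symm, hd.2.2.2.symm]),
      hU j,
    hM i (U j)]
  exact mask_mul hw i j _ fun hi => rfl

/-! ### The spectral subroutine -/

/-- Compute `K_{t+1}` (scalar `9`), `K_{t+1} / 12` (scalar `11`) and `3 K_{t+1} / 4` (scalar `14`)
from `K_t` (scalar `6`). The machine neither rounds nor divides naturals, so the program counts up
in steps of `12`. -/
noncomputable def dimCmd (m : Params) : Cmd :=
  .seq (.setNat 9 (.const 0) (.const 0) (.const 0))
      (.seq (.setNat 11 (.const 0) (.const 0) (.const 0))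
    (.seq (.setNat 14 (.const 0) (.const 0) (.const 0))
    (.while (.realLe (.ofNat (.add (nv 9) (.const 12)))
        (.mul (.mul (.const m.growth) (.ofNat (nv 6))) (.ofNat (nv 6))))
      (.seq (.setNat 9 (.const 0) (.const 0) (.add (nv 9) (.const 12)))
        (.seq (.setNat 11 (.const 0) (.const 0) (.add (nv 11) (.const 1)))
          (.setNat 14 (.const 0) (.const 0) (.add (nv 14) (.const 9))))))))

theorem dimCmd_spec {t : ℕ} (hB : Budget E n κ T) (hκ : m.K K0 (t + 1) ≤ κ)
    (h6 : s.nat 6 0 0 = m.K K0 t) :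
    Tri E (dimCmd m) s T (fun s' => s'.nat 9 0 0 = m.K K0 (t + 1) ∧
      s'.nat 11 0 0 = m.K K0 (t + 1) / 12 ∧ s'.nat 14 0 0 = 3 * m.K K0 (t + 1) / 4) := by
  have h1 := hB.one
  set N := ⌊m.growth * (m.K K0 t : ℝ) ^ 2 / 12⌋₊ with hN
  have hK : m.K K0 (t + 1) = 12 * N := rfl
  have hTN := hB.tab (a := N) (b := 0) (by omega) (by omega)
  refine Tri.seq (P := fun s' => s' = s.setNat 9 0 0 0) (Tri.setNat h1 (by simp)) ?_
  rintro s₁ f₁ rfl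
  refine Tri.seq (P := fun s' => s' = (s.setNat 9 0 0 0).setNat 11 0 0 0)
    (Tri.setNat h1 (by simp)) ?_
  rintro s₂ f₂ rfl
  refine Tri.seq (P := fun s' => s' = ((s.setNat 9 0 0 0).setNat 11 0 0 0).setNat 14 0 0 0)
    (Tri.setNat h1 (by simp)) ?_
  rintro s₃ f₃ rfl
  refine Tri.whileLoop (T₀ := 1) (fun i s' => s'.nat 9 0 0 = 12 * i ∧ s'.nat 11 0 0 = i ∧
    s'.nat 14 0 0 = 9 * i ∧ i ≤ N) N (by omega) le_rfl ?_ ?_ ?_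
  · simp [Mem.setNat]
  · rintro i s' f ⟨h9, h11, h14, hi⟩ hc
    have h6' : s'.nat 6 0 0 = m.K K0 t := by
      rw [f.nat 6 rfl, f₃.nat 6 rfl, f₂.nat 6 rfl, f₁.nat 6 rfl, h6]
    simp only [BExp.Holds, RExp.val, NExp.val, nv_val, h9, h6'] at hc
    have hlt : i + 1 ≤ N :=
      Nat.le_floor (by push_cast at hc ⊢; rw [le_div_iff₀ (by norm_num)]; linarith)
    refine ⟨hlt, Tri.seq (P := fun s'' => s'' = s'.setNat 9 0 0 (12 * i + 12)) (Tri.setNat le_rfl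
      (by simp [h9])) ?_⟩
    rintro s₄ - rfl
    refine Tri.seq (P := fun s'' => s'' = (s'.setNat 9 0 0 (12 * i + 12)).setNat 11 0 0 (i + 1))
      (Tri.setNat le_rfl (by simp [Mem.setNat, h11])) ?_
    rintro s₅ - rfl
    refine Tri.setNat le_rfl ?_
    simp [Mem.setNat, h14]
    omega
  · rintro i s' f ⟨h9, h11, h14, hi⟩ hc
    have h6' : s'.nat 6 0 0 = m.K K0 t := by
      rw [f.nat 6 rfl, f₃.nat 6 rfl, f₂.nat 6 rfl, f₁.nat 6 rfl, h6]
    simp only [BExp.Holds, RExp.val, NExp.val, nv_val, h9, h6', not_le] at hc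
    have hge : N < i + 1 := (Nat.floor_lt (by
      have : (0 : ℝ) ≤ m.growth * (m.K K0 t : ℝ) ^ 2 := by
        rw [Params.growth]
        have : (0 : ℝ) ≤ m.ρ ^ 20 := Even.pow_nonneg (by decide) _
        have : (0 : ℝ) ≤ m.Λ⁻¹ ^ 2 := sq_nonneg _
        positivity
      positivity)).2 (by push_cast at hc ⊢; rw [div_lt_iff₀ (by norm_num)]; linarith)
    obtain rfl : i = N := by omega
    refine ⟨by omega, by omega, by omega⟩

/-- The scalars and arrays on which the sampling of the sign matrix depends. -/
structure Mem.HoldsLevel (m : Params) (s : Mem) (σ : SpecState k)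
    (Ξ : Matrix (Fin k) (Fin (k / 12)) ℝ)
    (l t : ℕ) : Prop where
  dim : s.nat 6 0 0 = k
  dim12 : s.nat 5 0 0 = k / 12
  next : s.nat 9 0 0 = l
  next34 : s.nat 14 0 0 = 3 * l / 4
  time : s.nat 8 0 0 = t
  form : s.Holds 80 (Ξᵀ * σ.Psi * Ξ)
  eps : s.real 86 0 0 = m.φ.corr (m.ρ / 2 * (12 / (k : ℝ) * (Ξᵀ * σ.Psi * Ξ).trace))

theorem Mem.HoldsLevel.congr {s' : Mem} {σ : SpecState k} {Ξ : Matrix (Fin k) (Fin (k / 12)) ℝ}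
    {t : ℕ}
    {c : Cmd} (h : s.HoldsLevel m σ Ξ l t) (f : Frame c s s')
    (hn : (c.setsNat 6 || c.setsNat 5 || c.setsNat 9 || c.setsNat 14 || c.setsNat 8) =
      false := by rfl)
    (hr : (c.setsReal 80 || c.setsReal 86) = false := by rfl) : s'.HoldsLevel m σ Ξ l t := by
  simp only [Bool.or_eq_false_iff] at hn hr
  obtain ⟨⟨⟨⟨h6, h5⟩, h9⟩, h14⟩, h8⟩ := hn
  exact
  ⟨by rw [f.nat 6 h6, h.dim], by rw [f.nat 5 h5, h.dim12], by rw [f.nat 9 h9, h.next],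
    by rw [f.nat 14 h14, h.next34], by rw [f.nat 8 h8, h.time], h.form.congr (f.real 80 hr.1),
    by rw [f.real 86 hr.2, h.eps]⟩

/-- `ε_{t+1}`, from `D` in the array `80`. -/
noncomputable def epsCmd (m : Params) : Cmd :=
  .seq (sumTab 85 (.const 1) (.const 1) (nv 5) (.get 80 (nv 22) (nv 22)))
    (.setReal 86 (.const 0) (.const 0) (corrExp m.φ (.mul (.const (m.ρ / 2))
      (.mul (.div (.const 12) (.ofNat (nv 6))) (rv 85)))))

theorem epsCmd_spec {D : Matrix (Fin l) (Fin l) ℝ} (hB : Budget E n κ T) (hl : l ≤ κ)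
    (h5 : s.nat 5 0 0 = l) (h6 : s.nat 6 0 0 = k) (hD : s.Holds 80 D) :
    Tri E (epsCmd m) s T (fun s' =>
      s'.real 86 0 0 = m.φ.corr (m.ρ / 2 * (12 / (k : ℝ) * D.trace))) := by
  refine Tri.seq (P := fun s' => s'.real 85 0 0 = D.trace) ?_ ?_
  · have h : (1 + 1) * (1 + 1) * (l + 1) ≤ T := le_trans (Nat.mul_le_mul_left 4 (by
      rw [mul_assoc]
      exact le_trans (by omega) (Nat.le_mul_of_pos_right (n + κ + 1) (by positivity)))) hB.cube
    refine Tri.sumTab 1 1 l (fun _ _ c => s.real 80 c c) (by decide) h (fun _ _ => rfl)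
      (fun _ _ => rfl) (fun s' f => by rw [nv_val, f.nat 5 rfl, h5]) ?_ ?_
    · intro i _ j _ c _ s' f _ _ _ h22
      simp only [RExp.val, nv_val, h22]
      rw [f.real 80 rfl]
    · intro s' _ h _
      rw [h 0 one_pos 0 one_pos, Matrix.trace, Finset.sum_range]
      exact Finset.sum_congr rfl fun i _ => hD i i
  · intro s₁ f₁ h85
    refine Tri.setReal hB.one ?_
    simp only [corrExp_val, RExp.val, NExp.val, rv_val, nv_val, h85, f₁.nat 6 rfl, h6]
    exact Mem.setReal_real_self _ _ _ _ _

/-- `β` (array `81`), from the coins `(t, r)` for `t` in the scalar `8` and `r` in the scalar `10`.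
-/
def betaCmd : Cmd :=
  tabR 81 (nv 5) (nv 9) (.natLe (.const 1) (.coin (nv 8) (nv 10) (nv 20) (nv 21)))
    (.sqrt (.div (.const 12) (.ofNat (nv 6))))
    (.sub (.const 0) (.sqrt (.div (.const 12) (.ofNat (nv 6)))))

theorem betaCmd_spec {t r : ℕ} (hB : Budget E n κ T) (hk : k ≤ κ) (hl : l ≤ κ)
    (h6 : s.nat 6 0 0 = k)
    (h5 : s.nat 5 0 0 = k / 12) (h9 : s.nat 9 0 0 = l) (h8 : s.nat 8 0 0 = t)
    (h10 : s.nat 10 0 0 = r) :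
    Tri E betaCmd s T (fun s' => s'.Holds 81 (signMatrix k l (E.ω.coinAt t r))) := by
  refine Tri.tabR (k / 12) l
    (fun i j => if E.ω.coinAt t r i j then √(12 / (k : ℝ)) else -√(12 / (k : ℝ)))
    (hB.tab (by omega) (by omega)) (fun s' f => by rw [nv_val, f.nat 5 rfl, h5])
    (fun s' f => by rw [nv_val, f.nat 9 rfl, h9]) ?_ ?_
  · intro i _ j _ s' f _ h0 h1
    simp only
      [BExp.Holds, RExp.val, NExp.val, nv_val, h0, h1, f.nat 6 rfl, f.nat 8 rfl, f.nat 10 rfl, h6,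
      h8, h10]
    cases E.ω.coinAt t r i j <;> simp
  · intro s' _ h _ i j
    exact h i i.2 j j.2

/-- `Φ` (array `82`) and `Ψ` (array `84`) at the next level, from `β` and `D`. -/
noncomputable def nextCmd (m : Params) : Cmd :=
  .seq (mulCmd 82 81 81 true false 9 9 5) (.seq (tabR 82 (nv 9) (nv 9) btrue
      (corrExp m.φ (.get 82 (nv 20) (nv 21))) (.const 0))
    (.seq (mulCmd 83 81 80 true false 9 5 5) (.seq (mulCmd 84 83 81 false false 9 9 5)
      (tabR 84 (nv 9) (nv 9) btrue
        (corrExp m.φ (.mul (.const (m.ρ / 2)) (.get 84 (nv 20) (nv 21)))) (.const 0)))))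

theorem nextCmd_spec {σ : SpecState k} {Ξ : Matrix (Fin k) (Fin (k / 12)) ℝ} {t : ℕ}
    {β : Matrix (Fin (k / 12)) (Fin l) ℝ} (hB : Budget E n κ T) (hk : k ≤ κ) (hl : l ≤ κ)
    (hs : s.HoldsLevel m σ Ξ l t) (hβ : s.Holds 81 β) :
    Tri E (nextCmd m) s T (fun s' => s'.Holds 82 (σ.next m Ξ β).Phi ∧
      s'.Holds 84 (σ.next m Ξ β).Psi) := by
  refine Tri.seq
    (mulCmd_spec (X := βᵀ) (Y := β) (hB.mul (by omega) (by omega) (by omega)) hβ hβ hs.next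
    hs.next hs.dim12) ?_
  intro s₁ f₁ h1
  refine Tri.seq
    (Tri.mapTab (X := (σ.next m Ξ β).Phi) (Q := fun s' => s'.Holds 82 (σ.next m Ξ β).Phi)
    (hB.tab (by omega) (by omega)) (by rw [f₁.nat 9 rfl, hs.next]) (by rw [f₁.nat 9 rfl, hs.next])
    (fun i j s' f h h0 h1' => ?_) (fun s' _ h => h)) ?_
  · simp only [corrExp_val, RExp.val, nv_val, h0, h1', h, h1 i j]
    rfl
  intro s₂ f₂ h2
  have g₂ := f₁.seq f₂
  refine Tri.seq
    (mulCmd_spec (X := βᵀ) (Y := Ξᵀ * σ.Psi * Ξ) (hB.mul (by omega) (by omega) (by omega))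
    (hβ.congr (g₂.real 81 rfl)) (hs.form.congr (g₂.real 80 rfl)) (by rw [g₂.nat 9 rfl, hs.next])
    (by rw [g₂.nat 5 rfl, hs.dim12]) (by rw [g₂.nat 5 rfl, hs.dim12])) ?_
  intro s₃ f₃ h3
  have g₃ := g₂.seq f₃
  refine Tri.seq (mulCmd_spec (X := βᵀ * (Ξᵀ * σ.Psi * Ξ)) (Y := β)
    (hB.mul (by omega) (by omega) (by omega)) h3 (hβ.congr (g₃.real 81 rfl))
    (by rw [g₃.nat 9 rfl, hs.next]) (by rw [g₃.nat 9 rfl, hs.next])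
    (by rw [g₃.nat 5 rfl, hs.dim12])) ?_
  intro s₄ f₄ h4
  have g₄ := g₃.seq f₄
  refine Tri.mapTab (X := (σ.next m Ξ β).Psi) (hB.tab (by omega) (by omega))
    (by rw [g₄.nat 9 rfl, hs.next]) (by rw [g₄.nat 9 rfl, hs.next])
    (fun i j s' f h h0 h1' => ?_) (fun s' f h => ⟨?_, h⟩)
  · simp only [corrExp_val, RExp.val, nv_val, h0, h1', h, h4 i j]
    rfl
  · exact h2.congr (by rw [f.real 82 rfl, f₄.real 82 rfl, f₃.real 82 rfl])

/-- The number (scalar `70`) of eigenvalues of the array `x` that pass the test. -/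
def testCmd (x : ℕ) (a b : RExp) : Cmd := .seq (.spectral x (nv 9) 70 71) (countCmd (eigTest a b) 9)

open Classical in
theorem testCmd_spec {x : ℕ} {a b : RExp} {M : Matrix (Fin l) (Fin l) ℝ} {u v : ℝ}
    (hB : Budget E n κ T) (hl : l ≤ κ) (h9 : s.nat 9 0 0 = l) (hM : s.Holds x M)
    (ha : ∀ s', Frame (testCmd x a b) s s' → a.val E.ω s' = u ∧ b.val E.ω s' = v) :
    Tri E (testCmd x a b) s T (fun s' => s'.nat 70 0 0 = (Finset.univ.filter fun j =>
      u < (spectralDecomposition M).1 j ∧ (spectralDecomposition M).1 j < v).card) := by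
  refine Tri.seq (P := fun s' => ∀ j : Fin l, s'.real 70 j 0 = (spectralDecomposition M).1 j)
    (Tri.spectral (n := l) (by decide) (by simpa using h9) (hB.eig l hl) fun s' _ h1 _ => ?_) ?_
  · rwa [hM.block] at h1
  intro s₁ f₁ h70
  have hT1 := hB.tab (a := l) (b := 0) (by omega) (by omega)
  refine Tri.imp (countCmd_spec (P := fun j => u < (spectralDecomposition M).1 j ∧
    (spectralDecomposition M).1 j < v) (by omega) (by rw [f₁.nat 9 rfl, h9]) fun j s' f h23 => ?_)
    fun s' _ h => by convert h.1
  obtain ⟨h1, h2⟩ := ha s' (f₁.seq f)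
  exact eigTest_holds h23 (by
    rw [f.real 70 (by simp [countCmd, forN_setsReal, Cmd.setsReal]), h70]) h1 h2

/-- One attempt to find the sign matrix: if the next triple is good, the flag `12` is raised, and
otherwise the counter `10` of the samples is increased. -/
noncomputable def attemptCmd (m : Params) : Cmd :=
  .seq betaCmd (.seq (nextCmd m) (.seq (testCmd 82 (.const 0.9) (.const 1.1))
    (.seq (.setNat 13 (.const 0) (.const 0) (nv 70))
    (.seq (testCmd 84 (.mul (.const 0.9) (rv 86)) (.mul (.const 1.1) (rv 86)))
    (.ite (.and (.natLe (nv 14) (nv 13)) (.natLe (nv 14) (nv 70)))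
      (.setNat 12 (.const 0) (.const 0) (.const 1))
      (.setNat 10 (.const 0) (.const 0) (.add (nv 10) (.const 1))))))))

theorem attemptCmd_spec {σ : SpecState k} {Ξ : Matrix (Fin k) (Fin (k / 12)) ℝ} {t r : ℕ}
    (hB : Budget E n κ T) (hk : k ≤ κ) (hl : l ≤ κ) (hσ : σ.Psi.IsSymm)
    (hs : s.HoldsLevel m σ Ξ l t) (h10 : s.nat 10 0 0 = r) (h12 : s.nat 12 0 0 = 0) :
    Tri E (attemptCmd m) s T (fun s' => ∃ β : Matrix (Fin (k / 12)) (Fin l) ℝ,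
      β = signMatrix k l (E.ω.coinAt t r) ∧ s'.Holds 81 β ∧
      s'.Holds 82 (σ.next m Ξ β).Phi ∧ s'.Holds 84 (σ.next m Ξ β).Psi ∧
      (((σ.next m Ξ β).Good ∧ s'.nat 12 0 0 = 1 ∧ s'.nat 10 0 0 = r) ∨
        (¬ (σ.next m Ξ β).Good ∧ s'.nat 12 0 0 = 0 ∧ s'.nat 10 0 0 = r + 1))) := by
  classical
  obtain ⟨β, hβ⟩ : ∃ β, β = signMatrix k l (E.ω.coinAt t r) := ⟨_, rfl⟩
  refine Tri.seq (P := fun s' => s'.Holds 81 β)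
    (hβ ▸ betaCmd_spec hB hk hl hs.dim hs.dim12 hs.next hs.time h10) ?_
  intro s₁ f₁ h81
  have hs₁ := hs.congr f₁
  refine Tri.seq (nextCmd_spec hB hk hl hs₁ h81) ?_
  rintro s₂ f₂ ⟨h82, h84⟩
  have hs₂ := hs₁.congr f₂
  refine Tri.seq (testCmd_spec hB hl hs₂.next h82 fun _ _ => ⟨rfl, rfl⟩) ?_
  intro s₃ f₃ h70
  have hs₃ := hs₂.congr f₃
  refine Tri.seq (P := fun s' => s' = s₃.setNat 13 0 0 (s₃.nat 70 0 0))
    (Tri.setNat hB.one (by simp)) ?_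
  rintro s₄ f₄ rfl
  have hs₄ := hs₃.congr f₄
  have g₄ := f₃.seq f₄
  refine Tri.seq (testCmd_spec (u := 0.9 * (σ.next m Ξ β).eps) (v := 1.1 * (σ.next m Ξ β).eps) hB hl
    hs₄.next (h84.congr (g₄.real 84 rfl)) fun s' f => ?_) ?_
  · have e : s'.real 86 0 0 = (σ.next m Ξ β).eps := by rw [f.real 86 rfl]; exact hs₄.eps
    simp [e]
  intro s₅ f₅ h70'
  have hs₅ := hs₄.congr f₅
  have h13 : s₅.nat 13 0 0 = s₃.nat 70 0 0 := by
    rw [f₅.nat 13 rfl]; exact Mem.setNat_nat_self _ _ _ _ _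
  have g₅ := (f₁.seq f₂).seq (g₄.seq f₅)
  have e10 : s₅.nat 10 0 0 = r := by rw [g₅.nat 10 rfl, h10]
  have e12 : s₅.nat 12 0 0 = 0 := by rw [g₅.nat 12 rfl, h12]
  have hgood : (BExp.and (.natLe (nv 14) (nv 13)) (.natLe (nv 14) (nv 70))).Holds E.ω s₅ ↔
      (σ.next m Ξ β).Good := by
    rw [SpecState.Good, spectralAssumption_iff (next_phi_symm m σ Ξ β) (next_psi_symm m hσ Ξ β)]
    simp only [BExp.Holds, nv_val, hs₅.next34, h13, h70, h70']
    exact Iff.of_eq (by congr!)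
  have k₁ : s₅.Holds 81 β := h81.congr (by rw [f₅.real 81 rfl, g₄.real 81 rfl, f₂.real 81 rfl])
  have k₂ : s₅.Holds 82 (σ.next m Ξ β).Phi := h82.congr (by rw [f₅.real 82 rfl, g₄.real 82 rfl])
  have k₃ : s₅.Holds 84 (σ.next m Ξ β).Psi := h84.congr (by rw [f₅.real 84 rfl, g₄.real 84 rfl])
  refine Tri.ite hB.one (fun h => Tri.setNat hB.one ?_) (fun h => Tri.setNat hB.one ?_)
  · refine ⟨β, hβ, k₁, k₂, k₃, Or.inl ⟨hgood.1 h, Mem.setNat_nat_self _ _ _ _ _, ?_⟩⟩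
    rw [Mem.setNat_nat_ne _ _ _ _ (by decide), e10]
  · refine ⟨β, hβ, k₁, k₂, k₃, Or.inr ⟨fun h' => h (hgood.2 h'), ?_, ?_⟩⟩
    · rw [Mem.setNat_nat_ne _ _ _ _ (by decide), e12]
    · simp only [NExp.val, nv_val, e10]
      exact Mem.setNat_nat_self _ _ _ _ _

/-- Sampling of the sign matrix until the next triple is good. -/
noncomputable def sampleCmd (m : Params) : Cmd :=
  .seq (.setNat 10 (.const 0) (.const 0) (.const 0))
      (.seq (.setNat 12 (.const 0) (.const 0) (.const 0))
    (.while (.natLe (nv 12) (.const 0)) (attemptCmd m)))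

theorem sampleCmd_spec {t T₀ : ℕ} (hB : Budget E n κ T₀) (hk : m.K K0 t ≤ κ)
    (hl : m.K K0 (t + 1) ≤ κ)
    (hσ : Sound (specSeq m K0 rule E.ω t)) (hr : ∃ r, ¬ Rejected m K0 E.ω t r)
    (hT : (accepted m K0 E.ω t + 2) * T₀ ≤ T)
    (hs : s.HoldsLevel m (specSeq m K0 rule E.ω t) (xiSeq m K0 rule E.ω t) (m.K K0 (t + 1)) t) :
    Tri E (sampleCmd m) s T (fun s' => s'.Holds 81 (betaSeq m K0 rule E.ω t) ∧
      s'.Holds 82 (specSeq m K0 rule E.ω (t + 1)).Phi ∧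
      s'.Holds 84 (specSeq m K0 rule E.ω (t + 1)).Psi) := by
  have h1 : 1 ≤ T := le_trans hB.one (le_trans (Nat.le_mul_of_pos_left _ (by omega)) hT)
  refine Tri.seq (P := fun s' => s' = s.setNat 10 0 0 0) (Tri.setNat h1 (by simp)) ?_
  rintro s₁ f₁ rfl
  refine Tri.seq (P := fun s' => s' = (s.setNat 10 0 0 0).setNat 12 0 0 0)
    (Tri.setNat h1 (by simp)) ?_
  rintro s₂ f₂ rfl
  have hs₂ := (hs.congr f₁).congr f₂
  set a := accepted m K0 E.ω t with ha
  have hacc : ¬ Rejected m K0 E.ω t a := Nat.sInf_mem hr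
  refine Tri.whileLoop (T₀ := T₀) (fun i s' => (s'.nat 12 0 0 = 0 ∧ s'.nat 10 0 0 = i ∧ i ≤ a) ∨
    (s'.nat 12 0 0 = 1 ∧ s'.Holds 81 (betaSeq m K0 rule E.ω t) ∧
      s'.Holds 82 (specSeq m K0 rule E.ω (t + 1)).Phi ∧
      s'.Holds 84 (specSeq m K0 rule E.ω (t + 1)).Psi)) (a + 1) hT hB.one ?_ ?_ ?_
  · exact Or.inl ⟨by simp [Mem.setNat], by simp [Mem.setNat], Nat.zero_le _⟩
  · rintro i s' f (⟨h12, h10, hi⟩ | ⟨h12, -⟩) hc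
    · refine ⟨by omega, (attemptCmd_spec hB hk hl hσ.psi_symm (hs₂.congr f) h10 h12).imp ?_⟩
      rintro s'' - ⟨β, rfl, h81, h82, h84, ⟨hg, h12', h10'⟩ | ⟨hg, h12', h10'⟩⟩
      · have : a = i :=
          le_antisymm (Nat.sInf_le (show ¬ Rejected m K0 E.ω t i from fun h => h hg)) hi
        subst this
        rw [betaSeq_eq, specSeq_succ]
        exact Or.inr ⟨h12', h81, h82, h84⟩
      · refine Or.inl ⟨h12', h10', ?_⟩
        rcases hi.lt_or_eq with h | h
        · omega
        · rw [h] at hg; exact absurd hg hacc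
    · simp [h12] at hc
  · rintro i s' f (⟨h12, -⟩ | ⟨h12, h⟩) hc
    · simp [h12] at hc
    · exact h

end

section

variable {E : Env} {s : Mem} {T k l n κ K0 : ℕ} {m : Params} {MA MB : Matrix (Fin n) (Fin n) ℝ}
  {U V : Fin K0 ↪ Fin n}

/-! ### The iteration -/

theorem Budget.le {T' : ℕ} (h : Budget E n κ T) (hT : T ≤ T') : Budget E n κ T' :=
  ⟨h.cube.trans hT, fun d hd => (h.eig d hd).trans hT⟩

/-- The cleaned matrices and the indicators of the seeds are in the memory. -/
structure Mem.HoldsBase (s : Mem) (MA MB : Matrix (Fin n) (Fin n) ℝ)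
    (U V : Fin K0 ↪ Fin n) : Prop where
  dim : s.nat 0 0 0 = n
  fst : s.Holds 10 MA
  snd : s.Holds 11 MB
  maskFst : s.HoldsMask 50 U
  maskSnd : s.HoldsMask 51 V

theorem Mem.HoldsBase.congr {s' : Mem} {c : Cmd} (h : s.HoldsBase MA MB U V) (f : Frame c s s')
    (hn : c.setsNat 0 = false := by rfl)
    (hr : (c.setsReal 10 || c.setsReal 11 || c.setsReal 50 || c.setsReal 51) = false := by rfl) :
    s'.HoldsBase MA MB U V := by
  simp only [Bool.or_eq_false_iff] at hr
  obtain ⟨⟨⟨h10, h11⟩, h50⟩, h51⟩ := hr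
  exact ⟨by rw [f.nat 0 hn, h.dim], h.fst.congr (f.real 10 h10), h.snd.congr (f.real 11 h11),
    h.maskFst.congr (f.real 50 h50), h.maskSnd.congr (f.real 51 h51)⟩

/-- The state of the iteration at level `t`. -/
structure Mem.HoldsIter (m : Params) (s : Mem) (ω : Tape) (MA MB : Matrix (Fin n) (Fin n) ℝ)
    (U V : Fin K0 ↪ Fin n) (t : ℕ) : Prop where
  state : s.HoldsState (specSeq m K0 rule ω t)
  time : s.nat 8 0 0 = t
  fst : s.Holds 16 (pad U (ampF m rule ω MA U t))
  snd : s.Holds 17 (pad V (ampF m rule ω MB V t))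

theorem Mem.HoldsState.congr {s' : Mem} {σ : SpecState k} {c : Cmd} (h : s.HoldsState σ)
    (f : Frame c s s') (hn : (c.setsNat 6 || c.setsNat 7 || c.setsNat 5) = false := by rfl)
    (hr : (c.setsReal 12 || c.setsReal 13 || c.setsReal 14) = false := by rfl) : s'.HoldsState
      σ := by
  simp only [Bool.or_eq_false_iff] at hn hr
  exact
    ⟨by rw [f.nat 6 hn.1.1, h.dim], by rw [f.nat 7 hn.1.2, h.dim34], by rw [f.nat 5 hn.2, h.dim12],
    h.phi.congr (f.real 12 hr.1.1), h.psi.congr (f.real 13 hr.1.2), by rw [f.real 14 hr.2, h.eps]⟩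

/-- The matrices `Ξ`, `h` and `ℓ` at the present level. -/
noncomputable def linCmd : Cmd :=
  .seq commonCmd (.seq xiCmd (.seq (ampCmd 41 10 16) (ampCmd 43 11 17)))

theorem linCmd_spec {t : ℕ} (hB : Budget E n κ T) (hk : m.K K0 t ≤ κ) (h12 : 12 ∣ m.K K0 t)
    (hσ : Sound (specSeq m K0 rule E.ω t)) (hb : s.HoldsBase MA MB U V)
    (hs : s.HoldsIter m E.ω MA MB U V t) :
    Tri E linCmd s T (fun s' => s'.HoldsIter m E.ω MA MB U V t ∧
      s'.Holds 80 ((xiSeq m K0 rule E.ω t)ᵀ *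
        (specSeq m K0 rule E.ω t).Psi * xiSeq m K0 rule E.ω t) ∧
      s'.HoldsRest 41 (ampH m rule E.ω MA U t) ∧ s'.HoldsRest 43 (ampH m rule E.ω MB V t)) := by
  refine Tri.seq (commonCmd_spec hB hk h12 hσ hs.state) ?_
  intro s₁ f₁ h76
  have hs₁ := hs.state.congr f₁
  refine Tri.seq (xiCmd_spec hB hk hs₁ h76) ?_
  rintro s₂ f₂ ⟨h15, h80⟩
  have hs₂ := hs₁.congr f₂
  have g₂ := f₁.seq f₂
  have hb₂ := hb.congr g₂
  refine Tri.seq (ampCmd_spec (f := ampF m rule E.ω MA U t) (Ξ := xiSeq m K0 rule E.ω t) hB hk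
    (by omega) hb₂.dim hs₂.dim hs₂.dim12 hb₂.fst (hs.fst.congr (g₂.real 16 rfl)) h15) ?_
  intro s₃ f₃ h41
  have hs₃ := hs₂.congr f₃
  have g₃ := g₂.seq f₃
  have hb₃ := hb₂.congr f₃
  refine Tri.imp (ampCmd_spec (f := ampF m rule E.ω MB V t) (Ξ := xiSeq m K0 rule E.ω t) hB hk
    (by omega) hb₃.dim hs₃.dim hs₃.dim12 hb₃.snd (hs.snd.congr (g₃.real 17 rfl))
    (h15.congr (f₃.real 15 rfl))) ?_
  intro s₄ f₄ h43
  have g₄ := g₃.seq f₄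
  refine ⟨⟨hs₃.congr f₄, by rw [g₄.nat 8 rfl, hs.time], hs.fst.congr (g₄.real 16 rfl),
    hs.snd.congr (g₄.real 17 rfl)⟩, h80.congr (by rw [f₄.real 80 rfl, f₃.real 80 rfl]), ?_, h43⟩
  intro i j
  rw [f₄.real 41 rfl]
  exact h41 i j

/-- Replace the present triple by the next one. -/
def copyCmd : Cmd :=
  .seq (tabR 12 (nv 9) (nv 9) btrue (.get 82 (nv 20) (nv 21)) (.const 0))
    (.seq (tabR 13 (nv 9) (nv 9) btrue (.get 84 (nv 20) (nv 21)) (.const 0))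
    (.seq (.setReal 14 (.const 0) (.const 0) (rv 86)) (.seq (.setNat 6 (.const 0) (.const 0) (nv 9))
    (.seq (.setNat 5 (.const 0) (.const 0) (nv 11)) (.seq (.setNat 7 (.const 0) (.const 0) (nv 14))
    (.setNat 8 (.const 0) (.const 0) (.add (nv 8) (.const 1))))))))

theorem copyCmd_spec {σ : SpecState l} {t : ℕ} (hB : Budget E n κ T) (hl : l ≤ κ)
    (h9 : s.nat 9 0 0 = l) (h11 : s.nat 11 0 0 = l / 12) (h14 : s.nat 14 0 0 = 3 * l / 4)
    (h8 : s.nat 8 0 0 = t) (h82 : s.Holds 82 σ.Phi) (h84 : s.Holds 84 σ.Psi)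
    (h86 : s.real 86 0 0 = σ.eps) :
    Tri E copyCmd s T (fun s' => s'.HoldsState σ ∧ s'.nat 8 0 0 = t + 1) := by
  refine Tri.seq (Tri.mapTab (X := σ.Phi) (Q := fun s' => s'.Holds 12 σ.Phi)
    (hB.tab (by omega) (by omega)) h9 h9 (fun i j s' f h h0 h1 => ?_) (fun s' _ h => h)) ?_
  · simp only [RExp.val, nv_val, h0, h1, f.real 82 rfl, h82 i j]
  intro s₁ f₁ h12
  refine Tri.seq (Tri.mapTab (X := σ.Psi) (Q := fun s' => s'.Holds 13 σ.Psi)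
    (hB.tab (by omega) (by omega)) (by rw [f₁.nat 9 rfl, h9]) (by rw [f₁.nat 9 rfl, h9])
    (fun i j s' f h h0 h1 => ?_) (fun s' _ h => h)) ?_
  · simp only [RExp.val, nv_val, h0, h1, f.real 84 rfl, f₁.real 84 rfl, h84 i j]
  intro s₂ f₂ h13
  have g₂ := f₁.seq f₂
  refine Tri.seq (P := fun s' => s' = s₂.setReal 14 0 0 σ.eps) (Tri.setReal hB.one
    (by simp [g₂.real 86 rfl, h86])) ?_
  rintro s₃ f₃ rfl
  have g₃ := g₂.seq f₃
  refine Tri.seq (P := fun s' => s' = (s₂.setReal 14 0 0 σ.eps).setNat 6 0 0 l) (Tri.setNat hB.one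
    (by simp [g₃.nat 9 rfl, h9])) ?_
  rintro s₄ f₄ rfl
  have g₄ := g₃.seq f₄
  refine Tri.seq (P := fun s' => s' =
    ((s₂.setReal 14 0 0 σ.eps).setNat 6 0 0 l).setNat 5 0 0 (l / 12))
    (Tri.setNat hB.one (by simp [g₄.nat 11 rfl, h11])) ?_
  rintro s₅ f₅ rfl
  have g₅ := g₄.seq f₅
  refine Tri.seq (P := fun s' => s' = (((s₂.setReal 14 0 0 σ.eps).setNat 6 0 0 l).setNat 5 0 0
    (l / 12)).setNat 7 0 0 (3 * l / 4)) (Tri.setNat hB.one (by simp [g₅.nat 14 rfl, h14])) ?_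
  rintro s₆ f₆ rfl
  have g₆ := g₅.seq f₆
  refine Tri.setNat hB.one ?_
  simp only [NExp.val, nv_val, g₆.nat 8 rfl, h8]
  refine ⟨⟨by simp [Mem.setNat], by simp [Mem.setNat], by simp [Mem.setNat], ?_, ?_, ?_⟩,
    by simp [Mem.setNat]⟩
  · exact h12.congr (by
      simp only [Mem.setNat_real]
      rw [Mem.setReal_real_ne _ _ _ _ (by decide), f₂.real 12 rfl])
  · exact h13.congr (by
      simp only [Mem.setNat_real]
      rw [Mem.setReal_real_ne _ _ _ _ (by decide)])
  · simp only [Mem.setNat_real]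
    rw [Mem.setReal_real_self]

/-- One round of the iteration. -/
noncomputable def roundCmd (m : Params) : Cmd :=
  .seq linCmd (.seq (dimCmd m) (.seq (epsCmd m) (.seq (sampleCmd m)
    (.seq (denoiseCmd m 16 41 50) (.seq (denoiseCmd m 17 43 51) copyCmd)))))

theorem roundCmd_spec {t T₀ : ℕ} (hB : Budget E n κ T₀) (hk : m.K K0 t ≤ κ)
    (hl : m.K K0 (t + 1) ≤ κ) (h12 : 12 ∣ m.K K0 t) (hσ : Sound (specSeq m K0 rule E.ω t))
    (hr : ∃ r, ¬ Rejected m K0 E.ω t r) (hT : (accepted m K0 E.ω t + 2) * T₀ ≤ T)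
    (hb : s.HoldsBase MA MB U V) (hs : s.HoldsIter m E.ω MA MB U V t) :
    Tri E (roundCmd m) s T (fun s' => s'.HoldsIter m E.ω MA MB U V (t + 1)) := by
  have hB' : Budget E n κ T := hB.le (le_trans (Nat.le_mul_of_pos_left _ (by omega)) hT)
  refine Tri.seq (linCmd_spec hB' hk h12 hσ hb hs) ?_
  rintro s₁ f₁ ⟨hs₁, h80, h41, h43⟩
  have hb₁ := hb.congr f₁
  refine Tri.seq (dimCmd_spec hB' hl hs₁.state.dim) ?_
  rintro s₂ f₂ ⟨h9, h11, h14⟩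
  have hb₂ := hb₁.congr f₂
  have hs₂ := hs₁.state.congr f₂
  refine Tri.seq (epsCmd_spec hB' (by omega) hs₂.dim12 hs₂.dim (h80.congr (f₂.real 80 rfl))) ?_
  intro s₃ f₃ h86
  have hb₃ := hb₂.congr f₃
  have hs₃ := hs₂.congr f₃
  have hlev : s₃.HoldsLevel m (specSeq m K0 rule E.ω t) (xiSeq m K0 rule E.ω t)
    (m.K K0 (t + 1)) t :=
    ⟨hs₃.dim, hs₃.dim12, by rw [f₃.nat 9 rfl, h9], by rw [f₃.nat 14 rfl, h14],
      by rw [f₃.nat 8 rfl, f₂.nat 8 rfl, hs₁.time],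
      h80.congr (by rw [f₃.real 80 rfl, f₂.real 80 rfl]), h86⟩
  refine Tri.seq (sampleCmd_spec hB hk hl hσ hr hT hlev) ?_
  rintro s₄ f₄ ⟨h81, h82, h84⟩
  have hb₄ := hb₃.congr f₄
  have hlev₄ := hlev.congr f₄
  have g₄ := (f₂.seq f₃).seq f₄
  refine Tri.seq (denoiseCmd_spec (m := m) hB' hl (by omega) hb₄.dim hlev₄.next hlev₄.dim12
    (H := ampH m rule E.ω MA U t) (fun i j => by rw [g₄.real 41 rfl, h41 i j]) h81 hb₄.maskFst) ?_
  intro s₅ f₅ h16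
  have hb₅ := hb₄.congr f₅
  have hlev₅ := hlev₄.congr f₅
  have g₅ := g₄.seq f₅
  refine Tri.seq (denoiseCmd_spec (m := m) hB' hl (by omega) hb₅.dim hlev₅.next hlev₅.dim12
    (H := ampH m rule E.ω MB V t) (fun i j => by rw [g₅.real 43 rfl, h43 i j])
    (h81.congr (f₅.real 81 rfl)) hb₅.maskSnd) ?_
  intro s₆ f₆ h17
  have hlev₆ := hlev₅.congr f₆
  have g₆ := f₅.seq f₆
  refine Tri.imp (copyCmd_spec (σ := specSeq m K0 rule E.ω (t + 1)) hB' hl hlev₆.next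
    (by rw [((f₃.seq f₄).seq g₆).nat 11 rfl, h11]) hlev₆.next34 hlev₆.time
    (h82.congr (g₆.real 82 rfl))
    (h84.congr (g₆.real 84 rfl)) hlev₆.eps) ?_
  rintro s₇ f₇ ⟨hst, h8⟩
  exact ⟨hst, h8, h16.congr (by rw [f₇.real 16 rfl, f₆.real 16 rfl]), h17.congr (f₇.real 17 rfl)⟩

/-- The state at level `0`, and the bound `(log n)^{1.1}` in the scalar `87`, computed as
`exp (1.1 * log (log n))`. -/
noncomputable def startCmd (m : Params) (K0 : ℕ) : Cmd :=
  .seq (.setNat 6 (.const 0) (.const 0) (.const K0))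
    (.seq (.setNat 5 (.const 0) (.const 0) (.const (K0 / 12)))
    (.seq (.setNat 7 (.const 0) (.const 0) (.const (3 * K0 / 4)))
    (.seq (.setNat 8 (.const 0) (.const 0) (.const 0))
    (.seq (.setReal 14 (.const 0) (.const 0) (.const m.eps0))
    (.seq (.setReal 87 (.const 0) (.const 0)
      (.exp (.mul (.log (.log (.ofNat (nv 0)))) (.const 1.1))))
    (.seq (tabR 12 (nv 6) (nv 6) btrue (.ofNat (neq (nv 20) (nv 21))) (.const 0))
    (.seq
      (tabR 13 (nv 6) (nv 6) btrue (.mul (.const m.eps0) (.ofNat (neq (nv 20) (nv 21)))) (.const 0))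
    (.seq (firstCmd m 16 10 1 50) (firstCmd m 17 11 2 51)))))))))

theorem startCmd_spec (hB : Budget E n κ T) (hk : K0 ≤ κ) (hb : s.HoldsBase MA MB U V)
    (hU : s.HoldsSeeds 1 U) (hV : s.HoldsSeeds 2 V) :
    Tri E (startCmd m K0) s T (fun s' => s'.HoldsIter m E.ω MA MB U V 0 ∧
      s'.real 87 0 0 = Real.exp (Real.log (Real.log n) * 1.1)) := by
  refine Tri.seq (P := fun s' => s'.nat 6 0 0 = K0) (Tri.setNat hB.one (by simp [Mem.setNat])) ?_
  intro s₁ f₁ h6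
  refine Tri.seq (P := fun s' => s'.nat 5 0 0 = K0 / 12)
    (Tri.setNat hB.one (by simp [Mem.setNat])) ?_
  intro s₂ f₂ h5
  refine Tri.seq (P := fun s' => s'.nat 7 0 0 = 3 * K0 / 4)
    (Tri.setNat hB.one (by simp [Mem.setNat])) ?_
  intro s₃ f₃ h7
  refine Tri.seq (P := fun s' => s'.nat 8 0 0 = 0) (Tri.setNat hB.one (by simp [Mem.setNat])) ?_
  intro s₄ f₄ h8
  refine Tri.seq (P := fun s' => s'.real 14 0 0 = m.eps0)
    (Tri.setReal hB.one (by simp [Mem.setReal])) ?_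
  intro s₅ f₅ h14
  have g₅ := (((f₁.seq f₂).seq f₃).seq f₄).seq f₅
  refine Tri.seq (P := fun s' => s'.real 87 0 0 = Real.exp (Real.log (Real.log n) * 1.1))
    (Tri.setReal hB.one (by simp [Mem.setReal, g₅.nat 0 rfl, hb.dim])) ?_
  intro s₆ f₆ h87
  have g₆ := g₅.seq f₆
  have e6 : s₆.nat 6 0 0 = K0 := by
    rw [f₆.nat 6 rfl, f₅.nat 6 rfl, f₄.nat 6 rfl, f₃.nat 6 rfl, f₂.nat 6 rfl, h6]
  have hid : ∀ (s' : Mem) (i j : Fin K0), s'.nat 20 0 0 = i → s'.nat 21 0 0 = j →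
      ((neq (nv 20) (nv 21)).val E.ω s' : ℝ) = (1 : Matrix (Fin K0) (Fin K0) ℝ) i j := by
    intro s' i j h0 h1
    rw [neq_val, nv_val, nv_val, h0, h1, Matrix.one_apply]
    simp only [Fin.ext_iff]
    split_ifs <;> simp
  refine Tri.seq (Tri.mapTab (X := (1 : Matrix (Fin K0) (Fin K0) ℝ))
    (Q := fun s' => s'.Holds 12 (1 : Matrix (Fin K0) (Fin K0) ℝ))
    (hB.tab (by omega) (by omega)) e6 e6
    (fun i j s' f h h0 h1 => hid s' i j h0 h1) (fun s' _ h => h)) ?_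
  intro s₇ f₇ h12
  refine Tri.seq (Tri.mapTab (X := m.eps0 • (1 : Matrix (Fin K0) (Fin K0) ℝ))
    (Q := fun s' => s'.Holds 13 (m.eps0 • (1 : Matrix (Fin K0) (Fin K0) ℝ)))
    (hB.tab (by omega) (by omega)) (by rw [f₇.nat 6 rfl, e6]) (by rw [f₇.nat 6 rfl, e6])
    (fun i j s' f h h0 h1 => congrArg (m.eps0 * ·) (hid s' i j h0 h1)) (fun s' _ h => h)) ?_
  intro s₈ f₈ h13
  have g₈ := (g₆.seq f₇).seq f₈
  have hb₈ := hb.congr g₈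
  refine Tri.seq
    (firstCmd_spec (m := m) hB hk hb₈.dim (by rw [f₈.nat 6 rfl, f₇.nat 6 rfl, e6]) hb₈.fst
    (U := U) (fun k => by rw [g₈.nat 1 rfl, hU k]) hb₈.maskFst) ?_
  intro s₉ f₉ h16
  have hb₉ := hb₈.congr f₉
  have g₉ := g₈.seq f₉
  refine Tri.imp (firstCmd_spec (m := m) hB hk hb₉.dim
    (by rw [f₉.nat 6 rfl, f₈.nat 6 rfl, f₇.nat 6 rfl, e6]) hb₉.snd
    (U := V) (fun k => by rw [g₉.nat 2 rfl, hV k]) hb₉.maskSnd) ?_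
  intro s' f h17
  have k₁ := ((f₇.seq f₈).seq f₉).seq f
  have k₂ := (f₅.seq f₆).seq k₁
  have k₃ := f₄.seq k₂
  refine ⟨⟨⟨by rw [k₁.nat 6 rfl, e6]; rfl, ?_, ?_, ?_, h13.congr ?_, ?_⟩, ?_,
    h16.congr (f.real 16 rfl), h17⟩,
    by rw [k₁.real 87 rfl, h87]⟩
  · rw [k₃.nat 7 rfl, h7]; rfl
  · rw [k₃.nat 5 rfl, f₃.nat 5 rfl, h5]; rfl
  · exact h12.congr (by rw [f.real 12 rfl, f₉.real 12 rfl, f₈.real 12 rfl])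
  · rw [f.real 13 rfl, f₉.real 13 rfl]
  · rw [k₁.real 14 rfl, f₆.real 14 rfl, h14]; rfl
  · rw [k₂.nat 8 rfl, h8]

/-- The whole iteration: `h` in the array `41`, `ℓ` in the array `43`. -/
noncomputable def iterCmd (m : Params) (K0 : ℕ) : Cmd :=
  .seq (startCmd m K0) (.seq (.while (realLt (.ofNat (nv 6)) (rv 87)) (roundCmd m)) linCmd)

/-- As the dimensions at least double, the number of rounds is bounded by the last dimension. -/
theorem Dims.two_pow_le (hd : Dims m K0) (t : ℕ) : 2 ^ t ≤ m.K K0 t := by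
  induction t with
  | zero => have := hd.pos 0; omega
  | succ t ih => have := hd.double t; rw [pow_succ]; omega

theorem Dims.mono (hd : Dims m K0) : Monotone (m.K K0) :=
  monotone_nat_of_le_succ fun t => by have := hd.double t; omega

theorem Dims.tStar_mem (hd : Dims m K0) (n : ℕ) :
    Real.log n ^ (1.1 : ℝ) ≤ (m.K K0 (m.tStar K0 n) : ℝ) := by
  refine Nat.sInf_mem (s := {t : ℕ | Real.log n ^ (1.1 : ℝ) ≤ (m.K K0 t : ℝ)}) ?_
  obtain ⟨N, hN⟩ := exists_nat_ge (Real.log n ^ (1.1 : ℝ))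
  refine ⟨N, hN.trans ?_⟩
  exact_mod_cast (Nat.lt_two_pow_self.le).trans (hd.two_pow_le N)

/-- The time bound charges every round with the total number of samples over all rounds. This wastes
a factor `t* + 1` only, and makes the bound of the loop rule uniform. -/
theorem iterCmd_spec {T₀ : ℕ} (hd : Dims m K0) (hn : 3 ≤ n) (hB : Budget E n κ T₀)
    (hκ : m.K K0 (m.tStar K0 n) ≤ κ)
    (hσ : ∀ t, Sound (specSeq m K0 rule E.ω t) ∧ ∃ r, ¬ Rejected m K0 E.ω t r)
    (hT : (m.tStar K0 n + 1) *
      ((∑ t ∈ Finset.range (m.tStar K0 n), (accepted m K0 E.ω t + 1) + 1) * T₀)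
      ≤ T) (hb : s.HoldsBase MA MB U V) (hU : s.HoldsSeeds 1 U) (hV : s.HoldsSeeds 2 V) :
    Tri E (iterCmd m K0) s T (fun s' => s'.HoldsRest 41 (ampH m rule E.ω MA U (m.tStar K0 n)) ∧
      s'.HoldsRest 43 (ampH m rule E.ω MB V (m.tStar K0 n)) ∧
      s'.nat 5 0 0 = m.K K0 (m.tStar K0 n) / 12) := by
  set t₁ := m.tStar K0 n with ht₁
  set S := ∑ t ∈ Finset.range t₁, (accepted m K0 E.ω t + 1) with hS
  have hκ' : ∀ t ≤ t₁, m.K K0 t ≤ κ := fun t ht => (hd.mono ht).trans hκ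
  have hB' : Budget E n κ T := hB.le (le_trans (Nat.le_mul_of_pos_left _ (by positivity))
    (le_trans (Nat.le_mul_of_pos_left _ (Nat.succ_pos t₁)) hT))
  have hlog : Real.exp (Real.log (Real.log n) * 1.1) = Real.log n ^ (1.1 : ℝ) :=
    (Real.rpow_def_of_pos (Real.log_pos (by exact_mod_cast (by omega : 1 < n))) _).symm
  refine Tri.seq (startCmd_spec (m := m) hB' (hκ' 0 (Nat.zero_le _)) hb hU hV) ?_
  rintro s₁ f₁ ⟨hs₁, h87⟩
  have hb₁ := hb.congr f₁
  rw [hlog] at h87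
  refine Tri.seq (P := fun s' => s'.HoldsIter m E.ω MA MB U V t₁) ?_ ?_
  -- every round is charged with the samples of all rounds
  · refine Tri.whileLoop (T₀ := (S + 1) * T₀)
      (fun t s' => s'.HoldsIter m E.ω MA MB U V t ∧ t ≤ t₁) t₁ hT
      (Nat.mul_pos (Nat.succ_pos _) hB.one) ⟨hs₁, Nat.zero_le _⟩ ?_ ?_
    · rintro t s' f ⟨hs', ht⟩ hc
      rw [realLt_holds, RExp.val, rv_val, nv_val, hs'.state.dim, f.real 87 rfl, h87] at hc
      have hlt : t < t₁ := by
        refine lt_of_le_of_ne ht fun e => ?_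
        have := hd.tStar_mem n
        rw [e] at hc
        exact absurd hc (not_lt.2 this)
      refine ⟨hlt, (roundCmd_spec hB (hκ' t ht) (hκ' _ hlt) (hd.dvd t) (hσ t).1 (hσ t).2 ?_
        (hb₁.congr f) hs').imp fun s'' _ h => ⟨h, hlt⟩⟩
      refine Nat.mul_le_mul_right _ (Nat.succ_le_succ ?_)
      exact Finset.single_le_sum (f := fun t => accepted m K0 E.ω t + 1) (fun _ _ => Nat.zero_le _)
        (Finset.mem_range.2 hlt)
    · rintro t s' f ⟨hs', ht⟩ hc
      rw [realLt_holds, RExp.val, rv_val, nv_val, hs'.state.dim, f.real 87 rfl, h87, not_lt] at hc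
      have : t₁ ≤ t := Nat.sInf_le hc
      rwa [le_antisymm ht this] at hs'
  · intro s₂ f₂ hs₂
    refine Tri.imp (linCmd_spec hB' (hκ' _ le_rfl) (hd.dvd _) (hσ _).1 (hb₁.congr f₂) hs₂) ?_
    rintro s' f ⟨h1, -, h2, h3⟩
    exact ⟨h2, h3, h1.state.dim12⟩

end

section

variable {E : Env} {s : Mem} {T n κ K0 : ℕ} {m : Params} {A B : Matrix (Fin n) (Fin n) ℝ}
  {U V : Fin K0 ↪ Fin n}

/-! ### The program for one pair of seed sequences -/

/-- The cleaned version of the array `src` is written to the array `z`. -/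
noncomputable def prepareCmd (src x z : ℕ) : Cmd :=
  .seq (perturbCmd src x) (.seq (cleanCmd x)
    (tabR z (nv 0) (nv 0) btrue (.get 2 (nv 20) (nv 21)) (.const 0)))

theorem prepareCmd_spec {src x z : ℕ} (h0 : 0 < n)
    (hω : ∀ x r, 0 ≤ E.ω.unifAt x r ∧ E.ω.unifAt x r < 1)
    (hT : (n + 1) * (E.sv n + 4 * (n + 2) * (n + 2)) ≤ T) (hn : s.nat 0 0 0 = n)
    (hA : s.Holds src A)
    (hz : src ≠ 2 ∧ z ≠ 2 := by decide) :
    Tri E (prepareCmd src x z) s T (fun s' =>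
      s'.Holds z (clean (perturb A (E.ω.gaussAt x)) (E.ω.unifAt x))) := by
  have hT1 : (n + 1) * (n + 1) ≤ T := le_trans (Nat.mul_le_mul_left _ (by nlinarith)) hT
  refine Tri.seq (perturbCmd_spec (x := x) hz.1 hT1 hn hA) ?_
  intro s₁ f₁ h1
  refine Tri.seq (cleanCmd_spec h0 (hω x) hT (by rw [f₁.nat 0 rfl, hn]) h1) ?_
  intro s₂ f₂ h2
  have e : s₂.nat 0 0 0 = n := by rw [f₂.nat 0 rfl, f₁.nat 0 rfl, hn]
  refine Tri.mapTab hT1 e e (fun i j s' f _ h0 h1 => ?_) (fun s' _ h => h)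
  simp only [RExp.val, nv_val, h0, h1]
  rw [f.real 2 (by simp [tabR, table, forN_setsReal, Cmd.setsReal, hz.2]), h2 i j]

/-- The property of the tape on which the correctness of the programs depends: the uniform variables
are below `1`, and every level of the spectral subroutine is reached. It holds almost surely. -/
structure Regular (m : Params) (K0 : ℕ) (ω : Tape) : Prop where
  unif : ∀ x r, 0 ≤ ω.unifAt x r ∧ ω.unifAt x r < 1
  sound : ∀ t, Sound (specSeq m K0 rule ω t) ∧ ∃ r, ¬ Rejected m K0 ω t r

/-- From the seeds in the arrays `1` and `2` of naturals, the candidate matching (array `3`) and its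
refinement (array `4`). -/
noncomputable def pairCmd (m : Params) (K0 : ℕ) : Cmd :=
  .seq (prepareCmd 0 0 10) (.seq (prepareCmd 1 1 11) (.seq (seedCmd K0) (.seq (iterCmd m K0)
    (.seq (matchCmd K0) (refineCmd m.ρ)))))

theorem pairCmd_spec {T₀ : ℕ} (hd : Dims m K0) (hn : 3 ≤ n) (hB : Budget E n κ T₀)
    (hκ : 2 * m.K K0 (m.tStar K0 n) ≤ κ) (hω : Regular m K0 E.ω)
    (hT : (m.tStar K0 n + 1) *
      ((∑ t ∈ Finset.range (m.tStar K0 n), (accepted m K0 E.ω t + 1) + 1) * T₀)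
      ≤ T) (hT' : (n + 1) * (E.sv n + 4 * (n + 2) * (n + 2)) ≤ T) (h0 : s.nat 0 0 0 = n)
    (hA : s.Holds 0 A) (hB0 : s.Holds 1 B) (hU : s.HoldsSeeds 1 U) (hV : s.HoldsSeeds 2 V) :
    Tri E (pairCmd m K0) s T (fun s' => ∃ π σ : Equiv.Perm (Fin n),
      IsCandidate m rule E.ω A B U V π ∧ IsRefinement m.ρ A B π σ ∧ s'.Stores 3 π ∧
        s'.Stores 4 σ) := by
  have hT₀ : T₀ ≤ T := le_trans (Nat.le_mul_of_pos_left _ (by positivity))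
    (le_trans (Nat.le_mul_of_pos_left _ (Nat.succ_pos (m.tStar K0 n))) hT)
  have hK : m.K K0 0 ≤ m.K K0 (m.tStar K0 n) := hd.mono (Nat.zero_le _)
  have hK0 : K0 ≤ m.K K0 (m.tStar K0 n) := hK
  have hcube : ∀ c ≤ n + κ + 1, 4 * (n + 1) * (n + 1) * c ≤ T := fun c hc => by
    refine le_trans ?_ (hB.cube.trans hT₀)
    rw [mul_assoc, mul_assoc, ← mul_assoc (n + 1)]
    exact Nat.mul_le_mul_left _ (Nat.mul_le_mul (Nat.mul_le_mul (by omega) (by omega)) hc)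
  refine Tri.seq (prepareCmd_spec (x := 0) (by omega) hω.unif hT' h0 hA) ?_
  intro s₁ f₁ h10
  refine Tri.seq (prepareCmd_spec (x := 1) (by omega) hω.unif hT' (by rw [f₁.nat 0 rfl, h0])
    (hB0.congr (f₁.real 1 rfl))) ?_
  intro s₂ f₂ h11
  have g₂ := f₁.seq f₂
  refine Tri.seq (seedCmd_spec (U := U) (V := V) (le_trans (Nat.mul_le_mul_right _ (by nlinarith))
    (hcube (K0 + 1) (by omega)))
    (by rw [g₂.nat 0 rfl, h0]) (fun k => by rw [g₂.nat 1 rfl, hU k])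
    (fun k => by rw [g₂.nat 2 rfl, hV k])) ?_
  rintro s₃ f₃ ⟨h50, h51⟩
  have g₃ := g₂.seq f₃
  have hb : s₃.HoldsBase (cleanedA E.ω A) (cleanedB E.ω B) U V :=
    ⟨by rw [g₃.nat 0 rfl, h0], h10.congr (by rw [f₃.real 10 rfl, f₂.real 10 rfl]),
      h11.congr (f₃.real 11 rfl), h50, h51⟩
  refine Tri.seq (iterCmd_spec hd hn hB (by omega) hω.sound hT hb
    (fun k => by rw [g₃.nat 1 rfl, hU k]) (fun k => by rw [g₃.nat 2 rfl, hV k])) ?_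
  rintro s₄ f₄ ⟨h41, h43, h5⟩
  have g₄ := g₃.seq f₄
  have hb₄ := hb.congr f₄
  refine Tri.seq (matchCmd_spec (hcube _ (by omega)) hb₄.dim (fun k => by rw [g₄.nat 1 rfl, hU k])
    (fun k => by rw [g₄.nat 2 rfl, hV k]) hb₄.maskFst hb₄.maskSnd h5 h41 h43) ?_
  rintro s₅ f₅ ⟨π, hπ, h3⟩
  have g₅ := g₄.seq f₅
  refine Tri.imp (refineCmd_spec (ρ := m.ρ) (hcube _ (by omega)) (by rw [g₅.nat 0 rfl, h0])
    (hA.congr (g₅.real 0 rfl)) (hB0.congr (g₅.real 1 rfl)) h3) ?_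
  rintro s₆ f₆ ⟨σ, hσ, h4⟩
  exact ⟨π, σ, hπ, hσ, fun i => by rw [f₆.nat 3 rfl, h3 i], h4⟩

/-! ### The program for all pairs of seed sequences -/

/-- `c` is run for all values below the scalar `0` of the entries with index below `d` of the array
`90`. -/
def nest (c : Cmd) : ℕ → Cmd
  | 0 => c
  | d + 1 => .seq (.setNat 90 (.const d) (.const 0) (.const 0))
      (.while (natLt (.get 90 (.const d) (.const 0)) (nv 0))
        (.seq (nest c d)
          (.setNat 90 (.const d) (.const 0) (.add (.get 90 (.const d) (.const 0)) (.const 1)))))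

/-- The rule for `nest`, with an invariant that is indexed by the set of the tuples that have been
processed. -/
theorem Tri.nest {c : Cmd} {D T₀ : ℕ} (Inv : Set (Fin D → Fin n) → Mem → Prop) (hT₀ : 1 ≤ T₀)
    (hdim : ∀ Z s, Inv Z s → s.nat 0 0 0 = n)
    (hI : ∀ Z s i v, Inv Z s → Inv Z (s.setNat 90 i 0 v)) (hc : c.setsNat 90 = false)
    (hstep : ∀ Z s (f : Fin D → Fin n), Inv Z s → (∀ e : Fin D, s.nat 90 e 0 = f e) →
      Tri E c s T₀ (Inv (Z ∪ {f}))) (d : ℕ) (hd : d ≤ D) (Z : Set (Fin D → Fin n))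
        (g : Fin D → Fin n)
    (s : Mem) (hs : Inv Z s) (hg : ∀ e : Fin D, d ≤ e → s.nat 90 e 0 = g e) :
    Tri E (RobustMatching.nest c d) s ((n + 1) ^ d * T₀) (fun s' =>
      Inv (Z ∪ {f | ∀ e : Fin D, d ≤ e → f e = g e}) s' ∧
      ∀ e : ℕ, d ≤ e → s'.nat 90 e 0 = s.nat 90 e 0) := by
  induction d generalizing Z g s with
  | zero =>
    rw [pow_zero, one_mul]
    refine (hstep Z s g hs fun e => hg e (Nat.zero_le _)).imp fun s' f h => ⟨?_, fun e _ => ?_⟩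
    · convert h using 2
      ext f
      simp [funext_iff]
    · rw [f.nat 90 hc]
  | succ d ih =>
    have hT1 : 1 ≤ (n + 1) ^ d * T₀ := Nat.mul_pos (by positivity) hT₀
    have hT2 : (n + 1) * ((n + 1) ^ d * T₀) = (n + 1) ^ (d + 1) * T₀ := by rw [pow_succ]; ring
    rw [← hT2]
    refine Tri.seq (P := fun s' => s' = s.setNat 90 d 0 0) (Tri.setNat
      (le_trans hT1 (Nat.le_mul_of_pos_left _ (Nat.succ_pos n))) (by simp)) ?_
    rintro s₁ - rfl
    refine Tri.whileLoop (T₀ := (n + 1) ^ d * T₀) (fun v s' => v ≤ n ∧ s'.nat 90 d 0 = v ∧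
      Inv (Z ∪ {f | (∀ e : Fin D, d + 1 ≤ e → f e = g e) ∧ (f ⟨d, hd⟩ : ℕ) < v}) s' ∧
      ∀ e, d + 1 ≤ e → s'.nat 90 e 0 = s.nat 90 e 0) n le_rfl hT1 ?_ ?_ ?_
    · refine ⟨Nat.zero_le _, Mem.setNat_nat_self _ _ _ _ _, ?_, fun e he => ?_⟩
      · simpa using hI _ _ d 0 hs
      · rw [Mem.setNat_nat, if_neg (by omega)]
    · rintro v s' - ⟨-, hv, hinv, hpres⟩ hcond
      rw [natLt_holds] at hcond
      simp only [NExp.val, nv_val, hv, hdim _ _ hinv] at hcond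
      refine ⟨hcond, Tri.seq (ih (by omega) _ (Function.update g ⟨d, hd⟩ ⟨v, hcond⟩) s' hinv ?_) ?_⟩
      · intro e he
        by_cases h : e = ⟨d, hd⟩
        · subst h; rw [Function.update_self]; exact hv
        · have : d + 1 ≤ (e : ℕ) := by
            have : (e : ℕ) ≠ d := fun h' => h (Fin.ext h')
            omega
          rw [Function.update_of_ne h, hpres e this, hg e this]
      · rintro s'' - ⟨hinv', hpres'⟩
        refine Tri.setNat hT1 ?_
        have e : s''.nat 90 d 0 = v := by rw [hpres' d le_rfl, hv]
        simp only [NExp.val, e]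
        refine ⟨hcond, Mem.setNat_nat_self _ _ _ _ _, ?_, fun e he => ?_⟩
        · have h := hI _ _ d (v + 1) hinv'
          convert h using 1
          ext f
          simp only [Set.mem_union, Set.mem_ofPred_eq, or_assoc]
          refine or_congr_right ?_
          constructor
          · rintro ⟨h1, h2⟩
            rcases Nat.lt_succ_iff_lt_or_eq.1 h2 with h | h
            · exact Or.inl ⟨h1, h⟩
            · refine Or.inr fun e he => ?_
              by_cases h' : e = ⟨d, hd⟩
              · subst h'; rw [Function.update_self]; exact Fin.ext h
              · rw [Function.update_of_ne h']
                have : (e : ℕ) ≠ d := fun h'' => h' (Fin.ext h'')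
                exact h1 e (by omega)
          · rintro (⟨h1, h2⟩ | h1)
            · exact ⟨h1, by omega⟩
            · refine ⟨fun e he => ?_, ?_⟩
              · have h2 := h1 e (by omega)
                rwa [Function.update_of_ne (by intro h'; rw [h'] at he; simp at he)] at h2
              · have h2 := h1 ⟨d, hd⟩ le_rfl
                rw [Function.update_self] at h2
                rw [h2]; exact Nat.lt_succ_self v
        · rw [Mem.setNat_nat, if_neg (by omega), hpres' e (by omega), hpres e he]
    · rintro v s' - ⟨hvn, hv, hinv, hpres⟩ hcond
      rw [natLt_holds] at hcond
      simp only [NExp.val, nv_val, hv, hdim _ _ hinv] at hcond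
      refine ⟨?_, hpres⟩
      convert hinv using 4
      have := (‹Fin D → Fin n› ⟨d, hd⟩).2
      constructor
      · exact fun h => ⟨h, by omega⟩
      · exact fun h => h.1

/-- The first `k` entries of the array `x` of naturals differ from the entry `j`. -/
def freshTest (x j : ℕ) : ℕ → BExp
  | 0 => btrue
  | k + 1 => .and (freshTest x j k)
      (.not (natEq (.get x (.const k) (.const 0)) (.get x (.const j) (.const 0))))

/-- The first `k` entries of the array `x` of naturals are distinct. -/
def distinctTest (x : ℕ) : ℕ → BExp
  | 0 => btrue
  | k + 1 => .and (distinctTest x k) (freshTest x k k)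

theorem freshTest_holds {ω : Tape} {x j k : ℕ} :
    (freshTest x j k).Holds ω s ↔ ∀ i < k, s.nat x i 0 ≠ s.nat x j 0 := by
  induction k with
  | zero => simp [freshTest, btrue]
  | succ k ih =>
    simp only [freshTest, BExp.Holds, ih, natEq_holds, NExp.val]
    constructor
    · rintro ⟨h1, h2⟩ i hi
      rcases Nat.lt_succ_iff_lt_or_eq.1 hi with h | rfl
      · exact h1 i h
      · exact h2
    · exact fun h => ⟨fun i hi => h i (by omega), h k (by omega)⟩

theorem distinctTest_holds {ω : Tape} {x k : ℕ} :
    (distinctTest x k).Holds ω s ↔ ∀ i < k, ∀ j < i, s.nat x j 0 ≠ s.nat x i 0 := by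
  induction k with
  | zero => simp [distinctTest, btrue]
  | succ k ih =>
    simp only [distinctTest, BExp.Holds, ih, freshTest_holds]
    constructor
    · rintro ⟨h1, h2⟩ i hi
      rcases Nat.lt_succ_iff_lt_or_eq.1 hi with h | rfl
      · exact h1 i h
      · exact h2
    · exact fun h => ⟨fun i hi => h i (by omega), h k (by omega)⟩

theorem distinctTest_iff {ω : Tape} {x : ℕ} {f : Fin K0 → Fin n}
    (hf : ∀ k : Fin K0, s.nat x k 0 = f k) :
    (distinctTest x K0).Holds ω s ↔ Function.Injective f := by
  rw [distinctTest_holds]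
  constructor
  · intro h i j hij
    have e : s.nat x i 0 = s.nat x j 0 := by rw [hf, hf, hij]
    rcases lt_trichotomy i j with hlt | heq | hlt
    · exact absurd e (h j j.2 i hlt)
    · exact heq
    · exact absurd e.symm (h i i.2 j hlt)
  · intro h i hi j hj e
    have := h (a₁ := ⟨j, by omega⟩) (a₂ := ⟨i, hi⟩) (Fin.ext (by rw [← hf, ← hf]; exact e))
    simp only [Fin.mk.injEq] at this
    omega

/-- Process the pair of seed sequences in the array `90`: the best overlap so far is kept in the
scalar `88`, the corresponding matching in the array `92` of naturals. -/
noncomputable def visitCmd (m : Params) (K0 : ℕ) : Cmd :=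
  .seq (tabN 1 (.const K0) (.const 1) btrue (.get 90 (nv 20) (.const 0)) (.const 0))
    (.seq (tabN 2 (.const K0) (.const 1) btrue (.get 90 (.add (.const K0) (nv 20)) (.const 0))
      (.const 0))
    (.ite (.and (distinctTest 1 K0) (distinctTest 2 K0))
      (.seq (pairCmd m K0) (.seq overlapCmd
        (.ite (realLt (rv 88) (rv 67))
          (.seq (.setReal 88 (.const 0) (.const 0) (rv 67))
            (tabN 92 (nv 0) (.const 1) btrue (.get 4 (nv 20) (.const 0)) (.const 0))) .skip)))
              .skip))

/-- The invariant of the search, where `Z` is the set of the tuples that have been processed. The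
initial value `-1` of the scalar `88` is below every overlap, so it is left at the first pair. -/
structure Mem.HoldsBest (m : Params) (s : Mem) (ω : Tape) (A B : Matrix (Fin n) (Fin n) ℝ)
    (Z : Set (Fin (K0 + K0) → Fin n)) : Prop where
  dim : s.nat 0 0 0 = n
  fst : s.Holds 0 A
  snd : s.Holds 1 B
  le_best : ∀ U V : Fin K0 ↪ Fin n, Fin.append U V ∈ Z → ∃ π σ : Equiv.Perm (Fin n),
    IsCandidate m rule ω A B U V π ∧ IsRefinement m.ρ A B π σ ∧ (overlap A B σ : ℝ) ≤ s.real 88 0 0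
  best : s.real 88 0 0 = -1 ∨ ∃ (U V : Fin K0 ↪ Fin n) (π σ : Equiv.Perm (Fin n)),
    IsCandidate m rule ω A B U V π ∧ IsRefinement m.ρ A B π σ ∧
      (overlap A B σ : ℝ) = s.real 88 0 0 ∧
      s.Stores 92 σ

theorem Mem.HoldsBest.congr {s' : Mem} {ω : Tape} {Z : Set (Fin (K0 + K0) → Fin n)}
    (h : s.HoldsBest m ω A B Z) (h0 : s'.nat 0 = s.nat 0) (h92 : s'.nat 92 = s.nat 92)
    (r0 : s'.real 0 = s.real 0) (r1 : s'.real 1 = s.real 1) (r88 : s'.real 88 = s.real 88) :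
    s'.HoldsBest m ω A B Z :=
  ⟨by rw [h0, h.dim], h.fst.congr r0, h.snd.congr r1, by rw [r88]; exact h.le_best, by
    simp only [r88, Mem.Stores, h92]; exact h.best⟩

theorem visitCmd_spec {T₀ : ℕ} {Z : Set (Fin (K0 + K0) → Fin n)} {f : Fin (K0 + K0) → Fin n}
    (hd : Dims m K0) (hn : 3 ≤ n) (hB : Budget E n κ T₀)
    (hκ : 2 * m.K K0 (m.tStar K0 n) ≤ κ) (hω : Regular m K0 E.ω)
    (hT : (m.tStar K0 n + 1) *
      ((∑ t ∈ Finset.range (m.tStar K0 n), (accepted m K0 E.ω t + 1) + 1) * T₀)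
      ≤ T) (hT' : (n + 1) * (E.sv n + 4 * (n + 2) * (n + 2)) ≤ T)
    (hs : s.HoldsBest m E.ω A B Z) (hf : ∀ e : Fin (K0 + K0), s.nat 90 e 0 = f e) :
    Tri E (visitCmd m K0) s T (fun s' => s'.HoldsBest m E.ω A B (Z ∪ {f})) := by
  have hT₀ : T₀ ≤ T := le_trans (Nat.le_mul_of_pos_left _ (by positivity))
    (le_trans (Nat.le_mul_of_pos_left _ (Nat.succ_pos (m.tStar K0 n))) hT)
  have hB' := hB.le hT₀
  have hK : m.K K0 0 ≤ m.K K0 (m.tStar K0 n) := hd.mono (Nat.zero_le _)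
  have hK0 : K0 ≤ m.K K0 (m.tStar K0 n) := hK
  have hT1 := hB'.tab (a := K0) (b := 1) (by omega) (by omega)
  have hTn := hB'.tab (a := n) (b := 1) (by omega) (by omega)
  refine Tri.seq (P := fun s' => ∀ k : Fin K0, s'.nat 1 k 0 = f (Fin.castAdd K0 k)) ?_ ?_
  · refine Tri.tabN K0 1 (fun i _ => s.nat 90 i 0) (by decide) hT1 (fun _ _ => rfl)
      (fun _ _ => rfl) ?_ ?_
    · intro i _ j _ s' g _ h0 _
      refine ⟨fun _ => ?_, fun h => absurd (by simp [btrue]) h⟩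
      simp only [NExp.val, nv_val, h0, g.nat 90 rfl]
    · intro s' _ h _ k
      rw [h k k.2 0 one_pos]
      exact hf (Fin.castAdd K0 k)
  intro s₁ f₁ h1
  refine Tri.seq (P := fun s' => ∀ k : Fin K0, s'.nat 2 k 0 = f (Fin.natAdd K0 k)) ?_ ?_
  · refine Tri.tabN K0 1 (fun i _ => s.nat 90 (K0 + i) 0) (by decide) hT1 (fun _ _ => rfl)
      (fun _ _ => rfl)
      ?_ ?_
    · intro i _ j _ s' g _ h0 _
      refine ⟨fun _ => ?_, fun h => absurd (by simp [btrue]) h⟩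
      simp only [NExp.val, nv_val, h0, g.nat 90 rfl, f₁.nat 90 rfl]
    · intro s' _ h _ k
      rw [h k k.2 0 one_pos]
      exact hf (Fin.natAdd K0 k)
  intro s₂ f₂ h2
  have g₂ := f₁.seq f₂
  have h1' : ∀ k : Fin K0, s₂.nat 1 k 0 = f (Fin.castAdd K0 k) := fun k => by rw [f₂.nat 1 rfl, h1]
  have hs₂ : s₂.HoldsBest m E.ω A B Z :=
    hs.congr (g₂.nat 0 rfl) (g₂.nat 92 rfl) (g₂.real 0 rfl) (g₂.real 1 rfl) (g₂.real 88 rfl)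
  refine Tri.ite hB'.one (fun hc => ?_) (fun hc => Tri.skip hB'.one ?_)
  · rw [BExp.Holds, distinctTest_iff (f := fun k => f (Fin.castAdd K0 k)) h1',
      distinctTest_iff (f := fun k => f (Fin.natAdd K0 k)) h2] at hc
    obtain ⟨hi1, hi2⟩ := hc
    set U : Fin K0 ↪ Fin n := ⟨_, hi1⟩
    set V : Fin K0 ↪ Fin n := ⟨_, hi2⟩
    -- only the pair `U`, `V` corresponds to the tuple `f`
    have huniq : ∀ U' V' : Fin K0 ↪ Fin n, Fin.append U' V' = f → U' = U ∧ V' = V := by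
      intro U' V' h
      exact ⟨DFunLike.ext _ _ fun k => (Fin.append_left U' V' k).symm.trans (congrFun h _),
        DFunLike.ext _ _ fun k => (Fin.append_right U' V' k).symm.trans (congrFun h _)⟩
    refine Tri.seq
      (pairCmd_spec (U := U) (V := V) hd hn hB hκ hω hT hT' hs₂.dim hs₂.fst hs₂.snd h1' h2) ?_
    rintro s₃ f₃ ⟨π, σ, hπ, hσ, -, h4⟩
    have hs₃ : s₃.HoldsBest m E.ω A B Z :=
      hs₂.congr (f₃.nat 0 rfl) (f₃.nat 92 rfl) (f₃.real 0 rfl) (f₃.real 1 rfl) (f₃.real 88 rfl)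
    refine Tri.seq (overlapCmd_spec (by
      refine le_trans ?_ hB'.cube
      rw [mul_assoc]
      refine Nat.mul_le_mul_left _
        (le_trans (Nat.mul_le_mul ?_ ?_) (Nat.le_mul_of_pos_right _ ?_)) <;>
        omega) hs₃.dim hs₃.fst hs₃.snd h4) ?_
    intro s₄ f₄ h67
    have hs₄ : s₄.HoldsBest m E.ω A B Z :=
      hs₃.congr (f₄.nat 0 rfl) (f₄.nat 92 rfl) (f₄.real 0 rfl) (f₄.real 1 rfl) (f₄.real 88 rfl)
    refine Tri.ite hB'.one (fun hc => ?_) (fun hc => Tri.skip hB'.one ?_)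
    · rw [realLt_holds, rv_val, rv_val, h67] at hc
      refine Tri.seq (P := fun s' => s' = s₄.setReal 88 0 0 (overlap A B σ)) (Tri.setReal hB'.one
        (by simp [h67])) ?_
      rintro s₅ f₅ rfl
      have e88 : (s₄.setReal 88 0 0 (overlap A B σ)).real 88 0 0 = overlap A B σ :=
        Mem.setReal_real_self _ _ _ _ _
      refine Tri.tabN n 1 (fun i _ => s₄.nat 4 i 0) (by decide) hTn
        (fun s' g => by rw [nv_val, g.nat 0 rfl, f₅.nat 0 rfl, hs₄.dim]) (fun _ _ => rfl) ?_ ?_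
      · intro i _ j _ s' g _ h0 _
        refine ⟨fun _ => ?_, fun h => absurd (by simp [btrue]) h⟩
        simp only [NExp.val, nv_val, h0, g.nat 4 rfl, f₅.nat 4 rfl]
      · intro s' g h _
        have r88 : s'.real 88 0 0 = overlap A B σ := by rw [g.real 88 rfl, e88]
        refine ⟨by rw [g.nat 0 rfl, f₅.nat 0 rfl, hs₄.dim],
          hs₄.fst.congr (by rw [g.real 0 rfl, f₅.real 0 rfl]),
          hs₄.snd.congr (by rw [g.real 1 rfl, f₅.real 1 rfl]), ?_,
            Or.inr ⟨U, V, π, σ, hπ, hσ, r88.symm, ?_⟩⟩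
        · rw [r88]
          rintro U' V' (h' | h')
          · obtain ⟨π', σ', h1, h2, h3⟩ := hs₄.le_best U' V' h'
            exact ⟨π', σ', h1, h2, h3.trans hc.le⟩
          · obtain ⟨rfl, rfl⟩ := huniq U' V' h'
            exact ⟨π, σ, hπ, hσ, le_rfl⟩
        · intro i
          rw [h i i.2 0 one_pos, f₄.nat 4 rfl, h4 i]
    · rw [realLt_holds, rv_val, rv_val, h67, not_lt] at hc
      refine ⟨hs₄.dim, hs₄.fst, hs₄.snd, ?_, hs₄.best⟩
      rintro U' V' (h' | h')
      · exact hs₄.le_best U' V' h'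
      · obtain ⟨rfl, rfl⟩ := huniq U' V' h'
        exact ⟨π, σ, hπ, hσ, hc⟩
  · refine ⟨hs₂.dim, hs₂.fst, hs₂.snd, ?_, hs₂.best⟩
    rintro U' V' (h' | h')
    · exact hs₂.le_best U' V' h'
    · refine absurd ?_ hc
      rw [BExp.Holds, distinctTest_iff (f := fun k => f (Fin.castAdd K0 k)) h1',
        distinctTest_iff (f := fun k => f (Fin.natAdd K0 k)) h2, ← h']
      exact ⟨fun i j h => U'.injective (by simpa only [Fin.append_left] using h),
        fun i j h => V'.injective (by simpa only [Fin.append_right] using h)⟩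

/-- The search over all pairs of seed sequences. -/
noncomputable def searchAllCmd (m : Params) (K0 : ℕ) : Cmd :=
  .seq (.setReal 88 (.const 0) (.const 0) (.const (-1))) (.seq (nest (visitCmd m K0) (K0 + K0))
    (tabN 3 (nv 0) (.const 1) btrue (.get 92 (nv 20) (.const 0)) (.const 0)))

theorem searchAllCmd_spec {T₀ T₁ : ℕ} (hd : Dims m K0) (hn : 3 ≤ n) (hKn : K0 ≤ n)
    (hB : Budget E n κ T₀)
    (hκ : 2 * m.K K0 (m.tStar K0 n) ≤ κ) (hω : Regular m K0 E.ω)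
    (hT : (m.tStar K0 n + 1) *
      ((∑ t ∈ Finset.range (m.tStar K0 n), (accepted m K0 E.ω t + 1) + 1) * T₀)
      ≤ T₁) (hT' : (n + 1) * (E.sv n + 4 * (n + 2) * (n + 2)) ≤ T₁)
    (hT'' : (n + 1) ^ (K0 + K0) * T₁ ≤ T) (h0 : s.nat 0 0 0 = n) (hA : s.Holds 0 A)
    (hB0 : s.Holds 1 B) :
    Tri E (searchAllCmd m K0) s T (fun s' => ∃ σ : Equiv.Perm (Fin n),
      IsFinalOutput m K0 rule E.ω A B σ ∧ s'.Stores 3 σ) := by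
  classical
  have hT₀ : T₀ ≤ T₁ := le_trans (Nat.le_mul_of_pos_left _ (by positivity))
    (le_trans (Nat.le_mul_of_pos_left _ (Nat.succ_pos (m.tStar K0 n))) hT)
  have hT₁ : T₁ ≤ T := le_trans (Nat.le_mul_of_pos_left _ (by positivity)) hT''
  have hB' := hB.le (hT₀.trans hT₁)
  have h01 : 1 ≤ T₁ := hB.one.trans hT₀
  refine Tri.seq (P := fun s' => s' = s.setReal 88 0 0 (-1)) (Tri.setReal hB'.one (by simp)) ?_
  rintro s₁ f₁ rfl
  have hs₁ : (s.setReal 88 0 0 (-1)).HoldsBest (K0 := K0) m E.ω A B ∅ :=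
    ⟨h0, hA.congr (f₁.real 0 rfl), hB0.congr (f₁.real 1 rfl), fun U V h =>
      absurd h (Set.notMem_empty _),
      Or.inl (Mem.setReal_real_self _ _ _ _ _)⟩
  refine Tri.seq (P := fun s' => s'.HoldsBest (K0 := K0) m E.ω A B Set.univ) ?_ ?_
  · refine Tri.mono (Tri.nest (T₀ := T₁) (fun Z s' => s'.HoldsBest (K0 := K0) m E.ω A B Z) h01
      (fun Z s' h => h.dim) (fun Z s' i v h => ?_) rfl
      (fun Z s' f h hf => visitCmd_spec hd hn hB hκ hω hT hT' h hf) (K0 + K0) le_rfl ∅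
      (fun _ => ⟨0, by omega⟩) _ hs₁ (fun e he => absurd e.2 (not_lt.2 he))) hT'' ?_
    · exact h.congr (Mem.setNat_nat_ne _ _ _ _ (by decide)) (Mem.setNat_nat_ne _ _ _ _ (by decide))
        rfl rfl rfl
    · rintro s' - ⟨h, -⟩
      convert h using 1
      refine (Set.eq_univ_of_forall fun f => Or.inr ?_).symm
      exact fun e he => absurd e.2 (not_lt.2 he)
  · intro s₂ f₂ hs₂
    obtain ⟨U₀⟩ : Nonempty (Fin K0 ↪ Fin n) := ⟨Fin.castLEEmb hKn⟩
    have hbest := hs₂.le_best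
    obtain h | ⟨U, V, π, σ, hπ, hσ, hov, h92⟩ := hs₂.best
    -- some pair has been processed, and its overlap is not negative
    · obtain ⟨π, σ, -, -, h'⟩ := hbest U₀ U₀ (Set.mem_univ _)
      rw [h] at h'
      have : (0 : ℝ) ≤ overlap A B σ := Nat.cast_nonneg _
      linarith
    choose c r hc hr hle using fun U V => hbest U V (Set.mem_univ _)
    refine Tri.tabN n 1 (fun i _ => s₂.nat 92 i 0) (by decide) (hB'.tab (by omega) (by omega))
        (fun s' g => by rw [nv_val, g.nat 0 rfl, hs₂.dim]) (fun _ _ => rfl) ?_ ?_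
    · intro i _ j _ s' g _ h0 _
      refine ⟨fun _ => ?_, fun h => absurd (by simp [btrue]) h⟩
      simp only [NExp.val, nv_val, h0, g.nat 92 rfl]
    · intro s' g h _
      -- the candidate of the best pair is the one found for it, the others are arbitrary
      refine ⟨σ, ⟨fun U' V' => if U' = U ∧ V' = V then π else c U' V',
        fun U' V' => if U' = U ∧ V' = V then σ else r U' V', fun U' V' => ?_, fun U' V' =>
          ?_, U, V, ?_,
        fun U' V' => ?_⟩, fun i => by rw [h i i.2 0 one_pos, h92 i]⟩
      · dsimp only
        split_ifs with h
        · rw [h.1, h.2]; exact hπ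
        · exact hc U' V'
      · dsimp only
        split_ifs with h
        · exact hσ
        · exact hr U' V'
      · exact (if_pos ⟨rfl, rfl⟩).symm
      · dsimp only
        split_ifs with h
        · exact le_rfl
        · exact_mod_cast (hle U' V').trans hov.ge

/-! ### The input -/

theorem inputMem_dim (A B : Matrix (Fin n) (Fin n) ℝ) : (inputMem A B).nat 0 0 0 = n :=
  Mem.setNat_nat_self _ _ _ _ _

theorem inputMem_fst (A B : Matrix (Fin n) (Fin n) ℝ) : (inputMem A B).Holds 0 A := fun i j => by
  rw [inputMem, Mem.setNat_real, Mem.setBlock_real_ne _ _ (by decide)]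
  exact Mem.setBlock_real_self _ _ _ i j

theorem inputMem_snd (A B : Matrix (Fin n) (Fin n) ℝ) : (inputMem A B).Holds 1 B := fun i j => by
  rw [inputMem, Mem.setNat_real]
  exact Mem.setBlock_real_self _ _ _ i j

theorem inputMemSeeds_fst (A B : Matrix (Fin n) (Fin n) ℝ) (U V : Fin K0 ↪ Fin n) :
    (inputMemSeeds A B U V).HoldsSeeds 1 U := fun k => by simp [inputMemSeeds]

theorem inputMemSeeds_snd (A B : Matrix (Fin n) (Fin n) ℝ) (U V : Fin K0 ↪ Fin n) :
    (inputMemSeeds A B U V).HoldsSeeds 2 V := fun k => by simp [inputMemSeeds]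

end

section

/-! ### Asymptotics -/

variable {S T : ℕ → ℝ} {a b : ℝ}

theorem IsBigOPow.mono (h : IsBigOPow T a) (hS : ∀ n, 1 ≤ n → S n ≤ T n) : IsBigOPow S a := by
  obtain ⟨C, e, he, hC⟩ := h
  exact ⟨C, e, he, fun n hn => (hS n hn).trans (hC n hn)⟩

theorem IsBigOPow.abs (h : IsBigOPow T a) : ∃ (C : ℝ) (e : ℕ → ℝ), 0 ≤ C ∧ Tendsto e atTop (𝓝 0) ∧
    ∀ n : ℕ, 1 ≤ n → T n ≤ C * (n : ℝ) ^ (a + e n) := by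
  obtain ⟨C, e, he, hC⟩ := h
  refine ⟨|C|, e, abs_nonneg C, he, fun n hn => (hC n hn).trans ?_⟩
  exact mul_le_mul_of_nonneg_right (le_abs_self C) (by positivity)

theorem IsBigOPow.mul (hS : IsBigOPow S a) (hT : IsBigOPow T b) (hS0 : ∀ n, 0 ≤ S n)
    (hT0 : ∀ n, 0 ≤ T n) : IsBigOPow (fun n => S n * T n) (a + b) := by
  obtain ⟨C, e, hC0, he, hC⟩ := hS.abs
  obtain ⟨D, f, -, hf, hD⟩ := hT.abs
  refine ⟨C * D, fun n => e n + f n, by simpa using he.add hf, fun n hn => ?_⟩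
  have hn' : (0 : ℝ) < n := by exact_mod_cast hn
  calc S n * T n ≤ C * (n : ℝ) ^ (a + e n) * (D * (n : ℝ) ^ (b + f n)) :=
        mul_le_mul (hC n hn) (hD n hn) (hT0 n) ((hS0 n).trans (hC n hn))
    _ = C * D * (n : ℝ) ^ (a + b + (e n + f n)) := by
        rw [show a + b + (e n + f n) = (a + e n) + (b + f n) by ring,
          Real.rpow_add hn' (a + e n) (b + f n)]; ring

theorem IsBigOPow.exponent_mono (hT : IsBigOPow T a) (hab : a ≤ b) : IsBigOPow T b := by
  obtain ⟨C, e, hC0, he, hC⟩ := hT.abs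
  refine ⟨C, e, he, fun n hn => (hC n hn).trans (mul_le_mul_of_nonneg_left ?_ hC0)⟩
  exact Real.rpow_le_rpow_of_exponent_le (by exact_mod_cast hn) (by linarith)

theorem IsBigOPow.add (hS : IsBigOPow S a) (hT : IsBigOPow T a) :
    IsBigOPow (fun n => S n + T n) a := by
  obtain ⟨C, e, hC0, he, hC⟩ := hS.abs
  obtain ⟨D, f, hD0, hf, hD⟩ := hT.abs
  refine ⟨C + D, fun n => max (e n) (f n), by simpa using he.max hf, fun n hn => ?_⟩
  have hn' : (1 : ℝ) ≤ n := by exact_mod_cast hn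
  rw [add_mul]
  refine add_le_add ((hC n hn).trans (mul_le_mul_of_nonneg_left ?_ hC0))
    ((hD n hn).trans (mul_le_mul_of_nonneg_left ?_ hD0)) <;>
    exact Real.rpow_le_rpow_of_exponent_le hn' (by simp)

theorem isBigOPow_const (c : ℝ) : IsBigOPow (fun _ => c) 0 :=
  ⟨c, fun _ => 0, tendsto_const_nhds, fun n _ => by simp⟩

theorem isBigOPow_id : IsBigOPow (fun n => (n : ℝ)) 1 :=
  ⟨1, fun _ => 0, tendsto_const_nhds, fun n _ => by simp⟩

theorem isBigOPow_add_const (c : ℝ) : IsBigOPow (fun n => (n : ℝ) + c) 1 :=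
  isBigOPow_id.add ((isBigOPow_const c).exponent_mono zero_le_one)

theorem IsBigOPow.pow (hT : IsBigOPow T a) (hT0 : ∀ n, 0 ≤ T n) (k : ℕ) :
    IsBigOPow (fun n => T n ^ k) (k * a) := by
  induction k with
  | zero => simpa using isBigOPow_const 1
  | succ k ih =>
    have h := ih.mul hT (fun n => pow_nonneg (hT0 n) k) hT0
    simp only [pow_succ]
    convert h using 1
    push_cast; ring

/-- The exponent is `log (1 + log n) / log n`, which tends to `0`. -/
theorem isBigOPow_log : IsBigOPow (fun n => 1 + Real.log n) 0 := by
  refine ⟨1, fun n => Real.log (1 + Real.log n) / Real.log n, ?_, fun n hn => ?_⟩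
  · have h1 : Tendsto (fun x : ℝ => Real.log (1 + x) / x) atTop (𝓝 0) := by
      have h2 : Tendsto (fun x : ℝ => Real.log x ^ 1 / (1 * x + -1)) atTop (𝓝 0) :=
        Real.tendsto_pow_log_div_mul_add_atTop 1 (-1) 1 one_ne_zero
      refine (h2.comp (tendsto_atTop_add_const_left atTop 1 tendsto_id)).congr fun x => ?_
      simp
    exact h1.comp (Real.tendsto_log_atTop.comp tendsto_natCast_atTop_atTop)
  -- at `n = 1` both sides are `1`, whatever the exponent
  · rcases hn.eq_or_lt with rfl | hn
    · simp
    · have hl : 0 < Real.log n := Real.log_pos (by exact_mod_cast hn)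
      rw [zero_add, one_mul, Real.rpow_def_of_pos (by positivity), mul_div_cancel₀ _ hl.ne',
        Real.exp_log (by positivity)]

variable {m : Params} {K0 : ℕ}

/-- The last dimension is polylogarithmic in `n`: the previous one is below `(log n)^{1.1}`. -/
theorem Dims.isBigOPow_K (hd : Dims m K0) :
    IsBigOPow (fun n => (m.K K0 (m.tStar K0 n) : ℝ)) 0 := by
  have h : IsBigOPow (fun n => (K0 : ℝ) + |m.growth| * (1 + Real.log n) ^ 3) 0 := by
    have h1 := (isBigOPow_log.mono (S := fun n => |1 + Real.log n|) fun n hn => by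
      rw [abs_of_nonneg]; have := Real.log_natCast_nonneg n; linarith).pow (fun n => abs_nonneg _) 3
    have h2 := (isBigOPow_const |m.growth|).mul h1 (fun _ => abs_nonneg _) (fun n => by positivity)
    have h3 : IsBigOPow (fun n : ℕ => |m.growth| * |1 + Real.log n| ^ 3) 0 := by simpa using h2
    refine (isBigOPow_const (K0 : ℝ)).add (h3.mono fun n _ => ?_)
    gcongr
    exact le_abs_self _
  refine h.mono fun n hn => ?_
  have hlog := Real.log_natCast_nonneg n
  rcases Nat.eq_zero_or_pos (m.tStar K0 n) with h0 | h0
  · rw [h0]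
    have : (0 : ℝ) ≤ |m.growth| * (1 + Real.log n) ^ 3 := by positivity
    change (K0 : ℝ) ≤ _
    linarith
  · obtain ⟨t, ht⟩ : ∃ t, m.tStar K0 n = t + 1 := ⟨m.tStar K0 n - 1, by omega⟩
    have hlt : (m.K K0 t : ℝ) < Real.log n ^ (1.1 : ℝ) := by
      by_contra hc
      have : m.tStar K0 n ≤ t := Nat.sInf_le (not_lt.1 hc)
      omega
    have h1 : ((m.K K0 t : ℝ)) ^ 2 ≤ (1 + Real.log n) ^ 3 := by
      have h2 : (m.K K0 t : ℝ) ≤ (1 + Real.log n) ^ (1.5 : ℝ) := by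
        refine hlt.le.trans ((Real.rpow_le_rpow hlog (le_add_of_nonneg_left zero_le_one)
        (by norm_num)).trans ?_)
        exact Real.rpow_le_rpow_of_exponent_le (by linarith) (by norm_num)
      calc (m.K K0 t : ℝ) ^ 2 ≤ ((1 + Real.log n) ^ (1.5 : ℝ)) ^ 2 := by gcongr
        _ = (1 + Real.log n) ^ 3 := by
          rw [← Real.rpow_natCast, ← Real.rpow_mul (by linarith), ← Real.rpow_natCast]
          norm_num
    rw [ht]
    calc (m.K K0 (t + 1) : ℝ) ≤ m.growth * (m.K K0 t : ℝ) ^ 2 := hd.upper t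
      _ ≤ |m.growth| * (1 + Real.log n) ^ 3 :=
        mul_le_mul (le_abs_self _) h1 (sq_nonneg _) (abs_nonneg _)
      _ ≤ _ := by have : (0 : ℝ) ≤ K0 := Nat.cast_nonneg _; linarith

/-- A price of the form `O(d ^ (a + o(1)))` is bounded by a polynomial, which suffices for
dimensions that are polylogarithmic in `n`. -/
theorem IsBigOPow.polynomial {f : ℕ → ℕ} (h : IsBigOPow (fun d => (f d : ℝ)) a) :
    ∃ (C : ℝ) (p : ℕ), 0 ≤ C ∧ ∀ d, (f d : ℝ) ≤ C * ((d : ℝ) + 1) ^ p := by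
  obtain ⟨C, e, hC0, he, hC⟩ := h.abs
  obtain ⟨M, hM⟩ := he.bddAbove_range
  obtain ⟨p, hp⟩ := exists_nat_ge (a + M)
  refine ⟨C + f 0, p, by positivity, fun d => ?_⟩
  have h1 : (1 : ℝ) ≤ ((d : ℝ) + 1) ^ p :=
    one_le_pow₀ (by have : (0 : ℝ) ≤ d := Nat.cast_nonneg _; linarith)
  have h0 : (0 : ℝ) ≤ f 0 := Nat.cast_nonneg _
  rw [add_mul]
  rcases Nat.eq_zero_or_pos d with rfl | hd
  · nlinarith [mul_nonneg hC0 (zero_le_one.trans h1)]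
  · have hd' : (1 : ℝ) ≤ d := by exact_mod_cast hd
    have h2 : (d : ℝ) ^ (a + e d) ≤ ((d : ℝ) + 1) ^ p := by
      refine (Real.rpow_le_rpow_of_exponent_le hd' (y := a + e d) (z := p) ?_).trans ?_
      · have := hM (Set.mem_range_self d); linarith
      · rw [Real.rpow_natCast]; gcongr; linarith
    have h3 := mul_le_mul_of_nonneg_left h2 hC0
    have := hC d hd
    nlinarith

/-- The sum of the prices in all dimensions up to a polylogarithmic one is `n^{o(1)}`. -/
theorem isBigOPow_sum_prices {eg κ : ℕ → ℕ} (h : IsBigOPow (fun d => (eg d : ℝ)) a)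
    (hκ : IsBigOPow (fun n => (κ n : ℝ)) 0) :
    IsBigOPow (fun n => ((∑ d ∈ Finset.range (κ n + 1), eg d : ℕ) : ℝ)) 0 := by
  obtain ⟨C, p, hC0, hC⟩ := h.polynomial
  have h1 : IsBigOPow (fun n => (κ n : ℝ) + 1) 0 := hκ.add (isBigOPow_const 1)
  have h2 := (isBigOPow_const C).mul (h1.pow (fun n => by positivity) (p + 1)) (fun _ => hC0)
    (fun n => by positivity)
  rw [mul_zero, add_zero] at h2
  refine h2.mono fun n _ => ?_
  push_cast
  calc ∑ d ∈ Finset.range (κ n + 1), (eg d : ℝ)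
      ≤ ∑ _d ∈ Finset.range (κ n + 1), C * ((κ n : ℝ) + 1) ^ p := by
        refine Finset.sum_le_sum fun d hd => (hC d).trans ?_
        have : (d : ℝ) ≤ κ n := by exact_mod_cast Nat.lt_succ_iff.1 (Finset.mem_range.1 hd)
        gcongr
    _ = C * ((κ n : ℝ) + 1) ^ (p + 1) := by
        rw [Finset.sum_const, Finset.card_range, nsmul_eq_mul]; push_cast; ring

/-! ### The expected running time -/

/-- A common bound for every loop-free pass of the iteration: the cost of a matrix product with
dimensions up to `n + 2 K`, and of all spectral decompositions up to dimension `2 K`, where `K` is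
the last dimension. The sum over the dimensions replaces the maximum, as `eg` need not be monotone.
-/
noncomputable def passTime (m : Params) (K0 : ℕ) (eg : ℕ → ℕ) (n : ℕ) : ℕ :=
  4 * ((n + 2 * m.K K0 (m.tStar K0 n) + 1) * (n + 2 * m.K K0 (m.tStar K0 n) + 1) *
    (n + 2 * m.K K0 (m.tStar K0 n) + 1)) +
    ∑ d ∈ Finset.range (2 * m.K K0 (m.tStar K0 n) + 1), eg d + 1

/-- The time of the spectral cleaning. -/
def cleanTime (sv : ℕ → ℕ) (n : ℕ) : ℕ := (n + 1) * (sv n + 4 * (n + 2) * (n + 2))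

/-- The expected time for one pair of seed sequences, up to a constant factor. -/
noncomputable def pairTime (m : Params) (K0 : ℕ) (sv eg : ℕ → ℕ) (n : ℕ) : ℕ :=
  (m.tStar K0 n + 1) * ((2 * m.tStar K0 n + 1) * passTime m K0 eg n) + cleanTime sv n

/-- Twice the last dimension is allowed for `κ`, which leaves room for loop bounds such as the sum
of two dimensions. -/
theorem budget_passTime (ω : Tape) (sv eg : ℕ → ℕ) (n : ℕ) :
    Budget ⟨ω, sv, eg⟩ n (2 * m.K K0 (m.tStar K0 n)) (passTime m K0 eg n) := by
  refine ⟨by rw [passTime]; omega, fun d hd => ?_⟩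
  have := Finset.single_le_sum (f := eg) (fun _ _ => Nat.zero_le _)
    (Finset.mem_range.2 (show d < 2 * m.K K0 (m.tStar K0 n) + 1 by omega))
  rw [passTime]
  dsimp only
  omega

theorem isBigOPow_cleanTime {sv : ℕ → ℕ} (hsv : IsBigOPow (fun d => (sv d : ℝ)) 2) :
    IsBigOPow (fun n => (cleanTime sv n : ℝ)) 3 := by
  have h1 := (isBigOPow_add_const 2).pow (fun n => by positivity) 2
  have h2 := (isBigOPow_const 4).mul h1 (fun _ => by norm_num) (fun n => by positivity)
  have h3 : IsBigOPow (fun n : ℕ => 4 * ((n : ℝ) + 2) ^ 2) 2 := by simpa using h2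
  have h4 :=
    (isBigOPow_add_const 1).mul (hsv.add h3) (fun n => by positivity) (fun n => by positivity)
  rw [show (1 : ℝ) + 2 = 3 by norm_num] at h4
  refine h4.mono fun n _ => le_of_eq ?_
  rw [cleanTime]
  push_cast; ring

theorem Dims.isBigOPow_passTime (hd : Dims m K0) {eg : ℕ → ℕ}
    (heg : IsBigOPow (fun d => (eg d : ℝ)) 3) :
    IsBigOPow (fun n => (passTime m K0 eg n : ℝ)) 3 := by
  have hκ : IsBigOPow (fun n => ((2 * m.K K0 (m.tStar K0 n) : ℕ) : ℝ)) 0 := by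
    refine (hd.isBigOPow_K.add hd.isBigOPow_K).mono fun n _ => le_of_eq ?_
    push_cast; ring
  have h1 : IsBigOPow (fun n : ℕ => (n : ℝ) + 1 + ((2 * m.K K0 (m.tStar K0 n) : ℕ) : ℝ)) 1 :=
    (isBigOPow_add_const 1).add (hκ.exponent_mono zero_le_one)
  have h2 := (isBigOPow_const 4).mul (h1.pow (fun n => by positivity) 3) (fun _ => by norm_num)
    (fun n => by positivity)
  rw [show (0 : ℝ) + ((3 : ℕ) : ℝ) * 1 = 3 by norm_num] at h2
  refine (h2.add (((isBigOPow_sum_prices heg hκ).add (isBigOPow_const 1)).exponent_mono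
    (by norm_num))).mono fun n _ => le_of_eq ?_
  rw [passTime]
  push_cast; ring

theorem Dims.isBigOPow_pairTime (hd : Dims m K0) {sv eg : ℕ → ℕ}
    (hsv : IsBigOPow (fun d => (sv d : ℝ)) 2) (heg : IsBigOPow (fun d => (eg d : ℝ)) 3) :
    IsBigOPow (fun n => (pairTime m K0 sv eg n : ℝ)) 3 := by
  have ht : IsBigOPow (fun n => (m.tStar K0 n : ℝ)) 0 := hd.isBigOPow_K.mono fun n _ => by
    exact_mod_cast (Nat.lt_two_pow_self.le).trans (hd.two_pow_le _)
  have h1 : IsBigOPow (fun n => (m.tStar K0 n : ℝ) + 1) 0 := ht.add (isBigOPow_const 1)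
  have h2 := h1.mul (((ht.add h1).mul (hd.isBigOPow_passTime heg) (fun n => by positivity)
    (fun n => by positivity))) (fun n => by positivity) (fun n => by positivity)
  rw [zero_add, zero_add] at h2
  refine (h2.add (isBigOPow_cleanTime hsv)).mono fun n _ => le_of_eq ?_
  rw [pairTime]
  push_cast; ring

theorem ae_regular (hm : m.Standing) (hd : Dims m K0) : ∀ᵐ ω ∂tapeLaw, Regular m K0 ω := by
  filter_upwards [ae_unif, ae_accepted hm hd] with ω h1 h2
  exact ⟨h1, h2⟩

/-- A program whose time depends on the tape through the numbers of rejected samples only. -/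
theorem haltsInExpectedTime_of_tri (hm : m.Standing) (hd : Dims m K0) {sv eg : ℕ → ℕ} {c : Cmd}
    {s : Mem} {post : Tape → Mem → Prop} {t w a b : ℕ}
    (h : ∀ ω, Regular m K0 ω → Tri ⟨ω, sv, eg⟩ c s
      (w * ((t + 1) * ((∑ i ∈ Finset.range t, (accepted m K0 ω i + 1) + 1) * a) + b)) (post ω)) :
    HaltsInExpectedTime sv eg c s post
      ((c.size * (w * ((t + 1) * ((2 * t + 1) * a) + b)) : ℕ) : ℝ) := by
  have hmeas : Measurable fun ω => ∑ i ∈ Finset.range t, samples m K0 i ω :=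
    Finset.measurable_fun_sum _ fun i _ => measurable_samples i
  refine ⟨fun ω => (c.size : ℝ≥0∞) *
    (w * ((t + 1) * ((∑ i ∈ Finset.range t, samples m K0 i ω + 1) * a)
    + b)), by fun_prop, ?_, ?_⟩
  · have hsum : ∫⁻ ω, ∑ i ∈ Finset.range t, samples m K0 i ω ∂tapeLaw ≤ 2 * t := by
      rw [lintegral_finsetSum _ fun i _ => measurable_samples i]
      refine (Finset.sum_le_sum fun i _ => lintegral_samples_le hm hd i).trans (le_of_eq ?_)
      rw [Finset.sum_const, Finset.card_range, nsmul_eq_mul, mul_comm]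
    rw [lintegral_const_mul _ (by fun_prop), lintegral_const_mul _ (by fun_prop),
      lintegral_add_right _ measurable_const, lintegral_const_mul _ (by fun_prop),
      lintegral_mul_const _ (by fun_prop), lintegral_add_right _ measurable_const,
      lintegral_const, lintegral_const, measure_univ, mul_one, mul_one, ENNReal.ofReal_natCast]
    push_cast
    gcongr
  · filter_upwards [ae_regular hm hd] with ω hω
    obtain ⟨s', k, he, hk, hp⟩ := h ω hω
    refine ⟨s', k, he, ?_, hp⟩
    refine (Nat.cast_le (α := ℝ≥0∞).2 hk).trans ?_
    push_cast
    gcongr with i _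
    have := accepted_lt_samples (m := m) (K0 := K0) (ω := ω) (t := i)
    push_cast at this
    exact this

end

end RobustMatching

theorem propositionE1 (m : RobustMatching.Params) (hm : m.Standing) :
    ∃ Kmin : ℕ, ∀ K0 : ℕ, Kmin ≤ K0 → 12 ∣ K0 → m.SeedCondition K0 →
      ∃ χ : RobustMatching.XiRule, χ.Valid ∧
      ∃ P Q : RobustMatching.Cmd,
        ∀ sv eg : ℕ → ℕ,
          RobustMatching.IsBigOPow (fun d => (sv d : ℝ)) 2 →
          RobustMatching.IsBigOPow (fun d => (eg d : ℝ)) 3 →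
          (∃ T : ℕ → ℝ, RobustMatching.IsBigOPow T 3 ∧
            ∀ n : ℕ, K0 ≤ n → ∀ A B : Matrix (Fin n) (Fin n) ℝ, A.IsSymm → B.IsSymm →
              ∀ U V : Fin K0 ↪ Fin n,
                RobustMatching.ComputesCandidate m sv eg χ P A B U V (T n)) ∧
          (∃ T : ℕ → ℝ, RobustMatching.IsBigOPow T (2 * (K0 : ℝ) + 3) ∧
            ∀ n : ℕ, K0 ≤ n → ∀ A B : Matrix (Fin n) (Fin n) ℝ, A.IsSymm → B.IsSymm →
              RobustMatching.ComputesMatching m sv eg χ Q K0 A B (T n)) := by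
  obtain ⟨Kmin, hK⟩ := RobustMatching.exists_dims hm
  refine ⟨Kmin, fun K0 hK0 hdvd _ => ?_⟩
  have hd := hK K0 hK0 hdvd
  -- `n ≥ K0 ≥ 12`, so that `log n > 1` and `log (log n)` is not a junk value
  have h12 : 12 ≤ K0 := hd.pos 0
  refine ⟨RobustMatching.rule, RobustMatching.rule_valid, RobustMatching.pairCmd m K0,
    RobustMatching.searchAllCmd m K0, fun sv eg hsv heg => ⟨?_, ?_⟩⟩
  · refine ⟨fun n => (((RobustMatching.pairCmd m K0).size *
      (1 * RobustMatching.pairTime m K0 sv eg n) : ℕ) : ℝ), ?_, fun n hn A B _ _ U V => ?_⟩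
    · have h := (RobustMatching.isBigOPow_const ((RobustMatching.pairCmd m K0).size : ℝ)).mul
        (hd.isBigOPow_pairTime hsv heg) (fun _ => Nat.cast_nonneg _) (fun _ => Nat.cast_nonneg _)
      rw [zero_add] at h
      simpa using h
    · refine RobustMatching.haltsInExpectedTime_of_tri hm hd fun ω hω => ?_
      rw [one_mul]
      exact RobustMatching.pairCmd_spec hd (by omega)
        (RobustMatching.budget_passTime ω sv eg n) le_rfl hω
        (Nat.le_add_right _ _) (Nat.le_add_left _ _) (RobustMatching.inputMem_dim A B)
        (RobustMatching.inputMem_fst A B) (RobustMatching.inputMem_snd A B)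
        (RobustMatching.inputMemSeeds_fst A B U V) (RobustMatching.inputMemSeeds_snd A B U V)
  · refine ⟨fun n => (((RobustMatching.searchAllCmd m K0).size *
      ((n + 1) ^ (K0 + K0) * RobustMatching.pairTime m K0 sv eg n) : ℕ) : ℝ), ?_,
        fun n hn A B _ _ => ?_⟩
    · have h := (RobustMatching.isBigOPow_const ((RobustMatching.searchAllCmd m K0).size : ℝ)).mul
        (((RobustMatching.isBigOPow_add_const 1).pow (fun n => by positivity) (K0 + K0)).mul
          (hd.isBigOPow_pairTime hsv heg) (fun n => by positivity) (fun _ => Nat.cast_nonneg _))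
        (fun _ => Nat.cast_nonneg _) (fun n => by positivity)
      convert h using 1
      · funext n; push_cast; ring
      · push_cast; ring
    · refine RobustMatching.haltsInExpectedTime_of_tri hm hd fun ω hω => ?_
      exact RobustMatching.searchAllCmd_spec hd (by omega) hn
        (RobustMatching.budget_passTime ω sv eg n)
        le_rfl hω (Nat.le_add_right _ _) (Nat.le_add_left _ _) le_rfl
          (RobustMatching.inputMem_dim A B)
        (RobustMatching.inputMem_fst A B) (RobustMatching.inputMem_snd A B)
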